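/- **Setting.** Consider a sequence (indexed by $t\to\infty$; all quantities below may depend on $t$) of bipartite stochastic block models: $K,L\ge 2$, label vectors $y\in[K]^n$, $z\in[L]^m$, a matrix $P\in[0,1]^{K\times L}$, and a random $A\in\{0,1\}^{n\times m}$ with independent entries, $\mathbb P(A_{ij}=1)=P_{y_iz_j}$. Let $n_k(\cdot)$ and $\pi_k(\cdot)$ denote the number and the proportion of entries of a label vector equal to $k$. Put $\Lambda=(\lambda_{k\ell})=(P_{k\ell}\,n_\ell(z))\in\mathbb R^{K\times L}$ and $\Gamma=(n_k(y)P_{k\ell})_{\ell,k}\in\mathbb R^{L\times K}$; $\|\cdot\|_\infty$ and $(\cdot)_{\min}$ are the largest and smallest entries. Let $$I_{kr}=\sup_{s\in(0,1)}\sum_{\ell}\big[(1-s)\lambda_{k\ell}+s\lambda_{r\ell}-\lambda_{k\ell}^{1-s}\lambda_{r\ell}^{s}\big],\qquad I_{\min}=\min_{k\ne r}I_{kr},$$ let $I^{\rm col}_{\min}$ be the same quantity for $\Gamma$ in place of $\Lambda$, and $\varepsilon_{kr}=\max_\ell\big(\tfrac{\lambda_{k\ell}}{\lambda_{r\ell}}\vee\tfrac{\lambda_{r\ell}}{\lambda_{k\ell}}\big)-1$.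 For $\hat y,y\in[K]^N$ let $\mathrm{Mis}(\hat y,y)=\min_\sigma\frac1N|\{i:\sigma(\hat y_i)\neq y_i\}|$ over permutations $\sigma$ of $[K]$; the minimizers are the optimal relabelings $\sigma^*(\hat y\to y)$; and $\mathrm{Mis}_k(\hat y,y)=|\{i:\sigma^*(\hat y_i)\ne k,\ y_i=k\}|/n_k(y)$. Labels are *$\gamma$-good* if $\mathrm{Mis}\le\gamma/(\beta K)$ (row labels), respectively $\mathrm{Mis}\le\gamma/(\beta L)$ (column labels). **Algorithm.** Let $Q\ge4$, $2Q\mid n$, $Q\mid m$ (for instance $Q=4$). For a matrix $B$ and row, column labels $\tilde y,\tilde z$ put $\mathscr L(B,\tilde y,\tilde z)_{k\ell}=\frac1{n_k(\tilde y)}\sum_{i,j}B_{ij}1\{\tilde y_i=k,\tilde z_j=\ell\}$, and let $\mathrm{LR}(B,\tilde\Lambda,\tilde z)_i$ be a maximizer over $r\in[K]$ of $\prod_\ell \tilde\lambda_{r\ell}^{b_{i\ell}}e^{-\tilde\lambda_{r\ell}}$, $b_{i\ell}=\sum_jB_{ij}1\{\tilde z_j=\ell\}$. Non-unique optimizers (also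 the $\sigma^*$ used inside the algorithm) are chosen uniformly at random. Indices $q$ are in $\mathbb Z/Q$. 1. Split the rows uniformly at random into two halves, $A_\top$ and $A_\bot$. 2. Split the rows and the columns of $A_\bot$ uniformly at random into $Q$ groups of equal size each, giving blocks $A^{(q,q')}$. 3. For every $q$ apply an arbitrary (possibly randomized) initial row labeling procedure to $\big[A^{(q-1,q)};A^{(q,q)}\big]$, giving $[\tilde y^{(q-1)};\tilde y'^{(q)}]$. 4. For every $q$ apply an arbitrary initial column labeling procedure to $\big[A^{(q,q)}\ A^{(q,q+1)}\big]$, giving $[\tilde z^{(q)}\ \tilde z'^{(q+1)}]$. 5. Make the labels consistent: with $\tau_q=\sigma^*(\tilde y'^{(q)}\to\tilde y^{(q)})$ replace $\tilde y^{(q)}$ by $\tau_Q\circ\cdots\circ\tau_{q+1}(\tilde y^{(q)})$, $q=1,\dots,Q$; likewise for $\tilde z$. 6. For every $q$ set $\hat\Lambda^{(q+2)}=\mathscr L(A^{(q,q+2)},\tilde y^{(q)},\tilde z^{(q+2)})$. 7. For every $q$ update $\tilde y^{(q)}$ to $\mathrm{LR}(A^{(q,q+2)},\hat\Lambda^{(q+2)},\tilde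 z^{(q+2)})$. 8. Update the column labels $\tilde z^{(q+2)}$ in the same way from $(A^{(q,q+2)})^T$ and the labels of step 5. 9. For every $q$ set $\hat\Lambda^{(q+3)}=\mathscr L(A^{(q,q+3)},\tilde y^{(q)},\tilde z^{(q+3)})$ with the updated labels. 10. Set $\hat\Lambda=\sum_q\hat\Lambda^{(q)}$. 11. Set $\hat y_\top=\mathrm{LR}(A_\top,\hat\Lambda,\tilde z)$. 12. Swap the roles of $A_\top,A_\bot$ and repeat steps 2–11 to obtain $\hat y_\bot$, except that in step 5 every row sub-block label $\tilde y^{(q)}$ is matched, by its optimal relabeling, to the corresponding part of $\hat y_\top$. 13. Output $\hat y=[\hat y_\top;\hat y_\bot]$. **Theorem.** Assume that, for sequences $\beta,\omega$: * (A1) $\dfrac{\|\Lambda\|_\infty}{\Lambda_{\min}}\vee\dfrac{\|\Gamma\|_\infty}{\Gamma_{\min}}\le\omega$; * (A2) $\frac1{\beta K}\le\pi_k(y)\le\frac\beta K$ and $\frac1{\beta L}\le\pi_\ell(z)\le\frac\beta L$ for all $k,\ell$; * (A3) $(Q^2\log Q)\,\beta^2\omega^3KL(K\vee L)\log(K\vee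 L)\,(\|\Lambda\|_\infty\vee\|\Gamma\|_\infty)^2=O(n\wedge m)$; * (A4′) $\beta\omega(\|\Lambda\|_\infty\vee\|\Gamma\|_\infty)=o\Big(\Big[\dfrac{I_{\min}\wedge I^{\rm col}_{\min}}{Q\log Q\,(K\vee L)}\Big]^a\Big)$ for some constant $a>0$; * $I_{\min}\wedge I^{\rm col}_{\min}\to\infty$ and $\Lambda_{\min}\to\infty$; * with probability $1-o(1)$, all initial row and column labels produced in steps 3 and 4 (in both passes) are $\gamma_1$-good with respect to the true labels of the corresponding rows and columns, where $$\gamma_1\le\frac1{384\beta^2\omega}\Big(\frac{I_{\min}}{8L\|\Lambda\|_\infty}\wedge\frac{I^{\rm col}_{\min}}{16K\|\Gamma\|_\infty}\Big).$$ Then there are a constant $C$ and a sequence $\zeta=o(1)$ such that, for every $k\in[K]$, with probability $1-o(1)$ (the $o(1)$ being uniform in $k$), $$\mathrm{Mis}_k(\hat y,y)\le C\,\omega\sum_{r\ne k}\Big(1+\frac1{\varepsilon_{kr}}\Big)\exp\Big(-I_{kr}-\Big(\frac12-\zeta\Big)\log\Lambda_{\min}\Big)$$ for every choice of the optimal relabeling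 in the definition of $\mathrm{Mis}_k$. -/

import Mathlib

open Filter Topology
open scoped ENNReal

namespace Biclust

noncomputable section

/-! ### Finite probability -/

/-- The product law: independent coordinates, coordinate `i` distributed as `p i`. -/
def piPMF {ι α : Type} [Fintype ι] [DecidableEq ι] [Fintype α] (p : ι → PMF α) : PMF (ι → α) :=
  PMF.ofFintype (fun f => ∏ i, p i (f i)) (by
    have h := Finset.prod_univ_sum (fun _ : ι => (Finset.univ : Finset α)) (fun i a => p i a)
    rw [Fintype.piFinset_univ] at h
    rw [← h]
    refine Finset.prod_eq_one fun i _ => ?_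
    have h1 := (p i).tsum_coe
    rwa [tsum_fintype] at h1)

/-- The Bernoulli law on `Bool`: `true` has probability `p`. -/
def bern (p : ℝ) (hp : p ∈ Set.Icc (0 : ℝ) 1) : PMF Bool :=
  PMF.ofFintype (fun b => if b = true then ENNReal.ofReal p else ENNReal.ofReal (1 - p)) (by
    rw [Fintype.sum_bool]
    simp only [if_true, Bool.false_eq_true, if_false]
    rw [← ENNReal.ofReal_add hp.1 (by linarith [hp.2])]
    simp)

/-- The probability of an event under a discrete law. -/
def prob {α : Type} (p : PMF α) (S : Set α) : ℝ≥0∞ := p.toOuterMeasure S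

/-! ### Labels and misclassification rates -/

/-- `n_k(y)`, the number of indices that carry the label `k`. -/
def clusterSize {ι : Type} [Fintype ι] {K : ℕ} (y : ι → Fin K) (k : Fin K) : ℕ :=
  (Finset.univ.filter fun i => y i = k).card

/-- `π_k(y)`, the proportion of indices that carry the label `k`. -/
def clusterProp {ι : Type} [Fintype ι] {K : ℕ} (y : ι → Fin K) (k : Fin K) : ℝ :=
  (clusterSize y k : ℝ) / (Fintype.card ι : ℝ)

/-- Direct misclassification rate (normalized Hamming distance). -/
def dMis {ι : Type} [Fintype ι] {K : ℕ} (yh y : ι → Fin K) : ℝ :=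
  ((Finset.univ.filter fun i => yh i ≠ y i).card : ℝ) / (Fintype.card ι : ℝ)

/-- Misclassification rate: minimum over relabelings of the direct misclassification rate. -/
def mis {ι : Type} [Fintype ι] {K : ℕ} (yh y : ι → Fin K) : ℝ :=
  ⨅ σ : Equiv.Perm (Fin K), dMis (fun i => σ (yh i)) y

open scoped Classical in
/-- The optimal relabelings `σ*(yh → y)`. -/
def optPerms {ι : Type} [Fintype ι] {K : ℕ} (yh y : ι → Fin K) :
    Finset (Equiv.Perm (Fin K)) :=
  Finset.univ.filter fun σ => ∀ τ : Equiv.Perm (Fin K),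
    dMis (fun i => σ (yh i)) y ≤ dMis (fun i => τ (yh i)) y

theorem optPerms_nonempty {ι : Type} [Fintype ι] {K : ℕ} (yh y : ι → Fin K) :
    (optPerms yh y).Nonempty := by
  obtain ⟨σ, -, hσ⟩ := Finset.exists_min_image (Finset.univ : Finset (Equiv.Perm (Fin K)))
    (fun σ => dMis (fun i => σ (yh i)) y) Finset.univ_nonempty
  exact ⟨σ, by simpa [optPerms] using hσ⟩

/-- Misclassification rate over the cluster `k`, after the relabeling `σ` of `yh`. -/
def misCluster {ι : Type} [Fintype ι] {K : ℕ} (σ : Equiv.Perm (Fin K)) (yh y : ι → Fin K)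
    (k : Fin K) : ℝ :=
  ((Finset.univ.filter fun i => σ (yh i) ≠ k ∧ y i = k).card : ℝ) / (clusterSize y k : ℝ)

/-! ### Functionals of a mean parameter matrix -/

/-- The largest entry. -/
def entryMax {K L : ℕ} (Lam : Matrix (Fin K) (Fin L) ℝ) : ℝ :=
  ⨆ p : Fin K × Fin L, Lam p.1 p.2

/-- The smallest entry. -/
def entryMin {K L : ℕ} (Lam : Matrix (Fin K) (Fin L) ℝ) : ℝ :=
  ⨅ p : Fin K × Fin L, Lam p.1 p.2

/-- Chernoff information `I_{kr}` between the rows `k` and `r`. -/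
def info {K L : ℕ} (Lam : Matrix (Fin K) (Fin L) ℝ) (k r : Fin K) : ℝ :=
  ⨆ s : Set.Ioo (0 : ℝ) 1,
    ∑ l, ((1 - (s : ℝ)) * Lam k l + (s : ℝ) * Lam r l
      - Lam k l ^ (1 - (s : ℝ)) * Lam r l ^ (s : ℝ))

/-- Minimum of the Chernoff information over pairs of distinct rows. -/
def infoMin {K L : ℕ} (Lam : Matrix (Fin K) (Fin L) ℝ) : ℝ :=
  ⨅ p : {p : Fin K × Fin K // p.1 ≠ p.2}, info Lam p.1.1 p.1.2

/-- `ε_{kr}`: the largest ratio between corresponding entries of two rows, minus one. -/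
def epsGap {K L : ℕ} (Lam : Matrix (Fin K) (Fin L) ℝ) (k r : Fin K) : ℝ :=
  (⨆ l, max (Lam k l / Lam r l) (Lam r l / Lam k l)) - 1

/-! ### The operators used by the algorithm -/

/-- The mean parameter estimate computed from an adjacency matrix and row and column labels. -/
def meanEst {ι κ : Type} [Fintype ι] [Fintype κ] {K L : ℕ} (A : Matrix ι κ Bool)
    (y : ι → Fin K) (z : κ → Fin L) : Matrix (Fin K) (Fin L) ℝ :=
  fun k l => (∑ i, ∑ j, if A i j = true ∧ y i = k ∧ z j = l then (1 : ℝ) else 0)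
    / (clusterSize y k : ℝ)

/-- Column compression: the number of edges from row `i` to the columns labeled `l`. -/
def compress {ι κ : Type} [Fintype κ] {L : ℕ} (A : Matrix ι κ Bool) (z : κ → Fin L)
    (i : ι) (l : Fin L) : ℕ :=
  (Finset.univ.filter fun j => A i j = true ∧ z j = l).card

/-- Joint Poisson likelihood up to the factor that does not depend on the means. -/
def poisLik {L : ℕ} (x : Fin L → ℕ) (lam : Fin L → ℝ) : ℝ :=
  ∏ l, lam l ^ x l * Real.exp (-lam l)

open scoped Classical in
/-- The labels that maximize the likelihood of row `i`. -/
def lrArgmax {ι κ : Type} [Fintype κ] {K L : ℕ} (A : Matrix ι κ Bool)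
    (Lam : Matrix (Fin K) (Fin L) ℝ) (z : κ → Fin L) (i : ι) : Finset (Fin K) :=
  Finset.univ.filter fun r => ∀ r' : Fin K,
    poisLik (compress A z i) (Lam r') ≤ poisLik (compress A z i) (Lam r)

theorem lrArgmax_nonempty {ι κ : Type} [Fintype κ] {K L : ℕ} [NeZero K] (A : Matrix ι κ Bool)
    (Lam : Matrix (Fin K) (Fin L) ℝ) (z : κ → Fin L) (i : ι) :
    (lrArgmax A Lam z i).Nonempty := by
  obtain ⟨r, -, hr⟩ := Finset.exists_max_image (Finset.univ : Finset (Fin K))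
    (fun r => poisLik (compress A z i) (Lam r)) Finset.univ_nonempty
  exact ⟨r, by simpa [lrArgmax] using hr⟩

/-- The likelihood ratio classifier; ties are broken uniformly at random, independently over
the rows. -/
def LR {ι κ : Type} [Fintype ι] [DecidableEq ι] [Fintype κ] {K L : ℕ} [NeZero K]
    (A : Matrix ι κ Bool) (Lam : Matrix (Fin K) (Fin L) ℝ) (z : κ → Fin L) :
    PMF (ι → Fin K) :=
  piPMF fun i => PMF.uniformOfFinset (lrArgmax A Lam z i) (lrArgmax_nonempty A Lam z i)

/-- A uniformly chosen optimal relabeling `σ*(yh → y)`. -/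
def drawOptPerm {ι : Type} [Fintype ι] {K : ℕ} (yh y : ι → Fin K) : PMF (Equiv.Perm (Fin K)) :=
  PMF.uniformOfFinset (optPerms yh y) (optPerms_nonempty yh y)

/-- Matching of overlapping sub-block labels. Each labeling call labels two cyclically adjacent
blocks: `x q` (block `q`) and `x' (q + 1)` (block `q + 1`) come from the same call. The optimal
relabeling `τ q` of `x' q` to `x q` translates the labels of one call into those of the next one;
the translations are composed so that all blocks get the labels of the call that produced the
last block. -/
def matchChain {Q K : ℕ} {ι : Type} [Fintype ι] (x x' : Fin Q → ι → Fin K) :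
    PMF (Fin Q → ι → Fin K) := do
  let τ ← piPMF fun q => drawOptPerm (x' q) (x q)
  return fun q i =>
    (((List.finRange Q).filter fun j => q < j).reverse.map τ).prod (x q i)

/-- Matching of sub-block labels, block by block, to given reference labels. -/
def matchTo {Q K : ℕ} {ι : Type} [Fintype ι] (x ref : Fin Q → ι → Fin K) :
    PMF (Fin Q → ι → Fin K) := do
  let τ ← piPMF fun q => drawOptPerm (x q) (ref q)
  return fun q i => τ q (x q i)

/-! ### The algorithm -/

/-- An arbitrary (possibly randomized) initial labeling procedure: `row` labels the rows of two
vertically stacked blocks, `col` labels the columns of two horizontally adjacent blocks. -/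
structure Initializer (K L h w : ℕ) where
  row : Matrix (Fin h ⊕ Fin h) (Fin w) Bool → PMF (Fin h ⊕ Fin h → Fin K)
  col : Matrix (Fin h) (Fin w ⊕ Fin w) Bool → PMF (Fin w ⊕ Fin w → Fin L)

/-- What one pass of the algorithm produces: the partition of the rows of the half that is
subdivided, the partition of the columns, the initial labels (for each `q`, those obtained from
the row blocks `q - 1, q`, and those obtained from the column blocks `q, q + 1`), and the final
labels of the rows of the other half. -/
structure Pass (K L Q h w : ℕ) where
  rowPart : Fin (Q * h) ≃ Fin Q × Fin h
  colPart : Fin (Q * w) ≃ Fin Q × Fin w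
  rowInit : Fin Q → Fin h ⊕ Fin h → Fin K
  colInit : Fin Q → Fin w ⊕ Fin w → Fin L
  out : Fin (Q * h) → Fin K

instance (a b : ℕ) : Nonempty (Fin (a * b) ≃ Fin a × Fin b) := ⟨finProdFinEquiv.symm⟩

/-- One pass: `Asub` is the half that is subdivided into `Q × Q` blocks, `Atar` is the half whose
rows are labeled at the end; `rowMatch e x x'` is the matching rule for the initial row labels,
where `e` is the row partition. Block indices are cyclic. -/
def pass {K L Q h w : ℕ} [NeZero K] [NeZero L] [NeZero Q] (S : Initializer K L h w)
    (rowMatch : (Fin (Q * h) ≃ Fin Q × Fin h) → (Fin Q → Fin h → Fin K) →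
      (Fin Q → Fin h → Fin K) → PMF (Fin Q → Fin h → Fin K))
    (Asub Atar : Matrix (Fin (Q * h)) (Fin (Q * w)) Bool) : PMF (Pass K L Q h w) := do
  -- uniformly random partition of rows and columns into groups of equal size
  let e ← PMF.uniformOfFintype (Fin (Q * h) ≃ Fin Q × Fin h)
  let f ← PMF.uniformOfFintype (Fin (Q * w) ≃ Fin Q × Fin w)
  let B : Fin Q → Fin Q → Matrix (Fin h) (Fin w) Bool :=
    fun q q' i j => Asub (e.symm (q, i)) (f.symm (q', j))
  -- initial labels
  let u ← piPMF fun q : Fin Q => S.row (Matrix.fromRows (B (q - 1) q) (B q q))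
  let v ← piPMF fun q : Fin Q => S.col (Matrix.fromCols (B q q) (B q (q + 1)))
  -- consistent labels
  let y₁ ← rowMatch e (fun q i => u (q + 1) (Sum.inl i)) (fun q i => u q (Sum.inr i))
  let z₁ ← matchChain (fun q j => v q (Sum.inl j)) (fun q j => v (q - 1) (Sum.inr j))
  -- first likelihood ratio classification of the rows, from the blocks `(q, q + 2)`
  let y₂ ← piPMF fun q : Fin Q =>
    LR (B q (q + 2)) (meanEst (B q (q + 2)) (y₁ q) (z₁ (q + 2))) (z₁ (q + 2))
  -- the same for the columns, from the same blocks and labels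
  let z₂ ← piPMF fun q : Fin Q =>
    LR (B (q - 2) q).transpose (meanEst (B (q - 2) q).transpose (z₁ q) (y₁ (q - 2))) (y₁ (q - 2))
  -- global mean parameters, from the blocks `(q, q + 3)`
  let Lam : Matrix (Fin K) (Fin L) ℝ :=
    ∑ q : Fin Q, meanEst (B q (q + 3)) (y₂ q) (z₂ (q + 3))
  -- second likelihood ratio classification
  let out ← LR Atar Lam (fun j => z₂ (f j).1 (f j).2)
  return ⟨e, f, u, v, out⟩

/-- A run of the whole algorithm: the split of the rows into a top half (index `0`) and a bottom
half (index `1`), the first pass (subdivides the bottom, labels the top) and the second pass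
(subdivides the top, labels the bottom). -/
structure Run (K L Q h w : ℕ) where
  split : Fin (2 * (Q * h)) ≃ Fin 2 × Fin (Q * h)
  first : Pass K L Q h w
  second : Pass K L Q h w

/-- The row labels that the algorithm outputs. -/
def Run.labels {K L Q h w : ℕ} (R : Run K L Q h w) (i : Fin (2 * (Q * h))) : Fin K :=
  if (R.split i).1 = 0 then R.first.out (R.split i).2 else R.second.out (R.split i).2

/-- The algorithm, as a random procedure applied to the adjacency matrix. -/
def algorithm {K L Q h w : ℕ} [NeZero K] [NeZero L] [NeZero Q] (S : Initializer K L h w)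
    (A : Matrix (Fin (2 * (Q * h))) (Fin (Q * w)) Bool) : PMF (Run K L Q h w) := do
  let s ← PMF.uniformOfFintype (Fin (2 * (Q * h)) ≃ Fin 2 × Fin (Q * h))
  let Atop : Matrix (Fin (Q * h)) (Fin (Q * w)) Bool := fun i j => A (s.symm (0, i)) j
  let Abot : Matrix (Fin (Q * h)) (Fin (Q * w)) Bool := fun i j => A (s.symm (1, i)) j
  let R₁ ← pass S (fun _ x x' => matchChain x x') Abot Atop
  let R₂ ← pass S (fun e x _ => matchTo x fun q i => R₁.out (e.symm (q, i))) Atop Abot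
  return ⟨s, R₁, R₂⟩

/-! ### The model -/

/-- A bipartite stochastic block model with `n = 2 Q h` rows, `m = Q w` columns, `K` row and `L`
column clusters, together with the number `Q` of groups into which the algorithm partitions. -/
structure BlockModel where
  K : ℕ
  L : ℕ
  Q : ℕ
  h : ℕ
  w : ℕ
  two_le_K : 2 ≤ K
  two_le_L : 2 ≤ L
  four_le_Q : 4 ≤ Q
  y : Fin (2 * (Q * h)) → Fin K
  z : Fin (Q * w) → Fin L
  P : Matrix (Fin K) (Fin L) ℝ
  P_mem : ∀ k l, P k l ∈ Set.Icc (0 : ℝ) 1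

namespace BlockModel

instance (M : BlockModel) : NeZero M.K := ⟨by have := M.two_le_K; omega⟩
instance (M : BlockModel) : NeZero M.L := ⟨by have := M.two_le_L; omega⟩
instance (M : BlockModel) : NeZero M.Q := ⟨by have := M.four_le_Q; omega⟩

/-- Number of rows. -/
def n (M : BlockModel) : ℕ := 2 * (M.Q * M.h)

/-- Number of columns. -/
def m (M : BlockModel) : ℕ := M.Q * M.w

/-- Row mean parameters `λ_{kl} = P_{kl} n_l(z)`. -/
def Lam (M : BlockModel) : Matrix (Fin M.K) (Fin M.L) ℝ :=
  fun k l => M.P k l * (clusterSize M.z l : ℝ)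

/-- Column mean parameters `Γ_{lk} = n_k(y) P_{kl}`. -/
def Gam (M : BlockModel) : Matrix (Fin M.L) (Fin M.K) ℝ :=
  fun l k => (clusterSize M.y k : ℝ) * M.P k l

/-- The law of the adjacency matrix: independent Bernoulli entries with means `P_{y_i z_j}`. -/
def sbm (M : BlockModel) : PMF (Matrix (Fin (2 * (M.Q * M.h))) (Fin (M.Q * M.w)) Bool) :=
  piPMF fun i => piPMF fun j => bern (M.P (M.y i) (M.z j)) (M.P_mem (M.y i) (M.z j))

/-- The law of a run of the algorithm on an adjacency matrix drawn from the model. -/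
def law (M : BlockModel) (S : Initializer M.K M.L M.h M.w) :
    PMF (Run M.K M.L M.Q M.h M.w) :=
  M.sbm.bind fun A => algorithm S A

/-- The initial labels of one pass are `γ`-good; `yh` are the true labels of the rows of the half
that is subdivided. -/
def PassGood (M : BlockModel) (β γ : ℝ) (yh : Fin (M.Q * M.h) → Fin M.K)
    (R : Pass M.K M.L M.Q M.h M.w) : Prop :=
  (∀ q : Fin M.Q, mis (R.rowInit q)
      (Sum.elim (fun i => yh (R.rowPart.symm (q - 1, i))) (fun i => yh (R.rowPart.symm (q, i))))
      ≤ γ / (β * M.K)) ∧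
  (∀ q : Fin M.Q, mis (R.colInit q)
      (Sum.elim (fun j => M.z (R.colPart.symm (q, j))) (fun j => M.z (R.colPart.symm (q + 1, j))))
      ≤ γ / (β * M.L))

/-- All initial labels computed during a run are `γ`-good. -/
def InitGood (M : BlockModel) (β γ : ℝ) (R : Run M.K M.L M.Q M.h M.w) : Prop :=
  M.PassGood β γ (fun i => M.y (R.split.symm (1, i))) R.first ∧
  M.PassGood β γ (fun i => M.y (R.split.symm (0, i))) R.second

/-- `‖Λ‖_∞ ∨ ‖Γ‖_∞`. -/
def supMean (M : BlockModel) : ℝ := max (entryMax M.Lam) (entryMax M.Gam)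

/-- `I_min ∧ I_min^col`. -/
def infoBoth (M : BlockModel) : ℝ := min (infoMin M.Lam) (infoMin M.Gam)

/-- `ω ∑_{r ≠ k} (1 + 1 / ε_{kr}) exp (- I_{kr} - (1/2 - ζ) log Λ_min)`. -/
def rate (M : BlockModel) (ω ζ : ℝ) (k : Fin M.K) : ℝ :=
  ω * ∑ r ∈ Finset.univ.erase k, (1 + 1 / epsGap M.Lam k r) *
    Real.exp (-info M.Lam k r - (1 / 2 - ζ) * Real.log (entryMin M.Lam))

end BlockModel

end

end Biclust

/-!
Why the rate holds: for a row `i` of the half that is labeled at the end of a pass, that pass uses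
the entries of the row only in its last step, so there the row is a vector of independent Bernoulli
entries, independent of everything computed before. If the mean parameters are then known up to a
small relative error `δ` with `δ L ‖Λ‖_∞ ≤ 1`, and the column labels are correct up to relabeling
outside a set of columns with `O(1 / ω)` expected edges to the row, the row can be misclassified
only if a fixed linear statistic of its entries exceeds a threshold: the row is bad
(`badRow`, `eq_of_mem_lrArgmax`). The exponential Markov bound for this event loses only a constant
against `exp (-I_{kr})` (`exponent_le`). The factor `1 / √Λ_min` comes from an exponential change of
measure (`PB_lin_sharp`): under the tilted law the number of edges to the column cluster where the
rows `k` and `r` differ most has point probabilities `O(1 / √Λ_min)`, and the atoms of the statistic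
above the threshold form a geometric series whose ratio is governed by `ε_{kr}` (`PB_thr_sharp`).

That the last step is reached in such a state is a deterministic statement about favourable
outcomes of the earlier ones, `exists_perm_of_mem_support_pass` and `exists_perm_labels`. The
initial labels have few errors, so optimal relabelings of overlapping blocks recover the true
relation between their label alphabets, and composing them makes all blocks consistent up to a
single relabeling; in the second pass, matching to the output of the first pass forces the same
relabeling for both halves.

The favourable outcomes (`GoodPass`) are likely because the blocks `(q, q)`, `(q, q + 1)` of the
initial labels, the blocks `(q, q + 2)` of the first round and the blocks `(q, q + 3)` of the second
round are disjoint, as `Q ≥ 4`. Conditionally on the partitions and the initial labels the block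
`(q, q + 2)` is still distributed as in the model (`ex_indicator_le`), whatever the initial
procedure does, so the preliminary mean parameters concentrate and a row or column is bad with
probability `K exp (-I_min / (4 Q))` or `L exp (-I_min^col / (8 Q))`. Bad rows and columns are counted
with their degrees in the block `(q, q + 3)`, which bounds the bias of the final mean parameter
estimate: by Markov's inequality this weight is negligible, since the growth conditions make
`exp (-c I_min / Q)` smaller than every power of `Q`, `K`, `L`, `ω` and the mean parameters
(`eventually_pow_mul_exp_le`).

These bounds are combined in `prob_not_misCluster_le`, Markov's inequality for the number of bad rows
of cluster `k`. The slack `ζ = 1 / √(log Λ_min)` makes its failure probability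
`exp (-√(log Λ_min))`, which tends to zero uniformly in `k`.
-/

set_option linter.unusedSectionVars false

namespace Biclust

noncomputable section

/-! ### Expectations under discrete laws -/

/-- The expectation of a nonnegative function under a discrete law. -/
def ex {α : Type} (p : PMF α) (f : α → ℝ≥0∞) : ℝ≥0∞ := ∑' a, p a * f a

section Expectation

variable {α β : Type}

theorem prob_eq_ex (p : PMF α) (S : Set α) : prob p S = ex p (S.indicator fun _ => 1) := by
  rw [prob, PMF.toOuterMeasure_apply, ex]
  refine tsum_congr fun a => ?_
  by_cases h : a ∈ S <;> simp [h]

theorem ex_bind (p : PMF α) (g : α → PMF β) (f : β → ℝ≥0∞) :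
    ex (p.bind g) f = ex p fun a => ex (g a) f := by
  simp only [ex, PMF.bind_apply, ← ENNReal.tsum_mul_right, ← ENNReal.tsum_mul_left]
  rw [ENNReal.tsum_comm]
  simp only [mul_assoc]

theorem ex_pure (a : α) (f : α → ℝ≥0∞) : ex (PMF.pure a) f = f a := by
  rw [ex, tsum_eq_single a]
  · simp
  · intro b hb
    simp [hb]

theorem ex_map (p : PMF α) (g : α → β) (f : β → ℝ≥0∞) : ex (p.map g) f = ex p fun a => f (g a) := by
  rw [PMF.map, ex_bind]
  simp [ex_pure]

theorem ex_mono {p : PMF α} {f g : α → ℝ≥0∞} (h : ∀ a ∈ p.support, f a ≤ g a) :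
    ex p f ≤ ex p g := by
  refine ENNReal.tsum_le_tsum fun a => ?_
  by_cases ha : a ∈ p.support
  · exact mul_le_mul_right (h a ha) _
  · rw [(PMF.apply_eq_zero_iff p a).2 ha]; simp

theorem ex_const (p : PMF α) (c : ℝ≥0∞) : ex p (fun _ => c) = c := by
  rw [ex, ENNReal.tsum_mul_right, p.tsum_coe, one_mul]

theorem ex_le_of_forall {p : PMF α} {f : α → ℝ≥0∞} {c : ℝ≥0∞} (h : ∀ a, f a ≤ c) :
    ex p f ≤ c :=
  (ex_mono fun a _ => h a).trans (ex_const p c).le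

theorem ex_mul_left (p : PMF α) (c : ℝ≥0∞) (f : α → ℝ≥0∞) :
    ex p (fun a => c * f a) = c * ex p f := by
  rw [ex, ex, ← ENNReal.tsum_mul_left]
  exact tsum_congr fun a => by ring

theorem ex_finset_sum {ι : Type} (p : PMF α) (s : Finset ι) (f : ι → α → ℝ≥0∞) :
    ex p (fun a => ∑ i ∈ s, f i a) = ∑ i ∈ s, ex p (f i) := by
  simp only [ex, Finset.mul_sum]
  exact Summable.tsum_finsetSum fun i _ => ENNReal.summable

theorem ex_comm (p : PMF α) (q : PMF β) (F : α → β → ℝ≥0∞) :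
    ex p (fun a => ex q (F a)) = ex q fun b => ex p fun a => F a b := by
  simp only [ex, ← ENNReal.tsum_mul_left]
  rw [ENNReal.tsum_comm]
  exact tsum_congr fun b => tsum_congr fun a => by ring

theorem prob_mono (p : PMF α) {S T : Set α} (h : S ⊆ T) : prob p S ≤ prob p T :=
  p.toOuterMeasure.mono h

/-- Only outcomes of positive probability matter for the comparison of two events. -/
theorem prob_mono_support (p : PMF α) {S T : Set α} (h : ∀ a ∈ p.support, a ∈ S → a ∈ T) :
    prob p S ≤ prob p T := by
  rw [prob_eq_ex, prob_eq_ex]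
  refine ex_mono fun a ha => ?_
  by_cases hS : a ∈ S
  · simp [hS, h a ha hS]
  · simp [hS]

theorem prob_union_le (p : PMF α) (S T : Set α) : prob p (S ∪ T) ≤ prob p S + prob p T :=
  MeasureTheory.measure_union_le S T

theorem prob_exists_le {ι : Type} [Fintype ι] (p : PMF α) (E : ι → α → Prop) :
    prob p {a | ∃ i, E i a} ≤ ∑ i, prob p {a | E i a} := by
  have : {a | ∃ i, E i a} = ⋃ i, {a | E i a} := by ext; simp
  rw [this]
  exact MeasureTheory.measure_iUnion_fintype_le p.toOuterMeasure _

theorem prob_exists_le_card {ι : Type} [Fintype ι] (p : PMF α) (E : ι → α → Prop) {c : ℝ≥0∞}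
    (h : ∀ i, prob p {a | E i a} ≤ c) : prob p {a | ∃ i, E i a} ≤ Fintype.card ι * c := by
  refine (prob_exists_le p E).trans ?_
  refine (Finset.sum_le_sum fun i _ => h i).trans ?_
  simp

theorem prob_le_one (p : PMF α) (S : Set α) : prob p S ≤ 1 := by
  rw [prob_eq_ex]
  refine ex_le_of_forall fun a => ?_
  by_cases h : a ∈ S <;> simp [h]

theorem prob_add_compl (p : PMF α) (S : Set α) : prob p S + prob p Sᶜ = 1 := by
  have h := ex_const p 1
  rw [prob_eq_ex, prob_eq_ex, ← h]
  simp only [ex]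
  rw [← ENNReal.tsum_add]
  refine tsum_congr fun a => ?_
  by_cases ha : a ∈ S <;> simp [ha]

/-- Markov's inequality on an event. -/
theorem mul_prob_and_le_ex (p : PMF α) (G : α → Prop) (f : α → ℝ≥0∞) (c : ℝ≥0∞) :
    c * prob p {a | G a ∧ c ≤ f a} ≤ ex p (({a | G a}).indicator f) := by
  rw [prob_eq_ex, ← ex_mul_left]
  refine ex_mono fun a _ => ?_
  by_cases h : G a <;> by_cases h' : c ≤ f a <;> simp [h, h']

end Expectation

/-! ### Product laws -/

section Product

variable {ι κ T α : Type} [Fintype ι] [DecidableEq ι] [Fintype κ] [DecidableEq κ]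
  [Fintype T] [DecidableEq T] [Fintype α]

theorem piPMF_apply (p : ι → PMF α) (f : ι → α) : piPMF p f = ∏ i, p i (f i) := rfl

theorem mem_support_piPMF (p : ι → PMF α) (f : ι → α) :
    f ∈ (piPMF p).support ↔ ∀ i, f i ∈ (p i).support := by
  simp [PMF.mem_support_iff, piPMF_apply, Finset.prod_eq_zero_iff]

theorem sum_pi_prod {R : Type} [CommSemiring R] (g : ι → α → R) :
    ∑ x : ι → α, ∏ i, g i (x i) = ∏ i, ∑ a, g i a := by
  have h := Finset.prod_univ_sum (fun _ : ι => (Finset.univ : Finset α)) g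
  rw [Fintype.piFinset_univ] at h
  exact h.symm

open scoped Classical in
theorem piPMF_map_comp (p : ι → PMF α) (φ : T → ι) (hφ : Function.Injective φ) :
    (piPMF p).map (fun x t => x (φ t)) = piPMF fun t => p (φ t) := by
  ext b
  rw [PMF.map_apply, tsum_fintype, piPMF_apply]
  have h1 : ∀ x : ι → α, (if b = (fun t => x (φ t)) then piPMF p x else 0)
      = ∏ i, (p i (x i) * ∏ t ∈ Finset.univ.filter (fun t => φ t = i),
          if b t = x i then 1 else 0) := by
    intro x
    rw [Finset.prod_mul_distrib, ← piPMF_apply]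
    have h2 : ∏ i, ∏ t ∈ Finset.univ.filter (fun t => φ t = i), (if b t = x i then (1 : ℝ≥0∞) else 0)
        = ∏ t, if b t = x (φ t) then 1 else 0 := by
      rw [← Finset.prod_fiberwise (s := Finset.univ) (g := φ)]
      refine Finset.prod_congr rfl fun i _ => Finset.prod_congr rfl fun t ht => ?_
      rw [(Finset.mem_filter.1 ht).2]
    rw [h2]
    split_ifs with h
    · rw [Finset.prod_eq_one, mul_one]
      intro t _
      rw [if_pos (congrFun h t)]
    · obtain ⟨t, ht⟩ : ∃ t, b t ≠ x (φ t) := by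
        by_contra hc
        push Not at hc
        exact h (funext hc)
      rw [Finset.prod_eq_zero (Finset.mem_univ t), mul_zero]
      simp [ht]
  refine (Finset.sum_congr rfl fun x _ => ?_ : _ = ∑ x : ι → α, ∏ i, (p i (x i) *
    ∏ t ∈ Finset.univ.filter (fun t => φ t = i), if b t = x i then 1 else 0)).trans ?_
  · convert h1 x
  rw [sum_pi_prod (fun i a => p i a * ∏ t ∈ Finset.univ.filter (fun t => φ t = i),
          if b t = a then (1 : ℝ≥0∞) else 0)]
  rw [← Finset.prod_fiberwise (s := Finset.univ) (g := φ)]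
  refine Finset.prod_congr rfl fun i _ => ?_
  by_cases hi : ∃ t, φ t = i
  · obtain ⟨t, rfl⟩ := hi
    have hs : Finset.univ.filter (fun t' => φ t' = φ t) = {t} := by
      ext t'
      simp [hφ.eq_iff]
    rw [hs]
    simp
  · have hs : Finset.univ.filter (fun t' => φ t' = i) = ∅ := by
      ext t'
      simp only [Finset.mem_filter, Finset.mem_univ, true_and, Finset.notMem_empty, iff_false]
      exact fun h => hi ⟨t', h⟩
    rw [hs]
    simp only [Finset.prod_empty, mul_one]
    have := (p i).tsum_coe
    rwa [tsum_fintype] at this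

/-- The law of a matrix with independent entries. -/
def matLaw (p : ι → κ → PMF α) : PMF (Matrix ι κ α) := piPMF fun i => piPMF fun j => p i j

/-- The matrix with the entries `x (i, j)`. -/
def toMat (x : ι × κ → α) : Matrix ι κ α := Matrix.of fun i j => x (i, j)

theorem matLaw_apply (p : ι → κ → PMF α) (A : Matrix ι κ α) :
    matLaw p A = ∏ i, ∏ j, p i j (A i j) := rfl

theorem matLaw_eq_map (p : ι → κ → PMF α) :
    matLaw p = (piPMF fun t : ι × κ => p t.1 t.2).map toMat := by
  ext A
  rw [PMF.map_apply, tsum_eq_single (fun t => A t.1 t.2), matLaw_apply]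
  · rw [if_pos (by ext; rfl)]
    rw [piPMF_apply, Fintype.prod_prod_type]
  · intro x hx
    rw [if_neg]
    rintro rfl
    exact hx rfl

/-- The law of the entries at the positions `φ t` of a matrix with independent entries. -/
theorem ex_matrix_entries (p : ι → κ → PMF α) (φ : T → ι × κ) (hφ : Function.Injective φ)
    (F : (T → α) → ℝ≥0∞) :
    ex (matLaw p) (fun A => F fun t => A (φ t).1 (φ t).2)
      = ex (piPMF fun t => p (φ t).1 (φ t).2) F := by
  rw [matLaw_eq_map, ex_map]
  have := piPMF_map_comp (fun t : ι × κ => p t.1 t.2) φ hφ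
  rw [← this, ex_map]
  rfl

theorem prob_matrix_entries (p : ι → κ → PMF α) (φ : T → ι × κ) (hφ : Function.Injective φ)
    (E : (T → α) → Prop) :
    prob (matLaw p) {A | E fun t => A (φ t).1 (φ t).2}
      = prob (piPMF fun t => p (φ t).1 (φ t).2) {x | E x} := by
  rw [prob_eq_ex, prob_eq_ex, ← ex_matrix_entries p φ hφ]
  rfl

open scoped Classical in
/-- The coordinates in `S` are taken from `x'`, all others from `x`. -/
def mixOn (S : Set ι) (x' x : ι → α) (i : ι) : α := if i ∈ S then x' i else x i

theorem ex_piPMF_mix (p : ι → PMF α) (S : Set ι) (F : (ι → α) → ℝ≥0∞) :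
    ex (piPMF p) F = ex (piPMF p) fun x => ex (piPMF p) fun x' => F (mixOn S x' x) := by
  classical
  have hone : ∑ x, piPMF p x = 1 := by
    have := (piPMF p).tsum_coe
    rwa [tsum_fintype] at this
  have hinv : ∀ z : (ι → α) × (ι → α), (mixOn S (mixOn S z.1 z.2) (mixOn S z.2 z.1),
      mixOn S (mixOn S z.2 z.1) (mixOn S z.1 z.2)) = z := by
    intro z
    refine Prod.ext ?_ ?_ <;> funext i <;> by_cases h : i ∈ S <;> simp [mixOn, h]
  have e : (ι → α) × (ι → α) ≃ (ι → α) × (ι → α) :=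
    { toFun := fun z => (mixOn S z.2 z.1, mixOn S z.1 z.2)
      invFun := fun z => (mixOn S z.2 z.1, mixOn S z.1 z.2)
      left_inv := hinv
      right_inv := hinv }
  have hmul : ∀ z : (ι → α) × (ι → α),
      piPMF p (mixOn S z.2 z.1) * piPMF p (mixOn S z.1 z.2) = piPMF p z.1 * piPMF p z.2 := by
    intro z
    simp only [piPMF_apply, ← Finset.prod_mul_distrib]
    refine Finset.prod_congr rfl fun i _ => ?_
    by_cases h : i ∈ S <;> simp [mixOn, h, mul_comm]
  have hL : ex (piPMF p) F
      = ∑ z : (ι → α) × (ι → α), piPMF p z.1 * piPMF p z.2 * F z.1 := by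
    rw [Fintype.sum_prod_type, ex, tsum_fintype]
    refine Finset.sum_congr rfl fun x _ => ?_
    simp only
    rw [← Finset.sum_mul, ← Finset.mul_sum, hone, mul_one]
  have hR : (ex (piPMF p) fun x => ex (piPMF p) fun x' => F (mixOn S x' x))
      = ∑ z : (ι → α) × (ι → α), piPMF p z.1 * piPMF p z.2 * F (mixOn S z.2 z.1) := by
    rw [Fintype.sum_prod_type, ex, tsum_fintype]
    refine Finset.sum_congr rfl fun x _ => ?_
    rw [ex, tsum_fintype, Finset.mul_sum]
    exact Finset.sum_congr rfl fun x' _ => by ring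
  rw [hL, hR]
  refine Finset.sum_bijective (fun z => (mixOn S z.2 z.1, mixOn S z.1 z.2))
    (Function.Involutive.bijective hinv) (by simp) fun z _ => ?_
  have h2 := congrArg Prod.fst (hinv z)
  simp only at h2 ⊢
  rw [hmul, h2]

open scoped Classical in
/-- The entries of a matrix at the positions in `S` are taken from `A'`, all others from `A`. -/
def mixMat (S : Set (ι × κ)) (A' A : Matrix ι κ α) : Matrix ι κ α :=
  fun i j => if (i, j) ∈ S then A' i j else A i j

theorem ex_matrix_mix (p : ι → κ → PMF α) (S : Set (ι × κ)) (F : Matrix ι κ α → ℝ≥0∞) :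
    ex (matLaw p) F
      = ex (matLaw p) fun A =>
          ex (matLaw p) fun A' => F (mixMat S A' A) := by
  simp only [matLaw_eq_map, ex_map]
  rw [ex_piPMF_mix _ S]
  rfl

/-- Conditioning on the entries outside `S`: a random variable drawn from a law `κ'` that only
depends on these entries is independent of the entries in `S`, which may be resampled. -/
theorem ex_ex_le_of_resample {β : Type} (p : ι → κ → PMF α) (S : Set (ι × κ))
    (κ' : Matrix ι κ α → PMF β) (hκ : ∀ A A', κ' (mixMat S A' A) = κ' A)
    (F g : Matrix ι κ α → β → ℝ≥0∞) (c : ℝ≥0∞)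
    (h : ∀ A b, ex (matLaw p) (fun A' => F (mixMat S A' A) b)
      ≤ c * g A b) :
    ex (matLaw p) (fun A => ex (κ' A) (F A))
      ≤ c * ex (matLaw p) fun A => ex (κ' A) (g A) := by
  rw [ex_matrix_mix p S]
  simp only [hκ]
  rw [← ex_mul_left]
  refine ex_mono fun A _ => ?_
  rw [ex_comm, ← ex_mul_left]
  exact ex_mono fun b _ => h A b

end Product

/-! ### Real expectations under products of Bernoulli laws -/

section Bernoulli

variable {ι : Type} [Fintype ι] [DecidableEq ι]

/-- Weight of `x` under the product of the Bernoulli laws with means `p i`. -/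
def bw (p : ι → ℝ) (x : ι → Bool) : ℝ := ∏ i, if x i = true then p i else 1 - p i

/-- Expectation under the product of the Bernoulli laws with means `p i`. -/
def EB (p : ι → ℝ) (f : (ι → Bool) → ℝ) : ℝ := ∑ x, bw p x * f x

theorem bw_nonneg {p : ι → ℝ} (hp : ∀ i, p i ∈ Set.Icc (0 : ℝ) 1) (x : ι → Bool) :
    0 ≤ bw p x := by
  refine Finset.prod_nonneg fun i _ => ?_
  split_ifs
  · exact (hp i).1
  · linarith [(hp i).2]

theorem piPMF_bern_apply {p : ι → ℝ} (hp : ∀ i, p i ∈ Set.Icc (0 : ℝ) 1) (x : ι → Bool) :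
    piPMF (fun i => bern (p i) (hp i)) x = ENNReal.ofReal (bw p x) := by
  rw [piPMF_apply, bw, ENNReal.ofReal_prod_of_nonneg]
  · refine Finset.prod_congr rfl fun i _ => ?_
    rw [bern, PMF.ofFintype_apply]
    split_ifs <;> rfl
  · intro i _
    split_ifs
    · exact (hp i).1
    · linarith [(hp i).2]

theorem ex_bern {p : ι → ℝ} (hp : ∀ i, p i ∈ Set.Icc (0 : ℝ) 1) {f : (ι → Bool) → ℝ}
    (hf : ∀ x, 0 ≤ f x) :
    ex (piPMF fun i => bern (p i) (hp i)) (fun x => ENNReal.ofReal (f x))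
      = ENNReal.ofReal (EB p f) := by
  rw [ex, tsum_fintype, EB, ENNReal.ofReal_sum_of_nonneg]
  · refine Finset.sum_congr rfl fun x _ => ?_
    rw [piPMF_bern_apply, ENNReal.ofReal_mul (bw_nonneg hp x)]
  · exact fun x _ => mul_nonneg (bw_nonneg hp x) (hf x)

open scoped Classical in
/-- Probability under the product of the Bernoulli laws with means `p i`. -/
def PB (p : ι → ℝ) (E : (ι → Bool) → Prop) : ℝ := EB p fun x => if E x then 1 else 0

theorem prob_bern {p : ι → ℝ} (hp : ∀ i, p i ∈ Set.Icc (0 : ℝ) 1) (E : (ι → Bool) → Prop) :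
    prob (piPMF fun i => bern (p i) (hp i)) {x | E x} = ENNReal.ofReal (PB p E) := by
  classical
  rw [prob_eq_ex, PB, ← ex_bern hp]
  · congr 1
    funext x
    by_cases h : E x <;> simp [h]
  · intro x
    split_ifs <;> norm_num

theorem EB_mono {p : ι → ℝ} (hp : ∀ i, p i ∈ Set.Icc (0 : ℝ) 1) {f g : (ι → Bool) → ℝ}
    (h : ∀ x, f x ≤ g x) : EB p f ≤ EB p g :=
  Finset.sum_le_sum fun x _ => mul_le_mul_of_nonneg_left (h x) (bw_nonneg hp x)

theorem EB_const_mul (p : ι → ℝ) (c : ℝ) (f : (ι → Bool) → ℝ) :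
    EB p (fun x => c * f x) = c * EB p f := by
  rw [EB, EB, Finset.mul_sum]
  exact Finset.sum_congr rfl fun x _ => by ring

theorem EB_finset_sum {τ : Type} (p : ι → ℝ) (s : Finset τ) (f : τ → (ι → Bool) → ℝ) :
    EB p (fun x => ∑ t ∈ s, f t x) = ∑ t ∈ s, EB p (f t) := by
  simp only [EB, Finset.mul_sum]
  exact Finset.sum_comm

theorem EB_prod (p : ι → ℝ) (g : ι → Bool → ℝ) :
    EB p (fun x => ∏ i, g i (x i)) = ∏ i, (p i * g i true + (1 - p i) * g i false) := by
  simp only [EB, bw, ← Finset.prod_mul_distrib]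
  rw [sum_pi_prod fun i b => (if b = true then p i else 1 - p i) * g i b]
  simp

theorem EB_const (p : ι → ℝ) (c : ℝ) : EB p (fun _ => c) = c := by
  have h := EB_prod p fun _ _ => 1
  simp only [Finset.prod_const_one, mul_one, add_sub_cancel] at h
  have h2 := EB_const_mul p c fun _ => 1
  simp only [mul_one] at h2
  rw [h2, h, mul_one]

/-- The linear statistic `∑ i, x i * a i` of a binary vector. -/
def lin (a : ι → ℝ) (x : ι → Bool) : ℝ := ∑ i, if x i = true then a i else 0

theorem EB_exp_lin (p a : ι → ℝ) :
    EB p (fun x => Real.exp (lin a x)) = ∏ i, (1 + p i * (Real.exp (a i) - 1)) := by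
  have h := EB_prod p fun i b => Real.exp (if b = true then a i else 0)
  simp only [← Real.exp_sum] at h
  simp only [lin]
  rw [h]
  refine Finset.prod_congr rfl fun i _ => ?_
  simp
  ring

theorem EB_exp_lin_le {p : ι → ℝ} (hp : ∀ i, p i ∈ Set.Icc (0 : ℝ) 1) (a : ι → ℝ) :
    EB p (fun x => Real.exp (lin a x)) ≤ Real.exp (∑ i, p i * (Real.exp (a i) - 1)) := by
  rw [EB_exp_lin, Real.exp_sum]
  refine Finset.prod_le_prod (fun i _ => ?_) fun i _ => ?_
  · have := Real.exp_pos (a i)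
    nlinarith [(hp i).1, (hp i).2]
  · linarith [Real.add_one_le_exp (p i * (Real.exp (a i) - 1))]

theorem PB_le_EB {p : ι → ℝ} (hp : ∀ i, p i ∈ Set.Icc (0 : ℝ) 1) {E : (ι → Bool) → Prop}
    {f : (ι → Bool) → ℝ} (hf : ∀ x, 0 ≤ f x) (h : ∀ x, E x → 1 ≤ f x) : PB p E ≤ EB p f := by
  classical
  refine EB_mono hp fun x => ?_
  split_ifs with hx
  · exact h x hx
  · exact hf x

theorem PB_mono {p : ι → ℝ} (hp : ∀ i, p i ∈ Set.Icc (0 : ℝ) 1) {E F : (ι → Bool) → Prop}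
    (h : ∀ x, E x → F x) : PB p E ≤ PB p F := by
  classical
  refine EB_mono hp fun x => ?_
  by_cases hE : E x
  · simp [hE, h x hE]
  · simp only [hE, if_false]
    split_ifs <;> norm_num

theorem PB_exists_le {τ : Type} {p : ι → ℝ} (hp : ∀ i, p i ∈ Set.Icc (0 : ℝ) 1)
    (s : Finset τ) (E : τ → (ι → Bool) → Prop) :
    PB p (fun x => ∃ t ∈ s, E t x) ≤ ∑ t ∈ s, PB p (E t) := by
  classical
  simp only [PB]
  rw [← EB_finset_sum]
  refine EB_mono hp fun x => ?_
  have h0 : ∀ t ∈ s, (0 : ℝ) ≤ if E t x then 1 else 0 := fun t _ => by split_ifs <;> norm_num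
  split_ifs with hx
  · obtain ⟨t, ht, hE⟩ := hx
    refine le_trans ?_ (Finset.single_le_sum h0 ht)
    simp [hE]
  · exact Finset.sum_nonneg h0

/-- The exponential Markov inequality for a linear statistic. -/
theorem PB_lin_le {p : ι → ℝ} (hp : ∀ i, p i ∈ Set.Icc (0 : ℝ) 1) (a : ι → ℝ) (t : ℝ) {s : ℝ}
    (hs : 0 ≤ s) :
    PB p (fun x => t ≤ lin a x) ≤ Real.exp (-(s * t) + ∑ i, p i * (Real.exp (s * a i) - 1)) := by
  rw [Real.exp_add]
  have h1 := EB_exp_lin_le hp fun i => s * a i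
  refine le_trans ?_ (mul_le_mul_of_nonneg_left h1 (Real.exp_pos _).le)
  rw [← EB_const_mul]
  refine PB_le_EB hp (fun x => by positivity) fun x hx => ?_
  rw [← Real.exp_add, Real.one_le_exp_iff]
  have : lin (fun i => s * a i) x = s * lin a x := by
    simp only [lin, Finset.mul_sum]
    refine Finset.sum_congr rfl fun i _ => ?_
    split_ifs <;> simp
  rw [this]
  nlinarith

end Bernoulli

/-! ### Concentration of linear statistics -/

section Chernoff

variable {ι : Type} [Fintype ι] [DecidableEq ι]

theorem PB_lin_upper {p : ι → ℝ} (hp : ∀ i, p i ∈ Set.Icc (0 : ℝ) 1) (a : ι → ℝ) {W ν x : ℝ}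
    (hW : 0 < W) (hν : 0 < ν) (ha : ∀ i, |a i| ≤ W) (hv : ∑ i, p i * a i ^ 2 ≤ W * ν)
    (hx : 0 ≤ x) (hxν : x ≤ 2 * ν) :
    PB p (fun y => ∑ i, p i * a i + x ≤ lin a y) ≤ Real.exp (-(x ^ 2 / (4 * W * ν))) := by
  set s := x / (2 * W * ν) with hs
  have hs0 : 0 ≤ s := by positivity
  have hsW : s * W ≤ 1 := by
    rw [hs, div_mul_eq_mul_div, div_le_one (by positivity)]
    nlinarith
  refine (PB_lin_le hp a _ hs0).trans (Real.exp_le_exp.2 ?_)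
  have h1 : ∑ i, p i * (Real.exp (s * a i) - 1) ≤ ∑ i, (s * (p i * a i) + s ^ 2 * (p i * a i ^ 2)) := by
    refine Finset.sum_le_sum fun i _ => ?_
    have h2 : |s * a i| ≤ 1 := by
      rw [abs_mul, abs_of_nonneg hs0]
      exact (mul_le_mul_of_nonneg_left (ha i) hs0).trans hsW
    have h3 := (abs_le.1 (Real.abs_exp_sub_one_sub_id_le h2)).2
    nlinarith [mul_le_mul_of_nonneg_left h3 (hp i).1]
  rw [Finset.sum_add_distrib, ← Finset.mul_sum, ← Finset.mul_sum] at h1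
  have h4 := mul_le_mul_of_nonneg_left hv (sq_nonneg s)
  have h5 : s ^ 2 * (W * ν) - s * x = -(x ^ 2 / (4 * W * ν)) := by
    rw [hs]
    field_simp
    ring
  linarith

/-- Bernstein-type two-sided bound for a weighted sum of independent Bernoulli variables with
weights in `[0, W]` and mean at most `ν`. -/
theorem PB_abs_lin_sub_le {p : ι → ℝ} (hp : ∀ i, p i ∈ Set.Icc (0 : ℝ) 1) (a : ι → ℝ) {W ν x : ℝ}
    (hW : 0 < W) (hν : 0 < ν) (ha0 : ∀ i, 0 ≤ a i) (ha : ∀ i, a i ≤ W)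
    (hm : ∑ i, p i * a i ≤ ν) (hx : 0 ≤ x) (hxν : x ≤ 2 * ν) :
    PB p (fun y => x ≤ |lin a y - ∑ i, p i * a i|) ≤ 2 * Real.exp (-(x ^ 2 / (4 * W * ν))) := by
  have hv : ∑ i, p i * a i ^ 2 ≤ W * ν := by
    refine le_trans ?_ (mul_le_mul_of_nonneg_left hm hW.le)
    rw [Finset.mul_sum]
    refine Finset.sum_le_sum fun i _ => ?_
    have := mul_le_mul_of_nonneg_left (ha i) (mul_nonneg (hp i).1 (ha0 i))
    nlinarith
  have h1 := PB_lin_upper hp a hW hν (fun i => by rw [abs_of_nonneg (ha0 i)]; exact ha i) hv hx hxν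
  have h2 := PB_lin_upper hp (fun i => -a i) hW hν
    (fun i => by rw [abs_neg, abs_of_nonneg (ha0 i)]; exact ha i) (by simpa using hv) hx hxν
  have h3 := PB_exists_le hp (Finset.univ : Finset Bool)
    (fun b y => if b = true then ∑ i, p i * a i + x ≤ lin a y else
      ∑ i, p i * -a i + x ≤ lin (fun i => -a i) y)
  simp only [Fintype.sum_bool, if_true, Bool.false_eq_true, if_false] at h3
  refine (PB_mono hp fun y hy => ?_).trans (h3.trans (by linarith))
  have hneg : lin (fun i => -a i) y = -lin a y := by
    simp only [lin, ← Finset.sum_neg_distrib]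
    exact Finset.sum_congr rfl fun i _ => by split_ifs <;> simp
  rcases le_abs.1 hy with h | h
  · refine ⟨true, Finset.mem_univ _, ?_⟩
    simp only [if_true]
    linarith
  · refine ⟨false, Finset.mem_univ _, ?_⟩
    simp only [Bool.false_eq_true, if_false, hneg, mul_neg, Finset.sum_neg_distrib]
    linarith

end Chernoff

/-! ### A local bound for binomial laws -/

/-- Chernoff bound for a single atom: one term of the binomial expansion of
`(p e ^ t + 1 - p) ^ N` is at most the whole sum. -/
theorem binomial_le_exp {N x : ℕ} (hx : x ≤ N) {p : ℝ} (hp0 : 0 ≤ p) (hp1 : p ≤ 1) (t : ℝ) :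
    (N.choose x : ℝ) * p ^ x * (1 - p) ^ (N - x)
      ≤ Real.exp (N * p * (Real.exp t - 1) - t * x) := by
  have h1 : (N.choose x : ℝ) * (p * Real.exp t) ^ x * (1 - p) ^ (N - x)
      ≤ (p * Real.exp t + (1 - p)) ^ N := by
    rw [add_pow]
    have h2 : ∀ m ∈ Finset.range (N + 1),
        0 ≤ (p * Real.exp t) ^ m * (1 - p) ^ (N - m) * (N.choose m : ℝ) := by
      intro m _
      have : 0 ≤ 1 - p := by linarith
      positivity
    refine le_trans (le_of_eq ?_) (Finset.single_le_sum h2 (Finset.mem_range.2 (by omega : x < N + 1)))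
    ring
  have h3 : (p * Real.exp t + (1 - p)) ^ N ≤ Real.exp (N * p * (Real.exp t - 1)) := by
    have h4 := Real.add_one_le_exp (p * (Real.exp t - 1))
    have h5 : 0 ≤ p * Real.exp t + (1 - p) := by
      have := Real.exp_pos t
      nlinarith
    calc (p * Real.exp t + (1 - p)) ^ N ≤ Real.exp (p * (Real.exp t - 1)) ^ N :=
          pow_le_pow_left₀ h5 (by linarith) N
      _ = Real.exp (N * p * (Real.exp t - 1)) := by
          rw [← Real.exp_nat_mul]
          ring_nf
  rw [Real.exp_sub, le_div_iff₀ (Real.exp_pos _)]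
  refine le_trans (le_of_eq ?_) (h1.trans h3)
  rw [mul_pow, ← Real.exp_nat_mul, mul_comm (x : ℝ) t]
  ring

theorem exp_neg_le_inv_sqrt {μ : ℝ} (hμ : 0 < μ) : Real.exp (-(7 / 20 * μ)) ≤ 1 / √μ := by
  have h1 := Real.add_one_le_exp (7 / 20 * μ)
  have h2 := Real.sq_sqrt hμ.le
  have h3 := Real.sqrt_pos.2 hμ
  rw [Real.exp_neg, inv_eq_one_div]
  refine one_div_le_one_div_of_le h3 (le_trans ?_ h1)
  nlinarith [sq_nonneg (√μ - 1 / (7 / 10))]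

/-- Point probabilities of a binomial law of mean `μ` are `O(1 / √μ)`, as long as the law is close
to a Poisson law (`p μ` bounded). -/
theorem binomial_le_inv_sqrt {N x : ℕ} (hx : x ≤ N) {p c : ℝ} (hp0 : 0 < p) (hp1 : p < 1)
    (hN : 0 < N) (hc : p * (N * p) ≤ c) :
    (N.choose x : ℝ) * p ^ x * (1 - p) ^ (N - x) ≤ Real.exp (2 * c) / √(N * p) := by
  have hN' : (0 : ℝ) < N := by exact_mod_cast hN
  set μ : ℝ := N * p with hμd
  have hμ : 0 < μ := by positivity
  have hc0 : 0 ≤ c := le_trans (by positivity) hc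
  have hone : 1 / √μ ≤ Real.exp (2 * c) / √μ := by
    gcongr
    exact Real.one_le_exp (by positivity)
  -- Far from the mean the atoms are exponentially small; near the mean Stirling applies.
  by_cases h1 : 2 * μ ≤ x
  · refine le_trans (binomial_le_exp hx hp0.le hp1.le (1 / 2)) (le_trans ?_ hone)
    refine le_trans (Real.exp_le_exp.2 ?_) (exp_neg_le_inv_sqrt hμ)
    have h2 : Real.exp (1 / 2) ≤ 1.65 := by
      have h3 := Real.exp_one_lt_d9
      have h4 : Real.exp (1 / 2) ^ 2 = Real.exp 1 := by rw [← Real.exp_nat_mul]; norm_num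
      nlinarith [Real.exp_pos (1 / 2)]
    rw [← hμd]
    nlinarith
  by_cases h2 : (x : ℝ) < μ / 4
  · refine le_trans (binomial_le_exp hx hp0.le hp1.le (-1)) (le_trans ?_ hone)
    refine le_trans (Real.exp_le_exp.2 ?_) (exp_neg_le_inv_sqrt hμ)
    have h2 : Real.exp (-1) ≤ 0.4 := by
      have h3 := Real.exp_one_gt_d9
      rw [Real.exp_neg]
      refine (inv_anti₀ (by norm_num) h3.le).trans (by norm_num)
    rw [← hμd]
    nlinarith
  push Not at h1 h2
  have hx0 : (0 : ℝ) < x := lt_of_lt_of_le (by positivity) h2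
  have hpi := Real.pi_gt_three
  have hsq : √μ ≤ √(2 * Real.pi * x) := Real.sqrt_le_sqrt (by nlinarith)
  have hsμ := Real.sqrt_pos.2 hμ
  have hst := Stirling.le_factorial_stirling x
  have hch := Nat.choose_le_pow_div (α := ℝ) x N
  have hfac : (0 : ℝ) < x.factorial := by exact_mod_cast x.factorial_pos
  -- `(μ / x) ^ x ≤ exp (μ - x)`
  have hpow : μ ^ x ≤ x ^ x * Real.exp (μ - x) := by
    have h3 : μ / x ≤ Real.exp (μ / x - 1) := by linarith [Real.add_one_le_exp (μ / x - 1)]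
    have h4 := pow_le_pow_left₀ (by positivity) h3 x
    rw [div_pow, div_le_iff₀ (by positivity), ← Real.exp_nat_mul] at h4
    refine h4.trans (le_of_eq ?_)
    rw [mul_comm]
    congr 2
    field_simp
  -- `(1 - p) ^ (N - x) ≤ exp (-μ + p x)`; the correction `p x ≤ 2 p μ` is where `c` enters
  have hq : (1 - p) ^ (N - x) ≤ Real.exp (-μ + p * x) := by
    have h3 : 1 - p ≤ Real.exp (-p) := by linarith [Real.add_one_le_exp (-p)]
    refine (pow_le_pow_left₀ (by linarith) h3 (N - x)).trans (le_of_eq ?_)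
    rw [← Real.exp_nat_mul, Nat.cast_sub hx]
    congr 1
    rw [hμd]
    ring
  have hA : (N.choose x : ℝ) * p ^ x ≤ Real.exp μ / √μ := by
    have h5 : (N.choose x : ℝ) * p ^ x ≤ μ ^ x / x.factorial := by
      rw [hμd, mul_pow, mul_div_right_comm]
      gcongr
    refine h5.trans ?_
    rw [div_le_div_iff₀ hfac hsμ]
    calc μ ^ x * √μ ≤ (x ^ x * Real.exp (μ - x)) * √(2 * Real.pi * x) := by gcongr
      _ = Real.exp μ * (√(2 * Real.pi * x) * (x / Real.exp 1) ^ x) := by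
          rw [Real.exp_sub, div_pow, ← Real.exp_nat_mul, mul_one]
          ring
      _ ≤ Real.exp μ * x.factorial := by gcongr
  calc (N.choose x : ℝ) * p ^ x * (1 - p) ^ (N - x)
      ≤ Real.exp μ / √μ * Real.exp (-μ + p * x) := by
        refine mul_le_mul hA hq (pow_nonneg (by linarith) _) (by positivity)
    _ = Real.exp (p * x) / √μ := by
        rw [div_mul_eq_mul_div, ← Real.exp_add]
        ring_nf
    _ ≤ Real.exp (2 * c) / √μ := by
        refine div_le_div_of_nonneg_right (Real.exp_le_exp.2 ?_) hsμ.le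
        nlinarith [mul_le_mul_of_nonneg_left h1.le hp0.le]

/-! ### A sharp tail bound -/

theorem sum_exp_arith_le_of_pos {s a : ℝ} (hs : 0 < s) (ha : 0 < a) (N : ℕ) (c : ℝ) :
    ∑ x ∈ Finset.range N, (if 0 ≤ c + a * x then Real.exp (-(s * (c + a * x))) else 0)
      ≤ Real.exp (-(s * max c 0)) / (1 - Real.exp (-(s * a))) := by
  have hr : Real.exp (-(s * a)) < 1 := by
    rw [Real.exp_lt_one_iff]
    nlinarith [mul_pos hs ha]
  have hr' : 0 < 1 - Real.exp (-(s * a)) := by linarith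
  induction N generalizing c with
  | zero => simp; positivity
  | succ N ih =>
    rw [Finset.sum_range_succ']
    have h1 := ih (c + a)
    have h2 : ∑ x ∈ Finset.range N, (if 0 ≤ c + a * ((x + 1 : ℕ) : ℝ) then
          Real.exp (-(s * (c + a * ((x + 1 : ℕ) : ℝ)))) else 0)
        = ∑ x ∈ Finset.range N, (if 0 ≤ c + a + a * x then
          Real.exp (-(s * (c + a + a * x))) else 0) := by
      refine Finset.sum_congr rfl fun x _ => ?_
      have : c + a * ((x + 1 : ℕ) : ℝ) = c + a + a * x := by push_cast; ring
      rw [this]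
    rw [h2]
    simp only [Nat.cast_zero, mul_zero, add_zero]
    by_cases hc : 0 ≤ c
    · rw [if_pos hc, max_eq_left hc]
      rw [max_eq_left (by linarith)] at h1
      have h3 : Real.exp (-(s * (c + a))) = Real.exp (-(s * c)) * Real.exp (-(s * a)) := by
        rw [← Real.exp_add]; ring_nf
      rw [h3] at h1
      refine (add_le_add_left h1 _).trans (le_of_eq ?_)
      field_simp
      ring
    · rw [if_neg hc, add_zero, max_eq_right (not_le.1 hc).le]
      refine h1.trans ?_
      gcongr
      exact le_max_right _ _

/-- A geometric series along an arithmetic progression, restricted to its nonnegative terms. -/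
theorem sum_exp_arith_le {s a : ℝ} (hs : 0 < s) (ha : a ≠ 0) (N : ℕ) (c : ℝ) :
    ∑ x ∈ Finset.range N, (if 0 ≤ c + a * x then Real.exp (-(s * (c + a * x))) else 0)
      ≤ 1 + 1 / (s * |a|) := by
  have key : ∀ b : ℝ, 0 < b → ∀ c' : ℝ,
      ∑ x ∈ Finset.range N, (if 0 ≤ c' + b * x then Real.exp (-(s * (c' + b * x))) else 0)
      ≤ 1 + 1 / (s * b) := by
    intro b hb c'
    refine (sum_exp_arith_le_of_pos hs hb N c').trans ?_
    have hy : 0 < s * b := mul_pos hs hb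
    have hr : Real.exp (-(s * b)) ≤ 1 / (1 + s * b) := by
      rw [Real.exp_neg, inv_eq_one_div]
      refine one_div_le_one_div_of_le (by positivity) ?_
      linarith [Real.add_one_le_exp (s * b)]
    have h1 : s * b / (1 + s * b) ≤ 1 - Real.exp (-(s * b)) := by
      have : s * b / (1 + s * b) = 1 - 1 / (1 + s * b) := by field_simp; ring
      linarith
    calc Real.exp (-(s * max c' 0)) / (1 - Real.exp (-(s * b)))
        ≤ 1 / (s * b / (1 + s * b)) := by
          gcongr
          rw [Real.exp_le_one_iff]
          have := mul_nonneg hs.le (le_max_right c' 0)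
          linarith
      _ = 1 + 1 / (s * b) := by field_simp; ring
  rcases lt_or_gt_of_ne ha with h | h
  · rw [abs_of_neg h, ← Finset.sum_range_reflect]
    refine le_trans (Finset.sum_le_sum fun x hx => ?_) (key (-a) (by linarith) (c + a * (N - 1)))
    have hxN := Finset.mem_range.1 hx
    have : c + a * ((N - 1 - x : ℕ) : ℝ) = c + a * (N - 1) + -a * x := by
      rw [Nat.cast_sub (by omega), Nat.cast_sub (by omega)]
      push_cast
      ring
    rw [this]
  · rw [abs_of_pos h]
    exact key a h c

section Sharp

variable {ι : Type} [Fintype ι] [DecidableEq ι]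

/-- Averaging over the coordinates in `S` first, with the others frozen. -/
theorem EB_le_of_mix {p : ι → ℝ} (hp : ∀ i, p i ∈ Set.Icc (0 : ℝ) 1) (S : Set ι)
    {F : (ι → Bool) → ℝ} (hF : ∀ x, 0 ≤ F x) {B : ℝ}
    (h : ∀ x, EB p (fun x' => F (mixOn S x' x)) ≤ B) : EB p F ≤ B := by
  have hB : 0 ≤ B := le_trans (Finset.sum_nonneg fun x' _ =>
    mul_nonneg (bw_nonneg hp x') (hF _)) (h fun _ => true)
  rw [← ENNReal.ofReal_le_ofReal_iff hB, ← ex_bern hp hF, ex_piPMF_mix _ S]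
  refine ex_le_of_forall fun x => ?_
  rw [ex_bern hp fun x' => hF _]
  exact ENNReal.ofReal_le_ofReal (h x)

theorem PB_filter_eq (p : ι → ℝ) (J : Finset ι) {p₀ : ℝ} (hJ : ∀ j ∈ J, p j = p₀)
    {U : Finset ι} (hU : U ⊆ J) :
    PB p (fun x => J.filter (fun j => x j = true) = U) = p₀ ^ U.card * (1 - p₀) ^ (J.card - U.card) := by
  classical
  have h1 : ∀ x : ι → Bool, (if J.filter (fun j => x j = true) = U then (1 : ℝ) else 0)
      = ∏ j, if j ∈ J then (if x j = decide (j ∈ U) then 1 else 0) else 1 := by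
    intro x
    split_ifs with h
    · rw [Finset.prod_eq_one]
      intro j _
      split_ifs with hj hx <;> try rfl
      exfalso
      apply hx
      rw [← h]
      simp [hj]
    · symm
      by_contra hne
      replace hne : (∏ j, if j ∈ J then (if x j = decide (j ∈ U) then (1 : ℝ) else 0) else 1) ≠ 0 :=
        hne
      apply h
      rw [Finset.prod_ne_zero_iff] at hne
      ext j
      have hj := hne j (Finset.mem_univ _)
      by_cases hjJ : j ∈ J
      · simp only [hjJ, if_true, ne_eq, ite_eq_right_iff, one_ne_zero, imp_false, not_not] at hj
        simp [hjJ, hj]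
      · simp only [Finset.mem_filter, hjJ, false_and, false_iff]
        exact fun h => hjJ (hU h)
  rw [PB]
  have h2 := EB_prod p fun j b => if j ∈ J then (if b = decide (j ∈ U) then (1 : ℝ) else 0) else 1
  refine (Eq.trans ?_ h2).trans ?_
  · congr 1
    funext x
    rw [← h1 x]
    congr
  have h3 : ∀ j, (p j * (if j ∈ J then (if true = decide (j ∈ U) then (1 : ℝ) else 0) else 1) +
      (1 - p j) * (if j ∈ J then (if false = decide (j ∈ U) then (1 : ℝ) else 0) else 1))
      = if j ∈ J then (if j ∈ U then p₀ else 1 - p₀) else 1 := by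
    intro j
    by_cases hj : j ∈ J <;> by_cases hjU : j ∈ U <;> simp [hj, hjU]
    · exact hJ j hj
    · exact hJ j hj
  simp only [h3]
  rw [Fintype.prod_ite_mem, Finset.prod_ite, Finset.prod_const, Finset.prod_const,
    Finset.filter_mem_eq_inter, Finset.inter_eq_right.2 hU, Finset.filter_notMem_eq_sdiff,
    Finset.card_sdiff_of_subset hU]

/-- A function of the number of ones among the coordinates in `J`, when these have the same mean:
its expectation under a binomial law. -/
theorem EB_count (p : ι → ℝ) (J : Finset ι) {p₀ : ℝ} (hJ : ∀ j ∈ J, p j = p₀) (g : ℕ → ℝ) :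
    EB p (fun x => g (J.filter fun j => x j = true).card)
      = ∑ m ∈ Finset.range (J.card + 1),
          (J.card.choose m : ℝ) * p₀ ^ m * (1 - p₀) ^ (J.card - m) * g m := by
  classical
  have h1 : ∀ x : ι → Bool, g (J.filter fun j => x j = true).card
      = ∑ U ∈ J.powerset, g U.card * if J.filter (fun j => x j = true) = U then 1 else 0 := by
    intro x
    rw [Finset.sum_eq_single (J.filter fun j => x j = true)]
    · simp
    · intro U _ hU
      rw [if_neg (Ne.symm hU), mul_zero]
    · intro h
      exact absurd (Finset.mem_powerset.2 (Finset.filter_subset _ _)) h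
  simp only [h1]
  rw [EB_finset_sum]
  have h2 : ∀ U ∈ J.powerset, EB p (fun x => g U.card *
      if J.filter (fun j => x j = true) = U then 1 else 0)
      = p₀ ^ U.card * (1 - p₀) ^ (J.card - U.card) * g U.card := by
    intro U hU
    rw [EB_const_mul, ← PB_filter_eq p J hJ (Finset.mem_powerset.1 hU), PB, mul_comm]
    congr 2
    funext x
    congr
  rw [Finset.sum_congr rfl h2, Finset.sum_powerset_apply_card
    (fun m => p₀ ^ m * (1 - p₀) ^ (J.card - m) * g m)]
  refine Finset.sum_congr rfl fun m _ => ?_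
  rw [nsmul_eq_mul]
  ring

/-- Exponential change of measure for a linear statistic. -/
theorem bw_tilt {p : ι → ℝ} (a : ι → ℝ)
    (hz : ∀ i, 0 < 1 + p i * (Real.exp (a i) - 1)) (x : ι → Bool) :
    bw p x * Real.exp (lin a x) = (∏ i, (1 + p i * (Real.exp (a i) - 1))) *
      bw (fun i => p i * Real.exp (a i) / (1 + p i * (Real.exp (a i) - 1))) x := by
  rw [bw, bw, lin, Real.exp_sum, ← Finset.prod_mul_distrib, ← Finset.prod_mul_distrib]
  refine Finset.prod_congr rfl fun i _ => ?_
  have := (hz i).ne'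
  split_ifs
  · field_simp
  · field_simp
    simp
    ring

/-- Sharp upper tail of a linear statistic: the exponential Markov bound gains a factor
`1 / √(N p')`, where `N` is the size of a set `J` of coordinates with common mean and coefficient,
and `p'` their mean after the exponential change of measure. The number of ones in `J` has point
probabilities of that order, and the atoms above the level `t` are summed as a geometric series. -/
theorem PB_lin_sharp {p : ι → ℝ} (hp : ∀ i, p i ∈ Set.Icc (0 : ℝ) 1) (a : ι → ℝ) (t : ℝ)
    {s : ℝ} (hs : 0 < s) (hp1 : ∀ i, p i < 1) {J : Finset ι} (hJ0 : J.Nonempty) {p₀ a₀ π c : ℝ}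
    (hJp : ∀ j ∈ J, p j = p₀) (hJa : ∀ j ∈ J, a j = a₀) (hp₀ : 0 < p₀) (ha₀ : a₀ ≠ 0)
    (hπ : π = p₀ * Real.exp (s * a₀) / (1 + p₀ * (Real.exp (s * a₀) - 1)))
    (hc : π * (J.card * π) ≤ c) :
    PB p (fun x => t ≤ lin a x) ≤ Real.exp (-(s * t) + ∑ i, p i * (Real.exp (s * a i) - 1)) *
      (Real.exp (2 * c) / √(J.card * π) * (1 + 1 / (s * |a₀|))) := by
  classical
  have hz : ∀ i, 0 < 1 + p i * (Real.exp (s * a i) - 1) := by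
    intro i
    have := mul_nonneg (hp i).1 (Real.exp_pos (s * a i)).le
    nlinarith [hp1 i]
  set q : ι → ℝ := fun i =>
    p i * Real.exp (s * a i) / (1 + p i * (Real.exp (s * a i) - 1)) with hq
  have hqm : ∀ i, q i ∈ Set.Icc (0 : ℝ) 1 := by
    intro i
    refine ⟨div_nonneg (mul_nonneg (hp i).1 (Real.exp_pos _).le) (hz i).le, ?_⟩
    rw [hq]
    simp only
    rw [div_le_one (hz i)]
    nlinarith [(hp i).2]
  obtain ⟨j₀, hj₀⟩ := hJ0
  have hqJ : ∀ j ∈ J, q j = π := by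
    intro j hj
    rw [hπ, hq]
    simp only [hJp j hj, hJa j hj]
  have hπ0 : 0 < π := by
    rw [← hqJ j₀ hj₀]
    exact div_pos (mul_pos (by rw [hJp j₀ hj₀]; exact hp₀) (Real.exp_pos _)) (hz j₀)
  have hπ1 : π < 1 := by
    rw [← hqJ j₀ hj₀]
    simp only [hq]
    rw [div_lt_one (hz j₀)]
    nlinarith [hp1 j₀]
  have hN : 0 < J.card := Finset.card_pos.2 ⟨j₀, hj₀⟩
  -- the weight that is left over after the change of measure
  set G : ℝ → ℝ := fun y => if 0 ≤ y then Real.exp (-(s * y)) else 0 with hG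
  have hG0 : ∀ y, 0 ≤ G y := by
    intro y
    simp only [hG]
    split_ifs <;> positivity
  have hlin : ∀ x, lin (fun i => s * a i) x = s * lin a x := by
    intro x
    simp only [lin, Finset.mul_sum]
    exact Finset.sum_congr rfl fun i _ => by split_ifs <;> simp
  set B : ℝ := Real.exp (2 * c) / √(J.card * π) * (1 + 1 / (s * |a₀|)) with hB
  have htilt : PB p (fun x => t ≤ lin a x)
      = (∏ i, (1 + p i * (Real.exp (s * a i) - 1))) * Real.exp (-(s * t)) *
          EB q (fun x => G (lin a x - t)) := by
    rw [PB, EB, EB, Finset.mul_sum]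
    refine Finset.sum_congr rfl fun x _ => ?_
    have h1 := bw_tilt (p := p) (fun i => s * a i) hz x
    rw [hlin] at h1
    simp only [hG, sub_nonneg]
    split_ifs with hx
    · have h2 : Real.exp (-(s * (lin a x - t)))
          = Real.exp (s * t) * Real.exp (-(s * lin a x)) := by
        rw [← Real.exp_add]; ring_nf
      have h3 : Real.exp (s * lin a x) * Real.exp (-(s * lin a x)) = 1 := by
        rw [← Real.exp_add]; simp
      have h4 : Real.exp (-(s * t)) * Real.exp (s * t) = 1 := by
        rw [← Real.exp_add]; simp
      calc bw p x * 1 = bw p x * Real.exp (s * lin a x) * Real.exp (-(s * lin a x)) := by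
            rw [mul_assoc, h3]
        _ = (∏ i, (1 + p i * (Real.exp (s * a i) - 1))) * bw q x * Real.exp (-(s * lin a x))
              * (Real.exp (-(s * t)) * Real.exp (s * t)) := by rw [h1, h4, mul_one]
        _ = _ := by rw [h2]; ring
    · simp
  have hEB : EB q (fun x => G (lin a x - t)) ≤ B := by
    refine EB_le_of_mix hqm (J : Set ι) (fun x => hG0 _) fun x => ?_
    -- freeze the coordinates outside `J`: the statistic is then affine in the number of ones in `J`
    set cx : ℝ := (∑ i ∈ Finset.univ.filter (fun i => i ∉ J), if x i = true then a i else 0) - t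
      with hcx
    have h1 : ∀ x', lin a (mixOn (J : Set ι) x' x) - t
        = cx + a₀ * ((J.filter fun j => x' j = true).card : ℝ) := by
      intro x'
      have h2 : lin a (mixOn (J : Set ι) x' x)
          = ∑ i ∈ J, (if x' i = true then a₀ else 0) +
            ∑ i ∈ Finset.univ.filter (fun i => i ∉ J), if x i = true then a i else 0 := by
        rw [lin, ← Finset.sum_filter_add_sum_filter_not Finset.univ (fun i => i ∈ J)]
        congr 1
        · rw [Finset.filter_mem_eq_inter, Finset.univ_inter]
          refine Finset.sum_congr rfl fun i hi => ?_
          simp [mixOn, hi, hJa i hi]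
        · refine Finset.sum_congr rfl fun i hi => ?_
          have : i ∉ J := (Finset.mem_filter.1 hi).2
          simp [mixOn, this]
      rw [h2, ← Finset.sum_filter, Finset.sum_const, nsmul_eq_mul, hcx]
      ring
    simp only [h1]
    rw [EB_count q J hqJ fun m => G (cx + a₀ * (m : ℝ))]
    calc ∑ m ∈ Finset.range (J.card + 1),
          (J.card.choose m : ℝ) * π ^ m * (1 - π) ^ (J.card - m) * G (cx + a₀ * (m : ℝ))
        ≤ ∑ m ∈ Finset.range (J.card + 1),
          Real.exp (2 * c) / √(J.card * π) * G (cx + a₀ * (m : ℝ)) := by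
          refine Finset.sum_le_sum fun m hm => mul_le_mul_of_nonneg_right ?_ (hG0 _)
          exact binomial_le_inv_sqrt (by have := Finset.mem_range.1 hm; omega) hπ0 hπ1 hN hc
      _ = Real.exp (2 * c) / √(J.card * π) *
          ∑ m ∈ Finset.range (J.card + 1), G (cx + a₀ * (m : ℝ)) := by rw [Finset.mul_sum]
      _ ≤ B := by
          rw [hB]
          exact mul_le_mul_of_nonneg_left (sum_exp_arith_le hs ha₀ _ _) (by positivity)
  have hB0 : 0 ≤ B := by positivity
  rw [htilt, Real.exp_add, Real.exp_sum]
  have hprod : ∏ i, (1 + p i * (Real.exp (s * a i) - 1))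
      ≤ ∏ i, Real.exp (p i * (Real.exp (s * a i) - 1)) :=
    Finset.prod_le_prod (fun i _ => (hz i).le) fun i _ => by
      linarith [Real.add_one_le_exp (p i * (Real.exp (s * a i) - 1))]
  rw [mul_comm (Real.exp (-(s * t)))]
  have hpos : 0 ≤ ∏ i, (1 + p i * (Real.exp (s * a i) - 1)) :=
    Finset.prod_nonneg fun i _ => (hz i).le
  exact mul_le_mul (mul_le_mul_of_nonneg_right hprod (Real.exp_pos _).le) hEB
    (Finset.sum_nonneg fun x _ => mul_nonneg (bw_nonneg hqm x) (hG0 _)) (by positivity)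

end Sharp

/-! ### Chernoff information -/

/-- The summand of the Chernoff information: the gap in the weighted inequality between the
arithmetic and the geometric mean. -/
def gap (s a b : ℝ) : ℝ := (1 - s) * a + s * b - a ^ (1 - s) * b ^ s

theorem gap_nonneg {s a b : ℝ} (hs : s ∈ Set.Ioo (0 : ℝ) 1) (ha : 0 ≤ a) (hb : 0 ≤ b) :
    0 ≤ gap s a b := by
  have := Real.geom_mean_le_arith_mean2_weighted (by linarith [hs.2] : 0 ≤ 1 - s) hs.1.le ha hb
    (by ring)
  rw [gap]
  linarith

theorem gap_mul {s a b w : ℝ} (ha : 0 ≤ a) (hb : 0 ≤ b) (hw : 0 < w) :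
    gap s (w * a) (w * b) = w * gap s a b := by
  have h : (w * a) ^ (1 - s) * (w * b) ^ s = w * (a ^ (1 - s) * b ^ s) := by
    rw [Real.mul_rpow hw.le ha, Real.mul_rpow hw.le hb]
    have : w ^ (1 - s) * w ^ s = w := by
      rw [← Real.rpow_add hw]
      simp
    calc _ = (w ^ (1 - s) * w ^ s) * (a ^ (1 - s) * b ^ s) := by ring
      _ = _ := by rw [this]
  rw [gap, gap, h]
  ring

theorem gap_le_of_log_le {s a b X ρ : ℝ} (hs : s ∈ Set.Ioo (0 : ℝ) 1) (ha : 0 < a) (hb : 0 < b)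
    (haX : a ≤ X) (hbX : b ≤ X) (hab : Real.log (a / b) ≤ ρ) (hba : Real.log (b / a) ≤ ρ) :
    gap s a b ≤ X * ρ := by
  have key : ∀ u v : ℝ, 0 < u → u ≤ v → v ≤ X → Real.log (v / u) ≤ ρ → v - u ≤ X * ρ := by
    intro u v hu huv hv hl
    have hv0 : 0 < v := by linarith
    have h1 := Real.one_sub_inv_le_log_of_pos (div_pos hv0 hu)
    rw [inv_div] at h1
    have h2 : v - u = v * (1 - u / v) := by field_simp
    have h3 : 0 ≤ 1 - u / v := by
      rw [sub_nonneg, div_le_one hv0]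
      exact huv
    rw [h2]
    exact mul_le_mul hv (h1.trans hl) h3 (by linarith)
  have h1s : 0 < 1 - s := by linarith [hs.2]
  have hs0 := hs.1
  rw [gap]
  rcases le_total a b with h | h
  · have h4 : a ≤ a ^ (1 - s) * b ^ s := by
      calc a = a ^ (1 - s) * a ^ s := by rw [← Real.rpow_add ha]; simp
        _ ≤ _ := by gcongr
    have := key a b ha h hbX hba
    nlinarith
  · have h4 : b ≤ a ^ (1 - s) * b ^ s := by
      calc b = b ^ (1 - s) * b ^ s := by rw [← Real.rpow_add hb]; simp
        _ ≤ _ := by gcongr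
    have := key b a hb h haX hab
    nlinarith

theorem gap_le_of_le {s a b X : ℝ} (hs : s ∈ Set.Ioo (0 : ℝ) 1) (ha : 0 ≤ a) (hb : 0 ≤ b)
    (haX : a ≤ X) (hbX : b ≤ X) : gap s a b ≤ X := by
  have h1 : 0 ≤ a ^ (1 - s) * b ^ s := by positivity
  rw [gap]
  nlinarith [hs.1, hs.2]

theorem gap_le_linear {s a b : ℝ} (ha : 0 < a) (hb : 0 < b) :
    gap s a b ≤ s * (b - a - a * Real.log (b / a)) := by
  have h1 : a ^ (1 - s) * b ^ s = a * Real.exp (s * Real.log (b / a)) := by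
    rw [Real.rpow_sub ha, Real.rpow_one, div_mul_eq_mul_div, mul_div_assoc,
      ← Real.div_rpow hb.le ha.le, Real.rpow_def_of_pos (by positivity), mul_comm s]
  have h2 := Real.add_one_le_exp (s * Real.log (b / a))
  rw [gap, h1]
  nlinarith

theorem linear_le_gap_half {a b ω : ℝ} (ha : 0 < a) (hb : 0 < b) (hω : 1 ≤ ω) (hab : a ≤ ω * b) :
    b - a - a * Real.log (b / a) ≤ 8 * ω * gap (1 / 2) a b := by
  have h1 : gap (1 / 2) a b = (√a - √b) ^ 2 / 2 := by
    rw [gap, Real.sqrt_eq_rpow, Real.sqrt_eq_rpow]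
    have h3 : (a ^ (1 / 2 : ℝ)) ^ 2 = a := by
      rw [← Real.sqrt_eq_rpow, Real.sq_sqrt ha.le]
    have h4 : (b ^ (1 / 2 : ℝ)) ^ 2 = b := by
      rw [← Real.sqrt_eq_rpow, Real.sq_sqrt hb.le]
    rw [sub_sq, h3, h4]
    norm_num
    ring
  have h2 : -Real.log (b / a) ≤ a / b - 1 := by
    rw [← Real.log_inv, inv_div]
    linarith [Real.add_one_le_exp (Real.log (a / b)), Real.exp_log (div_pos ha hb)]
  have h3 : b - a - a * Real.log (b / a) ≤ (a - b) ^ 2 / b := by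
    have : (a - b) ^ 2 / b = b - a + a * (a / b - 1) := by field_simp; ring
    rw [this]
    nlinarith
  have h4 : (a - b) ^ 2 = (√a - √b) ^ 2 * (√a + √b) ^ 2 := by
    have h6 : (√a - √b) * (√a + √b) = a - b := by
      rw [← Real.sq_sqrt ha.le, ← Real.sq_sqrt hb.le, Real.sqrt_sq (Real.sqrt_nonneg a),
        Real.sqrt_sq (Real.sqrt_nonneg b)]
      ring
    rw [← mul_pow, h6]
  have h5 : (√a + √b) ^ 2 ≤ 4 * ω * b := by
    nlinarith [Real.sq_sqrt ha.le, Real.sq_sqrt hb.le, sq_nonneg (√a - √b)]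
  rw [h1]
  refine h3.trans ?_
  rw [h4, div_le_iff₀ hb]
  nlinarith [mul_le_mul_of_nonneg_left h5 (sq_nonneg (√a - √b))]

section Info

variable {K L : ℕ} {Lam : Matrix (Fin K) (Fin L) ℝ}

theorem info_eq (k r : Fin K) :
    info Lam k r = ⨆ s : Set.Ioo (0 : ℝ) 1, ∑ l, gap s (Lam k l) (Lam r l) := rfl

instance : Nonempty (Set.Ioo (0 : ℝ) 1) := ⟨⟨1 / 2, by norm_num, by norm_num⟩⟩

theorem sum_gap_le_info {X : ℝ} (h0 : ∀ k l, 0 < Lam k l) (hX : ∀ k l, Lam k l ≤ X)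
    {s : ℝ} (hs : s ∈ Set.Ioo (0 : ℝ) 1) (k r : Fin K) :
    ∑ l, gap s (Lam k l) (Lam r l) ≤ info Lam k r := by
  rw [info_eq]
  refine le_ciSup (f := fun s : Set.Ioo (0 : ℝ) 1 => ∑ l, gap s (Lam k l) (Lam r l)) ?_ ⟨s, hs⟩
  refine ⟨∑ _ : Fin L, X, ?_⟩
  rintro _ ⟨u, rfl⟩
  exact Finset.sum_le_sum fun l _ => gap_le_of_le u.2 (h0 k l).le (h0 r l).le (hX k l) (hX r l)

theorem info_le {X : ℝ} (h0 : ∀ k l, 0 < Lam k l) (hX : ∀ k l, Lam k l ≤ X) (k r : Fin K) :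
    info Lam k r ≤ L * X := by
  rw [info_eq]
  refine ciSup_le fun u => ?_
  refine (Finset.sum_le_sum fun l _ => gap_le_of_le u.2 (h0 k l).le (h0 r l).le (hX k l)
    (hX r l)).trans ?_
  simp

theorem info_le_log {X ρ : ℝ} (h0 : ∀ k l, 0 < Lam k l) (hX : ∀ k l, Lam k l ≤ X) (k r : Fin K)
    (h1 : ∀ l, Real.log (Lam k l / Lam r l) ≤ ρ) (h2 : ∀ l, Real.log (Lam r l / Lam k l) ≤ ρ) :
    info Lam k r ≤ L * (X * ρ) := by
  rw [info_eq]
  refine ciSup_le fun u => ?_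
  refine (Finset.sum_le_sum fun l _ => gap_le_of_log_le u.2 (h0 k l) (h0 r l) (hX k l)
    (hX r l) (h1 l) (h2 l)).trans ?_
  simp

theorem exists_lt_sum_gap {k r : Fin K} {c : ℝ} (hc : c < info Lam k r) :
    ∃ s ∈ Set.Ioo (0 : ℝ) 1, c < ∑ l, gap s (Lam k l) (Lam r l) := by
  rw [info_eq] at hc
  obtain ⟨s, hs⟩ := exists_lt_of_lt_ciSup hc
  exact ⟨s, s.2, hs⟩

/-- Nearly optimal exponents are bounded away from zero: the slope of the objective at zero is at
most `8 ω` times its value at `1 / 2`. -/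
theorem exists_exponent_ge {X ω : ℝ} (h0 : ∀ k l, 0 < Lam k l) (hX : ∀ k l, Lam k l ≤ X)
    (hω : 1 ≤ ω) {k r : Fin K} (hr : ∀ l, Lam k l ≤ ω * Lam r l) (hI : 2 ≤ info Lam k r) :
    ∃ s ∈ Set.Ioo (0 : ℝ) 1, info Lam k r - 1 ≤ ∑ l, gap s (Lam k l) (Lam r l) ∧
      1 / (16 * ω) ≤ s := by
  obtain ⟨s, hs, h1⟩ := exists_lt_sum_gap (Lam := Lam) (show info Lam k r - 1 < info Lam k r by linarith)
  refine ⟨s, hs, h1.le, ?_⟩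
  have h2 : ∑ l, gap s (Lam k l) (Lam r l) ≤ s * (8 * ω * ∑ l, gap (1 / 2) (Lam k l) (Lam r l)) := by
    rw [Finset.mul_sum, Finset.mul_sum]
    refine Finset.sum_le_sum fun l _ => (gap_le_linear (h0 k l) (h0 r l)).trans ?_
    exact mul_le_mul_of_nonneg_left (linear_le_gap_half (h0 k l) (h0 r l) hω (hr l)) hs.1.le
  have h3 := sum_gap_le_info h0 hX (s := 1 / 2) (by norm_num) k r
  have h4 : s * (8 * ω * ∑ l, gap (1 / 2) (Lam k l) (Lam r l)) ≤ s * (8 * ω * info Lam k r) := by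
    have := hs.1
    gcongr
  rw [div_le_iff₀ (by positivity)]
  have h5 : info Lam k r / 2 < s * (8 * ω * info Lam k r) := by linarith
  by_contra h
  push Not at h
  nlinarith

theorem le_entryMax (Lam : Matrix (Fin K) (Fin L) ℝ) (k : Fin K) (l : Fin L) :
    Lam k l ≤ entryMax Lam :=
  le_ciSup (f := fun p : Fin K × Fin L => Lam p.1 p.2) (Set.finite_range _).bddAbove (k, l)

theorem entryMin_le (Lam : Matrix (Fin K) (Fin L) ℝ) (k : Fin K) (l : Fin L) :
    entryMin Lam ≤ Lam k l :=
  ciInf_le (f := fun p : Fin K × Fin L => Lam p.1 p.2) (Set.finite_range _).bddBelow (k, l)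

theorem infoMin_le (Lam : Matrix (Fin K) (Fin L) ℝ) {k r : Fin K} (h : k ≠ r) :
    infoMin Lam ≤ info Lam k r :=
  ciInf_le (f := fun p : {p : Fin K × Fin K // p.1 ≠ p.2} => info Lam p.1.1 p.1.2)
    (Set.finite_range _).bddBelow ⟨(k, r), h⟩

end Info

/-! ### Misclassification of one row by the likelihood ratio rule -/

section BadRow

variable {κ : Type} [Fintype κ] [DecidableEq κ] {K L : ℕ}

/-- The largest possible contribution of an edge to column `j` to the log-likelihood ratio of the
labels `r` and `k`, when the means are known up to a relative error `δ` and the labels of the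
columns in `D` are unknown. -/
def coef (P : Matrix (Fin K) (Fin L) ℝ) (z : κ → Fin L) (D : Finset κ) (δ R : ℝ) (k r : Fin K)
    (j : κ) : ℝ :=
  if j ∈ D then Real.log R + 4 * δ else Real.log (P r (z j) / P k (z j)) + 4 * δ

/-- The expected number of edges from a row with label `k` to the columns with label `l`. -/
def blockMean (P : Matrix (Fin K) (Fin L) ℝ) (z : κ → Fin L) : Matrix (Fin K) (Fin L) ℝ :=
  fun k l => P k l * (clusterSize z l : ℝ)

/-- The smallest possible threshold for the log-likelihood ratio of the labels `r` and `k`. -/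
def thr (P : Matrix (Fin K) (Fin L) ℝ) (z : κ → Fin L) (δ : ℝ) (k r : Fin K) : ℝ :=
  ∑ l, (blockMean P z r l - blockMean P z k l) - δ * ∑ l, (blockMean P z r l + blockMean P z k l)

/-- A row `x` with label `k` is bad if the likelihood ratio rule may misclassify it for some means
that are within relative error `δ` of the truth and some labels of the columns in `D`. -/
def badRow (P : Matrix (Fin K) (Fin L) ℝ) (z : κ → Fin L) (D : Finset κ) (δ R : ℝ) (k : Fin K)
    (x : κ → Bool) : Prop :=
  ∃ r, r ≠ k ∧ thr P z δ k r ≤ lin (coef P z D δ R k r) x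

theorem sum_comp_eq_sum_clusterSize (z : κ → Fin L) (F : Fin L → ℝ) :
    ∑ j, F (z j) = ∑ l, (clusterSize z l : ℝ) * F l := by
  rw [← Finset.sum_fiberwise (s := Finset.univ) (g := z)]
  refine Finset.sum_congr rfl fun l _ => ?_
  rw [Finset.sum_congr rfl (g := fun _ => F l), Finset.sum_const, nsmul_eq_mul, clusterSize]
  intro j hj
  rw [(Finset.mem_filter.1 hj).2]

theorem sum_compress_mul {ι : Type} (A : Matrix ι κ Bool) (z : κ → Fin L) (i : ι)
    (c : Fin L → ℝ) : ∑ l, (compress A z i l : ℝ) * c l = lin (fun j => c (z j)) (A i) := by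
  rw [lin, ← Finset.sum_fiberwise (s := Finset.univ) (g := z)]
  refine Finset.sum_congr rfl fun l _ => ?_
  rw [← Finset.sum_filter, Finset.filter_filter]
  rw [Finset.sum_congr rfl (g := fun _ => c l), Finset.sum_const, nsmul_eq_mul, compress]
  · congr 3
    ext j
    simp [and_comm]
  · intro j hj
    rw [(Finset.mem_filter.1 hj).2.1]

theorem log_poisLik {x : Fin L → ℕ} {lam : Fin L → ℝ} (h : ∀ l, 0 < lam l) :
    Real.log (poisLik x lam) = ∑ l, ((x l : ℝ) * Real.log (lam l) - lam l) := by
  rw [poisLik, Real.log_prod]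
  · refine Finset.sum_congr rfl fun l _ => ?_
    rw [Real.log_mul (pow_ne_zero _ (h l).ne') (Real.exp_pos _).ne', Real.log_pow, Real.log_exp]
    ring
  · intro l _
    exact (mul_pos (pow_pos (h l) _) (Real.exp_pos _)).ne'

/-- A row that is not bad is classified correctly (up to the relabelings `σ`, `ρ`) from any means
within relative error `δ` and any column labels that are correct outside `D`. -/
theorem eq_of_mem_lrArgmax {ι : Type} {A : Matrix ι κ Bool} {P : Matrix (Fin K) (Fin L) ℝ}
    {z z' : κ → Fin L} {D : Finset κ} {σ : Equiv.Perm (Fin K)} {ρ : Equiv.Perm (Fin L)}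
    {Lam : Matrix (Fin K) (Fin L) ℝ} {δ R : ℝ} (hδ : δ ≤ 1 / 2)
    (hP : ∀ k l, 0 < P k l) (hn : ∀ l, 0 < clusterSize z l) (hR : ∀ k r l, P r l ≤ R * P k l)
    (hLam : ∀ k l, |Lam (σ k) (ρ l) - blockMean P z k l| ≤ δ * blockMean P z k l)
    (hz : ∀ j ∉ D, z' j = ρ (z j)) {i : ι} {k : Fin K} (h : ¬ badRow P z D δ R k (A i))
    {r' : Fin K} (hr : r' ∈ lrArgmax A Lam z' i) : r' = σ k := by
  classical
  by_contra hne
  obtain ⟨r, rfl⟩ := σ.surjective r'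
  have hμ : ∀ k l, 0 < blockMean P z k l := fun k l =>
    mul_pos (hP k l) (by exact_mod_cast hn l)
  have hpos : ∀ k l, 0 < Lam (σ k) (ρ l) := by
    intro k l
    have h1 := (abs_le.1 (hLam k l)).1
    nlinarith [hμ k l]
  have hpos' : ∀ k l, 0 < Lam (σ k) l := by
    intro k l
    have := hpos k (ρ.symm l)
    rwa [Equiv.apply_symm_apply] at this
  refine h ⟨r, fun e => hne (by rw [e]), ?_⟩
  have h2 : poisLik (compress A z' i) (Lam (σ k)) ≤ poisLik (compress A z' i) (Lam (σ r)) := by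
    simp only [lrArgmax, Finset.mem_filter] at hr
    exact hr.2 (σ k)
  have hp0 : 0 < poisLik (compress A z' i) (Lam (σ k)) :=
    Finset.prod_pos fun l _ => mul_pos (pow_pos (hpos' k l) _) (Real.exp_pos _)
  have h3 := Real.log_le_log hp0 h2
  rw [log_poisLik (hpos' k), log_poisLik (hpos' r)] at h3
  -- taking logarithms, the likelihood comparison becomes a threshold for a linear statistic
  have h4 : ∑ l, (Lam (σ r) l - Lam (σ k) l)
      ≤ lin (fun j => Real.log (Lam (σ r) (z' j) / Lam (σ k) (z' j))) (A i) := by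
    rw [← sum_compress_mul A z' i fun l => Real.log (Lam (σ r) l / Lam (σ k) l)]
    have h5 : ∑ l, (compress A z' i l : ℝ) * Real.log (Lam (σ r) l / Lam (σ k) l)
        = ∑ l, ((compress A z' i l : ℝ) * Real.log (Lam (σ r) l) - Lam (σ r) l)
          - ∑ l, ((compress A z' i l : ℝ) * Real.log (Lam (σ k) l) - Lam (σ k) l)
          + ∑ l, (Lam (σ r) l - Lam (σ k) l) := by
      rw [← Finset.sum_sub_distrib, ← Finset.sum_add_distrib]
      refine Finset.sum_congr rfl fun l _ => ?_
      rw [Real.log_div (hpos' r l).ne' (hpos' k l).ne']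
      ring
    linarith
  have h6 : thr P z δ k r ≤ ∑ l, (Lam (σ r) l - Lam (σ k) l) := by
    rw [← Equiv.sum_comp ρ, thr, Finset.mul_sum, ← Finset.sum_sub_distrib]
    refine Finset.sum_le_sum fun l _ => ?_
    have e1 := (abs_le.1 (hLam r l)).1
    have e2 := (abs_le.1 (hLam k l)).2
    linarith
  refine h6.trans (h4.trans ?_)
  -- relative errors `δ` in numerator and denominator change the log-ratio by at most `4 δ`
  have hratio : ∀ l, Real.log (Lam (σ r) (ρ l) / Lam (σ k) (ρ l))
      ≤ Real.log (P r l / P k l) + 4 * δ := by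
    intro l
    have e1 := (abs_le.1 (hLam r l)).2
    have e2 := (abs_le.1 (hLam k l)).1
    have hδ0 : 0 ≤ δ := by
      have := (abs_nonneg _).trans (hLam r l)
      by_contra hc
      nlinarith [hμ r l]
    have hq : P r l / P k l = blockMean P z r l / blockMean P z k l := by
      have : (clusterSize z l : ℝ) ≠ 0 := by exact_mod_cast (hn l).ne'
      rw [blockMean, blockMean, mul_div_mul_right _ _ this]
    have h7 : Lam (σ r) (ρ l) / Lam (σ k) (ρ l)
        ≤ (P r l / P k l) * (1 + 4 * δ) := by
      rw [hq, div_mul_eq_mul_div, div_le_div_iff₀ (hpos k l) (hμ k l)]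
      have h8 : (1 + δ) ≤ (1 + 4 * δ) * (1 - δ) := by nlinarith
      calc Lam (σ r) (ρ l) * blockMean P z k l
          ≤ ((1 + δ) * blockMean P z r l) * blockMean P z k l := by
            refine mul_le_mul_of_nonneg_right (by linarith) (hμ k l).le
        _ ≤ ((1 + 4 * δ) * (1 - δ) * blockMean P z r l) * blockMean P z k l := by
            have := (hμ k l).le
            have := (hμ r l).le
            gcongr
        _ = blockMean P z r l * (1 + 4 * δ) * ((1 - δ) * blockMean P z k l) := by ring
        _ ≤ blockMean P z r l * (1 + 4 * δ) * Lam (σ k) (ρ l) := by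
            refine mul_le_mul_of_nonneg_left (by linarith) ?_
            have := hμ r l
            positivity
    calc Real.log (Lam (σ r) (ρ l) / Lam (σ k) (ρ l))
        ≤ Real.log ((P r l / P k l) * (1 + 4 * δ)) :=
          Real.log_le_log (div_pos (hpos r l) (hpos k l)) h7
      _ = Real.log (P r l / P k l) + Real.log (1 + 4 * δ) :=
          Real.log_mul (div_pos (hP r l) (hP k l)).ne' (by positivity)
      _ ≤ _ := by
          have := Real.log_le_sub_one_of_pos (show 0 < 1 + 4 * δ by positivity)
          linarith
  refine Finset.sum_le_sum fun j _ => ?_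
  split_ifs with hA
  swap
  · exact le_rfl
  rw [coef]
  split_ifs with hj
  -- columns in `D` may carry any label, so only the uniform bound `R` on the ratios is available
  · have h9 := hratio (ρ.symm (z' j))
    rw [Equiv.apply_symm_apply] at h9
    refine h9.trans ?_
    have h10 : P r (ρ.symm (z' j)) / P k (ρ.symm (z' j)) ≤ R := by
      rw [div_le_iff₀ (hP _ _)]
      exact hR _ _ _
    have := Real.log_le_log (div_pos (hP r (ρ.symm (z' j))) (hP k (ρ.symm (z' j)))) h10
    linarith
  · have h9 := hratio (z j)
    rw [← hz j hj] at h9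
    exact h9

/-- The exponent in the exponential Markov bound for a bad row. -/
theorem exponent_le {P : Matrix (Fin K) (Fin L) ℝ} {z : κ → Fin L} {D : Finset κ} {δ R X d s : ℝ}
    (hs : s ∈ Set.Ioo (0 : ℝ) 1) (hδ0 : 0 ≤ δ) (hδ : δ ≤ 1 / 4) (hR1 : 1 ≤ R)
    (hP : ∀ k l, 0 < P k l) (hn : ∀ l, 0 < clusterSize z l)
    (hX : ∀ k l, blockMean P z k l ≤ X) {k r : Fin K} (hd : ∑ j ∈ D, P k (z j) ≤ d) :
    -(s * thr P z δ k r) + ∑ j, P k (z j) * (Real.exp (s * coef P z D δ R k r j) - 1)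
      ≤ -∑ l, gap s (blockMean P z k l) (blockMean P z r l) + (10 * δ * (L * X) + 3 * R * d) := by
  classical
  have hs0 := hs.1
  have hs1 := hs.2
  set E := Real.exp (4 * δ * s) with hE
  have hEle : E - 1 ≤ 8 * δ := by
    have h0 : |4 * δ * s| ≤ 1 := by
      rw [abs_of_nonneg (by positivity)]
      nlinarith
    have h1 := (abs_le.1 (Real.abs_exp_sub_one_sub_id_le h0)).2
    have h2 : 4 * δ * s ≤ 4 * δ := by nlinarith
    have h3 : (4 * δ * s) ^ 2 ≤ 4 * δ := by
      have h4 : 0 ≤ 4 * δ * s := by positivity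
      nlinarith
    linarith
  have hE1 : 1 ≤ E := Real.one_le_exp (by positivity)
  set F : Fin L → ℝ := fun l => P k l * (E * (P r l / P k l) ^ s - 1) with hF
  have h1 : ∑ j, P k (z j) * (Real.exp (s * coef P z D δ R k r j) - 1)
      ≤ ∑ j, F (z j) + 3 * R * d := by
    have h2 : ∀ j, P k (z j) * (Real.exp (s * coef P z D δ R k r j) - 1)
        ≤ F (z j) + (if j ∈ D then 3 * R * P k (z j) else 0) := by
      intro j
      have hq : 0 < P r (z j) / P k (z j) := div_pos (hP _ _) (hP _ _)
      rw [coef]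
      split_ifs with hj
      · have h3 : Real.exp (s * (Real.log R + 4 * δ)) ≤ 3 * R := by
          have h4 : s * (Real.log R + 4 * δ) ≤ Real.log R + 1 := by
            have := Real.log_nonneg hR1
            nlinarith
          refine (Real.exp_le_exp.2 h4).trans ?_
          rw [Real.exp_add, Real.exp_log (by linarith)]
          have := Real.exp_one_lt_d9
          nlinarith
        have h5 : -P k (z j) ≤ F (z j) := by
          have : 0 ≤ E * (P r (z j) / P k (z j)) ^ s := by positivity
          simp only [hF]
          nlinarith [hP k (z j)]
        nlinarith [hP k (z j)]
      · rw [add_zero]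
        simp only [hF]
        refine le_of_eq ?_
        rw [mul_add, Real.exp_add, Real.rpow_def_of_pos hq, hE]
        ring_nf
    refine (Finset.sum_le_sum fun j _ => h2 j).trans ?_
    rw [Finset.sum_add_distrib, ← Finset.sum_filter, Finset.filter_mem_eq_inter,
      Finset.univ_inter, ← Finset.mul_sum]
    gcongr
  have h6 : ∑ j, F (z j) = ∑ l, (E * (blockMean P z k l ^ (1 - s) * blockMean P z r l ^ s)
      - blockMean P z k l) := by
    rw [sum_comp_eq_sum_clusterSize]
    refine Finset.sum_congr rfl fun l _ => ?_
    have hnl : (0 : ℝ) < clusterSize z l := by exact_mod_cast hn l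
    have hPk := hP k l
    have hPr := hP r l
    have h7 : blockMean P z k l ^ (1 - s) * blockMean P z r l ^ s
        = (clusterSize z l : ℝ) * P k l * (P r l / P k l) ^ s := by
      rw [blockMean, blockMean, Real.rpow_sub (by positivity), Real.rpow_one, div_mul_eq_mul_div,
        mul_div_assoc, ← Real.div_rpow (by positivity) (by positivity),
        mul_div_mul_right _ _ hnl.ne']
      ring
    rw [h7]
    simp only [hF, blockMean]
    ring
  have hμ : ∀ k l, 0 < blockMean P z k l := fun k l =>
    mul_pos (hP k l) (by exact_mod_cast hn l)
  -- the arithmetic and geometric means of the two rows combine to `gap`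
  have h8 : ∀ l, -(s * ((blockMean P z r l - blockMean P z k l)
        - δ * (blockMean P z r l + blockMean P z k l))) +
      (E * (blockMean P z k l ^ (1 - s) * blockMean P z r l ^ s) - blockMean P z k l)
      ≤ -gap s (blockMean P z k l) (blockMean P z r l) + 10 * δ * X := by
    intro l
    have g := gap_nonneg hs (hμ k l).le (hμ r l).le
    rw [gap] at g ⊢
    have e1 := hX k l
    have e2 := hX r l
    have e3 := (hμ k l).le
    have e4 := (hμ r l).le
    set u := blockMean P z k l
    set v := blockMean P z r l
    set G := u ^ (1 - s) * v ^ s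
    have hG0 : 0 ≤ G := by positivity
    have hGX : G ≤ X := by nlinarith
    have e5 : (E - 1) * G ≤ 8 * δ * X := mul_le_mul hEle hGX hG0 (by positivity)
    have e6 : s * (δ * (v + u)) ≤ 1 * (δ * (X + X)) := by gcongr
    nlinarith
  have h9 := Finset.sum_le_sum fun l (_ : l ∈ (Finset.univ : Finset (Fin L))) => h8 l
  rw [Finset.sum_add_distrib, Finset.sum_add_distrib, Finset.sum_neg_distrib,
    Finset.sum_neg_distrib, ← Finset.mul_sum, Finset.sum_sub_distrib (f := fun l =>
      blockMean P z r l - blockMean P z k l), ← Finset.mul_sum, ← h6, Finset.sum_const,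
    Finset.card_univ, Fintype.card_fin, nsmul_eq_mul] at h9
  rw [thr]
  linarith

theorem PB_thr_le {P : Matrix (Fin K) (Fin L) ℝ} {z : κ → Fin L} {D : Finset κ} {δ R X d E : ℝ}
    (hδ0 : 0 ≤ δ) (hδ : δ ≤ 1 / 4) (hR1 : 1 ≤ R)
    (hP : ∀ k l, 0 < P k l) (hP1 : ∀ k l, P k l ≤ 1) (hn : ∀ l, 0 < clusterSize z l)
    (hX : ∀ k l, blockMean P z k l ≤ X) {k r : Fin K} (hd : ∑ j ∈ D, P k (z j) ≤ d)
    (hE : ∃ s ∈ Set.Ioo (0 : ℝ) 1, 10 * δ * (L * X) + 3 * R * d + E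
      ≤ ∑ l, gap s (blockMean P z k l) (blockMean P z r l)) :
    PB (fun j => P k (z j)) (fun x => thr P z δ k r ≤ lin (coef P z D δ R k r) x)
      ≤ Real.exp (-E) := by
  obtain ⟨s, hs, hsE⟩ := hE
  refine (PB_lin_le (fun j => ⟨(hP k (z j)).le, hP1 k (z j)⟩) _ _ hs.1.le).trans
    (Real.exp_le_exp.2 ?_)
  have := exponent_le (R := R) (r := r) hs hδ0 hδ hR1 hP hn hX hd
  linarith

theorem PB_badRow_le {P : Matrix (Fin K) (Fin L) ℝ} {z : κ → Fin L} {D : Finset κ} {δ R : ℝ}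
    {k : Fin K} {b : Fin K → ℝ} (hP : ∀ k l, 0 < P k l) (hP1 : ∀ k l, P k l ≤ 1)
    (h : ∀ r, r ≠ k →
      PB (fun j => P k (z j)) (fun x => thr P z δ k r ≤ lin (coef P z D δ R k r) x) ≤ b r) :
    PB (fun j => P k (z j)) (badRow P z D δ R k) ≤ ∑ r ∈ Finset.univ.erase k, b r := by
  have hp : ∀ j, P k (z j) ∈ Set.Icc (0 : ℝ) 1 := fun j => ⟨(hP k (z j)).le, hP1 k (z j)⟩
  refine le_trans ?_ ((PB_exists_le hp (Finset.univ.erase k)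
    (fun r x => thr P z δ k r ≤ lin (coef P z D δ R k r) x)).trans
    (Finset.sum_le_sum fun r hr => h r (Finset.ne_of_mem_erase hr)))
  refine PB_mono hp fun x hx => ?_
  obtain ⟨r, hr, hx⟩ := hx
  exact ⟨r, Finset.mem_erase.2 ⟨hr, Finset.mem_univ r⟩, hx⟩

end BadRow

section RowBounds

variable {κ : Type} [Fintype κ] [DecidableEq κ] {K L : ℕ}

/-- A row of a sub-block is bad with probability exponentially small in the information that the
sub-block contains, which is a fraction `1 / c₀` of the total information. -/
theorem PB_badRow_subblock_le {P Lam : Matrix (Fin K) (Fin L) ℝ} {N : Fin L → ℝ} {z : κ → Fin L}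
    {D : Finset κ} {c₀ ω X I d : ℝ} (hL : 0 < L) (hc : 0 < c₀) (hω : 1 ≤ ω)
    (hP : ∀ k l, 0 < P k l) (hP1 : ∀ k l, P k l ≤ 1) (hN : ∀ l, 0 < N l)
    (hLam : ∀ k l, Lam k l = P k l * N l) (hX : ∀ k l, Lam k l ≤ X) (hX0 : 0 < X)
    (hz : ∀ l, |(clusterSize z l : ℝ) - N l / c₀| ≤ 1 / 10 * (N l / c₀))
    (hI0 : 0 < I) (hI : ∀ k r, r ≠ k → I ≤ info Lam k r) (hIX : I ≤ L * X)
    {k : Fin K} (hd : ∑ j ∈ D, P k (z j) ≤ d) (hdI : 3 * ω * d ≤ I / (100 * c₀)) :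
    PB (fun j => P k (z j)) (badRow P z D (I / (20 * (L * X))) ω k)
      ≤ K * Real.exp (-(I / (4 * c₀))) := by
  have hL' : (0 : ℝ) < L := by exact_mod_cast hL
  have hnl : ∀ l, 9 / 10 * (N l / c₀) ≤ clusterSize z l ∧
      (clusterSize z l : ℝ) ≤ 11 / 10 * (N l / c₀) := by
    intro l
    have := abs_le.1 (hz l)
    constructor <;> linarith [this.1, this.2]
  have hn : ∀ l, 0 < clusterSize z l := by
    intro l
    have h1 : 0 < N l / c₀ := div_pos (hN l) hc
    have : (0 : ℝ) < clusterSize z l := by linarith [(hnl l).1]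
    exact_mod_cast this
  have hμ : ∀ k l, blockMean P z k l = (clusterSize z l / N l) * Lam k l := by
    intro k l
    rw [blockMean, hLam]
    have := (hN l).ne'
    field_simp
  have hw1 : ∀ l, 9 / 10 / c₀ ≤ clusterSize z l / N l := by
    intro l
    rw [le_div_iff₀ (hN l)]
    refine le_trans (le_of_eq ?_) (hnl l).1
    ring
  have hw2 : ∀ l, clusterSize z l / N l ≤ 11 / 10 / c₀ := by
    intro l
    rw [div_le_iff₀ (hN l)]
    refine (hnl l).2.trans (le_of_eq ?_)
    ring
  have hLam0 : ∀ k l, 0 < Lam k l := fun k l => by rw [hLam]; exact mul_pos (hP k l) (hN l)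
  have hb : ∀ r, r ≠ k →
      PB (fun j => P k (z j)) (fun x => thr P z (I / (20 * (L * X))) k r
        ≤ lin (coef P z D (I / (20 * (L * X))) ω k r) x) ≤ Real.exp (-(I / (4 * c₀))) := by
    intro r hr
    have hLX : 0 < (L : ℝ) * X := by positivity
    refine PB_thr_le (X := 11 / 10 / c₀ * X) (d := d) (by positivity) ?_ hω hP hP1 hn ?_ hd ?_
    · rw [div_le_iff₀ (by positivity)]
      linarith
    · intro k l
      rw [hμ]
      exact mul_le_mul (hw2 l) (hX k l) (hLam0 k l).le (by positivity)
    · obtain ⟨s, hs, h1⟩ := exists_lt_sum_gap (Lam := Lam) (k := k) (r := r)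
        (c := 9 / 10 * I) (by linarith [hI k r hr])
      refine ⟨s, hs, ?_⟩
      have h2 : 9 / 10 / c₀ * ∑ l, gap s (Lam k l) (Lam r l)
          ≤ ∑ l, gap s (blockMean P z k l) (blockMean P z r l) := by
        rw [Finset.mul_sum]
        refine Finset.sum_le_sum fun l _ => ?_
        rw [hμ, hμ, gap_mul (hLam0 k l).le (hLam0 r l).le
          (div_pos (by exact_mod_cast hn l) (hN l))]
        exact mul_le_mul_of_nonneg_right (hw1 l) (gap_nonneg hs (hLam0 k l).le (hLam0 r l).le)
      have h3 : 9 / 10 / c₀ * (9 / 10 * I) ≤ 9 / 10 / c₀ * ∑ l, gap s (Lam k l) (Lam r l) := by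
        gcongr
      have h4 : 10 * (I / (20 * (L * X))) * (L * (11 / 10 / c₀ * X)) = 11 / 20 * (I / c₀) := by
        field_simp
      have h5 : 9 / 10 / c₀ * (9 / 10 * I) = 81 / 100 * (I / c₀) := by ring
      have h6 : I / (100 * c₀) = 1 / 100 * (I / c₀) := by field_simp
      have h7 : I / (4 * c₀) = 1 / 4 * (I / c₀) := by field_simp
      linarith
  refine (PB_badRow_le hP hP1 hb).trans ?_
  rw [Finset.sum_const, nsmul_eq_mul]
  gcongr
  have := Finset.card_le_univ (Finset.univ.erase k)
  rwa [Fintype.card_fin] at this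

/-- A row of the full matrix is bad with probability exponentially small in the information. -/
theorem PB_badRow_full_le {P : Matrix (Fin K) (Fin L) ℝ} {z : κ → Fin L} {D : Finset κ}
    {δ ω X d : ℝ} {I : ℝ} (hω : 1 ≤ ω) (hP : ∀ k l, 0 < P k l) (hP1 : ∀ k l, P k l ≤ 1)
    (hn : ∀ l, 0 < clusterSize z l) (hX : ∀ k l, blockMean P z k l ≤ X) (hδ0 : 0 ≤ δ)
    (hδ : δ ≤ 1 / 4) (hδX : δ * (L * X) ≤ 1) (hdω : ω * d ≤ 1)
    (hI : ∀ k r, r ≠ k → I ≤ info (blockMean P z) k r)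
    {k : Fin K} (hd : ∑ j ∈ D, P k (z j) ≤ d) :
    PB (fun j => P k (z j)) (badRow P z D δ ω k) ≤ K * Real.exp (14 - I) := by
  have hb : ∀ r, r ≠ k →
      PB (fun j => P k (z j)) (fun x => thr P z δ k r ≤ lin (coef P z D δ ω k r) x)
        ≤ Real.exp (14 - I) := by
    intro r hr
    rw [show 14 - I = -(I - 14) by ring]
    refine PB_thr_le hδ0 hδ hω hP hP1 hn hX hd ?_
    obtain ⟨s, hs, h1⟩ := exists_lt_sum_gap (Lam := blockMean P z) (k := k) (r := r)
        (c := I - 1) (by linarith [hI k r hr])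
    refine ⟨s, hs, ?_⟩
    have : 10 * δ * (L * X) = 10 * (δ * (L * X)) := by ring
    have : 3 * ω * d = 3 * (ω * d) := by ring
    linarith
  refine (PB_badRow_le hP hP1 hb).trans ?_
  rw [Finset.sum_const, nsmul_eq_mul]
  gcongr
  have := Finset.card_le_univ (Finset.univ.erase k)
  rwa [Fintype.card_fin] at this

set_option maxHeartbeats 1000000 in
/-- Sharp bound for the probability that the likelihood ratio rule prefers `r` to the label `k` of
a row. The coordinates with a common coefficient in the sharp tail bound are those of the column
cluster where the rows `k` and `r` differ most. -/
theorem PB_thr_sharp {P : Matrix (Fin K) (Fin L) ℝ} {z : κ → Fin L} {D : Finset κ}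
    {δ ω X Lm d c : ℝ} (hL : 0 < L) (hω : 1 ≤ ω) (hP : ∀ k l, 0 < P k l)
    (hP6 : ∀ k l, P k l ≤ 1 / 6)
    (hX : ∀ k l, blockMean P z k l ≤ X) (hLm : 0 < Lm) (hLm' : ∀ k l, Lm ≤ blockMean P z k l)
    (hR : ∀ k r l, P r l ≤ ω * P k l) (hδ0 : 0 ≤ δ) (hδX : δ * (L * X) ≤ 1) (hdω : ω * d ≤ 1)
    {k r : Fin K} (hd : ∑ j ∈ D, P k (z j) ≤ d) (hD : ∀ l, 2 * D.card ≤ clusterSize z l)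
    (hc : ∀ k l, (clusterSize z l : ℝ) * P k l ^ 2 ≤ c)
    (hI : 8 ≤ info (blockMean P z) k r) :
    PB (fun j => P k (z j)) (fun x => thr P z δ k r ≤ lin (coef P z D δ ω k r) x)
      ≤ 66 * Real.exp (14 + 72 * c) * ω * ((1 + 1 / epsGap (blockMean P z) k r) *
        Real.exp (-info (blockMean P z) k r) / √Lm) := by
  classical
  set M := blockMean P z with hM
  have hM0 : ∀ k l, 0 < M k l := fun k l => lt_of_lt_of_le hLm (hLm' k l)
  have hn : ∀ l, 0 < clusterSize z l := by
    intro l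
    by_contra h
    have h0 : clusterSize z l = 0 := by omega
    have := hM0 k l
    rw [hM, blockMean, h0] at this
    simp at this
  have hn' : ∀ l, (0 : ℝ) < clusterSize z l := fun l => by exact_mod_cast hn l
  have hMq : ∀ k r l, M r l / M k l = P r l / P k l := fun k r l => by
    rw [hM, blockMean, blockMean, mul_div_mul_right _ _ (hn' l).ne']
  have : Nonempty (Fin L) := ⟨⟨0, hL⟩⟩
  -- the column cluster where the two rows differ most
  obtain ⟨l, hl⟩ := exists_eq_ciSup_of_finite
    (f := fun l => max (M k l / M r l) (M r l / M k l))
  set V := max (M k l / M r l) (M r l / M k l) with hV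
  have hVle : ∀ l', max (M k l' / M r l') (M r l' / M k l') ≤ V := by
    intro l'
    rw [hl]
    exact le_ciSup (f := fun l => max (M k l / M r l) (M r l / M k l))
      (Set.finite_range _).bddAbove l'
  have hV0 : 0 < V := lt_of_lt_of_le (div_pos (hM0 k l) (hM0 r l)) (le_max_left _ _)
  have hVlog1 : ∀ l', Real.log (M k l' / M r l') ≤ Real.log V := fun l' =>
    Real.log_le_log (div_pos (hM0 _ _) (hM0 _ _)) ((le_max_left _ _).trans (hVle l'))
  have hVlog2 : ∀ l', Real.log (M r l' / M k l') ≤ Real.log V := fun l' =>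
    Real.log_le_log (div_pos (hM0 _ _) (hM0 _ _)) ((le_max_right _ _).trans (hVle l'))
  set ρ := Real.log V with hρ
  have hε : epsGap M k r = V - 1 := by rw [epsGap, hl]
  have hIρ : info M k r ≤ L * (X * ρ) := info_le_log hM0 hX k r hVlog1 hVlog2
  have hX0 : 0 < X := lt_of_lt_of_le (hM0 k l) (hX k l)
  have hL' : (0 : ℝ) < L := by exact_mod_cast hL
  have hρ0 : 0 < ρ := by
    by_contra h
    push Not at h
    have : L * (X * ρ) ≤ 0 := by
      have := mul_nonpos_of_nonneg_of_nonpos hX0.le h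
      exact mul_nonpos_of_nonneg_of_nonpos hL'.le this
    linarith
  have hV1 : 1 < V := by
    by_contra h
    push Not at h
    have := Real.log_nonpos hV0.le h
    linarith
  have h8δ : 8 * δ ≤ ρ := by
    calc 8 * δ ≤ L * (X * ρ) * δ := mul_le_mul_of_nonneg_right (hI.trans hIρ) hδ0
      _ = δ * (L * X) * ρ := by ring
      _ ≤ 1 * ρ := by gcongr
      _ = ρ := one_mul ρ
  have hδ4 : δ ≤ 1 / 8 := by
    have h1 := info_le hM0 hX k r
    have h2 : δ * 8 ≤ δ * (L * X) := mul_le_mul_of_nonneg_left (by linarith) hδ0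
    linarith
  set a₀ := Real.log (P r l / P k l) + 4 * δ with ha₀
  have habs : ρ / 2 ≤ |a₀| := by
    have h1 : |Real.log (P r l / P k l)| = ρ := by
      rw [← hMq]
      rcases max_choice (M k l / M r l) (M r l / M k l) with h | h
      · have h2 : Real.log (M r l / M k l) = -ρ := by
          rw [hρ, hV, h, ← Real.log_inv, inv_div]
        rw [h2, abs_neg, abs_of_pos hρ0]
      · have h2 : Real.log (M r l / M k l) = ρ := by rw [hρ, hV, h]
        rw [h2, abs_of_pos hρ0]
    have h2 := abs_add_le a₀ (-(4 * δ))
    rw [abs_neg, abs_of_nonneg (by positivity : 0 ≤ 4 * δ)] at h2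
    have h3 : a₀ + -(4 * δ) = Real.log (P r l / P k l) := by rw [ha₀]; ring
    rw [h3, h1] at h2
    linarith
  have ha₀0 : a₀ ≠ 0 := by
    intro h
    rw [h, abs_zero] at habs
    linarith
  obtain ⟨s, hs, hsI, hsω⟩ := exists_exponent_ge (ω := ω) hM0 hX hω (k := k) (r := r) (by
    intro l
    simp only [hM, blockMean]
    have := hR r k l
    have := (hn' l).le
    calc P k l * (clusterSize z l : ℝ) ≤ ω * P r l * clusterSize z l := by gcongr
      _ = _ := by ring) (by linarith)
  -- the columns of that cluster with known labels; `D` takes away at most half of them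
  set J : Finset κ := Finset.univ.filter fun j => z j = l ∧ j ∉ D with hJ
  have hJcard : (clusterSize z l : ℝ) / 2 ≤ J.card := by
    have h1 : clusterSize z l ≤ J.card + D.card := by
      rw [clusterSize]
      refine (Finset.card_le_card fun j hj => ?_).trans (Finset.card_union_le J D)
      have hj' := (Finset.mem_filter.1 hj).2
      by_cases hjD : j ∈ D
      · exact Finset.mem_union_right _ hjD
      · exact Finset.mem_union_left _ (Finset.mem_filter.2 ⟨Finset.mem_univ _, hj', hjD⟩)
    have h2 := hD l
    have h3 : clusterSize z l ≤ 2 * J.card := by omega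
    have h4 : (clusterSize z l : ℝ) ≤ 2 * J.card := by exact_mod_cast h3
    linarith
  have hJle : (J.card : ℝ) ≤ clusterSize z l := by
    rw [clusterSize]
    have h : J ⊆ Finset.univ.filter fun j => z j = l := fun j hj => by
      rw [hJ, Finset.mem_filter] at hj
      exact Finset.mem_filter.2 ⟨Finset.mem_univ _, hj.2.1⟩
    exact_mod_cast Finset.card_le_card h
  have hJ0 : J.Nonempty := by
    rw [← Finset.card_pos]
    have : (0 : ℝ) < J.card := by linarith [hn' l]
    exact_mod_cast this
  -- the mean of these entries after the change of measure lies, up to constants, between the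
  -- means in the rows `k` and `r`
  set u := P k l * Real.exp (s * a₀) with hu
  have hs0 := hs.1
  have hs1 := hs.2
  have hPk := hP k l
  have hPr := hP r l
  have hueq : u = Real.exp (4 * δ * s) * (P k l ^ (1 - s) * P r l ^ s) := by
    rw [hu, ha₀, mul_add, Real.exp_add, Real.rpow_sub hPk, Real.rpow_one, div_mul_eq_mul_div,
      mul_div_assoc, ← Real.div_rpow hPr.le hPk.le, Real.rpow_def_of_pos (div_pos hPr hPk)]
    ring_nf
  have hE3 : Real.exp (4 * δ * s) ≤ 3 := by
    refine (Real.exp_le_exp.2 (show 4 * δ * s ≤ 1 by nlinarith)).trans ?_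
    have := Real.exp_one_lt_d9
    linarith
  have hE1 : 1 ≤ Real.exp (4 * δ * s) := Real.one_le_exp (by positivity)
  have hG : P k l ^ (1 - s) * P r l ^ s ≤ max (P k l) (P r l) := by
    have := Real.geom_mean_le_arith_mean2_weighted (by linarith : 0 ≤ 1 - s) hs0.le hPk.le hPr.le
      (by ring)
    have h1 := le_max_left (P k l) (P r l)
    have h2 := le_max_right (P k l) (P r l)
    nlinarith
  have hGlow : min (P k l) (P r l) ≤ P k l ^ (1 - s) * P r l ^ s := by
    have hm : 0 < min (P k l) (P r l) := lt_min hPk hPr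
    calc min (P k l) (P r l) = min (P k l) (P r l) ^ (1 - s) * min (P k l) (P r l) ^ s := by
          rw [← Real.rpow_add hm]; simp
      _ ≤ _ := by
          have h1s : 0 ≤ 1 - s := by linarith
          gcongr
          · exact min_le_left _ _
          · exact min_le_right _ _
  have hu3 : u ≤ 3 * max (P k l) (P r l) := by
    rw [hueq]
    gcongr
  have hu1 : u ≤ 1 := by
    have := max_le (hP6 k l) (hP6 r l)
    linarith
  have hulow : min (P k l) (P r l) ≤ u := by
    rw [hueq]
    refine hGlow.trans ?_
    exact le_mul_of_one_le_left (by positivity) hE1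
  have hu0 : 0 < u := mul_pos hPk (Real.exp_pos _)
  have hden : 1 + P k l * (Real.exp (s * a₀) - 1) = 1 - P k l + u := by rw [hu]; ring
  set π := u / (1 - P k l + u) with hπ
  have hd0 : 1 / 2 ≤ 1 - P k l + u := by linarith [hP6 k l]
  have hd2 : 1 - P k l + u ≤ 2 := by linarith
  have hπlow : u / 2 ≤ π := by
    rw [hπ]
    gcongr
  have hπup : π ≤ 2 * u := by
    rw [hπ, div_le_iff₀ (by linarith)]
    nlinarith
  have hπ0 : 0 < π := by linarith
  have hmax2 : (clusterSize z l : ℝ) * max (P k l) (P r l) ^ 2 ≤ c := by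
    rcases max_choice (P k l) (P r l) with h | h <;> rw [h] <;> exact hc _ l
  have hcJ : π * (J.card * π) ≤ 36 * c := by
    have h1 : π ≤ 6 * max (P k l) (P r l) := by linarith
    calc π * (J.card * π) = J.card * π ^ 2 := by ring
      _ ≤ clusterSize z l * (6 * max (P k l) (P r l)) ^ 2 := by gcongr
      _ = 36 * (clusterSize z l * max (P k l) (P r l) ^ 2) := by ring
      _ ≤ 36 * c := by gcongr
  have hp : ∀ j, P k (z j) ∈ Set.Icc (0 : ℝ) 1 := fun j =>
    ⟨(hP k (z j)).le, by linarith [hP6 k (z j)]⟩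
  have hmain := PB_lin_sharp hp (coef P z D δ ω k r) (thr P z δ k r) hs0
    (fun j => by linarith [hP6 k (z j)]) hJ0 (p₀ := P k l) (a₀ := a₀) (π := π) (c := 36 * c)
    (fun j hj => by rw [(Finset.mem_filter.1 hj).2.1])
    (fun j hj => by
      have := (Finset.mem_filter.1 hj).2
      rw [coef, if_neg this.2, this.1])
    hPk ha₀0 (by rw [hden, hπ]) hcJ
  refine hmain.trans ?_
  have hexp := exponent_le (R := ω) (r := r) (d := d) hs hδ0 (by linarith) hω hP hn hX hd
  have hexp2 : Real.exp (-(s * thr P z δ k r) +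
      ∑ j, P k (z j) * (Real.exp (s * coef P z D δ ω k r j) - 1))
      ≤ Real.exp 14 * Real.exp (-info M k r) := by
    rw [← Real.exp_add]
    refine Real.exp_le_exp.2 ?_
    have e1 : 10 * δ * (L * X) = 10 * (δ * (L * X)) := by ring
    have e2 : 3 * ω * d = 3 * (ω * d) := by ring
    linarith
  have hJπ : Lm / 4 ≤ J.card * π := by
    have h1 : Lm ≤ min (P k l) (P r l) * clusterSize z l := by
      rcases min_choice (P k l) (P r l) with h | h <;> rw [h] <;> exact hLm' _ l
    calc Lm / 4 ≤ (clusterSize z l / 2) * (min (P k l) (P r l) / 2) := by linarith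
      _ ≤ J.card * π := by
          have : 0 < min (P k l) (P r l) := lt_min hPk hPr
          gcongr
          linarith
  have hsq : Real.exp (2 * (36 * c)) / √(J.card * π) ≤ Real.exp (72 * c) * (2 / √Lm) := by
    have h1 : √Lm / 2 ≤ √(J.card * π) := by
      refine le_trans (le_of_eq ?_) (Real.sqrt_le_sqrt hJπ)
      rw [Real.sqrt_div hLm.le, show (4 : ℝ) = 2 ^ 2 by norm_num, Real.sqrt_sq (by norm_num)]
    have h2 := Real.sqrt_pos.2 hLm
    rw [show 2 * (36 * c) = 72 * c by ring, div_eq_mul_one_div]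
    refine mul_le_mul_of_nonneg_left ?_ (Real.exp_pos _).le
    rw [div_le_div_iff₀ (by positivity) h2]
    linarith
  -- the spacing `|a₀|` of the atoms is of the order of `log V`, and `1 / log V ≤ 1 + 1 / (V - 1)`
  have hgeo : 1 + 1 / (s * |a₀|) ≤ 33 * ω * (1 + 1 / (V - 1)) := by
    have h1 : 1 / ρ ≤ 1 + 1 / (V - 1) := by
      have h2 := Real.one_sub_inv_le_log_of_pos hV0
      have h3 : 0 < V - 1 := by linarith
      have h4 : 1 + 1 / (V - 1) = 1 / (1 - V⁻¹) := by
        have : 1 - V⁻¹ = (V - 1) / V := by field_simp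
        rw [this]
        field_simp
        ring
      rw [h4]
      refine one_div_le_one_div_of_le ?_ h2
      rw [sub_pos]
      exact inv_lt_one_of_one_lt₀ hV1
    have h5 : ρ / (32 * ω) ≤ s * |a₀| := by
      calc ρ / (32 * ω) = 1 / (16 * ω) * (ρ / 2) := by field_simp; norm_num
        _ ≤ s * |a₀| := by gcongr
    have h6 : 1 / (s * |a₀|) ≤ 32 * ω * (1 / ρ) := by
      calc 1 / (s * |a₀|) ≤ 1 / (ρ / (32 * ω)) := by gcongr
        _ = _ := by field_simp
    have h7 : 0 ≤ 1 / (V - 1) := by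
      have : 0 < V - 1 := by linarith
      positivity
    nlinarith
  calc _ ≤ (Real.exp 14 * Real.exp (-info M k r)) *
        ((Real.exp (72 * c) * (2 / √Lm)) * (33 * ω * (1 + 1 / (V - 1)))) := by
        gcongr
    _ = _ := by
        rw [hε, Real.exp_add]
        ring

end RowBounds

/-! ### Random partitions -/

section Partition

variable {α β γ : Type} [Fintype α] [DecidableEq α] [Fintype β] [DecidableEq β] [Fintype γ]

/-- The image of a point under a uniformly random bijection is uniform. -/
theorem card_equiv_apply_eq [Nonempty (α ≃ β)] (x : α) (a : β) :
    (Fintype.card α : ℝ) * ((Finset.univ.filter fun s : α ≃ β => s x = a).card : ℝ)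
      = Fintype.card (α ≃ β) := by
  have h1 : ∀ b : β, (Finset.univ.filter fun s : α ≃ β => s x = b).card
      = (Finset.univ.filter fun s : α ≃ β => s x = a).card := by
    intro b
    refine Finset.card_bij' (fun s _ => s.trans (Equiv.swap a b))
      (fun s _ => s.trans (Equiv.swap a b)) ?_ ?_ ?_ ?_
    · intro s hs
      simp only [Finset.mem_filter, Finset.mem_univ, true_and] at hs ⊢
      simp [hs]
    · intro s hs
      simp only [Finset.mem_filter, Finset.mem_univ, true_and] at hs ⊢
      simp [hs]
    · intro s _
      ext y
      simp
    · intro s _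
      ext y
      simp
  have h2 : ∑ b : β, (Finset.univ.filter fun s : α ≃ β => s x = b).card
      = Fintype.card (α ≃ β) := by
    rw [← Finset.card_univ]
    exact (Finset.card_eq_sum_card_fiberwise (f := fun s : α ≃ β => s x) (t := Finset.univ)
      (fun _ _ => Finset.mem_coe.2 (Finset.mem_univ _))).symm
  simp only [h1, Finset.sum_const, Finset.card_univ, smul_eq_mul] at h2
  obtain ⟨e⟩ := ‹Nonempty (α ≃ β)›
  rw [Fintype.card_congr e]
  exact_mod_cast h2

/-- Given the image of one point, the image of another point is uniform over the remaining values. -/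
theorem card_equiv_apply_eq_apply_eq {x x' : α} (hx : x ≠ x') {a b : β} (hab : a ≠ b) :
    ((Fintype.card β : ℝ) - 1) *
      ((Finset.univ.filter fun s : α ≃ β => s x = a ∧ s x' = b).card : ℝ)
      = (Finset.univ.filter fun s : α ≃ β => s x = a).card := by
  have h1 : ∀ c ∈ Finset.univ.erase a,
      (Finset.univ.filter fun s : α ≃ β => s x = a ∧ s x' = c).card
      = (Finset.univ.filter fun s : α ≃ β => s x = a ∧ s x' = b).card := by
    intro c hc
    have hca : c ≠ a := Finset.ne_of_mem_erase hc
    refine Finset.card_bij' (fun s _ => s.trans (Equiv.swap b c))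
      (fun s _ => s.trans (Equiv.swap b c)) ?_ ?_ ?_ ?_
    · intro s hs
      simp only [Finset.mem_filter, Finset.mem_univ, true_and] at hs ⊢
      simp [hs.1, hs.2, Equiv.swap_apply_of_ne_of_ne hab hca.symm]
    · intro s hs
      simp only [Finset.mem_filter, Finset.mem_univ, true_and] at hs ⊢
      simp [hs.1, hs.2, Equiv.swap_apply_of_ne_of_ne hab hca.symm]
    · intro s _
      ext y
      simp
    · intro s _
      ext y
      simp
  have h2 : ∑ c ∈ Finset.univ.erase a,
      (Finset.univ.filter fun s : α ≃ β => s x = a ∧ s x' = c).card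
      = (Finset.univ.filter fun s : α ≃ β => s x = a).card := by
    rw [Finset.card_eq_sum_card_fiberwise (f := fun s : α ≃ β => s x') (t := Finset.univ.erase a)]
    · refine Finset.sum_congr rfl fun c _ => ?_
      rw [Finset.filter_filter]
    · intro s hs
      have hs' : s x = a := (Finset.mem_filter.1 (Finset.mem_coe.1 hs)).2
      refine Finset.mem_coe.2 (Finset.mem_erase.2 ⟨fun h => hx ?_, Finset.mem_univ _⟩)
      exact s.injective (hs'.trans h.symm)
  rw [Finset.sum_congr rfl h1, Finset.sum_const, smul_eq_mul,
    Finset.card_erase_of_mem (Finset.mem_univ a), Finset.card_univ] at h2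
  have h3 : 1 ≤ Fintype.card β := Fintype.card_pos_iff.2 ⟨a⟩
  rw [← h2, Nat.cast_mul, Nat.cast_sub h3, Nat.cast_one]

/-- Chebyshev's inequality for the size of the intersection of a fixed set with the preimage of
another one under a uniformly random bijection. -/
theorem prob_equiv_inter_le [Nonempty (α ≃ β)] (S : Finset α) (T : Finset β) (hS : S.Nonempty)
    (hT : T.Nonempty) :
    prob (PMF.uniformOfFintype (α ≃ β))
      {s | ¬ |((S.filter fun x => s x ∈ T).card : ℝ) - S.card * T.card / Fintype.card α|
        ≤ 1 / 10 * (S.card * T.card / Fintype.card α)}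
      ≤ ENNReal.ofReal (100 * Fintype.card α / (S.card * T.card)) := by
  classical
  obtain ⟨x₀, hx₀⟩ := hS
  obtain ⟨e₀⟩ := id ‹Nonempty (α ≃ β)›
  have hSc : (0 : ℝ) < S.card := by exact_mod_cast Finset.card_pos.2 ⟨x₀, hx₀⟩
  have hTc : (0 : ℝ) < T.card := by exact_mod_cast Finset.card_pos.2 hT
  have hNβ : (Fintype.card β : ℝ) = Fintype.card α := by rw [Fintype.card_congr e₀]
  have hTN : (T.card : ℝ) ≤ Fintype.card α := by
    rw [← hNβ]
    exact_mod_cast Finset.card_le_univ T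
  have hSN : (S.card : ℝ) ≤ Fintype.card α := by exact_mod_cast Finset.card_le_univ S
  have hN : (0 : ℝ) < Fintype.card α := lt_of_lt_of_le hSc hSN
  have hW : (0 : ℝ) < Fintype.card (α ≃ β) := by exact_mod_cast Fintype.card_pos
  have hcnt1 := card_equiv_apply_eq (α := α) (β := β)
  set N : ℝ := (Fintype.card α : ℝ) with hNd
  set W : ℝ := (Fintype.card (α ≃ β) : ℝ) with hWd
  set μ : ℝ := S.card * T.card / N with hμ
  have hμ0 : 0 < μ := by positivity
  set I : (α ≃ β) → α → ℝ := fun s x => if s x ∈ T then 1 else 0 with hI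
  set c : (α ≃ β) → ℝ := fun s => ((S.filter fun x => s x ∈ T).card : ℝ) with hc
  have hcI : ∀ s, c s = ∑ x ∈ S, I s x := by
    intro s
    simp only [hc, hI]
    rw [← Finset.sum_filter, Finset.sum_const, nsmul_eq_mul, mul_one]
  have hE1 : ∀ x, ∑ s, I s x = T.card * W / N := by
    intro x
    have h1 : ∀ s : α ≃ β, I s x = ∑ a ∈ T, if s x = a then 1 else 0 := fun s => by
      simp [hI]
    simp only [h1]
    rw [Finset.sum_comm]
    have h2 : ∀ a ∈ T, ∑ s : α ≃ β, (if s x = a then (1 : ℝ) else 0) = W / N := by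
      intro a _
      rw [← Finset.sum_filter, Finset.sum_const, nsmul_eq_mul, mul_one, eq_div_iff hN.ne',
        mul_comm]
      exact hcnt1 x a
    rw [Finset.sum_congr rfl h2, Finset.sum_const, nsmul_eq_mul]
    ring
  -- sampling without replacement: the indicators of two points are negatively correlated
  have hE2 : ∀ x ∈ S, ∀ x' ∈ S.erase x,
      ((S.card : ℝ) - 1) * ∑ s, I s x * I s x' ≤ S.card * T.card ^ 2 * W / N ^ 2 := by
    intro x hx x' hx'
    have hxx : x ≠ x' := (Finset.ne_of_mem_erase hx').symm
    have hS2 : (2 : ℝ) ≤ S.card := by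
      have : 1 < S.card := Finset.one_lt_card.2 ⟨x, hx, x', Finset.mem_of_mem_erase hx', hxx⟩
      exact_mod_cast this
    have h1 : ∀ s : α ≃ β, I s x * I s x'
        = ∑ a ∈ T, ∑ b ∈ T.erase a, if s x = a ∧ s x' = b then 1 else 0 := by
      intro s
      have hne : s x' ≠ s x := fun h => hxx (s.injective h.symm)
      by_cases h1 : s x ∈ T
      · rw [Finset.sum_eq_single (s x)]
        · by_cases h2 : s x' ∈ T
          · rw [Finset.sum_eq_single (s x')]
            · simp [hI, h1, h2]
            · intro b _ hb
              simp [hb.symm]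
            · intro h
              exact absurd (Finset.mem_erase.2 ⟨hne, h2⟩) h
          · rw [Finset.sum_eq_zero]
            · simp [hI, h2]
            · intro b hb
              rw [if_neg]
              rintro ⟨-, rfl⟩
              exact h2 (Finset.mem_of_mem_erase hb)
        · intro a _ ha
          refine Finset.sum_eq_zero fun b _ => ?_
          rw [if_neg]
          rintro ⟨rfl, -⟩
          exact ha rfl
        · exact fun h => absurd h1 h
      · rw [Finset.sum_eq_zero]
        · simp [hI, h1]
        · intro a ha
          refine Finset.sum_eq_zero fun b _ => ?_
          rw [if_neg]
          rintro ⟨rfl, -⟩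
          exact h1 ha
    have h2 : ∀ a ∈ T, ∀ b ∈ T.erase a,
        (N - 1) * ∑ s : α ≃ β, (if s x = a ∧ s x' = b then (1 : ℝ) else 0) = W / N := by
      intro a _ b hb
      rw [← Finset.sum_filter, Finset.sum_const, nsmul_eq_mul, mul_one, ← hNβ,
        card_equiv_apply_eq_apply_eq hxx (Finset.ne_of_mem_erase hb).symm, hNβ,
        eq_div_iff hN.ne', mul_comm]
      exact hcnt1 x a
    have h3 : (N - 1) * ∑ s, I s x * I s x' = T.card * (T.card - 1) * (W / N) := by
      simp only [h1]
      rw [Finset.sum_comm, Finset.mul_sum]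
      have h4 : ∀ a ∈ T, (N - 1) * ∑ s : α ≃ β, ∑ b ∈ T.erase a,
          (if s x = a ∧ s x' = b then (1 : ℝ) else 0) = (T.card - 1) * (W / N) := by
        intro a ha
        rw [Finset.sum_comm, Finset.mul_sum, Finset.sum_congr rfl (h2 a ha), Finset.sum_const,
          nsmul_eq_mul, Finset.card_erase_of_mem ha,
          Nat.cast_sub (Finset.card_pos.2 ⟨a, ha⟩), Nat.cast_one]
      rw [Finset.sum_congr rfl h4, Finset.sum_const, nsmul_eq_mul]
      ring
    have hN2 : 0 < N - 1 := by linarith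
    have hEe : ∑ s, I s x * I s x' = T.card * (T.card - 1) * (W / N) / (N - 1) := by
      rw [eq_div_iff hN2.ne', ← h3]
      ring
    rw [hEe]
    have hT1 : (T.card : ℝ) - 1 ≤ T.card := by linarith
    have h5 : ((S.card : ℝ) - 1) / (N - 1) ≤ S.card / N := by
      rw [div_le_div_iff₀ hN2 hN]
      nlinarith
    have hT1' : (0 : ℝ) ≤ T.card - 1 := by
      have : (1 : ℝ) ≤ T.card := by exact_mod_cast Finset.card_pos.2 hT
      linarith
    calc ((S.card : ℝ) - 1) * (T.card * (T.card - 1) * (W / N) / (N - 1))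
        = ((S.card : ℝ) - 1) / (N - 1) * (T.card * (T.card - 1) * (W / N)) := by ring
      _ ≤ S.card / N * (T.card * T.card * (W / N)) := by
          have : 0 ≤ ((S.card : ℝ) - 1) / (N - 1) := div_nonneg (by linarith) hN2.le
          gcongr
      _ = _ := by field_simp
  have hsum1 : ∑ s, c s = W * μ := by
    simp only [hcI]
    rw [Finset.sum_comm, Finset.sum_congr rfl fun x _ => hE1 x, Finset.sum_const, nsmul_eq_mul, hμ]
    ring
  have hsum2 : ∑ s, c s ^ 2 ≤ W * (μ + μ ^ 2) := by
    have h1 : ∀ s, c s ^ 2 = ∑ x ∈ S, (I s x + ∑ x' ∈ S.erase x, I s x * I s x') := by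
      intro s
      rw [sq, hcI, Finset.sum_mul]
      refine Finset.sum_congr rfl fun x hx => ?_
      rw [← Finset.add_sum_erase S (fun x' => I s x') hx, mul_add, Finset.mul_sum]
      congr 1
      simp only [hI]
      split_ifs <;> simp
    simp only [h1]
    rw [Finset.sum_comm]
    have h2 : ∀ x ∈ S, ∑ s, (I s x + ∑ x' ∈ S.erase x, I s x * I s x')
        ≤ T.card * W / N + S.card * T.card ^ 2 * W / N ^ 2 := by
      intro x hx
      rw [Finset.sum_add_distrib, hE1, Finset.sum_comm]
      refine add_le_add_right ?_ _
      by_cases hS1 : S.erase x = ∅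
      · rw [hS1, Finset.sum_empty]
        positivity
      · obtain ⟨x₁, hx₁⟩ := Finset.nonempty_iff_ne_empty.2 hS1
        have hS2 : (0 : ℝ) < (S.card : ℝ) - 1 := by
          have : 1 < S.card := Finset.one_lt_card.2 ⟨x, hx, x₁, Finset.mem_of_mem_erase hx₁,
            (Finset.ne_of_mem_erase hx₁).symm⟩
          have : (1 : ℝ) < S.card := by exact_mod_cast this
          linarith
        have h3 : ∀ x' ∈ S.erase x, ∑ s, I s x * I s x'
            ≤ (S.card * T.card ^ 2 * W / N ^ 2) / (S.card - 1) := by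
          intro x' hx'
          rw [le_div_iff₀ hS2, mul_comm]
          exact hE2 x hx x' hx'
        refine (Finset.sum_le_sum h3).trans ?_
        rw [Finset.sum_const, nsmul_eq_mul, Finset.card_erase_of_mem hx,
          Nat.cast_sub (Finset.card_pos.2 ⟨x, hx⟩), Nat.cast_one, mul_div_cancel₀ _ hS2.ne']
    refine (Finset.sum_le_sum h2).trans (le_of_eq ?_)
    rw [Finset.sum_const, nsmul_eq_mul, hμ]
    field_simp
  have hvar : ∑ s, (c s - μ) ^ 2 ≤ W * μ := by
    have h1 : ∀ s, (c s - μ) ^ 2 = c s ^ 2 - 2 * μ * c s + μ ^ 2 := fun s => by ring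
    simp only [h1]
    rw [Finset.sum_add_distrib, Finset.sum_sub_distrib, ← Finset.mul_sum, hsum1, Finset.sum_const,
      Finset.card_univ, nsmul_eq_mul]
    nlinarith
  set B : Finset (α ≃ β) := Finset.univ.filter fun s => ¬ |c s - μ| ≤ 1 / 10 * μ with hB
  have hcard : (B.card : ℝ) * (μ ^ 2 / 100) ≤ W * μ := by
    refine le_trans ?_ hvar
    calc (B.card : ℝ) * (μ ^ 2 / 100) = ∑ s ∈ B, μ ^ 2 / 100 := by
          rw [Finset.sum_const, nsmul_eq_mul]
      _ ≤ ∑ s ∈ B, (c s - μ) ^ 2 := by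
          refine Finset.sum_le_sum fun s hs => ?_
          have h1 := (Finset.mem_filter.1 hs).2
          push Not at h1
          have h2 := pow_le_pow_left₀ (by positivity) h1.le 2
          rw [sq_abs] at h2
          linarith
      _ ≤ ∑ s, (c s - μ) ^ 2 :=
          Finset.sum_le_sum_of_subset_of_nonneg (Finset.subset_univ _) fun s _ _ => sq_nonneg _
  have hset : {s : α ≃ β | ¬ |c s - μ| ≤ 1 / 10 * μ} = (B : Set (α ≃ β)) := by
    ext s
    simp [hB]
  have hgoal : (B.card : ℝ) / W ≤ 100 * N / (S.card * T.card) := by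
    have h1 : 100 * N / (S.card * T.card) = 100 / μ := by rw [hμ]; field_simp
    rw [h1, div_le_div_iff₀ hW hμ0]
    have h2 : (B.card : ℝ) * μ * μ ≤ 100 * W * μ := by nlinarith
    exact le_of_mul_le_mul_right h2 hμ0
  change prob (PMF.uniformOfFintype (α ≃ β)) {s : α ≃ β | ¬ |c s - μ| ≤ 1 / 10 * μ} ≤ _
  rw [hset, prob, PMF.toOuterMeasure_uniformOfFintype_apply]
  refine le_trans (le_of_eq ?_) (ENNReal.ofReal_le_ofReal hgoal)
  rw [ENNReal.ofReal_div_of_pos hW, ENNReal.ofReal_natCast, hWd, ENNReal.ofReal_natCast]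
  congr 2
  rw [← Set.toFinset_card, Finset.toFinset_coe]

/-- In a block of a uniformly random partition, the cluster sizes are within ten percent of their
means, except with small probability. -/
theorem prob_clusterSize_block_le [Nonempty (α ≃ β)] [Nonempty γ] {K : ℕ} (y : α → Fin K)
    (k : Fin K) (hk : 0 < clusterSize y k) (g : γ → β) (hg : Function.Injective g) :
    prob (PMF.uniformOfFintype (α ≃ β))
      {s | ¬ |(clusterSize (fun i => y (s.symm (g i))) k : ℝ)
          - clusterSize y k * Fintype.card γ / Fintype.card α|
        ≤ 1 / 10 * (clusterSize y k * Fintype.card γ / Fintype.card α)}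
      ≤ ENNReal.ofReal (100 * Fintype.card α / (clusterSize y k * Fintype.card γ)) := by
  classical
  set S : Finset α := Finset.univ.filter fun x => y x = k with hS
  set T : Finset β := Finset.univ.image g with hT
  have hTc : T.card = Fintype.card γ := by
    rw [hT, Finset.card_image_of_injective _ hg, Finset.card_univ]
  have hSc : S.card = clusterSize y k := rfl
  have hcs : ∀ s : α ≃ β, clusterSize (fun i => y (s.symm (g i))) k
      = (S.filter fun x => s x ∈ T).card := by
    intro s
    rw [clusterSize]
    refine Finset.card_bij (fun i _ => s.symm (g i)) ?_ ?_ ?_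
    · intro i hi
      simp only [Finset.mem_filter, Finset.mem_univ, true_and] at hi
      simp [hS, hT, hi]
    · intro i _ i' _ h
      exact hg (s.symm.injective h)
    · intro x hx
      simp only [hS, hT, Finset.mem_filter, Finset.mem_univ, true_and, Finset.mem_image] at hx
      obtain ⟨hx1, i, hi⟩ := hx
      refine ⟨i, ?_, ?_⟩
      · simp [hi, hx1]
      · simp [hi]
  have h := prob_equiv_inter_le (α := α) (β := β) S T (Finset.card_pos.1 (by rw [hSc]; exact hk))
    (by rw [hT]; exact Finset.univ_nonempty.image g)
  rw [hTc, hSc] at h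
  simp only [hcs]
  exact h

end Partition

/-! ### Optimal relabelings -/

section Relabel

variable {ι : Type} [Fintype ι] [DecidableEq ι] {K : ℕ}

/-- If labels agree with the truth up to a relabeling outside a small set, then this relabeling is
the only optimal one. -/
theorem eq_inv_of_mem_optPerms {yh y : ι → Fin K} {σ₀ σ : Equiv.Perm (Fin K)} {S : Finset ι}
    (hS : ∀ i ∉ S, yh i = σ₀ (y i)) (hcard : ∀ k, 2 * S.card < clusterSize y k)
    (hσ : σ ∈ optPerms yh y) : σ = σ₀⁻¹ := by
  classical
  suffices h : ∀ k, σ (σ₀ k) = k by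
    ext1 k
    have := h (σ₀⁻¹ k)
    simpa using this
  intro k
  by_contra hk
  have hle : dMis (fun i => σ (yh i)) y ≤ dMis (fun i => σ₀⁻¹ (yh i)) y := by
    simp only [optPerms, Finset.mem_filter] at hσ
    exact hσ.2 _
  have h1 : (Finset.univ.filter fun i => σ₀⁻¹ (yh i) ≠ y i).card ≤ S.card := by
    refine Finset.card_le_card fun i hi => ?_
    by_contra hiS
    refine (Finset.mem_filter.1 hi).2 ?_
    rw [hS i hiS]
    simp
  have h2 : clusterSize y k ≤ (Finset.univ.filter fun i => σ (yh i) ≠ y i).card + S.card := by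
    refine (Finset.card_le_card fun i hi => ?_).trans (Finset.card_union_le _ _)
    by_cases hiS : i ∈ S
    · exact Finset.mem_union_right _ hiS
    · refine Finset.mem_union_left _ (Finset.mem_filter.2 ⟨Finset.mem_univ _, ?_⟩)
      rw [hS i hiS, (Finset.mem_filter.1 hi).2]
      exact hk
  have h3 := hcard k
  have hpos : (0 : ℝ) < Fintype.card ι := by
    have : 0 < clusterSize y k := by omega
    have h4 : clusterSize y k ≤ Fintype.card ι := Finset.card_le_univ _
    exact_mod_cast lt_of_lt_of_le this h4
  rw [dMis, dMis, div_le_div_iff_of_pos_right hpos, Nat.cast_le] at hle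
  omega

/-- Two labelings that agree with the truth up to relabelings and few errors are matched by the
composition of these relabelings. -/
theorem eq_of_mem_optPerms {x x' y : ι → Fin K} {a b τ : Equiv.Perm (Fin K)} {S S' : Finset ι}
    (hS : ∀ i ∉ S, a (x i) = y i) (hS' : ∀ i ∉ S', b (x' i) = y i)
    (hcard : ∀ k, 3 * S.card + 2 * S'.card < clusterSize y k)
    (hτ : τ ∈ optPerms x' x) : τ = a⁻¹ * b := by
  classical
  have h := eq_inv_of_mem_optPerms (σ₀ := b⁻¹ * a) (S := S ∪ S') ?_ ?_ hτ
  · rw [h]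
    simp
  · intro i hi
    rw [Finset.mem_union, not_or] at hi
    rw [Equiv.Perm.mul_apply, hS i hi.1, ← hS' i hi.2]
    simp
  · intro k
    have h1 : clusterSize y (a k) ≤ clusterSize x k + S.card := by
      refine (Finset.card_le_card fun i hi => ?_).trans (Finset.card_union_le _ _)
      by_cases hiS : i ∈ S
      · exact Finset.mem_union_right _ hiS
      · refine Finset.mem_union_left _ (Finset.mem_filter.2 ⟨Finset.mem_univ _, ?_⟩)
        have h2 := (Finset.mem_filter.1 hi).2
        rw [← hS i hiS] at h2
        exact a.injective h2
    have h3 := hcard (a k)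
    have h4 := Finset.card_union_le S S'
    omega

/-- The number of errors of an optimally relabeled labeling. -/
theorem card_le_of_mis_le {u y : ι → Fin K} {ρ : Equiv.Perm (Fin K)} (hρ : ρ ∈ optPerms u y)
    {c : ℝ} (h : mis u y ≤ c) :
    ((Finset.univ.filter fun i => ρ (u i) ≠ y i).card : ℝ) ≤ c * Fintype.card ι := by
  have h1 : dMis (fun i => ρ (u i)) y ≤ c := by
    refine le_trans (le_ciInf fun τ => ?_) h
    simp only [optPerms, Finset.mem_filter] at hρ
    exact hρ.2 τ
  by_cases hN : Fintype.card ι = 0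
  · have h2 : (Finset.univ.filter fun i => ρ (u i) ≠ y i).card ≤ Fintype.card ι :=
      Finset.card_le_univ _
    rw [hN] at h2 ⊢
    have h3 : (Finset.univ.filter fun i => ρ (u i) ≠ y i).card = 0 := by omega
    rw [h3]
    simp
  · rw [dMis, div_le_iff₀ (by exact_mod_cast Nat.pos_of_ne_zero hN)] at h1
    exact h1

theorem prod_reverse_finRange {G : Type} [Group G] (Q : ℕ) (β : ℕ → G) :
    ((List.finRange Q).reverse.map fun q : Fin Q => (β (q + 1))⁻¹ * β q).prod = (β Q)⁻¹ * β 0 := by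
  induction Q generalizing β with
  | zero => simp
  | succ Q ih =>
    have := ih fun n => β (n + 1)
    rw [List.finRange_succ, List.reverse_cons, List.map_append, List.prod_append,
      ← List.map_reverse, List.map_map]
    simp only [Function.comp_def, Fin.val_succ] at this ⊢
    rw [this]
    simp [mul_assoc]

theorem prod_reverse_filter_finRange {G : Type} [Group G] {Q : ℕ} (β : ℕ → G) (q : Fin Q) :
    (((List.finRange Q).filter fun j => q < j).reverse.map fun j : Fin Q =>
      (β (j + 1))⁻¹ * β j).prod
      = (β Q)⁻¹ * β (q + 1) := by
  induction Q generalizing β with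
  | zero => exact q.elim0
  | succ Q ih =>
    rw [List.finRange_succ, List.filter_cons, List.filter_map]
    simp only [Fin.not_lt_zero, decide_false, Bool.false_eq_true, if_false, Function.comp_def]
    rw [← List.map_reverse, List.map_map]
    refine Fin.cases ?_ (fun q' => ?_) q
    · have := prod_reverse_finRange Q fun n => β (n + 1)
      simp only [Fin.succ_pos, decide_true, List.filter_true, Function.comp_def, Fin.val_succ,
        Fin.val_zero, zero_add] at this ⊢
      exact this
    · have := ih (fun n => β (n + 1)) q'
      simp only [Fin.succ_lt_succ_iff, Function.comp_def, Fin.val_succ] at this ⊢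
      exact this

open scoped Fin.NatCast Fin.CommRing in
theorem exists_perm_of_mem_matchChain {Q : ℕ} [NeZero Q] {x x' w : Fin Q → ι → Fin K}
    (α : Fin Q → Equiv.Perm (Fin K))
    (hα : ∀ q, ∀ τ ∈ optPerms (x' q) (x q), τ = (α q)⁻¹ * α (q - 1))
    (hw : w ∈ (matchChain x x').support) :
    ∃ σ : Equiv.Perm (Fin K), ∀ q i, w q i = σ (α q (x q i)) := by
  obtain ⟨τ, hτ, hwτ⟩ := (PMF.mem_support_bind_iff _ _ _).1 hw
  rw [mem_support_piPMF] at hτ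
  have hτ' : τ = fun q => (α q)⁻¹ * α (q - 1) := by
    funext q
    exact hα q _ (by simpa [drawOptPerm] using hτ q)
  refine ⟨(α (((Q : ℕ) : Fin Q) - 1))⁻¹, fun q i => ?_⟩
  have hw' := (PMF.mem_support_pure_iff _ _).1 hwτ
  rw [hw', hτ']
  have h1 : (fun q : Fin Q => (α q)⁻¹ * α (q - 1))
      = fun q : Fin Q => ((fun n : ℕ => α ((n : Fin Q) - 1)) (q + 1))⁻¹ *
        (fun n : ℕ => α ((n : Fin Q) - 1)) q := by
    funext q
    simp
  beta_reduce
  rw [h1, prod_reverse_filter_finRange (fun n : ℕ => α ((n : Fin Q) - 1)) q]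
  simp

theorem eq_of_mem_matchTo {Q : ℕ} {x ref w : Fin Q → ι → Fin K}
    (α : Fin Q → Equiv.Perm (Fin K)) (σ : Equiv.Perm (Fin K))
    (hα : ∀ q, ∀ τ ∈ optPerms (x q) (ref q), τ = σ * α q)
    (hw : w ∈ (matchTo x ref).support) : ∀ q i, w q i = σ (α q (x q i)) := by
  obtain ⟨τ, hτ, hwτ⟩ := (PMF.mem_support_bind_iff _ _ _).1 hw
  rw [mem_support_piPMF] at hτ
  intro q i
  have hw' := (PMF.mem_support_pure_iff _ _).1 hwτ
  have hτq := hα q (τ q) (by simpa [drawOptPerm] using hτ q)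
  rw [hw']
  beta_reduce
  rw [hτq]
  rfl

end Relabel

/-! ### Accuracy of the mean parameter estimates -/

section MeanEst

variable {ι κ : Type} [Fintype ι] [DecidableEq ι] [Fintype κ] [DecidableEq κ] {K L : ℕ}

/-- The number of edges between the rows labeled `k` and the columns labeled `l`. -/
def edgeCount (B : Matrix ι κ Bool) (y : ι → Fin K) (z : κ → Fin L) (k : Fin K) (l : Fin L) : ℝ :=
  ∑ i, ∑ j, if B i j = true ∧ y i = k ∧ z j = l then (1 : ℝ) else 0

theorem meanEst_eq (B : Matrix ι κ Bool) (y : ι → Fin K) (z : κ → Fin L) (k : Fin K)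
    (l : Fin L) : meanEst B y z k l = edgeCount B y z k l / clusterSize y k := rfl

/-- The mean of `edgeCount` for labels `y'`, `z'` when the true labels are `y`, `z`. -/
def edgeMean (P : Matrix (Fin K) (Fin L) ℝ) (y y' : ι → Fin K) (z z' : κ → Fin L) (k : Fin K)
    (l : Fin L) : ℝ :=
  ∑ i, ∑ j, if y' i = k ∧ z' j = l then P (y i) (z j) else 0

/-- Few label errors bias the numerator of a mean parameter estimate only slightly. -/
theorem abs_edgeMean_sub_le {P : Matrix (Fin K) (Fin L) ℝ} {y y' : ι → Fin K} {z z' : κ → Fin L}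
    {pm Xb : ℝ} (hP0 : ∀ k l, 0 ≤ P k l) (hpm : ∀ k l, P k l ≤ pm)
    (hXb : ∀ k l, blockMean P z k l ≤ Xb) (k : Fin K) (l : Fin L) :
    |edgeMean P y y' z z' k l - clusterSize y' k * blockMean P z k l|
      ≤ clusterSize y' k * (pm * (Finset.univ.filter fun j => z' j ≠ z j).card)
        + (Finset.univ.filter fun i => y' i ≠ y i).card * Xb := by
  have hM0 : ∀ k l, 0 ≤ blockMean P z k l := fun k l => mul_nonneg (hP0 k l) (Nat.cast_nonneg _)
  set Ec := Finset.univ.filter fun j => z' j ≠ z j with hEc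
  set S := Finset.univ.filter fun i => y' i = k with hS
  have h1 : edgeMean P y y' z z' k l
      = ∑ i ∈ S, ∑ j, if z' j = l then P (y i) (z j) else 0 := by
    rw [edgeMean, hS, Finset.sum_filter]
    refine Finset.sum_congr rfl fun i _ => ?_
    by_cases h : y' i = k <;> simp [h]
  have h2 : (clusterSize y' k : ℝ) * blockMean P z k l = ∑ i ∈ S, blockMean P z k l := by
    rw [Finset.sum_const, nsmul_eq_mul]
    rfl
  -- only columns with a wrong label change the mean of a row
  have h3 : ∀ i, |(∑ j, if z' j = l then P (y i) (z j) else 0) - blockMean P z (y i) l|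
      ≤ pm * Ec.card := by
    intro i
    have h4 : blockMean P z (y i) l = ∑ j, if z j = l then P (y i) (z j) else 0 := by
      rw [sum_comp_eq_sum_clusterSize z fun l' => if l' = l then P (y i) l' else 0]
      simp [blockMean, mul_comm]
    rw [h4, ← Finset.sum_sub_distrib]
    refine (Finset.abs_sum_le_sum_abs _ _).trans ?_
    calc ∑ j, |(if z' j = l then P (y i) (z j) else 0) - if z j = l then P (y i) (z j) else 0|
        ≤ ∑ j, if z' j ≠ z j then pm else 0 := by
          refine Finset.sum_le_sum fun j _ => ?_
          have e1 := hP0 (y i) (z j)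
          have e2 := hpm (y i) (z j)
          by_cases h5 : z' j = z j
          · simp [h5]
          · rw [if_pos h5]
            split_ifs <;> rw [abs_le] <;> constructor <;> linarith
      _ = pm * Ec.card := by
          rw [← Finset.sum_filter, Finset.sum_const, nsmul_eq_mul, mul_comm]
  -- a row with a wrong label has the mean of another cluster, at most `Xb` away
  have h6 : ∀ i ∈ S, |(∑ j, if z' j = l then P (y i) (z j) else 0) - blockMean P z k l|
      ≤ pm * Ec.card + if y' i ≠ y i then Xb else 0 := by
    intro i hi
    have hik : y' i = k := (Finset.mem_filter.1 hi).2
    have h7 : |blockMean P z (y i) l - blockMean P z k l| ≤ if y' i ≠ y i then Xb else 0 := by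
      by_cases h8 : y' i = y i
      · rw [← h8, hik]
        simp
      · rw [if_pos h8, abs_le]
        constructor <;> linarith [hM0 (y i) l, hM0 k l, hXb (y i) l, hXb k l]
    calc _ = |((∑ j, if z' j = l then P (y i) (z j) else 0) - blockMean P z (y i) l)
          + (blockMean P z (y i) l - blockMean P z k l)| := by ring_nf
      _ ≤ _ := (abs_add_le _ _).trans (add_le_add (h3 i) h7)
  rw [h1, h2, ← Finset.sum_sub_distrib]
  refine (Finset.abs_sum_le_sum_abs _ _).trans ((Finset.sum_le_sum h6).trans ?_)
  rw [Finset.sum_add_distrib, Finset.sum_const, nsmul_eq_mul]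
  refine add_le_add (le_of_eq rfl) ?_
  by_cases hXb0 : 0 ≤ Xb
  · rw [← Finset.sum_filter, Finset.sum_const, nsmul_eq_mul]
    refine mul_le_mul_of_nonneg_right ?_ hXb0
    exact_mod_cast Finset.card_le_card (Finset.filter_subset_filter _ (Finset.subset_univ _))
  · exact absurd ((hM0 k l).trans (hXb k l)) hXb0

theorem edgeCount_toMat (x : ι × κ → Bool) (y' : ι → Fin K) (z' : κ → Fin L) (k : Fin K)
    (l : Fin L) : edgeCount (toMat x) y' z' k l
      = lin (fun t : ι × κ => if y' t.1 = k ∧ z' t.2 = l then (1 : ℝ) else 0) x := by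
  rw [edgeCount, lin, Fintype.sum_prod_type]
  refine Finset.sum_congr rfl fun i _ => Finset.sum_congr rfl fun j _ => ?_
  simp only [toMat, Matrix.of_apply]
  by_cases h : x (i, j) = true <;> simp [h]

/-- The mean parameter estimate of a block from preliminary labels is accurate. -/
theorem PB_meanEst_le {P : Matrix (Fin K) (Fin L) ℝ} {y y' : ι → Fin K} {z z' : κ → Fin L}
    (hP : ∀ k l, P k l ∈ Set.Icc (0 : ℝ) 1) {k : Fin K} {l : Fin L} {μ b η δ : ℝ} (hμ : 0 < μ)
    (hη0 : 0 < η) (hη : η ≤ 1) (hb : b ≤ 1) (hδ : b + η ≤ δ) (hn : 0 < clusterSize y' k)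
    (hm : |edgeMean P y y' z z' k l - clusterSize y' k * μ| ≤ b * (clusterSize y' k * μ)) :
    PB (fun t : ι × κ => P (y t.1) (z t.2))
      (fun x => ¬ |meanEst (toMat x) y' z' k l - μ| ≤ δ * μ)
      ≤ 2 * Real.exp (-(η ^ 2 * (clusterSize y' k * μ) / 8)) := by
  have hn' : (0 : ℝ) < clusterSize y' k := by exact_mod_cast hn
  set n : ℝ := (clusterSize y' k : ℝ) with hnd
  set a : ι × κ → ℝ := fun t => if y' t.1 = k ∧ z' t.2 = l then (1 : ℝ) else 0 with ha
  have hmean : ∑ t : ι × κ, P (y t.1) (z t.2) * a t = edgeMean P y y' z z' k l := by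
    rw [Fintype.sum_prod_type, edgeMean]
    simp only [ha, mul_ite, mul_one, mul_zero]
  have hnμ : 0 < n * μ := by positivity
  have hm' := abs_le.1 hm
  have h := PB_abs_lin_sub_le (p := fun t : ι × κ => P (y t.1) (z t.2)) (fun t => hP _ _) a
    (W := 1) (ν := 2 * (n * μ)) (x := η * (n * μ)) one_pos (by positivity)
    (fun t => by simp only [ha]; split_ifs <;> norm_num)
    (fun t => by simp only [ha]; split_ifs <;> norm_num)
    (by rw [hmean]; nlinarith [hm'.2]) (by positivity) (by nlinarith)
  rw [hmean] at h
  refine le_trans (PB_mono (fun t => hP _ _) fun x hx => ?_) (h.trans (le_of_eq ?_))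
  · by_contra hc
    push Not at hc
    apply hx
    rw [meanEst_eq, edgeCount_toMat]
    have h1 : lin a x / n - μ = (lin a x - n * μ) / n := by field_simp
    rw [h1, abs_div, abs_of_pos hn', div_le_iff₀ hn']
    calc |lin a x - n * μ| = |(lin a x - edgeMean P y y' z z' k l)
          + (edgeMean P y y' z z' k l - n * μ)| := by ring_nf
      _ ≤ η * (n * μ) + b * (n * μ) := (abs_add_le _ _).trans (add_le_add hc.le hm)
      _ = (b + η) * (n * μ) := by ring
      _ ≤ δ * (n * μ) := by gcongr
      _ = δ * μ * n := by ring
  · congr 2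
    field_simp
    ring

/-- The sum of the mean parameter estimates of several blocks from the true labels is accurate. -/
theorem PB_sum_meanEst_le {T : Type} [Fintype T] [DecidableEq T]
    {P : Matrix (Fin K) (Fin L) ℝ} {y : T → ι → Fin K} {z : T → κ → Fin L}
    (hP : ∀ k l, P k l ∈ Set.Icc (0 : ℝ) 1) {k : Fin K} {l : Fin L} {μ W δ : ℝ} (hμ : 0 < μ)
    (hW : 0 < W) (hn : ∀ q, 0 < clusterSize (y q) k) (hnW : ∀ q, 1 / (clusterSize (y q) k : ℝ) ≤ W)
    (hm : ∑ q, P k l * (clusterSize (z q) l : ℝ) = μ) (hδ0 : 0 ≤ δ) (hδ : δ ≤ 2) :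
    PB (fun t : T × ι × κ => P (y t.1 t.2.1) (z t.1 t.2.2))
      (fun x => ¬ |∑ q, meanEst (toMat fun t => x (q, t)) (y q) (z q) k l - μ| ≤ δ * μ)
      ≤ 2 * Real.exp (-(δ ^ 2 * μ / (4 * W))) := by
  have hn' : ∀ q, (0 : ℝ) < clusterSize (y q) k := fun q => by exact_mod_cast hn q
  set a : T × ι × κ → ℝ := fun t => if y t.1 t.2.1 = k ∧ z t.1 t.2.2 = l then
    1 / (clusterSize (y t.1) k : ℝ) else 0 with ha
  have hmean : ∑ t : T × ι × κ, P (y t.1 t.2.1) (z t.1 t.2.2) * a t = μ := by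
    rw [← hm, Fintype.sum_prod_type]
    refine Finset.sum_congr rfl fun q _ => ?_
    rw [Fintype.sum_prod_type]
    simp only [ha]
    have h1 : ∀ i, ∑ j, P (y q i) (z q j) * (if y q i = k ∧ z q j = l then
        1 / (clusterSize (y q) k : ℝ) else 0)
        = if y q i = k then (clusterSize (z q) l : ℝ) * (P k l / clusterSize (y q) k) else 0 := by
      intro i
      rw [sum_comp_eq_sum_clusterSize (z q) fun l' => P (y q i) l' *
        (if y q i = k ∧ l' = l then 1 / (clusterSize (y q) k : ℝ) else 0)]
      by_cases hi : y q i = k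
      · simp [hi, div_eq_mul_inv]
      · simp [hi]
    simp only [h1]
    rw [← Finset.sum_filter, Finset.sum_const, nsmul_eq_mul]
    change (clusterSize (y q) k : ℝ) * _ = _
    have := (hn' q).ne'
    field_simp
  have hsum : ∀ x : T × ι × κ → Bool,
      ∑ q, meanEst (toMat fun t => x (q, t)) (y q) (z q) k l = lin a x := by
    intro x
    rw [lin, Fintype.sum_prod_type]
    refine Finset.sum_congr rfl fun q _ => ?_
    rw [meanEst_eq, edgeCount_toMat, lin, Finset.sum_div]
    refine Finset.sum_congr rfl fun t _ => ?_
    simp only [ha]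
    split_ifs <;> simp
  have h := PB_abs_lin_sub_le (p := fun t : T × ι × κ => P (y t.1 t.2.1) (z t.1 t.2.2))
    (fun t => hP _ _) a (W := W) (ν := μ) (x := δ * μ) hW hμ
    (fun t => by
      simp only [ha]
      split_ifs
      · exact (div_pos one_pos (hn' _)).le
      · exact le_rfl)
    (fun t => by
      simp only [ha]
      split_ifs
      · exact hnW _
      · exact hW.le)
    hmean.le (by positivity) (by nlinarith)
  rw [hmean] at h
  refine le_trans (PB_mono (fun t => hP _ _) fun x hx => ?_) (h.trans (le_of_eq ?_))
  · rw [hsum] at hx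
    exact (not_le.1 hx).le
  · congr 2
    field_simp

/-- The number of edges of row `i`. -/
def rowDeg (B : Matrix ι κ Bool) (i : ι) : ℝ := ∑ j, if B i j = true then (1 : ℝ) else 0

theorem rowDeg_nonneg (B : Matrix ι κ Bool) (i : ι) : 0 ≤ rowDeg B i :=
  Finset.sum_nonneg fun j _ => by split_ifs <;> norm_num

theorem abs_edgeCount_sub_le {B : Matrix ι κ Bool} {y y' : ι → Fin K} {z z' : κ → Fin L}
    {σ : Equiv.Perm (Fin K)} {ρ : Equiv.Perm (Fin L)} {Dr : Finset ι} {Dc : Finset κ}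
    (hy : ∀ i ∉ Dr, y' i = σ (y i)) (hz : ∀ j ∉ Dc, z' j = ρ (z j)) (k : Fin K) (l : Fin L) :
    |edgeCount B y' z' (σ k) (ρ l) - edgeCount B y z k l|
      ≤ ∑ i ∈ Dr, rowDeg B i + ∑ j ∈ Dc, rowDeg B.transpose j := by
  have h1 : ∑ i ∈ Dr, rowDeg B i + ∑ j ∈ Dc, rowDeg B.transpose j
      = ∑ i, ∑ j, ((if i ∈ Dr then (if B i j = true then (1 : ℝ) else 0) else 0)
        + (if j ∈ Dc then (if B i j = true then (1 : ℝ) else 0) else 0)) := by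
    simp only [Finset.sum_add_distrib]
    congr 1
    · rw [← Finset.sum_filter_add_sum_filter_not Finset.univ (fun i => i ∈ Dr)]
      rw [Finset.filter_mem_eq_inter, Finset.univ_inter, Finset.sum_eq_zero (s := Finset.filter _ _),
        add_zero]
      · refine Finset.sum_congr rfl fun i hi => ?_
        simp [hi, rowDeg]
      · intro i hi
        simp [(Finset.mem_filter.1 hi).2]
    · rw [Finset.sum_comm, ← Finset.sum_filter_add_sum_filter_not Finset.univ (fun j => j ∈ Dc)]
      rw [Finset.filter_mem_eq_inter, Finset.univ_inter, Finset.sum_eq_zero (s := Finset.filter _ _),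
        add_zero]
      · refine Finset.sum_congr rfl fun i hi => ?_
        simp only [hi, if_true, rowDeg, Matrix.transpose_apply]
        rfl
      · intro i hi
        simp [(Finset.mem_filter.1 hi).2]
  rw [h1, edgeCount, edgeCount, ← Finset.sum_sub_distrib]
  refine (Finset.abs_sum_le_sum_abs _ _).trans (Finset.sum_le_sum fun i _ => ?_)
  rw [← Finset.sum_sub_distrib]
  refine (Finset.abs_sum_le_sum_abs _ _).trans (Finset.sum_le_sum fun j _ => ?_)
  have hab : ∀ p q : Prop, ∀ [Decidable p] [Decidable q],
      |(if p then (1 : ℝ) else 0) - if q then 1 else 0| ≤ 1 := by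
    intro p q _ _
    split_ifs <;> norm_num
  by_cases hB : B i j = true
  · by_cases hi : i ∈ Dr
    · refine (hab _ _).trans ?_
      simp only [hB, hi, if_true]
      split_ifs <;> norm_num
    · by_cases hj : j ∈ Dc
      · refine (hab _ _).trans ?_
        simp [hB, hj, hi]
      · rw [hy i hi, hz j hj]
        simp [hi, hj]
  · simp [hB]

/-- The effect of a few label errors on a mean parameter estimate. -/
theorem abs_meanEst_sub_le {B : Matrix ι κ Bool} {y y' : ι → Fin K} {z z' : κ → Fin L}
    {σ : Equiv.Perm (Fin K)} {ρ : Equiv.Perm (Fin L)} {Dr : Finset ι} {Dc : Finset κ}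
    (hy : ∀ i ∉ Dr, y' i = σ (y i)) (hz : ∀ j ∉ Dc, z' j = ρ (z j)) (k : Fin K) (l : Fin L)
    {E d : ℝ} (hE : ∑ i ∈ Dr, rowDeg B i + ∑ j ∈ Dc, rowDeg B.transpose j ≤ E)
    (hn : 0 < clusterSize y k) (hd : (Dr.card : ℝ) ≤ d) (hdn : 2 * d ≤ clusterSize y k) :
    |meanEst B y' z' (σ k) (ρ l) - meanEst B y z k l|
      ≤ 2 * E / clusterSize y k + 2 * d / clusterSize y k * meanEst B y z k l := by
  have hn0 : (0 : ℝ) < clusterSize y k := by exact_mod_cast hn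
  have hc1 : clusterSize y k ≤ clusterSize y' (σ k) + Dr.card := by
    refine (Finset.card_le_card fun i hi => ?_).trans (Finset.card_union_le _ _)
    by_cases hiS : i ∈ Dr
    · exact Finset.mem_union_right _ hiS
    · refine Finset.mem_union_left _ (Finset.mem_filter.2 ⟨Finset.mem_univ _, ?_⟩)
      rw [hy i hiS, (Finset.mem_filter.1 hi).2]
  have hc2 : clusterSize y' (σ k) ≤ clusterSize y k + Dr.card := by
    refine (Finset.card_le_card fun i hi => ?_).trans (Finset.card_union_le _ _)
    by_cases hiS : i ∈ Dr
    · exact Finset.mem_union_right _ hiS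
    · refine Finset.mem_union_left _ (Finset.mem_filter.2 ⟨Finset.mem_univ _, ?_⟩)
      have h1 := (Finset.mem_filter.1 hi).2
      rw [hy i hiS] at h1
      exact σ.injective h1
  have hN := abs_edgeCount_sub_le (B := B) hy hz k l
  have hN0 : 0 ≤ edgeCount B y z k l :=
    Finset.sum_nonneg fun i _ => Finset.sum_nonneg fun j _ => by split_ifs <;> norm_num
  rw [meanEst_eq, meanEst_eq]
  have hc1' : (clusterSize y k : ℝ) ≤ clusterSize y' (σ k) + Dr.card := by exact_mod_cast hc1
  have hc2' : (clusterSize y' (σ k) : ℝ) ≤ clusterSize y k + Dr.card := by exact_mod_cast hc2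
  set n : ℝ := (clusterSize y k : ℝ)
  set n' : ℝ := (clusterSize y' (σ k) : ℝ)
  set N : ℝ := edgeCount B y z k l
  set N' : ℝ := edgeCount B y' z' (σ k) (ρ l)
  have hn'2 : n / 2 ≤ n' := by linarith
  have hn'0 : 0 < n' := by linarith
  have h1 : N' / n' - N / n = (N' - N) / n' + (n - n') / n' * (N / n) := by
    field_simp
    ring
  have hE0 : |N' - N| ≤ E := hN.trans hE
  have hE00 : 0 ≤ E := (abs_nonneg _).trans hE0
  have hd0 : 0 ≤ d := (Nat.cast_nonneg _).trans hd
  have hnn : |n - n'| ≤ d := by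
    rw [abs_le]
    constructor <;> linarith
  rw [h1]
  refine (abs_add_le _ _).trans (add_le_add ?_ ?_)
  · rw [abs_div, abs_of_pos hn'0, div_le_div_iff₀ hn'0 hn0]
    nlinarith
  · have h2 : 0 ≤ N / n := by positivity
    rw [abs_mul, abs_of_nonneg h2]
    refine mul_le_mul_of_nonneg_right ?_ h2
    rw [abs_div, abs_of_pos hn'0, div_le_div_iff₀ hn'0 hn0]
    nlinarith

end MeanEst

/-! ### One pass on a favourable outcome -/

section Blocks

variable {ι κ : Type} [Fintype ι] [DecidableEq ι] [Fintype κ] [DecidableEq κ] {K L Q h w : ℕ}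

/-- The indices at which two labelings differ. -/
def errSet (y' y : ι → Fin K) : Finset ι := Finset.univ.filter fun i => y' i ≠ y i

theorem mem_errSet {y' y : ι → Fin K} {i : ι} : i ∈ errSet y' y ↔ y' i ≠ y i := by simp [errSet]

open scoped Classical in
/-- The rows of the block `B` that the likelihood ratio rule may misclassify when it uses the
column labels `z'`; the true labels are `y` and `z`. -/
def badSet (P : Matrix (Fin K) (Fin L) ℝ) (y : ι → Fin K) (z z' : κ → Fin L) (δ R : ℝ)
    (B : Matrix ι κ Bool) : Finset ι :=
  Finset.univ.filter fun i => badRow P z (errSet z' z) δ R (y i) (B i)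

theorem meanEst_relabel (B : Matrix ι κ Bool) (y : ι → Fin K) (z : κ → Fin L)
    (σ : Equiv.Perm (Fin K)) (ρ : Equiv.Perm (Fin L)) (k : Fin K) (l : Fin L) :
    meanEst B (fun i => σ (y i)) (fun j => ρ (z j)) (σ k) (ρ l) = meanEst B y z k l := by
  simp [meanEst, clusterSize]

theorem mem_support_LR [NeZero K] {A : Matrix ι κ Bool} {Lam : Matrix (Fin K) (Fin L) ℝ}
    {z : κ → Fin L} {y : ι → Fin K} (hy : y ∈ (LR A Lam z).support) (i : ι) :
    y i ∈ lrArgmax A Lam z i := by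
  rw [LR, mem_support_piPMF] at hy
  simpa using hy i

/-- Outside the bad set, the first likelihood ratio classification is correct, up to the
relabeling of the preliminary labels. -/
theorem eq_of_mem_support_LR_meanEst [NeZero K] {B : Matrix ι κ Bool}
    {P : Matrix (Fin K) (Fin L) ℝ} {y y' : ι → Fin K} {z z' : κ → Fin L}
    {σ : Equiv.Perm (Fin K)} {ρ : Equiv.Perm (Fin L)} {δ R : ℝ} (hδ : δ ≤ 1 / 2)
    (hP : ∀ k l, 0 < P k l) (hn : ∀ l, 0 < clusterSize z l) (hR : ∀ k r l, P r l ≤ R * P k l)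
    (hLam : ∀ k l, |meanEst B y' z' k l - blockMean P z k l| ≤ δ * blockMean P z k l)
    {x : ι → Fin K}
    (hx : x ∈ (LR B (meanEst B (fun i => σ (y' i)) fun j => ρ (z' j)) fun j => ρ (z' j)).support)
    {i : ι} (hi : i ∉ badSet P y z z' δ R B) : x i = σ (y i) := by
  refine eq_of_mem_lrArgmax (ρ := ρ) (D := errSet z' z) hδ hP hn hR (fun k l => ?_) (fun j hj => ?_) ?_
    (mem_support_LR hx i)
  · rw [meanEst_relabel]
    exact hLam k l
  · rw [mem_errSet, not_not] at hj
    rw [hj]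
  · simpa [badSet] using hi

/-- The labels of the blocks of a partition. -/
def blockLabels {α β γ ℓ : Type} (y : α → ℓ) (e : α ≃ β × γ) (q : β) (i : γ) : ℓ := y (e.symm (q, i))

/-- The blocks of a matrix. -/
def block (A : Matrix (Fin (Q * h)) (Fin (Q * w)) Bool) (e : Fin (Q * h) ≃ Fin Q × Fin h)
    (f : Fin (Q * w) ≃ Fin Q × Fin w) (q q' : Fin Q) : Matrix (Fin h) (Fin w) Bool :=
  fun i j => A (e.symm (q, i)) (f.symm (q', j))

/-- A relabeling that matches labels of two adjacent blocks best with the truth. -/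
def bestPerm {N : ℕ} (x : ι ⊕ ι → Fin N) (y y' : ι → Fin N) : Equiv.Perm (Fin N) :=
  (optPerms_nonempty x (Sum.elim y y')).choose

theorem bestPerm_mem {N : ℕ} (x : ι ⊕ ι → Fin N) (y y' : ι → Fin N) :
    bestPerm x y y' ∈ optPerms x (Sum.elim y y') := (optPerms_nonempty x (Sum.elim y y')).choose_spec

/-- The relabeling attached to the call that labels the row blocks `q` and `q + 1`. -/
def rowPerm [NeZero Q] (yb : Fin Q → Fin h → Fin K) (u : Fin Q → Fin h ⊕ Fin h → Fin K) (q : Fin Q) :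
    Equiv.Perm (Fin K) := bestPerm (u (q + 1)) (yb q) (yb (q + 1))

/-- The relabeling attached to the call that labels the column blocks `q` and `q + 1`. -/
def colPerm [NeZero Q] (zb : Fin Q → Fin w → Fin L) (v : Fin Q → Fin w ⊕ Fin w → Fin L) (q : Fin Q) :
    Equiv.Perm (Fin L) := bestPerm (v q) (zb q) (zb (q + 1))

/-- The initial row labels, relabeled so as to agree with the truth. -/
def rowCanon [NeZero Q] (yb : Fin Q → Fin h → Fin K) (u : Fin Q → Fin h ⊕ Fin h → Fin K)
    (q : Fin Q) (i : Fin h) : Fin K := rowPerm yb u q (u (q + 1) (Sum.inl i))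

/-- The initial column labels, relabeled so as to agree with the truth. -/
def colCanon [NeZero Q] (zb : Fin Q → Fin w → Fin L) (v : Fin Q → Fin w ⊕ Fin w → Fin L)
    (q : Fin Q) (j : Fin w) : Fin L := colPerm zb v q (v q (Sum.inl j))

/-- The rows of the block `q` that the first likelihood ratio classification may misclassify. -/
def rowBad [NeZero Q] (P : Matrix (Fin K) (Fin L) ℝ) (δ R : ℝ) (yb : Fin Q → Fin h → Fin K)
    (zb zc : Fin Q → Fin w → Fin L) (B : Fin Q → Fin Q → Matrix (Fin h) (Fin w) Bool) (q : Fin Q) :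
    Finset (Fin h) := badSet P (yb q) (zb (q + 2)) (zc (q + 2)) δ R (B q (q + 2))

/-- The columns of the block `q` that the first likelihood ratio classification may misclassify. -/
def colBad [NeZero Q] (P : Matrix (Fin K) (Fin L) ℝ) (δ R : ℝ) (yb yc : Fin Q → Fin h → Fin K)
    (zb : Fin Q → Fin w → Fin L) (B : Fin Q → Fin Q → Matrix (Fin h) (Fin w) Bool) (q : Fin Q) :
    Finset (Fin w) :=
  badSet P.transpose (zb q) (yb (q - 2)) (yc (q - 2)) δ R (B (q - 2) q).transpose

/-- The columns misclassified by the first likelihood ratio classification, among all columns. -/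
def colBadAll [NeZero Q] (P : Matrix (Fin K) (Fin L) ℝ) (δ R : ℝ) (yb yc : Fin Q → Fin h → Fin K)
    (zb : Fin Q → Fin w → Fin L) (B : Fin Q → Fin Q → Matrix (Fin h) (Fin w) Bool)
    (f : Fin (Q * w) ≃ Fin Q × Fin w) : Finset (Fin (Q * w)) :=
  Finset.univ.filter fun j => (f j).2 ∈ colBad P δ R yb yc zb B (f j).1

/-- Weight of a set of misclassified rows: its size, and the number of edges it contributes to the
block `B` (both relative to `h`). -/
def badWeight (D : Finset ι) (B : Matrix ι κ Bool) (a b : ℝ) : ℝ := ∑ i ∈ D, (1 / a + rowDeg B i / b)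

/-- The favourable outcomes of a pass: the preliminary mean parameter estimates are accurate, few
rows and columns are misclassified by the first likelihood ratio classification, and the global
mean parameter estimate from the true labels is accurate. -/
structure GoodPass [NeZero Q] (P Lam : Matrix (Fin K) (Fin L) ℝ) (δ₁ δ₂ δ' R θ : ℝ)
    (yb yc : Fin Q → Fin h → Fin K) (zb zc : Fin Q → Fin w → Fin L)
    (B : Fin Q → Fin Q → Matrix (Fin h) (Fin w) Bool) : Prop where
  rowMean : ∀ q k l, |meanEst (B q (q + 2)) (yc q) (zc (q + 2)) k l - blockMean P (zb (q + 2)) k l|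
    ≤ δ₁ * blockMean P (zb (q + 2)) k l
  colMean : ∀ q l k, |meanEst (B (q - 2) q).transpose (zc q) (yc (q - 2)) l k
    - blockMean P.transpose (yb (q - 2)) l k| ≤ δ₂ * blockMean P.transpose (yb (q - 2)) l k
  rowWeight : ∀ q, badWeight (rowBad P δ₁ R yb zb zc B q) (B q (q + 3)) h h ≤ θ
  colWeight : ∀ q, badWeight (colBad P δ₂ R yb yc zb B q) (B (q - 3) q).transpose w h ≤ θ
  allMean : ∀ k l, |∑ q, meanEst (B q (q + 3)) (yb q) (zb (q + 3)) k l - Lam k l| ≤ δ' * Lam k l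

theorem card_le_of_badWeight_le {D : Finset ι} {B : Matrix ι κ Bool} {a b θ : ℝ} (ha : 0 < a)
    (hb : 0 < b) (h : badWeight D B a b ≤ θ) : (D.card : ℝ) ≤ θ * a := by
  have h1 : ∑ i ∈ D, 1 / a ≤ badWeight D B a b :=
    Finset.sum_le_sum fun i _ => le_add_of_nonneg_right (div_nonneg (rowDeg_nonneg _ _) hb.le)
  rw [Finset.sum_const, nsmul_eq_mul, mul_one_div] at h1
  rw [← div_le_iff₀ ha]
  exact h1.trans h

/-- The weight controls the number of edges in the rows of `D`. -/
theorem sum_rowDeg_le_of_badWeight_le {D : Finset ι} {B : Matrix ι κ Bool} {a b θ : ℝ} (ha : 0 < a)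
    (hb : 0 < b) (h : badWeight D B a b ≤ θ) : ∑ i ∈ D, rowDeg B i ≤ θ * b := by
  have h1 : ∑ i ∈ D, rowDeg B i / b ≤ badWeight D B a b :=
    Finset.sum_le_sum fun i _ => le_add_of_nonneg_left (div_nonneg zero_le_one ha.le)
  rw [← Finset.sum_div] at h1
  rw [← div_le_iff₀ hb]
  exact h1.trans h

/-- The global mean parameter estimate from the labels of the first likelihood ratio
classification is accurate. -/
theorem abs_sum_meanEst_sub_le [NeZero Q] {P Lam : Matrix (Fin K) (Fin L) ℝ} {δ₁ δ₂ δ' R θ ν : ℝ}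
    {yb yc y₂ : Fin Q → Fin h → Fin K} {zb zc z₂ : Fin Q → Fin w → Fin L}
    {B : Fin Q → Fin Q → Matrix (Fin h) (Fin w) Bool} (hh : 0 < h) (hw : 0 < w) (hθ0 : 0 ≤ θ)
    (hν : 0 < ν) (hG : GoodPass P Lam δ₁ δ₂ δ' R θ yb yc zb zc B)
    (hsz : ∀ q k, ν ≤ clusterSize (yb q) k) (hLam0 : ∀ k l, 0 ≤ Lam k l) (hδ' : δ' ≤ 1)
    (hνθ : 2 * (θ * h) ≤ ν)
    (hfin : ∀ k l, Q * (4 * (θ * h) / ν) + 2 * (θ * h) / ν * (2 * Lam k l) ≤ δ' * Lam k l)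
    {σ : Equiv.Perm (Fin K)} {ρ : Equiv.Perm (Fin L)}
    (hy : ∀ q, ∀ i ∉ rowBad P δ₁ R yb zb zc B q, y₂ q i = σ (yb q i))
    (hz : ∀ q, ∀ j ∉ colBad P δ₂ R yb yc zb B q, z₂ q j = ρ (zb q j)) (k : Fin K) (l : Fin L) :
    |(∑ q, meanEst (B q (q + 3)) (y₂ q) (z₂ (q + 3))) (σ k) (ρ l) - Lam k l|
      ≤ 2 * δ' * Lam k l := by
  have hh' : (0 : ℝ) < h := by exact_mod_cast hh
  have hw' : (0 : ℝ) < w := by exact_mod_cast hw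
  set T : ℝ := ∑ q, meanEst (B q (q + 3)) (yb q) (zb (q + 3)) k l with hT
  have hTL := abs_le.1 (hG.allMean k l)
  have hmul : δ' * Lam k l ≤ 1 * Lam k l := mul_le_mul_of_nonneg_right hδ' (hLam0 k l)
  have hT2 : T ≤ 2 * Lam k l := by linarith [hTL.2]
  have h1 : ∀ q, |meanEst (B q (q + 3)) (y₂ q) (z₂ (q + 3)) (σ k) (ρ l)
      - meanEst (B q (q + 3)) (yb q) (zb (q + 3)) k l|
      ≤ 4 * (θ * h) / ν + 2 * (θ * h) / ν * meanEst (B q (q + 3)) (yb q) (zb (q + 3)) k l := by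
    intro q
    have hs := hsz q k
    have hspos : (0 : ℝ) < clusterSize (yb q) k := hν.trans_le hs
    have hm0 : 0 ≤ meanEst (B q (q + 3)) (yb q) (zb (q + 3)) k l :=
      div_nonneg (Finset.sum_nonneg fun i _ => Finset.sum_nonneg fun j _ => by
        split_ifs <;> norm_num) (Nat.cast_nonneg _)
    have hc := hG.colWeight (q + 3)
    rw [add_sub_cancel_right] at hc
    refine (abs_meanEst_sub_le (σ := σ) (ρ := ρ) (hy q) (hz (q + 3)) k l (E := 2 * (θ * h))
      (d := θ * h) ?_ (by exact_mod_cast hspos)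
      (card_le_of_badWeight_le hh' hh' (hG.rowWeight q)) (hνθ.trans hs)).trans ?_
    · have := sum_rowDeg_le_of_badWeight_le hh' hh' (hG.rowWeight q)
      have := sum_rowDeg_le_of_badWeight_le hw' hh' hc
      linarith
    · have h2 : 2 * (2 * (θ * h)) / (clusterSize (yb q) k : ℝ) ≤ 4 * (θ * h) / ν := by
        rw [show 2 * (2 * (θ * (h : ℝ))) = 4 * (θ * h) by ring]
        gcongr
      have h3 : 2 * (θ * h) / (clusterSize (yb q) k : ℝ) ≤ 2 * (θ * h) / ν := by gcongr
      exact add_le_add h2 (mul_le_mul_of_nonneg_right h3 hm0)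
  have h2 : |(∑ q, meanEst (B q (q + 3)) (y₂ q) (z₂ (q + 3))) (σ k) (ρ l) - T|
      ≤ Q * (4 * (θ * h) / ν) + 2 * (θ * h) / ν * T := by
    rw [hT, Matrix.sum_apply, ← Finset.sum_sub_distrib]
    refine (Finset.abs_sum_le_sum_abs _ _).trans ((Finset.sum_le_sum fun q _ => h1 q).trans ?_)
    rw [Finset.sum_add_distrib, ← Finset.mul_sum, Finset.sum_const, nsmul_eq_mul,
      Finset.card_univ, Fintype.card_fin]
  have h4 : 2 * (θ * h) / ν * T ≤ 2 * (θ * h) / ν * (2 * Lam k l) := by gcongr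
  calc _ = |((∑ q, meanEst (B q (q + 3)) (y₂ q) (z₂ (q + 3))) (σ k) (ρ l) - T)
        + (T - Lam k l)| := by ring_nf
    _ ≤ _ := (abs_add_le _ _).trans (add_le_add h2 (hG.allMean k l))
    _ ≤ _ := by linarith [hfin k l]

/-- The labels that a pass outputs, when the labels of all blocks are consistent. -/
theorem exists_perm_of_mem_support_pass [NeZero K] [NeZero L] [NeZero Q] {S : Initializer K L h w}
    {rowMatch : (Fin (Q * h) ≃ Fin Q × Fin h) → (Fin Q → Fin h → Fin K) →
      (Fin Q → Fin h → Fin K) → PMF (Fin Q → Fin h → Fin K)}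
    {Asub Atar : Matrix (Fin (Q * h)) (Fin (Q * w)) Bool} {P Lam : Matrix (Fin K) (Fin L) ℝ}
    {z : Fin (Q * w) → Fin L} {ysub ytar : Fin (Q * h) → Fin K} {δ₁ δ₂ δ' R θ ν : ℝ}
    {T : Pass K L Q h w} (hT : T ∈ (pass S rowMatch Asub Atar).support)
    {yb yc : Fin Q → Fin h → Fin K} {zb zc : Fin Q → Fin w → Fin L}
    {B : Fin Q → Fin Q → Matrix (Fin h) (Fin w) Bool}
    (hyb : yb = blockLabels ysub T.rowPart) (hzb : zb = blockLabels z T.colPart)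
    (hyc : yc = rowCanon yb T.rowInit) (hzc : zc = colCanon zb T.colInit)
    (hB : B = block Asub T.rowPart T.colPart)
    (hh : 0 < h) (hw : 0 < w) (hθ0 : 0 ≤ θ) (hν : 0 < ν)
    (hG : GoodPass P Lam δ₁ δ₂ δ' R θ yb yc zb zc B) (hLam : Lam = blockMean P z)
    (hsz : ∀ q k, ν ≤ clusterSize (yb q) k) (hsz' : ∀ q l, 0 < clusterSize (zb q) l)
    (hn : ∀ l, 0 < clusterSize z l) (hP : ∀ k l, 0 < P k l)
    (hR : ∀ k r l, P r l ≤ R * P k l) (hR' : ∀ k l r, P k r ≤ R * P k l)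
    (hδ₁ : δ₁ ≤ 1 / 2) (hδ₂ : δ₂ ≤ 1 / 2) (hδ' : δ' ≤ 1 / 4) (hνθ : 2 * (θ * h) ≤ ν)
    (hfin : ∀ k l, Q * (4 * (θ * h) / ν) + 2 * (θ * h) / ν * (2 * Lam k l) ≤ δ' * Lam k l)
    {C : Equiv.Perm (Fin K) → Prop}
    (hrow : ∀ y₁ ∈ (rowMatch T.rowPart (fun q i => T.rowInit (q + 1) (Sum.inl i))
      fun q i => T.rowInit q (Sum.inr i)).support, ∃ σ, C σ ∧ ∀ q i, y₁ q i = σ (yc q i))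
    (hcol : ∀ z₁ ∈ (matchChain (fun q j => T.colInit q (Sum.inl j))
      fun q j => T.colInit (q - 1) (Sum.inr j)).support, ∃ ρ : Equiv.Perm (Fin L),
        ∀ q j, z₁ q j = ρ (zc q j)) :
    ∃ σ, C σ ∧ ∀ i, ¬ badRow P z (colBadAll P δ₂ R yb yc zb B T.colPart) (2 * δ') R (ytar i)
      (Atar i) → T.out i = σ (ytar i) := by
  obtain ⟨e, -, hT⟩ := (PMF.mem_support_bind_iff _ _ _).1 hT
  obtain ⟨f, -, hT⟩ := (PMF.mem_support_bind_iff _ _ _).1 hT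
  obtain ⟨u, -, hT⟩ := (PMF.mem_support_bind_iff _ _ _).1 hT
  obtain ⟨v, -, hT⟩ := (PMF.mem_support_bind_iff _ _ _).1 hT
  obtain ⟨y₁, hy₁, hT⟩ := (PMF.mem_support_bind_iff _ _ _).1 hT
  obtain ⟨z₁, hz₁, hT⟩ := (PMF.mem_support_bind_iff _ _ _).1 hT
  obtain ⟨y₂, hy₂, hT⟩ := (PMF.mem_support_bind_iff _ _ _).1 hT
  obtain ⟨z₂, hz₂, hT⟩ := (PMF.mem_support_bind_iff _ _ _).1 hT
  obtain ⟨out, hout, hT⟩ := (PMF.mem_support_bind_iff _ _ _).1 hT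
  have hT' := (PMF.mem_support_pure_iff _ _).1 hT
  subst hT'
  dsimp only at *
  obtain ⟨σ, hCσ, hσ⟩ := hrow y₁ hy₁
  obtain ⟨ρ, hρ⟩ := hcol z₁ hz₁
  refine ⟨σ, hCσ, fun i hi => ?_⟩
  have hszp : ∀ q k, 0 < clusterSize (yb q) k := fun q k => by
    exact_mod_cast hν.trans_le (hsz q k)
  -- first classification: errors are confined to the bad rows and columns
  have hy₂' : ∀ q, ∀ i ∉ rowBad P δ₁ R yb zb zc B q, y₂ q i = σ (yb q i) := by
    intro q i hi
    have h1 := (mem_support_piPMF _ _).1 hy₂ q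
    have e1 : y₁ q = fun i => σ (yc q i) := funext fun i => hσ q i
    have e2 : z₁ (q + 2) = fun j => ρ (zc (q + 2) j) := funext fun j => hρ (q + 2) j
    rw [e1, e2] at h1
    refine eq_of_mem_support_LR_meanEst (B := B q (q + 2)) (P := P) hδ₁ hP (hsz' (q + 2)) hR
      (hG.rowMean q) (by rw [hB]; exact h1) hi
  have hz₂' : ∀ q, ∀ j ∉ colBad P δ₂ R yb yc zb B q, z₂ q j = ρ (zb q j) := by
    intro q j hj
    have h1 := (mem_support_piPMF _ _).1 hz₂ q
    have e1 : z₁ q = fun i => ρ (zc q i) := funext fun i => hρ q i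
    have e2 : y₁ (q - 2) = fun j => σ (yc (q - 2) j) := funext fun j => hσ (q - 2) j
    rw [e1, e2] at h1
    refine eq_of_mem_support_LR_meanEst (B := (B (q - 2) q).transpose) (P := P.transpose) hδ₂
      (fun k l => hP l k) (hszp (q - 2)) (fun k r l => hR' l k r)
      (hG.colMean q) (by rw [hB]; exact h1) hj
  have hLam0 : ∀ k l, 0 ≤ Lam k l := fun k l => by
    rw [hLam]
    exact mul_nonneg (hP k l).le (Nat.cast_nonneg _)
  -- second classification, from the global estimate and the column labels just obtained
  refine eq_of_mem_lrArgmax (ρ := ρ) (D := colBadAll P δ₂ R yb yc zb B f) (δ := 2 * δ') (by linarith) hP hn hR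
    (fun k l => ?_) (fun j hj => ?_) hi (mem_support_LR hout i)
  · have h1 := abs_sum_meanEst_sub_le hh hw hθ0 hν hG hsz hLam0 (by linarith) hνθ hfin hy₂' hz₂' k l
    rw [hLam, hB] at h1
    exact h1
  · simp only [colBadAll, Finset.mem_filter, Finset.mem_univ, true_and] at hj
    have := hz₂' _ _ hj
    rw [this, hzb]
    simp [blockLabels]

end Blocks

section Matching

variable {K L Q h w : ℕ} {ι : Type} [Fintype ι] [DecidableEq ι] {N : ℕ}

theorem card_errSet_inl_le {x : ι ⊕ ι → Fin N} {y y' : ι → Fin N} {c : ℝ}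
    (h : mis x (Sum.elim y y') ≤ c) :
    ((errSet (fun i => bestPerm x y y' (x (Sum.inl i))) y).card : ℝ)
      ≤ c * (2 * Fintype.card ι) := by
  have h1 := card_le_of_mis_le (bestPerm_mem x y y') h
  rw [Fintype.card_sum, Nat.cast_add, ← two_mul] at h1
  refine le_trans ?_ h1
  exact_mod_cast Finset.card_le_card_of_injOn Sum.inl
    (fun i hi => by simpa [errSet] using hi) Sum.inl_injective.injOn

theorem card_errSet_inr_le {x : ι ⊕ ι → Fin N} {y y' : ι → Fin N} {c : ℝ}
    (h : mis x (Sum.elim y y') ≤ c) :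
    ((errSet (fun i => bestPerm x y y' (x (Sum.inr i))) y').card : ℝ)
      ≤ c * (2 * Fintype.card ι) := by
  have h1 := card_le_of_mis_le (bestPerm_mem x y y') h
  rw [Fintype.card_sum, Nat.cast_add, ← two_mul] at h1
  refine le_trans ?_ h1
  exact_mod_cast Finset.card_le_card_of_injOn Sum.inr
    (fun i hi => by simpa [errSet] using hi) Sum.inr_injective.injOn

variable [NeZero Q]

theorem card_errSet_rowCanon_le {yb : Fin Q → Fin h → Fin K}
    {u : Fin Q → Fin h ⊕ Fin h → Fin K} {c : ℝ}
    (hu : ∀ q, mis (u q) (Sum.elim (yb (q - 1)) (yb q)) ≤ c) (q : Fin Q) :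
    ((errSet (rowCanon yb u q) (yb q)).card : ℝ) ≤ c * (2 * h) := by
  have h1 := hu (q + 1)
  rw [add_sub_cancel_right] at h1
  have := card_errSet_inl_le h1
  rwa [Fintype.card_fin] at this

theorem card_errSet_colCanon_le {zb : Fin Q → Fin w → Fin L}
    {v : Fin Q → Fin w ⊕ Fin w → Fin L} {c : ℝ}
    (hv : ∀ q, mis (v q) (Sum.elim (zb q) (zb (q + 1))) ≤ c) (q : Fin Q) :
    ((errSet (colCanon zb v q) (zb q)).card : ℝ) ≤ c * (2 * w) := by
  have := card_errSet_inl_le (hv q)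
  rwa [Fintype.card_fin] at this

/-- Matching along the chain makes the initial row labels of all blocks consistent. -/
theorem exists_perm_matchChain_row {yb : Fin Q → Fin h → Fin K}
    {u : Fin Q → Fin h ⊕ Fin h → Fin K} {c : ℝ}
    (hu : ∀ q, mis (u q) (Sum.elim (yb (q - 1)) (yb q)) ≤ c)
    (hsz : ∀ q k, 5 * (c * (2 * h)) < clusterSize (yb q) k) {y₁ : Fin Q → Fin h → Fin K}
    (hy : y₁ ∈ (matchChain (fun q i => u (q + 1) (Sum.inl i))
      fun q i => u q (Sum.inr i)).support) :
    ∃ σ : Equiv.Perm (Fin K), ∀ q i, y₁ q i = σ (rowCanon yb u q i) := by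
  refine exists_perm_of_mem_matchChain (rowPerm yb u) (fun q τ hτ => ?_) hy
  have h2 := hu q
  have h3 := card_errSet_inr_le h2
  rw [Fintype.card_fin] at h3
  refine eq_of_mem_optPerms (y := yb q) (S := errSet (rowCanon yb u q) (yb q))
    (S' := errSet (fun i => bestPerm (u q) (yb (q - 1)) (yb q) (u q (Sum.inr i))) (yb q))
    (fun i hi => ?_) (fun i hi => ?_) (fun k => ?_) hτ
  · simpa [mem_errSet, rowCanon] using hi
  · rw [mem_errSet, not_not] at hi
    rw [rowPerm, sub_add_cancel]
    exact hi
  · have := card_errSet_rowCanon_le hu q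
    have h4 := hsz q k
    have h5 : (3 : ℝ) * ((errSet (rowCanon yb u q) (yb q)).card : ℝ) + 2 *
      ((errSet (fun i => bestPerm (u q) (yb (q - 1)) (yb q) (u q (Sum.inr i))) (yb q)).card : ℝ)
        < clusterSize (yb q) k := by linarith
    exact_mod_cast h5

/-- Matching along the chain makes the initial column labels of all blocks consistent. -/
theorem exists_perm_matchChain_col {zb : Fin Q → Fin w → Fin L}
    {v : Fin Q → Fin w ⊕ Fin w → Fin L} {c : ℝ}
    (hv : ∀ q, mis (v q) (Sum.elim (zb q) (zb (q + 1))) ≤ c)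
    (hsz : ∀ q l, 5 * (c * (2 * w)) < clusterSize (zb q) l) {z₁ : Fin Q → Fin w → Fin L}
    (hz : z₁ ∈ (matchChain (fun q j => v q (Sum.inl j))
      fun q j => v (q - 1) (Sum.inr j)).support) :
    ∃ ρ : Equiv.Perm (Fin L), ∀ q j, z₁ q j = ρ (colCanon zb v q j) := by
  refine exists_perm_of_mem_matchChain (colPerm zb v) (fun q τ hτ => ?_) hz
  have h2 := hv (q - 1)
  rw [sub_add_cancel] at h2
  have h3 := card_errSet_inr_le h2
  rw [Fintype.card_fin] at h3
  refine eq_of_mem_optPerms (y := zb q) (S := errSet (colCanon zb v q) (zb q))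
    (S' := errSet (fun i => bestPerm (v (q - 1)) (zb (q - 1)) (zb q) (v (q - 1) (Sum.inr i))) (zb q))
    (fun i hi => ?_) (fun i hi => ?_) (fun k => ?_) hτ
  · simpa [mem_errSet, colCanon] using hi
  · rw [mem_errSet, not_not] at hi
    rw [colPerm, sub_add_cancel]
    exact hi
  · have := card_errSet_colCanon_le hv q
    have h4 := hsz q k
    have h5 : (3 : ℝ) * ((errSet (colCanon zb v q) (zb q)).card : ℝ) + 2 *
      ((errSet (fun i => bestPerm (v (q - 1)) (zb (q - 1)) (zb q) (v (q - 1) (Sum.inr i)))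
        (zb q)).card : ℝ) < clusterSize (zb q) k := by linarith
    exact_mod_cast h5

/-- Matching to mostly correct reference labels carries over their relabeling. -/
theorem eq_perm_of_matchTo {yb ref : Fin Q → Fin h → Fin K}
    {u : Fin Q → Fin h ⊕ Fin h → Fin K} {c d : ℝ} {σ : Equiv.Perm (Fin K)}
    (hu : ∀ q, mis (u q) (Sum.elim (yb (q - 1)) (yb q)) ≤ c)
    (href : ∀ q, ((errSet (ref q) fun i => σ (yb q i)).card : ℝ) ≤ d)
    (hsz : ∀ q k, 3 * d + 2 * (c * (2 * h)) < clusterSize (yb q) k) {y₁ : Fin Q → Fin h → Fin K}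
    (hy : y₁ ∈ (matchTo (fun q i => u (q + 1) (Sum.inl i)) ref).support) (q : Fin Q) (i : Fin h) :
    y₁ q i = σ (rowCanon yb u q i) := by
  refine eq_of_mem_matchTo (rowPerm yb u) σ (fun q τ hτ => ?_) hy q i
  have h1 := eq_of_mem_optPerms (y := yb q) (a := σ⁻¹) (b := rowPerm yb u q)
    (S := errSet (ref q) fun i => σ (yb q i)) (S' := errSet (rowCanon yb u q) (yb q))
    (fun i hi => ?_) (fun i hi => ?_) (fun k => ?_) hτ
  · rwa [inv_inv] at h1
  · rw [mem_errSet, not_not] at hi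
    rw [hi]
    simp
  · simpa [mem_errSet, rowCanon] using hi
  · have := card_errSet_rowCanon_le hu q
    have h4 := hsz q k
    have h5 : (3 : ℝ) * ((errSet (ref q) fun i => σ (yb q i)).card : ℝ) + 2 *
      ((errSet (rowCanon yb u q) (yb q)).card : ℝ) < clusterSize (yb q) k := by
        linarith [href q]
    exact_mod_cast h5

end Matching

/-! ### The random choices of one pass and the favourable runs -/

/-- The part of a pass that does not depend on the labels of the other pass: the partitions and
the initial labels. -/
structure View (K L Q h w : ℕ) where
  e : Fin (Q * h) ≃ Fin Q × Fin h
  f : Fin (Q * w) ≃ Fin Q × Fin w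
  u : Fin Q → Fin h ⊕ Fin h → Fin K
  v : Fin Q → Fin w ⊕ Fin w → Fin L

/-- The partitions and the initial labels of a pass. -/
def Pass.view {K L Q h w : ℕ} (T : Pass K L Q h w) : View K L Q h w :=
  ⟨T.rowPart, T.colPart, T.rowInit, T.colInit⟩

/-- The law of the initial labels, given the blocks. -/
def initLaw {K L Q h w : ℕ} [NeZero Q] (S : Initializer K L h w)
    (B : Fin Q → Fin Q → Matrix (Fin h) (Fin w) Bool) :
    PMF ((Fin Q → Fin h ⊕ Fin h → Fin K) × (Fin Q → Fin w ⊕ Fin w → Fin L)) :=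
  (piPMF fun q : Fin Q => S.row (Matrix.fromRows (B (q - 1) q) (B q q))).bind fun u =>
    (piPMF fun q : Fin Q => S.col (Matrix.fromCols (B q q) (B q (q + 1)))).map fun v => (u, v)

/-- The law of the partitions and the initial labels of a pass. -/
def viewLaw {K L Q h w : ℕ} [NeZero Q] (S : Initializer K L h w)
    (Asub : Matrix (Fin (Q * h)) (Fin (Q * w)) Bool) : PMF (View K L Q h w) :=
  (PMF.uniformOfFintype (Fin (Q * h) ≃ Fin Q × Fin h)).bind fun e =>
    (PMF.uniformOfFintype (Fin (Q * w) ≃ Fin Q × Fin w)).bind fun f =>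
      (initLaw S (block Asub e f)).map fun uv => ⟨e, f, uv.1, uv.2⟩

/-- The rows of `A` in the half `b` of the split `s`. -/
def half {N : ℕ} {κ : Type} (A : Matrix (Fin (2 * N)) κ Bool) (s : Fin (2 * N) ≃ Fin 2 × Fin N)
    (b : Fin 2) : Matrix (Fin N) κ Bool := fun i j => A (s.symm (b, i)) j

section Marginals

theorem ex_do_bind {α β : Type} (p : PMF α) (g : α → PMF β) (f : β → ℝ≥0∞) :
    ex (p >>= g) f = ex p fun a => ex (g a) f := ex_bind p g f

theorem ex_do_pure {α : Type} (a : α) (f : α → ℝ≥0∞) : ex (pure a : PMF α) f = f a := ex_pure a f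

variable {K L Q h w : ℕ} [NeZero K] [NeZero L] [NeZero Q]

theorem ex_initLaw (S : Initializer K L h w) (B : Fin Q → Fin Q → Matrix (Fin h) (Fin w) Bool)
    (F : _ → ℝ≥0∞) : ex (initLaw S B) F
      = ex (piPMF fun q : Fin Q => S.row (Matrix.fromRows (B (q - 1) q) (B q q))) fun u =>
        ex (piPMF fun q : Fin Q => S.col (Matrix.fromCols (B q q) (B q (q + 1)))) fun v =>
          F (u, v) := by
  simp only [initLaw, ex_bind, ex_map]

theorem ex_viewLaw (S : Initializer K L h w) (Asub : Matrix (Fin (Q * h)) (Fin (Q * w)) Bool)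
    (F : View K L Q h w → ℝ≥0∞) : ex (viewLaw S Asub) F
      = ex (PMF.uniformOfFintype (Fin (Q * h) ≃ Fin Q × Fin h)) fun e =>
        ex (PMF.uniformOfFintype (Fin (Q * w) ≃ Fin Q × Fin w)) fun f =>
          ex (initLaw S (block Asub e f)) fun uv => F ⟨e, f, uv.1, uv.2⟩ := by
  simp only [viewLaw, ex_bind, ex_map]

theorem ex_pass_view (S : Initializer K L h w)
    (rowMatch : (Fin (Q * h) ≃ Fin Q × Fin h) → (Fin Q → Fin h → Fin K) →
      (Fin Q → Fin h → Fin K) → PMF (Fin Q → Fin h → Fin K))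
    (Asub Atar : Matrix (Fin (Q * h)) (Fin (Q * w)) Bool) (F : View K L Q h w → ℝ≥0∞) :
    ex (pass S rowMatch Asub Atar) (fun T => F T.view) = ex (viewLaw S Asub) F := by
  simp only [ex_viewLaw, ex_initLaw]
  simp only [pass, ex_do_bind, ex_do_pure, ex_const, Pass.view]
  rfl

theorem ex_algorithm_first (S : Initializer K L h w)
    (A : Matrix (Fin (2 * (Q * h))) (Fin (Q * w)) Bool) (F : _ → View K L Q h w → ℝ≥0∞) :
    ex (algorithm S A) (fun R => F R.split R.first.view)
      = ex (PMF.uniformOfFintype (Fin (2 * (Q * h)) ≃ Fin 2 × Fin (Q * h))) fun s =>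
        ex (viewLaw S (half A s 1)) (F s) := by
  simp only [algorithm, ex_do_bind, ex_do_pure, ex_const]
  refine congrArg _ (funext fun s => ?_)
  exact ex_pass_view S _ _ _ (F s)

theorem ex_algorithm_second (S : Initializer K L h w)
    (A : Matrix (Fin (2 * (Q * h))) (Fin (Q * w)) Bool) (F : _ → View K L Q h w → ℝ≥0∞) :
    ex (algorithm S A) (fun R => F R.split R.second.view)
      = ex (PMF.uniformOfFintype (Fin (2 * (Q * h)) ≃ Fin 2 × Fin (Q * h))) fun s =>
        ex (viewLaw S (half A s 0)) (F s) := by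
  simp only [algorithm, ex_do_bind, ex_do_pure]
  refine congrArg _ (funext fun s => ?_)
  have h1 : ∀ R₁ : Pass K L Q h w,
      ex (pass S (fun e x _ => matchTo x fun q i => R₁.out (e.symm (q, i))) (half A s 0)
        (half A s 1)) (fun R₂ => F s R₂.view) = ex (viewLaw S (half A s 0)) (F s) :=
    fun R₁ => ex_pass_view S _ _ _ (F s)
  have h2 := ex_const (pass S (fun _ x x' => matchChain x x') (half A s 1) (half A s 0))
    (ex (viewLaw S (half A s 0)) (F s))
  rw [← h2]
  exact congrArg _ (funext fun R₁ => h1 R₁)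

end Marginals

/-- The tolerances and the thresholds of the analysis: relative errors of the preliminary mean
parameter estimates for rows and columns (`δ₁`, `δ₂`) and of the global one (`δ`), bound `R` on the
ratios of the connection probabilities, admissible weight `θ` of the misclassified rows and columns
of a block, lower bounds on the cluster sizes in the row and column blocks (`ν`, `ν'`), initial error
rates for rows and columns (`cr`, `cc`), admissible number `d` of misclassified rows of a half. -/
structure Tuning where
  δ₁ : ℝ
  δ₂ : ℝ
  δ : ℝ
  R : ℝ
  θ : ℝ
  ν : ℝ
  ν' : ℝ
  cr : ℝ
  cc : ℝ
  d : ℝ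

namespace BlockModel

variable (M : BlockModel)

/-- Labels of the row blocks of the half `b`. -/
def rowLab (s : Fin (2 * (M.Q * M.h)) ≃ Fin 2 × Fin (M.Q * M.h)) (b : Fin 2)
    (e : Fin (M.Q * M.h) ≃ Fin M.Q × Fin M.h) : Fin M.Q → Fin M.h → Fin M.K :=
  blockLabels (fun i => M.y (s.symm (b, i))) e

/-- Labels of the column blocks. -/
def colLab (f : Fin (M.Q * M.w) ≃ Fin M.Q × Fin M.w) : Fin M.Q → Fin M.w → Fin M.L :=
  blockLabels M.z f

/-- The favourable outcomes of the pass that subdivides the half `b`. -/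
def ViewGood (τ : Tuning) (A : Matrix (Fin (2 * (M.Q * M.h))) (Fin (M.Q * M.w)) Bool)
    (s : Fin (2 * (M.Q * M.h)) ≃ Fin 2 × Fin (M.Q * M.h)) (b : Fin 2)
    (V : View M.K M.L M.Q M.h M.w) : Prop :=
  GoodPass M.P M.Lam τ.δ₁ τ.δ₂ τ.δ τ.R τ.θ (M.rowLab s b V.e)
    (rowCanon (M.rowLab s b V.e) V.u) (M.colLab V.f) (colCanon (M.colLab V.f) V.v)
    (block (half A s b) V.e V.f)

/-- All clusters have about the expected size in all blocks. -/
def Sized (s : Fin (2 * (M.Q * M.h)) ≃ Fin 2 × Fin (M.Q * M.h)) (b : Fin 2)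
    (e : Fin (M.Q * M.h) ≃ Fin M.Q × Fin M.h) (f : Fin (M.Q * M.w) ≃ Fin M.Q × Fin M.w) : Prop :=
  (∀ q k, |(clusterSize (M.rowLab s b e q) k : ℝ) - clusterSize M.y k / (2 * M.Q)|
      ≤ 1 / 10 * (clusterSize M.y k / (2 * M.Q))) ∧
  ∀ q l, |(clusterSize (M.colLab f q) l : ℝ) - clusterSize M.z l / M.Q|
      ≤ 1 / 10 * (clusterSize M.z l / M.Q)

/-- The initial labels have error rates at most `τ.cr` for rows and `τ.cc` for columns. -/
def InitOk (τ : Tuning) (s : Fin (2 * (M.Q * M.h)) ≃ Fin 2 × Fin (M.Q * M.h)) (b : Fin 2)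
    (V : View M.K M.L M.Q M.h M.w) : Prop :=
  (∀ q, mis (V.u q) (Sum.elim (M.rowLab s b V.e (q - 1)) (M.rowLab s b V.e q)) ≤ τ.cr) ∧
  ∀ q, mis (V.v q) (Sum.elim (M.colLab V.f q) (M.colLab V.f (q + 1))) ≤ τ.cc

/-- The columns that the pass may misclassify in its first likelihood ratio classification. -/
def wrongCols (τ : Tuning) (A : Matrix (Fin (2 * (M.Q * M.h))) (Fin (M.Q * M.w)) Bool)
    (s : Fin (2 * (M.Q * M.h)) ≃ Fin 2 × Fin (M.Q * M.h)) (b : Fin 2)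
    (V : View M.K M.L M.Q M.h M.w) : Finset (Fin (M.Q * M.w)) :=
  colBadAll M.P τ.δ₂ τ.R (M.rowLab s b V.e) (rowCanon (M.rowLab s b V.e) V.u) (M.colLab V.f)
    (block (half A s b) V.e V.f) V.f

open scoped Classical in
/-- The rows outside the half `b` that the pass may misclassify at the end. -/
def wrongRows (τ : Tuning) (A : Matrix (Fin (2 * (M.Q * M.h))) (Fin (M.Q * M.w)) Bool)
    (s : Fin (2 * (M.Q * M.h)) ≃ Fin 2 × Fin (M.Q * M.h)) (b : Fin 2)
    (V : View M.K M.L M.Q M.h M.w) : Finset (Fin (2 * (M.Q * M.h))) :=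
  Finset.univ.filter fun i => (s i).1 ≠ b ∧
    badRow M.P M.z (M.wrongCols τ A s b V) (2 * τ.δ) τ.R (M.y i) (A i)

/-- The inequalities between the tolerances that the analysis of a run needs. -/
structure Valid (τ : Tuning) : Prop where
  h_pos : 0 < M.h
  w_pos : 0 < M.w
  θ_nonneg : 0 ≤ τ.θ
  ν_pos : 0 < τ.ν
  ν'_pos : 0 < τ.ν'
  P_pos : ∀ k l, 0 < M.P k l
  z_pos : ∀ l, 0 < clusterSize M.z l
  ratio_row : ∀ k r l, M.P r l ≤ τ.R * M.P k l
  ratio_col : ∀ k l r, M.P k r ≤ τ.R * M.P k l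
  δ₁_le : τ.δ₁ ≤ 1 / 2
  δ₂_le : τ.δ₂ ≤ 1 / 2
  δ_le : τ.δ ≤ 1 / 4
  ν_le : ∀ k, τ.ν ≤ 9 / 10 * ((clusterSize M.y k : ℝ) / (2 * M.Q))
  ν'_le : ∀ l, τ.ν' ≤ 9 / 10 * ((clusterSize M.z l : ℝ) / M.Q)
  θ_ν : 2 * (τ.θ * M.h) ≤ τ.ν
  fin : ∀ k l, M.Q * (4 * (τ.θ * M.h) / τ.ν) + 2 * (τ.θ * M.h) / τ.ν * (2 * M.Lam k l)
    ≤ τ.δ * M.Lam k l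
  cr_lt : 5 * (τ.cr * (2 * M.h)) < τ.ν
  cc_lt : 5 * (τ.cc * (2 * M.w)) < τ.ν'
  d_lt : 3 * τ.d + 2 * (τ.cr * (2 * M.h)) < τ.ν

variable {M}

theorem Valid.row_size {τ : Tuning} (hτ : M.Valid τ) {s b e f} (h : M.Sized s b e f) (q k) :
    τ.ν ≤ clusterSize (M.rowLab s b e q) k := by
  have h1 := abs_le.1 (h.1 q k)
  linarith [hτ.ν_le k]

theorem Valid.col_size {τ : Tuning} (hτ : M.Valid τ) {s b e f} (h : M.Sized s b e f) (q l) :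
    τ.ν' ≤ clusterSize (M.colLab f q) l := by
  have h1 := abs_le.1 (h.2 q l)
  linarith [hτ.ν'_le l]

/-- In a favourable run all rows that are not wrong get their true label, up to one relabeling. -/
theorem exists_perm_labels {τ : Tuning} (hτ : M.Valid τ) {S : Initializer M.K M.L M.h M.w}
    {A : Matrix (Fin (2 * (M.Q * M.h))) (Fin (M.Q * M.w)) Bool} {R : Run M.K M.L M.Q M.h M.w}
    (hR : R ∈ (algorithm S A).support)
    (hs₁ : M.Sized R.split 1 R.first.rowPart R.first.colPart)
    (hs₂ : M.Sized R.split 0 R.second.rowPart R.second.colPart)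
    (hi₁ : M.InitOk τ R.split 1 R.first.view) (hi₂ : M.InitOk τ R.split 0 R.second.view)
    (hg₁ : M.ViewGood τ A R.split 1 R.first.view) (hg₂ : M.ViewGood τ A R.split 0 R.second.view)
    (hd : ((M.wrongRows τ A R.split 1 R.first.view).card : ℝ) ≤ τ.d) :
    ∃ σ : Equiv.Perm (Fin M.K), ∀ i, i ∉ M.wrongRows τ A R.split 1 R.first.view →
      i ∉ M.wrongRows τ A R.split 0 R.second.view → R.labels i = σ (M.y i) := by
  obtain ⟨s, -, hR⟩ := (PMF.mem_support_bind_iff _ _ _).1 hR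
  obtain ⟨R₁, hR₁, hR⟩ := (PMF.mem_support_bind_iff _ _ _).1 hR
  obtain ⟨R₂, hR₂, hR⟩ := (PMF.mem_support_bind_iff _ _ _).1 hR
  have hR' := (PMF.mem_support_pure_iff _ _).1 hR
  subst hR'
  dsimp only at *
  have hν'1 : ∀ q l, 0 < clusterSize (M.colLab R₁.colPart q) l := fun q l => by
    exact_mod_cast hτ.ν'_pos.trans_le (hτ.col_size hs₁ q l)
  have hν'2 : ∀ q l, 0 < clusterSize (M.colLab R₂.colPart q) l := fun q l => by
    exact_mod_cast hτ.ν'_pos.trans_le (hτ.col_size hs₂ q l)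
  obtain ⟨σ, -, hσ⟩ := exists_perm_of_mem_support_pass (C := fun _ => True) (z := M.z)
    (ysub := fun i => M.y (s.symm (1, i))) (ytar := fun i => M.y (s.symm (0, i))) hR₁ rfl rfl rfl rfl
    rfl hτ.h_pos hτ.w_pos hτ.θ_nonneg hτ.ν_pos hg₁ rfl (hτ.row_size hs₁) hν'1 hτ.z_pos hτ.P_pos
    hτ.ratio_row hτ.ratio_col hτ.δ₁_le hτ.δ₂_le hτ.δ_le hτ.θ_ν hτ.fin
    (fun y₁ hy₁ => by
      obtain ⟨σ, hσ⟩ := exists_perm_matchChain_row (yb := M.rowLab s 1 R₁.rowPart) hi₁.1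
        (fun q k => hτ.cr_lt.trans_le (hτ.row_size hs₁ q k)) hy₁
      exact ⟨σ, trivial, hσ⟩)
    (fun z₁ hz₁ => exists_perm_matchChain_col (zb := M.colLab R₁.colPart) hi₁.2
        (fun q l => hτ.cc_lt.trans_le (hτ.col_size hs₁ q l)) hz₁)
  have hσ1 : ∀ i, s.symm (0, i) ∉ M.wrongRows τ A s 1 R₁.view → R₁.out i = σ (M.y (s.symm (0, i))) := by
    intro i hi
    refine hσ i fun hb => hi ?_
    simp only [wrongRows, Finset.mem_filter, Finset.mem_univ, true_and]
    exact ⟨by simp, hb⟩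
  -- matching to the output of the first pass forces the second pass to use the same relabeling
  obtain ⟨σ', rfl, hσ'⟩ := exists_perm_of_mem_support_pass (C := fun σ' => σ' = σ) (z := M.z)
    (ysub := fun i => M.y (s.symm (0, i))) (ytar := fun i => M.y (s.symm (1, i))) hR₂ rfl rfl rfl rfl
    rfl hτ.h_pos hτ.w_pos hτ.θ_nonneg hτ.ν_pos hg₂ rfl (hτ.row_size hs₂) hν'2 hτ.z_pos hτ.P_pos
    hτ.ratio_row hτ.ratio_col hτ.δ₁_le hτ.δ₂_le hτ.δ_le hτ.θ_ν hτ.fin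
    (fun y₁ hy₁ => ⟨σ, rfl, eq_perm_of_matchTo (yb := M.rowLab s 0 R₂.rowPart) (d := τ.d) hi₂.1
      (fun q => by
        refine le_trans ?_ hd
        exact_mod_cast Finset.card_le_card_of_injOn (fun i => s.symm (0, R₂.rowPart.symm (q, i)))
          (fun i hi => by
            by_contra hc
            exact (mem_errSet.1 hi) (hσ1 _ hc))
          (fun i _ i' _ hii => by simpa using hii))
      (fun q k => hτ.d_lt.trans_le (hτ.row_size hs₂ q k)) hy₁⟩)
    (fun z₁ hz₁ => exists_perm_matchChain_col (zb := M.colLab R₂.colPart) hi₂.2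
        (fun q l => hτ.cc_lt.trans_le (hτ.col_size hs₂ q l)) hz₁)
  refine ⟨σ', fun i hi1 hi2 => ?_⟩
  by_cases hb : (s i).1 = 0
  · have hi : s.symm (0, (s i).2) = i := by
      rw [← hb]
      simp
    have h1 := hσ1 (s i).2
    rw [hi] at h1
    simp only [Run.labels, hb, if_true]
    exact h1 hi1
  · have hb1 : (s i).1 = 1 := by omega
    have hi : s.symm (1, (s i).2) = i := by
      rw [← hb1]
      simp
    have h1 := hσ' (s i).2
    simp only [hi] at h1
    simp only [Run.labels, hb, if_false]
    refine h1 fun hbad => hi2 ?_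
    simp only [wrongRows, Finset.mem_filter, Finset.mem_univ, true_and]
    exact ⟨hb, hbad⟩

end BlockModel

/-! ### The joint law of the matrix and the choices of one pass -/

/-- A split of the rows into two halves. -/
abbrev Split (Q h : ℕ) : Type := Fin (2 * (Q * h)) ≃ Fin 2 × Fin (Q * h)

namespace BlockModel

variable (M : BlockModel)

/-- Adjacency matrices. -/
abbrev Adj : Type := Matrix (Fin (2 * (M.Q * M.h))) (Fin (M.Q * M.w)) Bool

/-- Partitions and initial labels of a pass of the model. -/
abbrev Vw : Type := View M.K M.L M.Q M.h M.w

/-- The initial labels of a pass. -/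
abbrev Ini : Type := (Fin M.Q → Fin M.h ⊕ Fin M.h → Fin M.K) × (Fin M.Q → Fin M.w ⊕ Fin M.w → Fin M.L)

/-- The joint law of the matrix, the split, and the partitions and initial labels of the pass that
subdivides the half `b`. -/
def joint (S : Initializer M.K M.L M.h M.w) (b : Fin 2) : PMF (M.Adj × Split M.Q M.h × M.Vw) :=
  M.sbm.bind fun A => (PMF.uniformOfFintype (Split M.Q M.h)).bind fun s =>
    (viewLaw S (half A s b)).map fun V => (A, s, V)

/-- The joint law of the matrix and a run of the algorithm. -/
def fullLaw (S : Initializer M.K M.L M.h M.w) : PMF (M.Adj × Run M.K M.L M.Q M.h M.w) :=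
  M.sbm.bind fun A => (algorithm S A).map fun R => (A, R)

variable {M}

theorem prob_law (S : Initializer M.K M.L M.h M.w) (E : Run M.K M.L M.Q M.h M.w → Prop) :
    prob (M.law S) {R | E R} = prob (M.fullLaw S) {x | E x.2} := by
  simp only [prob_eq_ex, law, fullLaw, ex_bind, ex_map]
  rfl

theorem prob_fullLaw_first (S : Initializer M.K M.L M.h M.w)
    (E : M.Adj × Split M.Q M.h × M.Vw → Prop) :
    prob (M.fullLaw S) {x | E (x.1, x.2.split, x.2.first.view)} = prob (M.joint S 1) {x | E x} := by
  simp only [prob_eq_ex, joint, fullLaw, ex_bind, ex_map]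
  refine congrArg _ (funext fun A => ?_)
  exact ex_algorithm_first S A fun s V => Set.indicator {x | E x} (fun _ => 1) (A, s, V)

/-- The partitions and initial labels of the second pass do not depend on the first pass, so they have
the same law as those of a first pass on the other half. -/
theorem prob_fullLaw_second (S : Initializer M.K M.L M.h M.w)
    (E : M.Adj × Split M.Q M.h × M.Vw → Prop) :
    prob (M.fullLaw S) {x | E (x.1, x.2.split, x.2.second.view)} = prob (M.joint S 0) {x | E x} := by
  simp only [prob_eq_ex, joint, fullLaw, ex_bind, ex_map]
  refine congrArg _ (funext fun A => ?_)
  exact ex_algorithm_second S A fun s V => Set.indicator {x | E x} (fun _ => 1) (A, s, V)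

/-- The partitions may be drawn first. -/
theorem ex_joint (S : Initializer M.K M.L M.h M.w) (b : Fin 2)
    (F : M.Adj × Split M.Q M.h × M.Vw → ℝ≥0∞) : ex (M.joint S b) F
      = ex (PMF.uniformOfFintype (Split M.Q M.h)) fun s =>
        ex (PMF.uniformOfFintype (Fin (M.Q * M.h) ≃ Fin M.Q × Fin M.h)) fun e =>
        ex (PMF.uniformOfFintype (Fin (M.Q * M.w) ≃ Fin M.Q × Fin M.w)) fun f =>
        ex M.sbm fun A => ex (initLaw S (block (half A s b) e f)) fun uv =>
          F (A, s, ⟨e, f, uv.1, uv.2⟩) := by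
  simp only [joint, ex_bind, ex_map, ex_viewLaw]
  rw [ex_comm M.sbm]
  refine congrArg _ (funext fun s => ?_)
  rw [ex_comm M.sbm]
  refine congrArg _ (funext fun e => ?_)
  rw [ex_comm M.sbm]

theorem ex_joint_le (S : Initializer M.K M.L M.h M.w) (b : Fin 2)
    {F : M.Adj × Split M.Q M.h × M.Vw → ℝ≥0∞} {c : ℝ≥0∞}
    (h : ∀ s e f, ex M.sbm (fun A => ex (initLaw S (block (half A s b) e f)) fun uv =>
      F (A, s, ⟨e, f, uv.1, uv.2⟩)) ≤ c) : ex (M.joint S b) F ≤ c := by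
  rw [ex_joint]
  exact ex_le_of_forall fun s => ex_le_of_forall fun e => ex_le_of_forall fun f => h s e f

theorem prob_joint_le (S : Initializer M.K M.L M.h M.w) (b : Fin 2)
    {E : M.Adj × Split M.Q M.h × M.Vw → Prop} {c : ℝ≥0∞}
    (h : ∀ s e f, ex M.sbm (fun A => prob (initLaw S (block (half A s b) e f))
      {uv | E (A, s, ⟨e, f, uv.1, uv.2⟩)}) ≤ c) : prob (M.joint S b) {x | E x} ≤ c := by
  rw [prob_eq_ex]
  refine ex_joint_le S b fun s e f => ?_
  refine le_trans (le_of_eq ?_) (h s e f)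
  refine congrArg _ (funext fun A => ?_)
  rw [prob_eq_ex]
  rfl

/-- Entries on which the initial labels do not depend. -/
def Avoids (s : Split M.Q M.h) (b : Fin 2) (e : Fin (M.Q * M.h) ≃ Fin M.Q × Fin M.h)
    (f : Fin (M.Q * M.w) ≃ Fin M.Q × Fin M.w)
    (Sx : Set (Fin (2 * (M.Q * M.h)) × Fin (M.Q * M.w))) : Prop :=
  ∀ q i j, (s.symm (b, e.symm (q, i)), f.symm (q, j)) ∉ Sx ∧
    (s.symm (b, e.symm (q, i)), f.symm (q + 1, j)) ∉ Sx

/-- The initial labels use only the blocks `(q, q)` and `(q, q + 1)`. -/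
theorem initLaw_mixMat (S : Initializer M.K M.L M.h M.w) {s : Split M.Q M.h} {b : Fin 2} {e f}
    {Sx : Set (Fin (2 * (M.Q * M.h)) × Fin (M.Q * M.w))} (hS : Avoids (M := M) s b e f Sx)
    (A A' : M.Adj) : initLaw S (block (half (mixMat Sx A' A) s b) e f)
      = initLaw S (block (half A s b) e f) := by
  have h1 : ∀ q, block (half (mixMat Sx A' A) s b) e f q q = block (half A s b) e f q q := by
    intro q
    ext i j
    simp [block, half, mixMat, (hS q i j).1]
  have h2 : ∀ q, block (half (mixMat Sx A' A) s b) e f q (q + 1)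
      = block (half A s b) e f q (q + 1) := by
    intro q
    ext i j
    simp [block, half, mixMat, (hS q i j).2]
  have h3 : ∀ q, block (half (mixMat Sx A' A) s b) e f (q - 1) q
      = block (half A s b) e f (q - 1) q := by
    intro q
    have := h2 (q - 1)
    rwa [sub_add_cancel] at this
  simp only [initLaw, h1, h2, h3]

/-- Conditionally on the initial labels, the entries they do not depend on still follow the block
model. -/
theorem ex_indicator_le (S : Initializer M.K M.L M.h M.w) {s : Split M.Q M.h} {b : Fin 2} {e f}
    {Sx : Set (Fin (2 * (M.Q * M.h)) × Fin (M.Q * M.w))} (hS : Avoids (M := M) s b e f Sx)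
    {T : Type} [Fintype T] [DecidableEq T] (φ : T → Fin (2 * (M.Q * M.h)) × Fin (M.Q * M.w))
    (hφ : Function.Injective φ) (hφS : ∀ t, φ t ∈ Sx)
    (E : M.Adj → M.Ini → (T → Bool) → Prop) (hE : ∀ A A' uv, E (mixMat Sx A' A) uv = E A uv)
    (W : M.Adj → ℝ≥0∞) (hW : ∀ A A', W (mixMat Sx A' A) = W A) {c : ℝ}
    (hc : ∀ A uv, PB (fun t => M.P (M.y (φ t).1) (M.z (φ t).2)) (E A uv) ≤ c) :
    ex M.sbm (fun A => ex (initLaw S (block (half A s b) e f)) fun uv =>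
      {x | E A uv x}.indicator (fun _ => W A) fun t => A (φ t).1 (φ t).2)
      ≤ ENNReal.ofReal c * ex M.sbm W := by
  -- redraw the entries in `Sx`; the law of the initial labels does not notice
  have h := ex_ex_le_of_resample (fun i j => bern (M.P (M.y i) (M.z j)) (M.P_mem (M.y i) (M.z j))) Sx
    (fun A : M.Adj => initLaw S (block (half A s b) e f)) (initLaw_mixMat S hS)
    (fun A uv => {x | E A uv x}.indicator (fun _ => W A) fun t => A (φ t).1 (φ t).2)
    (fun A _ => W A) (ENNReal.ofReal c) fun A uv => ?_
  · simp only [ex_const] at h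
    exact h
  · have h1 : ∀ A' : M.Adj, ({x | E (mixMat Sx A' A) uv x}.indicator (fun _ => W (mixMat Sx A' A))
        fun t => mixMat Sx A' A (φ t).1 (φ t).2)
        = W A * {x | E A uv x}.indicator (fun _ => 1) fun t => A' (φ t).1 (φ t).2 := by
      intro A'
      have h2 : (fun t => mixMat Sx A' A (φ t).1 (φ t).2) = fun t => A' (φ t).1 (φ t).2 := by
        funext t
        exact if_pos (hφS t)
      rw [h2, hW, hE]
      by_cases hx : (fun t => A' (φ t).1 (φ t).2) ∈ {x | E A uv x}
      · simp [hx]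
      · simp [hx]
    simp only [h1, ex_mul_left]
    rw [ex_matrix_entries _ φ hφ fun x => {x | E A uv x}.indicator (fun _ => 1) x, ← prob_eq_ex,
      prob_bern (p := fun t => M.P (M.y (φ t).1) (M.z (φ t).2)) (fun t => M.P_mem _ _), mul_comm]
    gcongr
    exact hc A uv

/-- Conditionally on the initial labels, an event about entries that they do not depend on has its
probability under the block model. -/
theorem ex_prob_le (S : Initializer M.K M.L M.h M.w) {s : Split M.Q M.h} {b : Fin 2} {e f}
    {Sx : Set (Fin (2 * (M.Q * M.h)) × Fin (M.Q * M.w))} (hS : Avoids (M := M) s b e f Sx)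
    {T : Type} [Fintype T] [DecidableEq T] (φ : T → Fin (2 * (M.Q * M.h)) × Fin (M.Q * M.w))
    (hφ : Function.Injective φ) (hφS : ∀ t, φ t ∈ Sx)
    (E : M.Adj → M.Ini → (T → Bool) → Prop) (hE : ∀ A A' uv, E (mixMat Sx A' A) uv = E A uv) {c : ℝ}
    (hc : ∀ A uv, PB (fun t => M.P (M.y (φ t).1) (M.z (φ t).2)) (E A uv) ≤ c) :
    ex M.sbm (fun A => prob (initLaw S (block (half A s b) e f))
      {uv | E A uv fun t => A (φ t).1 (φ t).2}) ≤ ENNReal.ofReal c := by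
  have h := ex_indicator_le S hS φ hφ hφS E hE (fun _ => 1) (fun _ _ => rfl) hc
  rw [ex_const, mul_one] at h
  refine le_trans (le_of_eq ?_) h
  simp only [prob_eq_ex]
  rfl

/-- The entries of the block `(q, q')`. -/
def blockSet (s : Split M.Q M.h) (b : Fin 2) (e : Fin (M.Q * M.h) ≃ Fin M.Q × Fin M.h)
    (f : Fin (M.Q * M.w) ≃ Fin M.Q × Fin M.w) (q q' : Fin M.Q) :
    Set (Fin (2 * (M.Q * M.h)) × Fin (M.Q * M.w)) :=
  Set.range fun t : Fin M.h × Fin M.w => (s.symm (b, e.symm (q, t.1)), f.symm (q', t.2))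

theorem mem_blockSet {s : Split M.Q M.h} {b : Fin 2} {e f} {q q' q₁ q₁' : Fin M.Q} {i j} :
    (s.symm (b, e.symm (q₁, i)), f.symm (q₁', j)) ∈ blockSet (M := M) s b e f q q'
      ↔ q₁ = q ∧ q₁' = q' := by
  constructor
  · rintro ⟨⟨i', j'⟩, ht⟩
    simp only [Prod.mk.injEq, EmbeddingLike.apply_eq_iff_eq, true_and] at ht
    exact ⟨ht.1.1.symm, ht.2.1.symm⟩
  · rintro ⟨rfl, rfl⟩
    exact ⟨(i, j), rfl⟩

theorem avoids_blockSet {s : Split M.Q M.h} {b : Fin 2} {e f} {q q' : Fin M.Q} (h0 : q' ≠ q)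
    (h1 : q' ≠ q + 1) : Avoids (M := M) s b e f (blockSet s b e f q q') := by
  intro q₁ i j
  rw [mem_blockSet, mem_blockSet]
  constructor
  · rintro ⟨rfl, rfl⟩
    exact h0 rfl
  · rintro ⟨rfl, rfl⟩
    exact h1 rfl

theorem block_mixMat {s : Split M.Q M.h} {b : Fin 2} {e f} {q q' q₁ q₁' : Fin M.Q}
    (h : ¬ (q₁ = q ∧ q₁' = q')) (A A' : M.Adj) :
    block (half (mixMat (blockSet (M := M) s b e f q q') A' A) s b) e f q₁ q₁'
      = block (half A s b) e f q₁ q₁' := by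
  ext i j
  simp only [block, half, mixMat]
  exact if_neg (by rwa [mem_blockSet])

/-- At least four blocks keep the blocks used by the different steps apart: `(q, q)` and `(q, q + 1)`
for the initial labels, `(q, q + 2)` and `(q, q + 3)` for the two rounds of estimation. -/
theorem add_two_three_ne {Q : ℕ} [NeZero Q] (hQ : 4 ≤ Q) (q : Fin Q) :
    q + 2 ≠ q ∧ q + 2 ≠ q + 1 ∧ q + 3 ≠ q ∧ q + 3 ≠ q + 1 ∧ q + 3 ≠ q + 2 := by
  have h : ∀ a b : ℕ, a < 4 → b < 4 → a ≠ b → (Fin.ofNat Q a) ≠ Fin.ofNat Q b := by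
    intro a b ha hb hab h
    have := congrArg Fin.val h
    simp only [Fin.ofNat, Nat.mod_eq_of_lt (ha.trans_le hQ), Nat.mod_eq_of_lt (hb.trans_le hQ)] at this
    exact hab this
  have h0 : (0 : Fin Q) = Fin.ofNat Q 0 := rfl
  have h1 : (1 : Fin Q) = Fin.ofNat Q 1 := rfl
  have h2 : (2 : Fin Q) = Fin.ofNat Q 2 := rfl
  have h3 : (3 : Fin Q) = Fin.ofNat Q 3 := rfl
  refine ⟨fun hc => ?_, fun hc => ?_, fun hc => ?_, fun hc => ?_, fun hc => ?_⟩
  · exact h 2 0 (by omega) (by omega) (by omega) (by rw [← h2, ← h0]; exact add_eq_left.1 hc)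
  · exact h 2 1 (by omega) (by omega) (by omega) (by rw [← h2, ← h1]; exact add_left_cancel hc)
  · exact h 3 0 (by omega) (by omega) (by omega) (by rw [← h3, ← h0]; exact add_eq_left.1 hc)
  · exact h 3 1 (by omega) (by omega) (by omega) (by rw [← h3, ← h1]; exact add_left_cancel hc)
  · exact h 3 2 (by omega) (by omega) (by omega) (by rw [← h3, ← h2]; exact add_left_cancel hc)

end BlockModel

/-! ### Error probabilities inside a block -/

section OneBlock

variable {ι κ : Type} [Fintype ι] [DecidableEq ι] [Fintype κ] [DecidableEq κ] {K L : ℕ}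

/-- The mean parameter estimate of a block from initial labels with error rates of order `γ₀` is
accurate. -/
theorem PB_meanEst_block_le {P : Matrix (Fin K) (Fin L) ℝ} {y y' : ι → Fin K} {z z' : κ → Fin L}
    {γ₀ ω X I c₀ ν pm : ℝ} (hP : ∀ k l, P k l ∈ Set.Icc (0 : ℝ) 1) (hpm : ∀ k l, P k l ≤ pm)
    (hX0 : 0 < X) (hω : 1 ≤ ω) (hc : 0 < c₀) (hν : 0 < ν) (hI : 0 < I) (hIX : I ≤ L * X) (hL : 0 < L)
    (hγ0 : 0 ≤ γ₀) (hγ : γ₀ * ω ≤ I / (3072 * (L * X)))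
    (hXb : ∀ k l, blockMean P z k l ≤ 11 / 10 * (X / c₀))
    (hμ : ∀ k l, 9 / 10 * (X / (ω * c₀)) ≤ blockMean P z k l)
    (hy : ∀ k, ν ≤ clusterSize y k) (her : ((errSet y' y).card : ℝ) ≤ 20 / 9 * (γ₀ * ν))
    (hec : pm * (errSet z' z).card ≤ 2 * (γ₀ * X / c₀)) (k : Fin K) (l : Fin L) :
    PB (fun t : ι × κ => P (y t.1) (z t.2))
      (fun x => ¬ |meanEst (toMat x) y' z' k l - blockMean P z k l|
        ≤ I / (20 * (L * X)) * blockMean P z k l)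
      ≤ 2 * Real.exp (-((I / (40 * (L * X))) ^ 2 * (ν * (9 / 10 * (X / (ω * c₀)))) / 16)) := by
  have hL' : (0 : ℝ) < L := by exact_mod_cast hL
  have hLX : 0 < L * X := by positivity
  have hω0 : 0 < ω := by linarith
  set μ := blockMean P z k l with hμd
  have hμ1 := hμ k l
  have hμ0 : 0 < μ := lt_of_lt_of_le (by positivity) hμ1
  set r := I / (L * X) with hr
  have hr0 : 0 < r := by positivity
  have hr1 : r ≤ 1 := (div_le_one hLX).2 hIX
  have e1 : I / (20 * (L * X)) = r / 20 := by rw [hr]; field_simp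
  have e2 : I / (40 * (L * X)) = r / 40 := by rw [hr]; field_simp
  have e3 : I / (3072 * (L * X)) = r / 3072 := by rw [hr]; field_simp
  rw [e3] at hγ
  have hγ1 : γ₀ ≤ 1 / 3072 := by nlinarith
  set n : ℝ := (clusterSize y' k : ℝ) with hn
  have hn2 : ν / 2 ≤ n := by
    have h1 : (clusterSize y k : ℝ) ≤ n + (errSet y' y).card := by
      rw [hn]
      have : clusterSize y k ≤ clusterSize y' k + (errSet y' y).card := by
        refine (Finset.card_le_card fun i hi => ?_).trans (Finset.card_union_le _ _)
        by_cases hiS : i ∈ errSet y' y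
        · exact Finset.mem_union_right _ hiS
        · refine Finset.mem_union_left _ (Finset.mem_filter.2 ⟨Finset.mem_univ _, ?_⟩)
          rw [mem_errSet, not_not] at hiS
          rw [hiS, (Finset.mem_filter.1 hi).2]
      exact_mod_cast this
    have := hy k
    nlinarith
  have hn0 : 0 < n := by linarith
  have hXc : X / c₀ ≤ 10 / 9 * (ω * μ) := by
    have : X / (ω * c₀) = X / c₀ / ω := by field_simp
    rw [this] at hμ1
    have h2 : X / c₀ / ω ≤ 10 / 9 * μ := by linarith
    rw [div_le_iff₀ hω0] at h2
    linarith
  have hXc0 : 0 < X / c₀ := by positivity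
  have hbias := abs_edgeMean_sub_le (P := P) (y := y) (y' := y') (z := z) (z' := z')
    (fun k l => (hP k l).1) hpm hXb k l
  have hb : |edgeMean P y y' z z' k l - n * μ| ≤ r / 40 * (n * μ) := by
    refine hbias.trans ?_
    have g1 : n * (pm * (errSet z' z).card) ≤ n * (2 * (γ₀ * (X / c₀))) := by
      refine mul_le_mul_of_nonneg_left (hec.trans (le_of_eq ?_)) hn0.le
      ring
    have g2 : ((errSet y' y).card : ℝ) * (11 / 10 * (X / c₀))
        ≤ 20 / 9 * (γ₀ * (2 * n)) * (11 / 10 * (X / c₀)) := by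
      refine mul_le_mul_of_nonneg_right (her.trans ?_) (by positivity)
      nlinarith
    -- `X / c₀` exceeds the mean `μ` of the block by a factor of at most `10 / 9 ω`, which the
    -- bound on `γ₀ ω` absorbs
    have g3 : γ₀ * (X / c₀) ≤ r / 3072 * (10 / 9 * μ) := by
      calc γ₀ * (X / c₀) ≤ γ₀ * (10 / 9 * (ω * μ)) := mul_le_mul_of_nonneg_left hXc hγ0
        _ = γ₀ * ω * (10 / 9 * μ) := by ring
        _ ≤ _ := mul_le_mul_of_nonneg_right hγ (by positivity)
    have g4 : n * (γ₀ * (X / c₀)) ≤ n * (r / 3072 * (10 / 9 * μ)) :=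
      mul_le_mul_of_nonneg_left g3 hn0.le
    have g5 : 0 < r * (n * μ) := by positivity
    calc _ ≤ n * (2 * (γ₀ * (X / c₀))) + 20 / 9 * (γ₀ * (2 * n)) * (11 / 10 * (X / c₀)) :=
          add_le_add g1 g2
      _ = (2 + 20 / 9 * 2 * (11 / 10)) * (n * (γ₀ * (X / c₀))) := by ring
      _ ≤ (2 + 20 / 9 * 2 * (11 / 10)) * (n * (r / 3072 * (10 / 9 * μ))) := by gcongr
      _ ≤ r / 40 * (n * μ) := by nlinarith
  have h := PB_meanEst_le (y := y) (z := z) (y' := y') (z' := z') hP (k := k) (l := l) (μ := μ)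
    (b := r / 40) (η := r / 40) (δ := r / 20) hμ0 (by positivity) (by linarith) (by linarith)
    (by linarith) (Nat.cast_pos.1 hn0) hb
  rw [e1, e2]
  refine h.trans ?_
  have h5 : ν / 2 * (9 / 10 * (X / (ω * c₀))) ≤ n * μ := mul_le_mul hn2 hμ1 (by positivity) hn0.le
  gcongr 2 * Real.exp (-?_)
  have h6 : 0 ≤ (r / 40) ^ 2 := by positivity
  calc (r / 40) ^ 2 * (ν * (9 / 10 * (X / (ω * c₀)))) / 16
      = (r / 40) ^ 2 * (ν / 2 * (9 / 10 * (X / (ω * c₀)))) / 8 := by ring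
    _ ≤ _ := by gcongr

/-- A row of a block is misclassified with exponentially small probability if the error rate of the
initial column labels is of order `γ₀`. -/
theorem PB_badRow_block_le {P Lam : Matrix (Fin K) (Fin L) ℝ} {N : Fin L → ℝ} {z z' : κ → Fin L}
    {γ₀ ω X I c₀ pm : ℝ} (hL : 0 < L) (hc : 0 < c₀) (hω : 1 ≤ ω)
    (hP : ∀ k l, 0 < P k l) (hP1 : ∀ k l, P k l ≤ 1) (hpm : ∀ k l, P k l ≤ pm) (hN : ∀ l, 0 < N l)
    (hLam : ∀ k l, Lam k l = P k l * N l) (hX : ∀ k l, Lam k l ≤ X) (hX0 : 0 < X)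
    (hz : ∀ l, |(clusterSize z l : ℝ) - N l / c₀| ≤ 1 / 10 * (N l / c₀))
    (hI0 : 0 < I) (hI : ∀ k r, r ≠ k → I ≤ info Lam k r) (hIX : I ≤ L * X)
    (hγ : γ₀ * ω ≤ I / (3072 * (L * X)))
    (hec : pm * (errSet z' z).card ≤ 2 * (γ₀ * X / c₀)) (k : Fin K) :
    PB (fun j => P k (z j)) (badRow P z (errSet z' z) (I / (20 * (L * X))) ω k)
      ≤ K * Real.exp (-(I / (4 * c₀))) := by
  have hL' : (1 : ℝ) ≤ L := by exact_mod_cast hL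
  refine PB_badRow_subblock_le hL hc hω hP hP1 hN hLam hX hX0 hz hI0 hI hIX (d := 2 * (γ₀ * X / c₀))
    ?_ ?_
  · refine le_trans (Finset.sum_le_sum fun j _ => hpm k (z j)) ?_
    rw [Finset.sum_const, nsmul_eq_mul, mul_comm]
    exact hec
  · have h1 : 3 * ω * (2 * (γ₀ * X / c₀)) = 6 * (γ₀ * ω) * X / c₀ := by ring
    rw [h1, div_le_div_iff₀ hc (by positivity)]
    have h2 : I / (3072 * (L * X)) ≤ I / (3072 * X) := by
      gcongr
      nlinarith
    have h3 : γ₀ * ω * X ≤ I / 3072 := by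
      calc γ₀ * ω * X ≤ I / (3072 * X) * X := mul_le_mul_of_nonneg_right (hγ.trans h2) hX0.le
        _ = I / 3072 := by field_simp
    have h4 : γ₀ * ω * X * c₀ ≤ I / 3072 * c₀ := mul_le_mul_of_nonneg_right h3 hc.le
    nlinarith [mul_pos hI0 hc]

theorem sum_clusterSize_block {α β γ : Type} [Fintype α] [Fintype β] [Fintype γ] (y : α → Fin K)
    (e : α ≃ β × γ) (k : Fin K) : ∑ q, clusterSize (blockLabels y e q) k = clusterSize y k := by
  simp only [clusterSize, Finset.card_filter]
  rw [← Equiv.sum_comp e.symm, Fintype.sum_prod_type]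
  rfl

end OneBlock

namespace BlockModel

variable (M : BlockModel) (β ω : ℝ)

/-- The properties of a single model that the non-asymptotic error bounds use. -/
structure Regime : Prop where
  one_le_β : 1 ≤ β
  one_le_ω : 1 ≤ ω
  h_pos : 0 < M.h
  w_pos : 0 < M.w
  row_lower : ∀ k, 2 * ((M.Q : ℝ) * M.h) / (β * M.K) ≤ clusterSize M.y k
  col_lower : ∀ l, (M.Q : ℝ) * M.w / (β * M.L) ≤ clusterSize M.z l
  ratio_Lam : entryMax M.Lam ≤ ω * entryMin M.Lam
  ratio_Gam : entryMax M.Gam ≤ ω * entryMin M.Gam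
  two_le : 2 ≤ entryMin M.Lam
  info_Lam_pos : 0 < infoMin M.Lam
  info_Gam_pos : 0 < infoMin M.Gam

/-- The admissible rate of the initial label errors. -/
def initRate : ℝ := 1 / (384 * β ^ 2 * ω) *
  min (infoMin M.Lam / (8 * M.L * entryMax M.Lam)) (infoMin M.Gam / (16 * M.K * entryMax M.Gam))

/-- The tolerances with which the algorithm is analysed. The errors `δ₁`, `δ₂` cost a fixed fraction
of the information, while `δ` costs only a bounded amount of it; `θ` is so small that
the columns misclassified in the first round change the exponents of the second by a constant only. -/
def tuning : Tuning where
  δ₁ := infoMin M.Lam / (20 * (M.L * entryMax M.Lam))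
  δ₂ := infoMin M.Gam / (20 * (M.K * entryMax M.Gam))
  δ := 1 / (2 * (M.L * entryMax M.Lam))
  R := ω
  θ := 1 / (1000 * (M.Q * β * M.K * M.L * ω * entryMax M.Lam))
  ν := 9 / 10 * (M.h / (β * M.K))
  ν' := 9 / 10 * (M.w / (β * M.L))
  cr := M.initRate β ω / (β * M.K)
  cc := M.initRate β ω / (β * M.L)
  d := M.h / (16 * (β * M.K))

variable {M β ω}

theorem two_le_castK : (2 : ℝ) ≤ M.K := by exact_mod_cast M.two_le_K
theorem two_le_castL : (2 : ℝ) ≤ M.L := by exact_mod_cast M.two_le_L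
theorem four_le_castQ : (4 : ℝ) ≤ M.Q := by exact_mod_cast M.four_le_Q

end BlockModel

/-! ### Parameters of a single model -/

namespace BlockModel

variable {M : BlockModel} {β ω : ℝ}

-- In the names below `X`, `Y` stand for the largest entries of `M.Lam`, `M.Gam`, and `I`, `J` for
-- their minimal informations.
namespace Regime

theorem one_le_h (hM : M.Regime β ω) : (1 : ℝ) ≤ M.h := by exact_mod_cast hM.h_pos
theorem one_le_w (hM : M.Regime β ω) : (1 : ℝ) ≤ M.w := by exact_mod_cast hM.w_pos

theorem Lam_ge_two (hM : M.Regime β ω) (k l) : 2 ≤ M.Lam k l := hM.two_le.trans (entryMin_le _ k l)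

theorem P_pos (hM : M.Regime β ω) (k l) : 0 < M.P k l := by
  have h := hM.Lam_ge_two k l
  rcases (M.P_mem k l).1.lt_or_eq with h1 | h1
  · exact h1
  · rw [Lam, ← h1] at h
    norm_num at h

theorem P_le_one (k l) : M.P k l ≤ 1 := (M.P_mem k l).2

theorem z_pos (hM : M.Regime β ω) (l) : 0 < clusterSize M.z l := by
  have h := hM.col_lower l
  have h1 := hM.one_le_β
  have h2 := hM.one_le_w
  have h3 := M.two_le_castL
  have h4 := M.four_le_castQ
  have : (0 : ℝ) < M.Q * M.w / (β * M.L) := by positivity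
  exact_mod_cast this.trans_le h

theorem y_pos (hM : M.Regime β ω) (k) : 0 < clusterSize M.y k := by
  have h := hM.row_lower k
  have h1 := hM.one_le_β
  have h2 := hM.one_le_h
  have h3 := M.two_le_castK
  have h4 := M.four_le_castQ
  have : (0 : ℝ) < 2 * (M.Q * M.h) / (β * M.K) := by positivity
  exact_mod_cast this.trans_le h

theorem X_ge_two (hM : M.Regime β ω) : 2 ≤ entryMax M.Lam :=
  (hM.Lam_ge_two 0 0).trans (le_entryMax _ 0 0)

theorem Gam_pos (hM : M.Regime β ω) (l k) : 0 < M.Gam l k :=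
  mul_pos (by exact_mod_cast hM.y_pos k) (hM.P_pos k l)

theorem Y_pos (hM : M.Regime β ω) : 0 < entryMax M.Gam :=
  (hM.Gam_pos 0 0).trans_le (le_entryMax _ 0 0)

theorem X_le (hM : M.Regime β ω) (k l) : entryMax M.Lam ≤ ω * M.Lam k l :=
  hM.ratio_Lam.trans (mul_le_mul_of_nonneg_left (entryMin_le _ k l) (by linarith [hM.one_le_ω]))

theorem Y_le (hM : M.Regime β ω) (l k) : entryMax M.Gam ≤ ω * M.Gam l k :=
  hM.ratio_Gam.trans (mul_le_mul_of_nonneg_left (entryMin_le _ l k) (by linarith [hM.one_le_ω]))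

theorem ratio_row (hM : M.Regime β ω) (k r l) : M.P r l ≤ ω * M.P k l := by
  have h1 := (le_entryMax M.Lam r l).trans (hM.X_le k l)
  have h2 : (0 : ℝ) < clusterSize M.z l := by exact_mod_cast hM.z_pos l
  simp only [Lam] at h1
  nlinarith

theorem ratio_col (hM : M.Regime β ω) (k l r) : M.P k r ≤ ω * M.P k l := by
  have h1 := (le_entryMax M.Gam r k).trans (hM.Y_le l k)
  have h2 : (0 : ℝ) < clusterSize M.y k := by exact_mod_cast hM.y_pos k
  simp only [Gam] at h1
  nlinarith

theorem P_le_X (hM : M.Regime β ω) (k l) :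
    M.P k l ≤ entryMax M.Lam * (β * M.L) / (M.Q * M.w) := by
  have h1 := le_entryMax M.Lam k l
  have h2 := hM.col_lower l
  have h3 := hM.one_le_w
  have h4 := M.four_le_castQ
  have h5 := M.two_le_castL
  have h6 := hM.one_le_β
  simp only [Lam] at h1
  rw [div_le_iff₀ (by positivity)] at h2
  rw [le_div_iff₀ (by positivity)]
  calc M.P k l * (M.Q * M.w) ≤ M.P k l * (clusterSize M.z l * (β * M.L)) :=
        mul_le_mul_of_nonneg_left h2 (M.P_mem k l).1
    _ = M.P k l * clusterSize M.z l * (β * M.L) := by ring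
    _ ≤ _ := mul_le_mul_of_nonneg_right h1 (by positivity)

theorem P_le_Y (hM : M.Regime β ω) (k l) :
    M.P k l ≤ entryMax M.Gam * (β * M.K) / (2 * (M.Q * M.h)) := by
  have h1 := le_entryMax M.Gam l k
  have h2 := hM.row_lower k
  have h3 := hM.one_le_h
  have h4 := M.four_le_castQ
  have h5 := M.two_le_castK
  have h6 := hM.one_le_β
  simp only [Gam] at h1
  rw [div_le_iff₀ (by positivity)] at h2
  rw [le_div_iff₀ (by positivity)]
  calc M.P k l * (2 * (M.Q * M.h)) ≤ M.P k l * (clusterSize M.y k * (β * M.K)) :=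
        mul_le_mul_of_nonneg_left h2 (M.P_mem k l).1
    _ = clusterSize M.y k * M.P k l * (β * M.K) := by ring
    _ ≤ _ := mul_le_mul_of_nonneg_right h1 (by positivity)

theorem I_le (hM : M.Regime β ω) : infoMin M.Lam ≤ M.L * entryMax M.Lam := by
  have hne : (0 : Fin M.K) ≠ ⟨1, by have := M.two_le_K; omega⟩ := by
    intro h
    have := congrArg Fin.val h
    simp at this
  refine (infoMin_le M.Lam hne).trans (info_le (fun k l => by linarith [hM.Lam_ge_two k l])
    (le_entryMax _) _ _)

theorem J_le (hM : M.Regime β ω) : infoMin M.Gam ≤ M.K * entryMax M.Gam := by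
  have hne : (0 : Fin M.L) ≠ ⟨1, by have := M.two_le_L; omega⟩ := by
    intro h
    have := congrArg Fin.val h
    simp at this
  exact (infoMin_le M.Gam hne).trans (info_le hM.Gam_pos (le_entryMax _) _ _)

theorem initRate_nonneg (hM : M.Regime β ω) : 0 ≤ M.initRate β ω := by
  have h1 := hM.one_le_β
  have h2 := hM.one_le_ω
  have h3 := hM.X_ge_two
  have h4 := hM.Y_pos
  have h5 := hM.info_Lam_pos
  have h6 := hM.info_Gam_pos
  have h7 := M.two_le_castK
  have h8 := M.two_le_castL
  unfold initRate
  positivity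

theorem initRate_mul_le (hM : M.Regime β ω) {B m : ℝ} (hB : 0 < B)
    (hm : min (infoMin M.Lam / (8 * M.L * entryMax M.Lam)) (infoMin M.Gam / (16 * M.K * entryMax M.Gam))
      ≤ m / (8 * B)) (hm0 : 0 ≤ m) : M.initRate β ω * ω ≤ m / (3072 * B) := by
  have h1 := hM.one_le_β
  have h2 := hM.one_le_ω
  have e : M.initRate β ω * ω = 1 / (384 * β ^ 2) *
      min (infoMin M.Lam / (8 * M.L * entryMax M.Lam))
        (infoMin M.Gam / (16 * M.K * entryMax M.Gam)) := by
    unfold initRate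
    field_simp
  rw [e]
  have h3 : 1 / (384 * β ^ 2) ≤ 1 / 384 := by
    apply one_div_le_one_div_of_le (by norm_num)
    nlinarith
  calc _ ≤ 1 / (384 * β ^ 2) * (m / (8 * B)) := mul_le_mul_of_nonneg_left hm (by positivity)
    _ ≤ 1 / 384 * (m / (8 * B)) := mul_le_mul_of_nonneg_right h3 (by positivity)
    _ = m / (3072 * B) := by
      field_simp
      ring

theorem initRate_mul_le_row (hM : M.Regime β ω) :
    M.initRate β ω * ω ≤ infoMin M.Lam / (3072 * (M.L * entryMax M.Lam)) := by
  have h3 := hM.X_ge_two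
  have h8 := M.two_le_castL
  refine hM.initRate_mul_le (by positivity) ((min_le_left _ _).trans (le_of_eq ?_))
    hM.info_Lam_pos.le
  ring_nf

theorem initRate_mul_le_col (hM : M.Regime β ω) :
    M.initRate β ω * ω ≤ infoMin M.Gam / (3072 * (M.K * entryMax M.Gam)) := by
  have h3 := hM.Y_pos
  have h8 := M.two_le_castK
  have h6 := hM.info_Gam_pos
  refine hM.initRate_mul_le (by positivity) ((min_le_right _ _).trans ?_)
    hM.info_Gam_pos.le
  apply div_le_div_of_nonneg_left h6.le (by positivity)
  nlinarith [mul_pos (show (0 : ℝ) < M.K by linarith) h3]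

theorem initRate_le (hM : M.Regime β ω) : M.initRate β ω ≤ 1 / 3072 := by
  have h1 := hM.initRate_mul_le_row
  have h2 := hM.one_le_ω
  have h3 := hM.X_ge_two
  have h8 := M.two_le_castL
  have h4 := hM.initRate_nonneg
  have h5 : infoMin M.Lam / (3072 * (M.L * entryMax M.Lam)) ≤ 1 / 3072 := by
    rw [div_le_div_iff₀ (by positivity) (by norm_num)]
    linarith [hM.I_le]
  nlinarith

theorem valid (hM : M.Regime β ω) : M.Valid (M.tuning β ω) := by
  have h1 := hM.one_le_β
  have h2 := hM.one_le_ω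
  have hX := hM.X_ge_two
  have hY := hM.Y_pos
  have hK := M.two_le_castK
  have hL := M.two_le_castL
  have hQ := M.four_le_castQ
  have hh := hM.one_le_h
  have hw := hM.one_le_w
  have hI := hM.info_Lam_pos
  have hJ := hM.info_Gam_pos
  have hγ0 := hM.initRate_nonneg
  have hγ := hM.initRate_le
  have hLX : (4 : ℝ) ≤ M.L * entryMax M.Lam := by nlinarith
  have hs : 0 < (M.h : ℝ) / (β * M.K) := by positivity
  have hs' : 0 < (M.w : ℝ) / (β * M.L) := by positivity
  set s := (M.h : ℝ) / (β * M.K) with hsd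
  have eθ : (M.tuning β ω).θ * M.h = s / (1000 * (M.Q * M.L * ω * entryMax M.Lam)) := by
    simp only [tuning, hsd]
    field_simp
  have hθ4 : (M.tuning β ω).θ * M.h ≤ s / 1000 := by
    rw [eθ]
    apply div_le_div_of_nonneg_left hs.le (by norm_num)
    have : 1 ≤ M.Q * M.L * ω * entryMax M.Lam := by
      have a1 : (1 : ℝ) ≤ M.Q * M.L := by nlinarith
      have a2 : 1 ≤ M.Q * M.L * ω := by nlinarith
      nlinarith
    linarith
  have ecr : (M.tuning β ω).cr * (2 * M.h) = 2 * (M.initRate β ω * s) := by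
    simp only [tuning, hsd]
    field_simp
  have ecc : (M.tuning β ω).cc * (2 * M.w) = 2 * (M.initRate β ω * (M.w / (β * M.L))) := by
    simp only [tuning]
    field_simp
  have hγs : M.initRate β ω * s ≤ 1 / 3072 * s := mul_le_mul_of_nonneg_right hγ hs.le
  have hγs' : M.initRate β ω * (M.w / (β * M.L)) ≤ 1 / 3072 * (M.w / (β * M.L)) :=
    mul_le_mul_of_nonneg_right hγ hs'.le
  have hν : (M.tuning β ω).ν = 9 / 10 * s := rfl
  have hν' : (M.tuning β ω).ν' = 9 / 10 * (M.w / (β * M.L)) := rfl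
  refine ⟨hM.h_pos, hM.w_pos, ?_, ?_, ?_, hM.P_pos, hM.z_pos, hM.ratio_row, hM.ratio_col, ?_, ?_, ?_,
    ?_, ?_, ?_, ?_, ?_, ?_, ?_⟩
  · simp only [tuning]
    positivity
  · rw [hν]
    positivity
  · rw [hν']
    positivity
  · simp only [tuning]
    rw [div_le_div_iff₀ (by positivity) (by norm_num)]
    linarith [hM.I_le, show 0 < M.L * entryMax M.Lam by positivity]
  · simp only [tuning]
    rw [div_le_div_iff₀ (by positivity) (by norm_num)]
    linarith [hM.J_le, show 0 < M.K * entryMax M.Gam by positivity]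
  · simp only [tuning]
    rw [div_le_div_iff₀ (by positivity) (by norm_num)]
    linarith
  · intro k
    rw [hν]
    have := hM.row_lower k
    have e : 2 * ((M.Q : ℝ) * M.h) / (β * M.K) = 2 * M.Q * s := by rw [hsd]; ring
    rw [e] at this
    gcongr
    rw [le_div_iff₀ (by positivity)]
    linarith
  · intro l
    rw [hν']
    have := hM.col_lower l
    refine mul_le_mul_of_nonneg_left ?_ (by norm_num)
    rw [le_div_iff₀ (by positivity)]
    refine le_trans (le_of_eq ?_) this
    ring
  · rw [hν]
    linarith
  · intro k l
    rw [eθ, hν]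
    have hΛ := hM.X_le k l
    have hΛ0 : 0 < M.Lam k l := by linarith [hM.Lam_ge_two k l]
    set X := entryMax M.Lam
    have a1 : (M.Q : ℝ) * (4 * (s / (1000 * (M.Q * M.L * ω * X))) / (9 / 10 * s))
        = 1 / (225 * (M.L * X)) * (1 / ω) := by
      field_simp
      norm_num
    have a2 : 2 * (s / (1000 * (M.Q * M.L * ω * X))) / (9 / 10 * s) * (2 * M.Lam k l)
        = 1 / (225 * (M.L * X)) * (M.Lam k l / (M.Q * ω)) := by
      field_simp
      norm_num
    have a3 : (M.tuning β ω).δ * M.Lam k l = 1 / (225 * (M.L * X)) * (225 / 2 * M.Lam k l) := by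
      change 1 / (2 * (M.L * X)) * _ = _
      field_simp
    rw [a1, a2, a3, ← mul_add]
    gcongr
    have b1 : 1 / ω ≤ 1 := (div_le_one (by positivity)).2 h2
    have b2 : M.Lam k l / (M.Q * ω) ≤ M.Lam k l := div_le_self hΛ0.le (by nlinarith)
    linarith [hM.Lam_ge_two k l]
  · rw [ecr, hν]
    linarith
  · rw [ecc, hν']
    linarith
  · rw [ecr, hν]
    have : (M.tuning β ω).d = s / 16 := by
      simp only [tuning, hsd]
      field_simp
    rw [this]
    linarith

end Regime

end BlockModel

/-! ### Probabilities of the unfavourable outcomes of a pass -/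

section Prelim

variable {ι : Type} [Fintype ι] [DecidableEq ι]

theorem EB_lin (p a : ι → ℝ) : EB p (lin a) = ∑ i, p i * a i := by
  have h1 : lin a = fun x : ι → Bool => ∑ i, if x i = true then a i else 0 := rfl
  rw [h1, EB_finset_sum]
  refine Finset.sum_congr rfl fun i _ => ?_
  have h2 := EB_prod p fun i' c => if i' = i then (if c = true then a i else 0) else 1
  have h3 : ∀ x : ι → Bool, ∏ i', (if i' = i then (if x i' = true then a i else 0) else 1)
      = if x i = true then a i else 0 := fun x => by simp
  simp only [h3] at h2
  rw [h2, Finset.prod_eq_single i]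
  · simp
  · intro j _ hj
    simp [hj]
  · simp

theorem EB_add (p : ι → ℝ) (f g : (ι → Bool) → ℝ) :
    EB p (fun x => f x + g x) = EB p f + EB p g := by
  simp only [EB, mul_add, Finset.sum_add_distrib]

theorem PB_and_le {p : ι → ℝ} {G : Prop}
    {E : (ι → Bool) → Prop} {c : ℝ} (hc : 0 ≤ c) (h : G → PB p E ≤ c) :
    PB p (fun x => G ∧ E x) ≤ c := by
  classical
  by_cases hG : G
  · simpa only [hG, true_and] using h hG
  · refine le_trans (le_of_eq ?_) hc
    simp only [PB, hG, false_and, if_false]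
    exact EB_const p 0

/-- Markov's inequality for a real statistic on an event. -/
theorem prob_and_not_le_le {α : Type} (p : PMF α) {G : α → Prop} {f : α → ℝ} {θ c : ℝ} (hθ : 0 < θ)
    (h : ex p ({a | G a}.indicator fun a => ENNReal.ofReal (f a)) ≤ ENNReal.ofReal c) :
    prob p {a | G a ∧ ¬ f a ≤ θ} ≤ ENNReal.ofReal (c / θ) := by
  have h1 := (mul_prob_and_le_ex p G (fun a => ENNReal.ofReal (f a)) (ENNReal.ofReal θ)).trans h
  have h2 : prob p {a | G a ∧ ¬ f a ≤ θ}
      ≤ prob p {a | G a ∧ ENNReal.ofReal θ ≤ ENNReal.ofReal (f a)} :=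
    prob_mono p fun a ha => ⟨ha.1, ENNReal.ofReal_le_ofReal (not_le.1 ha.2).le⟩
  rw [ENNReal.ofReal_div_of_pos hθ]
  rw [ENNReal.le_div_iff_mul_le (Or.inl (by simpa using hθ)) (Or.inl ENNReal.ofReal_ne_top), mul_comm]
  exact (mul_le_mul_right h2 _).trans h1

/-- Union bound over three indices. -/
theorem prob_exists_prod_le {α : Type} {a b c : ℕ} (p : PMF α)
    (E : Fin a → Fin b → Fin c → α → Prop) {r : ℝ}
    (h : ∀ i j k, prob p {x | E i j k x} ≤ ENNReal.ofReal r) :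
    prob p {x | ∃ i j k, E i j k x} ≤ ENNReal.ofReal (a * b * c * r) := by
  have h1 := prob_exists_le_card p (fun (t : Fin a × Fin b × Fin c) x => E t.1 t.2.1 t.2.2 x)
    fun t => h t.1 t.2.1 t.2.2
  refine le_trans (prob_mono p ?_) (h1.trans (le_of_eq ?_))
  · rintro x ⟨i, j, k, hx⟩
    exact ⟨(i, j, k), hx⟩
  · simp only [Fintype.card_prod, Fintype.card_fin]
    rw [ENNReal.ofReal_mul (by positivity), ← Nat.cast_mul, ← Nat.cast_mul, ENNReal.ofReal_natCast,
      mul_assoc]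

end Prelim

namespace BlockModel

variable {M : BlockModel} {β ω : ℝ}

/-- All row clusters have about the expected size in all blocks. The split and the partition of a half
compose to a uniform choice of a block of rows. -/
theorem prob_joint_rowSize (hM : M.Regime β ω) (S : Initializer M.K M.L M.h M.w) (b : Fin 2) :
    prob (M.joint S b) {x | ∃ (_ : Fin 1) (q : Fin M.Q) (k : Fin M.K),
      ¬ |(clusterSize (M.rowLab x.2.1 b x.2.2.e q) k : ℝ) - clusterSize M.y k / (2 * M.Q)|
        ≤ 1 / 10 * (clusterSize M.y k / (2 * M.Q))}
      ≤ ENNReal.ofReal ((1 : ℕ) * M.Q * M.K * (100 * β * M.K / M.h)) := by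
  refine prob_exists_prod_le _ _ fun _ q k => ?_
  rw [prob_eq_ex, ex_joint]
  simp only [Set.indicator, Set.mem_ofPred_eq, ex_const]
  rw [ex_comm]
  refine ex_le_of_forall fun e => ?_
  have hne : Nonempty (Fin M.h) := ⟨⟨0, hM.h_pos⟩⟩
  have h := prob_clusterSize_block_le (α := Fin (2 * (M.Q * M.h))) (β := Fin 2 × Fin (M.Q * M.h))
    M.y k (hM.y_pos k) (fun i : Fin M.h => ((b, e.symm (q, i)) : Fin 2 × Fin (M.Q * M.h)))
    (fun i i' hii => by simpa using hii)
  have hQ := M.four_le_castQ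
  have hh := hM.one_le_h
  have hn : (0 : ℝ) < clusterSize M.y k := by exact_mod_cast hM.y_pos k
  have e1 : (clusterSize M.y k : ℝ) * Fintype.card (Fin M.h) / Fintype.card (Fin (2 * (M.Q * M.h)))
      = clusterSize M.y k / (2 * M.Q) := by
    rw [Fintype.card_fin, Fintype.card_fin]
    push_cast
    field_simp
  rw [e1, prob_eq_ex] at h
  refine le_trans (le_of_eq ?_) (h.trans (ENNReal.ofReal_le_ofReal ?_))
  · refine congrArg _ (funext fun s => ?_)
    simp only [Set.indicator, Set.mem_ofPred_eq]
    congr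
  · rw [Fintype.card_fin, Fintype.card_fin]
    push_cast
    have h1 := hM.row_lower k
    have hβ := hM.one_le_β
    have hK := M.two_le_castK
    rw [div_le_iff₀ (by positivity)] at h1
    rw [div_le_div_iff₀ (by positivity) (by positivity)]
    have h2 : (0 : ℝ) < M.h := by linarith
    nlinarith

theorem prob_joint_colSize (hM : M.Regime β ω) (S : Initializer M.K M.L M.h M.w) (b : Fin 2) :
    prob (M.joint S b) {x | ∃ (_ : Fin 1) (q : Fin M.Q) (l : Fin M.L),
      ¬ |(clusterSize (M.colLab x.2.2.f q) l : ℝ) - clusterSize M.z l / M.Q|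
        ≤ 1 / 10 * (clusterSize M.z l / M.Q)}
      ≤ ENNReal.ofReal ((1 : ℕ) * M.Q * M.L * (100 * β * M.L / M.w)) := by
  refine prob_exists_prod_le _ _ fun _ q l => ?_
  rw [prob_eq_ex, ex_joint]
  simp only [Set.indicator, Set.mem_ofPred_eq, ex_const]
  have hne : Nonempty (Fin M.w) := ⟨⟨0, hM.w_pos⟩⟩
  have h := prob_clusterSize_block_le (α := Fin (M.Q * M.w)) (β := Fin M.Q × Fin M.w)
    M.z l (hM.z_pos l) (fun j : Fin M.w => ((q, j) : Fin M.Q × Fin M.w))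
    (fun i i' hii => by simpa using hii)
  have hQ := M.four_le_castQ
  have hh := hM.one_le_w
  have hn : (0 : ℝ) < clusterSize M.z l := by exact_mod_cast hM.z_pos l
  have e1 : (clusterSize M.z l : ℝ) * Fintype.card (Fin M.w) / Fintype.card (Fin (M.Q * M.w))
      = clusterSize M.z l / M.Q := by
    rw [Fintype.card_fin, Fintype.card_fin]
    push_cast
    field_simp
  rw [e1, prob_eq_ex] at h
  refine le_trans (le_of_eq ?_) (h.trans (ENNReal.ofReal_le_ofReal ?_))
  · refine congrArg _ (funext fun s => ?_)
    simp only [Set.indicator, Set.mem_ofPred_eq]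
    congr
  · rw [Fintype.card_fin, Fintype.card_fin]
    push_cast
    have h1 := hM.col_lower l
    have hβ := hM.one_le_β
    have hK := M.two_le_castL
    rw [div_le_iff₀ (by positivity)] at h1
    rw [div_le_div_iff₀ (by positivity) (by positivity)]
    have h2 : (0 : ℝ) < M.w := by linarith
    nlinarith

section Facts

variable {s : Split M.Q M.h} {b : Fin 2} {e : Fin (M.Q * M.h) ≃ Fin M.Q × Fin M.h}
  {f : Fin (M.Q * M.w) ≃ Fin M.Q × Fin M.w}

theorem Lam_div_Q (k : Fin M.K) (l : Fin M.L) :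
    M.Lam k l / M.Q = M.P k l * (clusterSize M.z l / M.Q) := by
  rw [Lam, mul_div_assoc]

theorem Sized.blockMean_le (h : M.Sized s b e f) (q k l) :
    blockMean M.P (M.colLab f q) k l ≤ 11 / 10 * (entryMax M.Lam / M.Q) := by
  have h1 := abs_le.1 (h.2 q l)
  have h2 : M.P k l * (clusterSize (M.colLab f q) l : ℝ)
      ≤ M.P k l * (11 / 10 * (clusterSize M.z l / M.Q)) :=
    mul_le_mul_of_nonneg_left (by linarith) (M.P_mem k l).1
  have h3 : M.Lam k l / M.Q ≤ entryMax M.Lam / M.Q := by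
    gcongr
    exact le_entryMax _ k l
  rw [M.Lam_div_Q] at h3
  rw [blockMean]
  linarith

theorem Sized.le_blockMean (hM : M.Regime β ω) (h : M.Sized s b e f) (q k l) :
    9 / 10 * (entryMax M.Lam / (ω * M.Q)) ≤ blockMean M.P (M.colLab f q) k l := by
  have h1 := abs_le.1 (h.2 q l)
  have hω := hM.one_le_ω
  have hQ := M.four_le_castQ
  have h2 : M.P k l * (9 / 10 * (clusterSize M.z l / M.Q))
      ≤ M.P k l * (clusterSize (M.colLab f q) l : ℝ) :=
    mul_le_mul_of_nonneg_left (by linarith) (M.P_mem k l).1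
  have h3 : entryMax M.Lam / (ω * M.Q) ≤ M.Lam k l / M.Q := by
    rw [div_le_div_iff₀ (by positivity) (by positivity)]
    nlinarith [hM.X_le k l]
  rw [M.Lam_div_Q] at h3
  rw [blockMean]
  linarith

theorem Gam_div_Q (l : Fin M.L) (k : Fin M.K) :
    M.Gam l k / (2 * M.Q) = M.P k l * (clusterSize M.y k / (2 * M.Q)) := by
  rw [Gam]
  ring

theorem Sized.blockMean_transpose_le (h : M.Sized s b e f) (q l k) :
    blockMean M.P.transpose (M.rowLab s b e q) l k ≤ 11 / 10 * (entryMax M.Gam / (2 * M.Q)) := by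
  have h1 := abs_le.1 (h.1 q k)
  have h2 : M.P k l * (clusterSize (M.rowLab s b e q) k : ℝ)
      ≤ M.P k l * (11 / 10 * (clusterSize M.y k / (2 * M.Q))) :=
    mul_le_mul_of_nonneg_left (by linarith) (M.P_mem k l).1
  have h3 : M.Gam l k / (2 * M.Q) ≤ entryMax M.Gam / (2 * M.Q) := by
    gcongr
    exact le_entryMax _ l k
  rw [M.Gam_div_Q] at h3
  rw [blockMean, Matrix.transpose_apply]
  linarith

theorem Sized.le_blockMean_transpose (hM : M.Regime β ω) (h : M.Sized s b e f) (q l k) :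
    9 / 10 * (entryMax M.Gam / (ω * (2 * M.Q))) ≤ blockMean M.P.transpose (M.rowLab s b e q) l k := by
  have h1 := abs_le.1 (h.1 q k)
  have hω := hM.one_le_ω
  have hQ := M.four_le_castQ
  have h2 : M.P k l * (9 / 10 * (clusterSize M.y k / (2 * M.Q)))
      ≤ M.P k l * (clusterSize (M.rowLab s b e q) k : ℝ) :=
    mul_le_mul_of_nonneg_left (by linarith) (M.P_mem k l).1
  have h3 : entryMax M.Gam / (ω * (2 * M.Q)) ≤ M.Gam l k / (2 * M.Q) := by
    rw [div_le_div_iff₀ (by positivity) (by positivity)]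
    nlinarith [hM.Y_le l k]
  rw [M.Gam_div_Q] at h3
  rw [blockMean, Matrix.transpose_apply]
  linarith

theorem InitOk.card_row (hM : M.Regime β ω) {V : M.Vw} (h : M.InitOk (M.tuning β ω) s b V) (q) :
    ((errSet (rowCanon (M.rowLab s b V.e) V.u q) (M.rowLab s b V.e q)).card : ℝ)
      ≤ 20 / 9 * (M.initRate β ω * (M.tuning β ω).ν) := by
  refine (card_errSet_rowCanon_le h.1 q).trans (le_of_eq ?_)
  have := hM.one_le_β
  have := M.two_le_castK
  simp only [tuning]
  field_simp
  ring

theorem InitOk.card_col (hM : M.Regime β ω) {V : M.Vw} (h : M.InitOk (M.tuning β ω) s b V) (q) :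
    ((errSet (colCanon (M.colLab V.f) V.v q) (M.colLab V.f q)).card : ℝ)
      ≤ 20 / 9 * (M.initRate β ω * (M.tuning β ω).ν') := by
  refine (card_errSet_colCanon_le h.2 q).trans (le_of_eq ?_)
  have := hM.one_le_β
  have := M.two_le_castL
  simp only [tuning]
  field_simp
  ring

theorem InitOk.mul_card_col (hM : M.Regime β ω) {V : M.Vw} (h : M.InitOk (M.tuning β ω) s b V) (q) :
    entryMax M.Lam * (β * M.L) / (M.Q * M.w)
        * (errSet (colCanon (M.colLab V.f) V.v q) (M.colLab V.f q)).card
      ≤ 2 * (M.initRate β ω * entryMax M.Lam / M.Q) := by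
  have h1 := hM.one_le_β
  have h2 := M.two_le_castL
  have h3 := M.four_le_castQ
  have h4 := hM.one_le_w
  have h5 := hM.X_ge_two
  refine (mul_le_mul_of_nonneg_left (h.card_col hM q) (by positivity)).trans (le_of_eq ?_)
  simp only [tuning]
  field_simp
  ring

theorem InitOk.mul_card_row (hM : M.Regime β ω) {V : M.Vw} (h : M.InitOk (M.tuning β ω) s b V) (q) :
    entryMax M.Gam * (β * M.K) / (2 * (M.Q * M.h))
        * (errSet (rowCanon (M.rowLab s b V.e) V.u q) (M.rowLab s b V.e q)).card
      ≤ 2 * (M.initRate β ω * entryMax M.Gam / (2 * M.Q)) := by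
  have h1 := hM.one_le_β
  have h2 := M.two_le_castK
  have h3 := M.four_le_castQ
  have h4 := hM.one_le_h
  have h5 := hM.Y_pos
  refine (mul_le_mul_of_nonneg_left (h.card_row hM q) (by positivity)).trans (le_of_eq ?_)
  simp only [tuning]
  field_simp
  ring

end Facts

end BlockModel

namespace BlockModel

variable {M : BlockModel} {β ω : ℝ}

/-- The bound for the failure of the preliminary row mean parameter estimates. -/
def failRowMean (M : BlockModel) (β ω : ℝ) : ℝ :=
  M.Q * M.K * M.L * (2 * Real.exp (-((infoMin M.Lam / (40 * (M.L * entryMax M.Lam))) ^ 2 *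
    ((M.tuning β ω).ν * (9 / 10 * (entryMax M.Lam / (ω * M.Q)))) / 16)))

/-- The bound for the failure of the preliminary column mean parameter estimates. -/
def failColMean (M : BlockModel) (β ω : ℝ) : ℝ :=
  M.Q * M.L * M.K * (2 * Real.exp (-((infoMin M.Gam / (40 * (M.K * entryMax M.Gam))) ^ 2 *
    ((M.tuning β ω).ν' * (9 / 10 * (entryMax M.Gam / (ω * (2 * M.Q))))) / 16)))

/-- The preliminary row mean parameters are accurate: the block `(q, q + 2)` from which they are
estimated is independent of the initial labels. -/
theorem prob_joint_rowMean (hM : M.Regime β ω) (S : Initializer M.K M.L M.h M.w) (b : Fin 2) :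
    prob (M.joint S b) {x | ∃ q k l, (M.Sized x.2.1 b x.2.2.e x.2.2.f ∧
        M.InitOk (M.tuning β ω) x.2.1 b x.2.2) ∧
      ¬ |meanEst (block (half x.1 x.2.1 b) x.2.2.e x.2.2.f q (q + 2))
          (rowCanon (M.rowLab x.2.1 b x.2.2.e) x.2.2.u q) (colCanon (M.colLab x.2.2.f) x.2.2.v (q + 2))
          k l - blockMean M.P (M.colLab x.2.2.f (q + 2)) k l|
        ≤ (M.tuning β ω).δ₁ * blockMean M.P (M.colLab x.2.2.f (q + 2)) k l}
      ≤ ENNReal.ofReal (M.failRowMean β ω) := by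
  refine prob_exists_prod_le _ _ fun q k l => prob_joint_le S b fun s e f => ?_
  have hq := add_two_three_ne M.four_le_Q q
  refine ex_prob_le S (avoids_blockSet hq.1 hq.2.1)
    (fun t : Fin M.h × Fin M.w => (s.symm (b, e.symm (q, t.1)), f.symm (q + 2, t.2)))
    (fun t t' h => by simpa [Prod.ext_iff] using h) (fun t => ⟨t, rfl⟩)
    (fun _ uv x => (M.Sized s b e f ∧ M.InitOk (M.tuning β ω) s b ⟨e, f, uv.1, uv.2⟩) ∧
      ¬ |meanEst (toMat x) (rowCanon (M.rowLab s b e) uv.1 q) (colCanon (M.colLab f) uv.2 (q + 2)) k l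
        - blockMean M.P (M.colLab f (q + 2)) k l|
        ≤ (M.tuning β ω).δ₁ * blockMean M.P (M.colLab f (q + 2)) k l)
    (fun _ _ _ => rfl) fun A uv => ?_
  refine PB_and_le (by positivity) fun hG => ?_
  have hL := M.two_le_castL
  have hQ := M.four_le_castQ
  exact PB_meanEst_block_le (P := M.P) (y := M.rowLab s b e q) (z := M.colLab f (q + 2)) M.P_mem
    hM.P_le_X (by linarith [hM.X_ge_two]) hM.one_le_ω (by linarith) hM.valid.ν_pos hM.info_Lam_pos
    hM.I_le (by have := M.two_le_L; omega) hM.initRate_nonneg hM.initRate_mul_le_row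
    (hG.1.blockMean_le _) (hG.1.le_blockMean hM _) (hM.valid.row_size hG.1 q) (hG.2.card_row hM q)
    (hG.2.mul_card_col hM (q + 2)) k l

theorem prob_joint_colMean (hM : M.Regime β ω) (S : Initializer M.K M.L M.h M.w) (b : Fin 2) :
    prob (M.joint S b) {x | ∃ q l k, (M.Sized x.2.1 b x.2.2.e x.2.2.f ∧
        M.InitOk (M.tuning β ω) x.2.1 b x.2.2) ∧
      ¬ |meanEst (block (half x.1 x.2.1 b) x.2.2.e x.2.2.f (q - 2) q).transpose
          (colCanon (M.colLab x.2.2.f) x.2.2.v q) (rowCanon (M.rowLab x.2.1 b x.2.2.e) x.2.2.u (q - 2))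
          l k - blockMean M.P.transpose (M.rowLab x.2.1 b x.2.2.e (q - 2)) l k|
        ≤ (M.tuning β ω).δ₂ * blockMean M.P.transpose (M.rowLab x.2.1 b x.2.2.e (q - 2)) l k}
      ≤ ENNReal.ofReal (M.failColMean β ω) := by
  refine prob_exists_prod_le _ _ fun q l k => prob_joint_le S b fun s e f => ?_
  have hq := add_two_three_ne M.four_le_Q (q - 2)
  simp only [sub_add_cancel] at hq
  refine ex_prob_le S (avoids_blockSet hq.1 hq.2.1)
    (fun t : Fin M.w × Fin M.h => (s.symm (b, e.symm (q - 2, t.2)), f.symm (q, t.1)))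
    (fun t t' h => by simpa [Prod.ext_iff, and_comm] using h) (fun t => ⟨t.swap, rfl⟩)
    (fun _ uv x => (M.Sized s b e f ∧ M.InitOk (M.tuning β ω) s b ⟨e, f, uv.1, uv.2⟩) ∧
      ¬ |meanEst (toMat x) (colCanon (M.colLab f) uv.2 q) (rowCanon (M.rowLab s b e) uv.1 (q - 2)) l k
        - blockMean M.P.transpose (M.rowLab s b e (q - 2)) l k|
        ≤ (M.tuning β ω).δ₂ * blockMean M.P.transpose (M.rowLab s b e (q - 2)) l k)
    (fun _ _ _ => rfl) fun A uv => ?_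
  refine PB_and_le (by positivity) fun hG => ?_
  have hK := M.two_le_castK
  have hQ := M.four_le_castQ
  exact PB_meanEst_block_le (P := M.P.transpose) (y := M.colLab f q)
    (z := M.rowLab s b e (q - 2)) (fun l k => M.P_mem k l)
    (fun l k => hM.P_le_Y k l) hM.Y_pos hM.one_le_ω (by linarith) hM.valid.ν'_pos
    hM.info_Gam_pos hM.J_le (by have := M.two_le_K; omega) hM.initRate_nonneg hM.initRate_mul_le_col
    (hG.1.blockMean_transpose_le _) (hG.1.le_blockMean_transpose hM _)
    (hM.valid.col_size hG.1 q) (hG.2.card_col hM q) (hG.2.mul_card_row hM (q - 2)) l k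

/-- The bound for the failure of the global mean parameter estimate. -/
def failAllMean (M : BlockModel) (β ω : ℝ) : ℝ :=
  (1 : ℕ) * M.K * M.L * (2 * Real.exp (-((M.tuning β ω).δ ^ 2 * entryMin M.Lam /
    (4 * (1 / (M.tuning β ω).ν)))))

/-- An event on the matrix alone. -/
theorem ex_prob_const_le (S : Initializer M.K M.L M.h M.w) {s : Split M.Q M.h} {b : Fin 2} {e f}
    {T : Type} [Fintype T] [DecidableEq T] (φ : T → Fin (2 * (M.Q * M.h)) × Fin (M.Q * M.w))
    (hφ : Function.Injective φ) (E : (T → Bool) → Prop) {c : ℝ}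
    (hc : PB (fun t => M.P (M.y (φ t).1) (M.z (φ t).2)) E ≤ c) :
    ex M.sbm (fun A => prob (initLaw S (block (half A s b) e f))
      {_uv | E fun t => A (φ t).1 (φ t).2}) ≤ ENNReal.ofReal c := by
  have h1 : ex M.sbm (fun A => prob (initLaw S (block (half A s b) e f))
      {_uv | E fun t => A (φ t).1 (φ t).2}) ≤ prob M.sbm {A | E fun t => A (φ t).1 (φ t).2} := by
    rw [prob_eq_ex]
    refine ex_mono fun A _ => ?_
    by_cases hE : E fun t => A (φ t).1 (φ t).2
    · refine (prob_le_one _ _).trans (le_of_eq ?_)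
      simp [hE]
    · simp [hE, prob_eq_ex, ex_const]
  refine h1.trans ?_
  have h2 := prob_matrix_entries (fun i j => bern (M.P (M.y i) (M.z j)) (M.P_mem (M.y i) (M.z j)))
    φ hφ E
  have h3 := prob_bern (p := fun t => M.P (M.y (φ t).1) (M.z (φ t).2)) (fun t => M.P_mem _ _) E
  exact (h2.trans h3).le.trans (ENNReal.ofReal_le_ofReal hc)

/-- With the true labels the global mean parameter estimate is accurate. Its blocks `(q, q + 3)` are
disjoint, and the true labels are deterministic once the partition is given. -/
theorem prob_joint_allMean (hM : M.Regime β ω) (S : Initializer M.K M.L M.h M.w) (b : Fin 2) :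
    prob (M.joint S b) {x | ∃ (_ : Fin 1) (k : Fin M.K) (l : Fin M.L),
      M.Sized x.2.1 b x.2.2.e x.2.2.f ∧
      ¬ |∑ q, meanEst (block (half x.1 x.2.1 b) x.2.2.e x.2.2.f q (q + 3))
          (M.rowLab x.2.1 b x.2.2.e q) (M.colLab x.2.2.f (q + 3)) k l - M.Lam k l|
        ≤ (M.tuning β ω).δ * M.Lam k l}
      ≤ ENNReal.ofReal (M.failAllMean β ω) := by
  refine prob_exists_prod_le _ _ fun _ k l => prob_joint_le S b fun s e f => ?_
  refine ex_prob_const_le S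
    (fun t : Fin M.Q × Fin M.h × Fin M.w =>
      (s.symm (b, e.symm (t.1, t.2.1)), f.symm (t.1 + 3, t.2.2)))
    (fun t t' h => by
      simp only [Prod.mk.injEq, EmbeddingLike.apply_eq_iff_eq, true_and] at h
      exact Prod.ext h.1.1 (Prod.ext h.1.2 h.2.2))
    (fun x => M.Sized s b e f ∧ ¬ |∑ q, meanEst (toMat fun t => x (q, t))
          (M.rowLab s b e q) (M.colLab f (q + 3)) k l - M.Lam k l|
        ≤ (M.tuning β ω).δ * M.Lam k l) ?_
  refine PB_and_le (by positivity) fun hG => ?_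
  have hν := hM.valid.ν_pos
  have hpos : ∀ q, (0 : ℝ) < clusterSize (M.rowLab s b e q) k :=
    fun q => hν.trans_le (hM.valid.row_size hG q k)
  have hΛ : 0 < M.Lam k l := by linarith [hM.Lam_ge_two k l]
  have h := PB_sum_meanEst_le (P := M.P) (y := M.rowLab s b e) (z := fun q => M.colLab f (q + 3))
    M.P_mem (k := k) (l := l) (μ := M.Lam k l) (W := 1 / (M.tuning β ω).ν) (δ := (M.tuning β ω).δ)
    hΛ (by positivity) (fun q => by exact_mod_cast hpos q)
    (fun q => one_div_le_one_div_of_le hν (hM.valid.row_size hG q k)) ?_ ?_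
    (by linarith [hM.valid.δ_le])
  · refine h.trans ?_
    gcongr
    exact entryMin_le _ k l
  · rw [← Finset.mul_sum]
    have h1 : ∑ q, (clusterSize (M.colLab f (q + 3)) l : ℝ) = clusterSize M.z l := by
      refine (Equiv.sum_comp (Equiv.addRight 3) fun q => (clusterSize (M.colLab f q) l : ℝ)).trans ?_
      exact_mod_cast sum_clusterSize_block M.z f l
    rw [h1]
    rfl
  · have := hM.X_ge_two
    simp only [tuning]
    positivity

end BlockModel

namespace BlockModel

variable {M : BlockModel} {β ω : ℝ}

/-- The expected number of edges of a row in a block of columns. -/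
theorem sum_P_le (k : Fin M.K)
    (f : Fin (M.Q * M.w) ≃ Fin M.Q × Fin M.w) (q : Fin M.Q) :
    ∑ j, M.P k (M.colLab f q j) ≤ M.L * entryMax M.Lam := by
  have h1 : ∀ l, (clusterSize (M.colLab f q) l : ℝ) * M.P k l ≤ entryMax M.Lam := by
    intro l
    refine le_trans ?_ (le_entryMax _ k l)
    have h2 : clusterSize (M.colLab f q) l ≤ clusterSize M.z l := by
      rw [← sum_clusterSize_block M.z f l]
      exact Finset.single_le_sum (f := fun q => clusterSize (blockLabels M.z f q) l)
        (fun _ _ => Nat.zero_le _) (Finset.mem_univ q)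
    have h3 : (clusterSize (M.colLab f q) l : ℝ) ≤ clusterSize M.z l := by exact_mod_cast h2
    rw [mul_comm]
    exact mul_le_mul_of_nonneg_left h3 (M.P_mem k l).1
  rw [sum_comp_eq_sum_clusterSize (M.colLab f q) fun l => M.P k l]
  refine (Finset.sum_le_sum fun l _ => h1 l).trans ?_
  simp

/-- The expected number of edges between a vertex and a set of vertices on the other side. -/
theorem ex_sbm_degree {T : Type} [Fintype T] [DecidableEq T]
    (φ : T → Fin (2 * (M.Q * M.h)) × Fin (M.Q * M.w)) (hφ : Function.Injective φ) {a r : ℝ}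
    (ha : 0 ≤ a) (hr : 0 ≤ r) :
    ex M.sbm (fun A => ENNReal.ofReal (a + (∑ t, if A (φ t).1 (φ t).2 = true then (1 : ℝ) else 0) / r))
      = ENNReal.ofReal (a + (∑ t, M.P (M.y (φ t).1) (M.z (φ t).2)) / r) := by
  have h := ex_matrix_entries (fun i j => bern (M.P (M.y i) (M.z j)) (M.P_mem (M.y i) (M.z j)))
    φ hφ fun x => ENNReal.ofReal (a + lin (fun _ => 1) x / r)
  have h0 : ∀ x : T → Bool, 0 ≤ lin (fun _ => 1) x := fun x =>
    Finset.sum_nonneg fun t _ => by split_ifs <;> norm_num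
  have h2 := ex_bern (p := fun t => M.P (M.y (φ t).1) (M.z (φ t).2)) (fun t => M.P_mem _ _)
    (f := fun x => a + lin (fun _ => 1) x / r) fun x => by
      have := h0 x
      positivity
  refine (h.trans h2).trans (congrArg _ ?_)
  rw [EB_add, EB_const]
  have h3 : ∀ x : T → Bool, lin (fun _ => (1 : ℝ)) x / r = r⁻¹ * lin (fun _ => 1) x := fun x => by
    rw [div_eq_inv_mul]
  simp only [h3]
  rw [EB_const_mul, EB_lin, div_eq_inv_mul]
  simp

open scoped Classical in
theorem ofReal_badWeight {ι κ : Type} [Fintype ι] [DecidableEq ι] [Fintype κ] (D : Finset ι)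
    (B : Matrix ι κ Bool) {a r : ℝ} (ha : 0 ≤ a) (hr : 0 ≤ r) :
    ENNReal.ofReal (badWeight D B a r)
      = ∑ i, if i ∈ D then ENNReal.ofReal (1 / a + rowDeg B i / r) else 0 := by
  rw [badWeight, ENNReal.ofReal_sum_of_nonneg]
  · rw [← Finset.sum_filter]
    congr 1
    ext i
    simp
  · intro i _
    have : 0 ≤ rowDeg B i := Finset.sum_nonneg fun j _ => by split_ifs <;> norm_num
    positivity

/-- The bound for the weight of the misclassified rows of a block. -/
def failRowWeight (M : BlockModel) (β ω : ℝ) : ℝ :=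
  M.Q * (M.K * Real.exp (-(infoMin M.Lam / (4 * M.Q))) * (1 + M.L * entryMax M.Lam)
    / (M.tuning β ω).θ)

/-- The bound for the weight of the misclassified columns of a block. -/
def failColWeight (M : BlockModel) (β ω : ℝ) : ℝ :=
  M.Q * (M.L * Real.exp (-(infoMin M.Gam / (4 * (2 * M.Q)))) * (1 + M.L * entryMax M.Lam)
    / (M.tuning β ω).θ)

theorem θ_pos (hM : M.Regime β ω) : 0 < (M.tuning β ω).θ := by
  have h1 := hM.one_le_β
  have h2 := hM.one_le_ω
  have h3 := hM.X_ge_two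
  have h4 := M.two_le_castK
  have h5 := M.two_le_castL
  have h6 := M.four_le_castQ
  simp only [tuning]
  positivity

theorem prob_exists_fin_le {α : Type} {a : ℕ} (p : PMF α) (E : Fin a → α → Prop) {r : ℝ}
    (h : ∀ i, prob p {x | E i x} ≤ ENNReal.ofReal r) :
    prob p {x | ∃ i, E i x} ≤ ENNReal.ofReal (a * r) := by
  refine (prob_exists_le_card p E h).trans (le_of_eq ?_)
  rw [ENNReal.ofReal_mul (by positivity), ENNReal.ofReal_natCast, Fintype.card_fin]

open scoped Classical in
/-- Markov bound for the weight of the bad rows of a block. Whether a row is bad is decided by the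
block `(q, q + 2)`, its degree by the independent block `(q, q + 3)`. -/
theorem prob_joint_rowWeight (hM : M.Regime β ω) (S : Initializer M.K M.L M.h M.w) (b : Fin 2) :
    prob (M.joint S b) {x | ∃ q, (M.Sized x.2.1 b x.2.2.e x.2.2.f ∧
        M.InitOk (M.tuning β ω) x.2.1 b x.2.2) ∧
      ¬ badWeight (rowBad M.P (M.tuning β ω).δ₁ (M.tuning β ω).R (M.rowLab x.2.1 b x.2.2.e)
          (M.colLab x.2.2.f) (colCanon (M.colLab x.2.2.f) x.2.2.v)
          (block (half x.1 x.2.1 b) x.2.2.e x.2.2.f) q)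
        (block (half x.1 x.2.1 b) x.2.2.e x.2.2.f q (q + 3)) M.h M.h ≤ (M.tuning β ω).θ}
      ≤ ENNReal.ofReal (M.failRowWeight β ω) := by
  refine prob_exists_fin_le _ _ fun q => prob_and_not_le_le _ (θ_pos hM) ?_
  refine ex_joint_le S b fun s e f => ?_
  have hq := add_two_three_ne M.four_le_Q q
  have hh := hM.one_le_h
  have hX := hM.X_ge_two
  have hL := M.two_le_castL
  have hQ := M.four_le_castQ
  set c : ℝ := M.K * Real.exp (-(infoMin M.Lam / (4 * M.Q))) with hc
  have hc0 : 0 ≤ c := by positivity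
  have hi : ∀ i : Fin M.h, ex M.sbm (fun A => ex (initLaw S (block (half A s b) e f)) fun uv =>
      {x | (M.Sized s b e f ∧ M.InitOk (M.tuning β ω) s b ⟨e, f, uv.1, uv.2⟩) ∧
        badRow M.P (M.colLab f (q + 2))
          (errSet (colCanon (M.colLab f) uv.2 (q + 2)) (M.colLab f (q + 2)))
          (M.tuning β ω).δ₁ (M.tuning β ω).R (M.rowLab s b e q i) x}.indicator
        (fun _ => ENNReal.ofReal (1 / M.h + rowDeg (block (half A s b) e f q (q + 3)) i / M.h))
        fun j => A (s.symm (b, e.symm (q, i))) (f.symm (q + 2, j)))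
      ≤ ENNReal.ofReal (c * ((1 + M.L * entryMax M.Lam) / M.h)) := by
    intro i
    refine (ex_indicator_le S (avoids_blockSet hq.1 hq.2.1)
      (fun j : Fin M.w => (s.symm (b, e.symm (q, i)), f.symm (q + 2, j)))
      (fun t t' h => by simpa using h) (fun t => ⟨(i, t), rfl⟩)
      (fun _ uv x => (M.Sized s b e f ∧ M.InitOk (M.tuning β ω) s b ⟨e, f, uv.1, uv.2⟩) ∧
        badRow M.P (M.colLab f (q + 2))
          (errSet (colCanon (M.colLab f) uv.2 (q + 2)) (M.colLab f (q + 2)))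
          (M.tuning β ω).δ₁ (M.tuning β ω).R (M.rowLab s b e q i) x) (fun _ _ _ => rfl)
      (fun A => ENNReal.ofReal (1 / M.h + rowDeg (block (half A s b) e f q (q + 3)) i / M.h))
      (fun A A' => by rw [block_mixMat fun hc => hq.2.2.2.2 hc.2]) (c := c) fun A uv => ?_).trans ?_
    · refine PB_and_le hc0 fun hG => ?_
      exact PB_badRow_block_le (P := M.P) (Lam := M.Lam) (N := fun l => (clusterSize M.z l : ℝ))
        (z := M.colLab f (q + 2)) (z' := colCanon (M.colLab f) uv.2 (q + 2)) (c₀ := M.Q)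
        (X := entryMax M.Lam) (by have := M.two_le_L; omega) (by linarith) hM.one_le_ω hM.P_pos
        Regime.P_le_one hM.P_le_X (fun l => by exact_mod_cast hM.z_pos l) (fun k l => rfl)
        (le_entryMax _) (by linarith) (hG.1.2 (q + 2)) hM.info_Lam_pos
        (fun k r hr => infoMin_le _ hr.symm) hM.I_le hM.initRate_mul_le_row
        (hG.2.mul_card_col hM (q + 2)) (M.rowLab s b e q i)
    · rw [ENNReal.ofReal_mul hc0]
      gcongr
      have h1 := ex_sbm_degree (M := M)
        (fun j : Fin M.w => (s.symm (b, e.symm (q, i)), f.symm (q + 3, j)))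
        (fun t t' h => by simpa using h) (a := 1 / M.h) (r := M.h) (by positivity) (by positivity)
      refine h1.le.trans (ENNReal.ofReal_le_ofReal ?_)
      rw [add_div]
      gcongr
      exact sum_P_le (M.rowLab s b e q i) f (q + 3)
  calc _ = ∑ i : Fin M.h, ex M.sbm (fun A => ex (initLaw S (block (half A s b) e f)) fun uv =>
      {x | (M.Sized s b e f ∧ M.InitOk (M.tuning β ω) s b ⟨e, f, uv.1, uv.2⟩) ∧
        badRow M.P (M.colLab f (q + 2))
          (errSet (colCanon (M.colLab f) uv.2 (q + 2)) (M.colLab f (q + 2)))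
          (M.tuning β ω).δ₁ (M.tuning β ω).R (M.rowLab s b e q i) x}.indicator
        (fun _ => ENNReal.ofReal (1 / M.h + rowDeg (block (half A s b) e f q (q + 3)) i / M.h))
        fun j => A (s.symm (b, e.symm (q, i))) (f.symm (q + 2, j))) := by
        simp only [← ex_finset_sum]
        refine congrArg _ (funext fun A => congrArg _ (funext fun uv => ?_))
        simp only [Set.indicator, Set.mem_ofPred_eq]
        split_ifs with hG
        · rw [ofReal_badWeight _ _ (by positivity) (by positivity)]
          refine Finset.sum_congr rfl fun i _ => ?_
          simp only [hG, true_and, rowBad, badSet, Finset.mem_filter, Finset.mem_univ, true_and]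
          exact if_congr Iff.rfl rfl rfl
        · simp only [hG, false_and, if_false, Finset.sum_const_zero]
    _ ≤ ∑ _i : Fin M.h, ENNReal.ofReal (c * ((1 + M.L * entryMax M.Lam) / M.h)) :=
        Finset.sum_le_sum fun i _ => hi i
    _ = ENNReal.ofReal (c * (1 + M.L * entryMax M.Lam)) := by
        rw [Finset.sum_const, Finset.card_univ, Fintype.card_fin, nsmul_eq_mul,
          ← ENNReal.ofReal_natCast, ← ENNReal.ofReal_mul (by positivity)]
        congr 1
        field_simp

open scoped Classical in
/-- The analogous bound for the bad columns, which are decided by the block `(q - 2, q)`, with degrees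
from the block `(q - 3, q)`. -/
theorem prob_joint_colWeight (hM : M.Regime β ω) (S : Initializer M.K M.L M.h M.w) (b : Fin 2) :
    prob (M.joint S b) {x | ∃ q, (M.Sized x.2.1 b x.2.2.e x.2.2.f ∧
        M.InitOk (M.tuning β ω) x.2.1 b x.2.2) ∧
      ¬ badWeight (colBad M.P (M.tuning β ω).δ₂ (M.tuning β ω).R (M.rowLab x.2.1 b x.2.2.e)
          (rowCanon (M.rowLab x.2.1 b x.2.2.e) x.2.2.u) (M.colLab x.2.2.f)
          (block (half x.1 x.2.1 b) x.2.2.e x.2.2.f) q)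
        (block (half x.1 x.2.1 b) x.2.2.e x.2.2.f (q - 3) q).transpose M.w M.h ≤ (M.tuning β ω).θ}
      ≤ ENNReal.ofReal (M.failColWeight β ω) := by
  refine prob_exists_fin_le _ _ fun q => prob_and_not_le_le _ (θ_pos hM) ?_
  refine ex_joint_le S b fun s e f => ?_
  have hq := add_two_three_ne M.four_le_Q (q - 2)
  simp only [sub_add_cancel] at hq
  have hq3 : q - 3 ≠ q - 2 := fun hc =>
    (add_two_three_ne M.four_le_Q q).2.2.2.2 (by rw [sub_right_inj.1 hc])
  have hh := hM.one_le_h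
  have hw := hM.one_le_w
  have hX := hM.X_ge_two
  have hL := M.two_le_castL
  have hQ := M.four_le_castQ
  set c : ℝ := M.L * Real.exp (-(infoMin M.Gam / (4 * (2 * M.Q)))) with hc
  have hc0 : 0 ≤ c := by positivity
  have hi : ∀ j : Fin M.w, ex M.sbm (fun A => ex (initLaw S (block (half A s b) e f)) fun uv =>
      {x | (M.Sized s b e f ∧ M.InitOk (M.tuning β ω) s b ⟨e, f, uv.1, uv.2⟩) ∧
        badRow M.P.transpose (M.rowLab s b e (q - 2))
          (errSet (rowCanon (M.rowLab s b e) uv.1 (q - 2)) (M.rowLab s b e (q - 2)))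
          (M.tuning β ω).δ₂ (M.tuning β ω).R (M.colLab f q j) x}.indicator
        (fun _ => ENNReal.ofReal
          (1 / M.w + rowDeg (block (half A s b) e f (q - 3) q).transpose j / M.h))
        fun i => A (s.symm (b, e.symm (q - 2, i))) (f.symm (q, j)))
      ≤ ENNReal.ofReal (c * (1 / M.w + (∑ i, M.P (M.rowLab s b e (q - 3) i) (M.colLab f q j)) / M.h)) := by
    intro j
    refine (ex_indicator_le S (avoids_blockSet hq.1 hq.2.1)
      (fun i : Fin M.h => (s.symm (b, e.symm (q - 2, i)), f.symm (q, j)))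
      (fun t t' h => by simpa using h) (fun t => ⟨(t, j), rfl⟩)
      (fun _ uv x => (M.Sized s b e f ∧ M.InitOk (M.tuning β ω) s b ⟨e, f, uv.1, uv.2⟩) ∧
        badRow M.P.transpose (M.rowLab s b e (q - 2))
          (errSet (rowCanon (M.rowLab s b e) uv.1 (q - 2)) (M.rowLab s b e (q - 2)))
          (M.tuning β ω).δ₂ (M.tuning β ω).R (M.colLab f q j) x) (fun _ _ _ => rfl)
      (fun A => ENNReal.ofReal
          (1 / M.w + rowDeg (block (half A s b) e f (q - 3) q).transpose j / M.h))
      (fun A A' => by rw [block_mixMat fun hc => hq3 hc.1]) (c := c) fun A uv => ?_).trans ?_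
    · refine PB_and_le hc0 fun hG => ?_
      exact PB_badRow_block_le (P := M.P.transpose) (Lam := M.Gam)
        (N := fun k => (clusterSize M.y k : ℝ))
        (z := M.rowLab s b e (q - 2)) (z' := rowCanon (M.rowLab s b e) uv.1 (q - 2)) (c₀ := 2 * M.Q)
        (X := entryMax M.Gam) (by have := M.two_le_K; omega) (by linarith) hM.one_le_ω
        (fun l k => hM.P_pos k l) (fun l k => Regime.P_le_one k l) (fun l k => hM.P_le_Y k l)
        (fun k => by exact_mod_cast hM.y_pos k) (fun l k => mul_comm _ _)
        (le_entryMax _) hM.Y_pos (hG.1.1 (q - 2)) hM.info_Gam_pos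
        (fun k r hr => infoMin_le _ hr.symm) hM.J_le hM.initRate_mul_le_col
        (hG.2.mul_card_row hM (q - 2)) (M.colLab f q j)
    · rw [ENNReal.ofReal_mul hc0]
      gcongr
      exact (ex_sbm_degree (M := M)
        (fun i : Fin M.h => (s.symm (b, e.symm (q - 3, i)), f.symm (q, j)))
        (fun t t' h => by simpa using h) (a := 1 / M.w) (r := M.h) (by positivity)
        (by positivity)).le
  calc _ = ∑ j : Fin M.w, ex M.sbm (fun A => ex (initLaw S (block (half A s b) e f)) fun uv =>
      {x | (M.Sized s b e f ∧ M.InitOk (M.tuning β ω) s b ⟨e, f, uv.1, uv.2⟩) ∧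
        badRow M.P.transpose (M.rowLab s b e (q - 2))
          (errSet (rowCanon (M.rowLab s b e) uv.1 (q - 2)) (M.rowLab s b e (q - 2)))
          (M.tuning β ω).δ₂ (M.tuning β ω).R (M.colLab f q j) x}.indicator
        (fun _ => ENNReal.ofReal
          (1 / M.w + rowDeg (block (half A s b) e f (q - 3) q).transpose j / M.h))
        fun i => A (s.symm (b, e.symm (q - 2, i))) (f.symm (q, j))) := by
        simp only [← ex_finset_sum]
        refine congrArg _ (funext fun A => congrArg _ (funext fun uv => ?_))
        simp only [Set.indicator, Set.mem_ofPred_eq]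
        split_ifs with hG
        · rw [ofReal_badWeight _ _ (by positivity) (by positivity)]
          refine Finset.sum_congr rfl fun i _ => ?_
          simp only [hG, true_and, colBad, badSet, Finset.mem_filter, Finset.mem_univ, true_and]
          exact if_congr Iff.rfl rfl rfl
        · simp only [hG, false_and, if_false, Finset.sum_const_zero]
    _ ≤ ∑ j : Fin M.w, ENNReal.ofReal
          (c * (1 / M.w + (∑ i, M.P (M.rowLab s b e (q - 3) i) (M.colLab f q j)) / M.h)) :=
        Finset.sum_le_sum fun i _ => hi i
    _ ≤ ENNReal.ofReal (c * (1 + M.L * entryMax M.Lam)) := by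
        have hp : ∀ i j, 0 ≤ M.P (M.rowLab s b e (q - 3) i) (M.colLab f q j) :=
          fun i j => (M.P_mem _ _).1
        rw [← ENNReal.ofReal_sum_of_nonneg fun j _ => mul_nonneg hc0 (add_nonneg (by positivity)
          (div_nonneg (Finset.sum_nonneg fun i _ => hp i j) (by positivity)))]
        refine ENNReal.ofReal_le_ofReal ?_
        have hsum : ∑ j, (∑ i, M.P (M.rowLab s b e (q - 3) i) (M.colLab f q j)) / (M.h : ℝ)
            = (∑ i, ∑ j, M.P (M.rowLab s b e (q - 3) i) (M.colLab f q j)) / M.h := by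
          rw [← Finset.sum_div]
          exact congrArg (· / (M.h : ℝ)) Finset.sum_comm
        rw [← Finset.mul_sum, Finset.sum_add_distrib]
        refine mul_le_mul_of_nonneg_left (add_le_add ?_ (hsum.le.trans ?_)) hc0
        · rw [Finset.sum_const, Finset.card_univ, Fintype.card_fin, nsmul_eq_mul,
            mul_one_div_cancel (by positivity)]
        · rw [div_le_iff₀ (by positivity)]
          refine (Finset.sum_le_sum fun i _ => sum_P_le _ f q).trans ?_
          rw [Finset.sum_const, Finset.card_univ, Fintype.card_fin, nsmul_eq_mul, mul_comm]

open scoped Classical in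
/-- The number of rows in a set that a pass may misclassify at the end, when it has misclassified
few columns before. -/
theorem ex_joint_wrongRows (S : Initializer M.K M.L M.h M.w) (b : Fin 2) (τ : Tuning)
    (U : Finset (Fin (2 * (M.Q * M.h)))) {D₀ c : ℝ} (hc0 : 0 ≤ c)
    (hc : ∀ i ∈ U, ∀ D : Finset (Fin (M.Q * M.w)), (D.card : ℝ) ≤ D₀ →
      PB (fun j => M.P (M.y i) (M.z j)) (badRow M.P M.z D (2 * τ.δ) τ.R (M.y i)) ≤ c) :
    ex (M.joint S b) ({x | ((M.wrongCols τ x.1 x.2.1 b x.2.2).card : ℝ) ≤ D₀}.indicator fun x =>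
      ENNReal.ofReal ((M.wrongRows τ x.1 x.2.1 b x.2.2 ∩ U).card : ℝ))
      ≤ ENNReal.ofReal (U.card * c) := by
  refine ex_joint_le S b fun s e f => ?_
  have hi : ∀ i ∈ U, ex M.sbm (fun A => prob (initLaw S (block (half A s b) e f)) {uv |
      ((M.wrongCols τ A s b ⟨e, f, uv.1, uv.2⟩).card : ℝ) ≤ D₀ ∧
      i ∈ M.wrongRows τ A s b ⟨e, f, uv.1, uv.2⟩}) ≤ ENNReal.ofReal c := by
    intro i hiU
    by_cases hb : (s i).1 = b
    · have : ∀ A : M.Adj, {uv : M.Ini | ((M.wrongCols τ A s b ⟨e, f, uv.1, uv.2⟩).card : ℝ) ≤ D₀ ∧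
          i ∈ M.wrongRows τ A s b ⟨e, f, uv.1, uv.2⟩} = ∅ := by
        intro A
        ext uv
        simp [wrongRows, hb]
      simp [this, prob_eq_ex, ex_const]
    -- the other half is independent of everything that the pass computes from the half `b`
    have hav : Avoids (M := M) s b e f {p | (s p.1).1 ≠ b} := by
      intro q i j
      simp
    have hhalf : ∀ A A' : M.Adj, half (mixMat {p | (s p.1).1 ≠ b} A' A) s b = half A s b := by
      intro A A'
      ext i j
      simp [half, mixMat]
    have h := ex_prob_le S hav (fun j : Fin (M.Q * M.w) => (i, j)) (fun t t' h => by simpa using h)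
      (fun t => hb)
      (fun A uv x => ((M.wrongCols τ A s b ⟨e, f, uv.1, uv.2⟩).card : ℝ) ≤ D₀ ∧
        badRow M.P M.z (M.wrongCols τ A s b ⟨e, f, uv.1, uv.2⟩) (2 * τ.δ) τ.R (M.y i) x)
      (fun A A' uv => by simp only [wrongCols, hhalf]) (c := c)
      fun A uv => PB_and_le hc0 fun hG => hc i hiU _ hG
    refine le_trans (le_of_eq ?_) h
    refine congrArg _ (funext fun A => congrArg _ ?_)
    ext uv
    simp only [wrongRows, Set.mem_ofPred_eq, Finset.mem_filter, Finset.mem_univ, true_and]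
    constructor
    · rintro ⟨h1, -, h2⟩
      exact ⟨h1, h2⟩
    · rintro ⟨h1, h2⟩
      exact ⟨h1, hb, h2⟩
  calc _ = ∑ i ∈ U, ex M.sbm (fun A => prob (initLaw S (block (half A s b) e f)) {uv |
      ((M.wrongCols τ A s b ⟨e, f, uv.1, uv.2⟩).card : ℝ) ≤ D₀ ∧
      i ∈ M.wrongRows τ A s b ⟨e, f, uv.1, uv.2⟩}) := by
        simp only [prob_eq_ex, ← ex_finset_sum]
        refine congrArg _ (funext fun A => congrArg _ (funext fun uv => ?_))
        simp only [Set.indicator, Set.mem_ofPred_eq]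
        split_ifs with hG
        · simp only [hG, true_and]
          rw [ENNReal.ofReal_natCast, Finset.sum_ite_mem, Finset.sum_const, nsmul_eq_mul, mul_one,
            Finset.inter_comm]
        · simp only [hG, false_and, if_false, Finset.sum_const_zero]
    _ ≤ ∑ _i ∈ U, ENNReal.ofReal c := Finset.sum_le_sum hi
    _ = _ := by
        rw [Finset.sum_const, nsmul_eq_mul, ENNReal.ofReal_mul (by positivity),
          ENNReal.ofReal_natCast]

end BlockModel

/-! ### A non-asymptotic bound for the error rate in a cluster -/

namespace BlockModel

variable {M : BlockModel} {β ω : ℝ}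

/-- The bound for the probability that a pass with accurate initial labels is unfavourable. -/
def failPass (M : BlockModel) (β ω : ℝ) : ℝ :=
  (1 : ℕ) * M.Q * M.K * (100 * β * M.K / M.h) + (1 : ℕ) * M.Q * M.L * (100 * β * M.L / M.w)
    + M.failRowMean β ω + M.failColMean β ω + M.failRowWeight β ω + M.failColWeight β ω
    + M.failAllMean β ω

/-- Union bound over the unfavourable outcomes of a pass. -/
theorem prob_joint_not_good (hM : M.Regime β ω) (S : Initializer M.K M.L M.h M.w) (b : Fin 2) :
    prob (M.joint S b) {x | ¬ (M.Sized x.2.1 b x.2.2.e x.2.2.f ∧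
      (M.InitOk (M.tuning β ω) x.2.1 b x.2.2 → M.ViewGood (M.tuning β ω) x.1 x.2.1 b x.2.2))}
      ≤ ENNReal.ofReal (M.failPass β ω) := by
  classical
  have h1 := prob_joint_rowSize hM S b
  have h2 := prob_joint_colSize hM S b
  have h3 := prob_joint_rowMean hM S b
  have h4 := prob_joint_colMean hM S b
  have h5 := prob_joint_rowWeight hM S b
  have h6 := prob_joint_colWeight hM S b
  have h7 := prob_joint_allMean hM S b
  have hβ := hM.one_le_β
  have hθ := θ_pos hM
  have hX := hM.X_ge_two
  have p1 : 0 ≤ (1 : ℕ) * (M.Q : ℝ) * M.K * (100 * β * M.K / M.h) := by positivity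
  have p2 : 0 ≤ (1 : ℕ) * (M.Q : ℝ) * M.L * (100 * β * M.L / M.w) := by positivity
  have p3 : 0 ≤ M.failRowMean β ω := by unfold failRowMean; positivity
  have p4 : 0 ≤ M.failColMean β ω := by unfold failColMean; positivity
  have p5 : 0 ≤ M.failRowWeight β ω := by unfold failRowWeight; positivity
  have p6 : 0 ≤ M.failColWeight β ω := by unfold failColWeight; positivity
  have p7 : 0 ≤ M.failAllMean β ω := by unfold failAllMean; positivity
  unfold failPass
  rw [ENNReal.ofReal_add (by positivity) p7, ENNReal.ofReal_add (by positivity) p6,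
    ENNReal.ofReal_add (by positivity) p5, ENNReal.ofReal_add (by positivity) p4,
    ENNReal.ofReal_add (by positivity) p3, ENNReal.ofReal_add p1 p2]
  refine le_trans ?_ (add_le_add (add_le_add (add_le_add (add_le_add (add_le_add (add_le_add
    h1 h2) h3) h4) h5) h6) h7)
  refine le_trans ?_ (add_le_add_left (add_le_add_left (add_le_add_left (add_le_add_left
    (add_le_add_left (prob_union_le _ _ _) _) _) _) _) _)
  refine le_trans ?_ (add_le_add_left (add_le_add_left (add_le_add_left (add_le_add_left
    (prob_union_le _ _ _) _) _) _) _)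
  refine le_trans ?_ (add_le_add_left (add_le_add_left (add_le_add_left (prob_union_le _ _ _) _) _) _)
  refine le_trans ?_ (add_le_add_left (add_le_add_left (prob_union_le _ _ _) _) _)
  refine le_trans ?_ (add_le_add_left (prob_union_le _ _ _) _)
  refine le_trans ?_ (prob_union_le _ _ _)
  refine prob_mono _ fun x hx => ?_
  by_contra hn
  simp only [Set.mem_union, not_or, Set.mem_ofPred_eq, not_exists, not_not, not_and] at hn
  obtain ⟨⟨⟨⟨⟨⟨n1, n2⟩, n3⟩, n4⟩, n5⟩, n6⟩, n7⟩ := hn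
  have hs : M.Sized x.2.1 b x.2.2.e x.2.2.f := ⟨n1 0, n2 0⟩
  exact hx ⟨hs, fun hi => ⟨fun q k l => n3 q k l ⟨hs, hi⟩, fun q k l => n4 q k l ⟨hs, hi⟩,
    fun q => n5 q ⟨hs, hi⟩, fun q => n6 q ⟨hs, hi⟩, fun k l => n7 0 k l hs⟩⟩

/-- A favourable pass misclassifies few columns in its first classification. -/
theorem ViewGood.card_wrongCols (hM : M.Regime β ω) {A s b} {V : M.Vw}
    (h : M.ViewGood (M.tuning β ω) A s b V) :
    ((M.wrongCols (M.tuning β ω) A s b V).card : ℝ) ≤ M.Q * ((M.tuning β ω).θ * M.w) := by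
  classical
  have hw := hM.one_le_w
  have hh := hM.one_le_h
  have h1 : (M.wrongCols (M.tuning β ω) A s b V).card
      ≤ ∑ q, (colBad M.P (M.tuning β ω).δ₂ (M.tuning β ω).R (M.rowLab s b V.e)
        (rowCanon (M.rowLab s b V.e) V.u) (M.colLab V.f) (block (half A s b) V.e V.f) q).card := by
    rw [← Finset.card_sigma]
    refine Finset.card_le_card_of_injOn (fun j => ⟨(V.f j).1, (V.f j).2⟩) (fun j hj => ?_) ?_
    · have hj' := (Finset.mem_filter.1 hj).2
      simpa using hj'
    · intro j _ j' _ hjj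
      simp only [Sigma.mk.injEq] at hjj
      exact V.f.injective (Prod.ext hjj.1 (eq_of_heq hjj.2))
  have h2 : ((M.wrongCols (M.tuning β ω) A s b V).card : ℝ)
      ≤ ∑ _q : Fin M.Q, (M.tuning β ω).θ * M.w := by
    refine (Nat.cast_le.2 h1).trans ?_
    push_cast
    exact Finset.sum_le_sum fun q _ =>
      card_le_of_badWeight_le (by linarith) (by linarith) (h.colWeight q)
  simpa using h2

theorem InitGood.initOk_first (hM : M.Regime β ω) {γ : ℝ} (hγ : γ ≤ M.initRate β ω)
    {R : Run M.K M.L M.Q M.h M.w} (h : M.InitGood β γ R) :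
    M.InitOk (M.tuning β ω) R.split 1 R.first.view := by
  have hβ := hM.one_le_β
  refine ⟨fun q => (h.1.1 q).trans ?_, fun q => (h.1.2 q).trans ?_⟩ <;>
  · simp only [tuning]
    gcongr

theorem InitGood.initOk_second (hM : M.Regime β ω) {γ : ℝ} (hγ : γ ≤ M.initRate β ω)
    {R : Run M.K M.L M.Q M.h M.w} (h : M.InitGood β γ R) :
    M.InitOk (M.tuning β ω) R.split 0 R.second.view := by
  have hβ := hM.one_le_β
  refine ⟨fun q => (h.2.1 q).trans ?_, fun q => (h.2.2 q).trans ?_⟩ <;>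
  · simp only [tuning]
    gcongr

open scoped Classical in
/-- In a favourable run the error rate in a cluster is governed by the number of wrong rows. -/
theorem misCluster_le_of_good (hM : M.Regime β ω) {S : Initializer M.K M.L M.h M.w} {A : M.Adj}
    {R : Run M.K M.L M.Q M.h M.w} (hR : R ∈ (algorithm S A).support)
    (hs₁ : M.Sized R.split 1 R.first.rowPart R.first.colPart)
    (hs₂ : M.Sized R.split 0 R.second.rowPart R.second.colPart)
    (hi₁ : M.InitOk (M.tuning β ω) R.split 1 R.first.view)
    (hi₂ : M.InitOk (M.tuning β ω) R.split 0 R.second.view)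
    (hg₁ : M.ViewGood (M.tuning β ω) A R.split 1 R.first.view)
    (hg₂ : M.ViewGood (M.tuning β ω) A R.split 0 R.second.view)
    (hd₁ : ((M.wrongRows (M.tuning β ω) A R.split 1 R.first.view).card : ℝ) ≤ (M.tuning β ω).d)
    (hd₂ : ((M.wrongRows (M.tuning β ω) A R.split 0 R.second.view).card : ℝ) ≤ (M.tuning β ω).d)
    {k : Fin M.K} {ρ : ℝ}
    (hk₁ : ((M.wrongRows (M.tuning β ω) A R.split 1 R.first.view ∩
      Finset.univ.filter fun i => M.y i = k).card : ℝ) ≤ clusterSize M.y k * (ρ / 2))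
    (hk₂ : ((M.wrongRows (M.tuning β ω) A R.split 0 R.second.view ∩
      Finset.univ.filter fun i => M.y i = k).card : ℝ) ≤ clusterSize M.y k * (ρ / 2))
    {σ : Equiv.Perm (Fin M.K)} (hσ : σ ∈ optPerms R.labels M.y) :
    misCluster σ R.labels M.y k ≤ ρ := by
  obtain ⟨σ₀, h₀⟩ := exists_perm_labels hM.valid hR hs₁ hs₂ hi₁ hi₂ hg₁ hg₂ hd₁
  set W₁ := M.wrongRows (M.tuning β ω) A R.split 1 R.first.view
  set W₂ := M.wrongRows (M.tuning β ω) A R.split 0 R.second.view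
  have hW : ∀ i ∉ W₁ ∪ W₂, R.labels i = σ₀ (M.y i) := by
    intro i hi
    rw [Finset.mem_union, not_or] at hi
    exact h₀ i hi.1 hi.2
  have hβ := hM.one_le_β
  have hK := M.two_le_castK
  have hQ := M.four_le_castQ
  have hh := hM.one_le_h
  have hs : 0 < (M.h : ℝ) / (β * M.K) := by positivity
  -- fewer than half of every cluster is wrong, so the optimal relabeling is unique
  have hσ₀ : σ = σ₀⁻¹ := by
    refine eq_inv_of_mem_optPerms hW (fun k => ?_) hσ
    have h1 : ((W₁ ∪ W₂).card : ℝ) ≤ W₁.card + W₂.card := by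
      exact_mod_cast Finset.card_union_le _ _
    have h2 : (M.tuning β ω).d = (M.h : ℝ) / (β * M.K) / 16 := by
      simp only [tuning]
      field_simp
    have h3 := hM.row_lower k
    have h4 : 2 * ((M.Q : ℝ) * M.h) / (β * M.K) = 2 * M.Q * ((M.h : ℝ) / (β * M.K)) := by ring
    have h5 : 2 * ((W₁ ∪ W₂).card : ℝ) < clusterSize M.y k := by nlinarith
    exact_mod_cast h5
  have hn : (0 : ℝ) < clusterSize M.y k := by exact_mod_cast hM.y_pos k
  rw [misCluster, div_le_iff₀ hn]
  have h6 : (Finset.univ.filter fun i => σ (R.labels i) ≠ k ∧ M.y i = k)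
      ⊆ (W₁ ∩ Finset.univ.filter fun i => M.y i = k) ∪
        (W₂ ∩ Finset.univ.filter fun i => M.y i = k) := by
    intro i hi
    obtain ⟨h7, h8⟩ := (Finset.mem_filter.1 hi).2
    by_contra hc
    refine h7 ?_
    rw [hW i fun hiW => hc ?_, hσ₀, h8]
    · simp
    · rw [← Finset.union_inter_distrib_right]
      exact Finset.mem_inter.2 ⟨hiW, Finset.mem_filter.2 ⟨Finset.mem_univ _, h8⟩⟩
  have h9 : ((Finset.univ.filter fun i => σ (R.labels i) ≠ k ∧ M.y i = k).card : ℝ)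
      ≤ (W₁ ∩ Finset.univ.filter fun i => M.y i = k).card
        + (W₂ ∩ Finset.univ.filter fun i => M.y i = k).card := by
    exact_mod_cast (Finset.card_le_card h6).trans (Finset.card_union_le _ _)
  refine le_trans ?_ (h9.trans ?_)
  · exact le_of_eq (by congr)
  · linarith

open scoped Classical in
/-- The non-asymptotic error bound: `c₀` bounds the probability that a row is misclassified, and
`c₁` that a row with label `k` is. -/
theorem prob_not_misCluster_le (hM : M.Regime β ω) (S : Initializer M.K M.L M.h M.w) {γ : ℝ}
    (hγ : γ ≤ M.initRate β ω) {k : Fin M.K} {ρ c₀ c₁ : ℝ} (hρ : 0 < ρ) (hc₀ : 0 ≤ c₀) (hc₁ : 0 ≤ c₁)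
    (h₀ : ∀ k, ∀ D : Finset (Fin (M.Q * M.w)), (D.card : ℝ) ≤ M.Q * ((M.tuning β ω).θ * M.w) →
      PB (fun j => M.P k (M.z j)) (badRow M.P M.z D (2 * (M.tuning β ω).δ) ω k) ≤ c₀)
    (h₁ : ∀ D : Finset (Fin (M.Q * M.w)), (D.card : ℝ) ≤ M.Q * ((M.tuning β ω).θ * M.w) →
      PB (fun j => M.P k (M.z j)) (badRow M.P M.z D (2 * (M.tuning β ω).δ) ω k) ≤ c₁) :
    prob (M.law S) {R | ¬ ∀ σ ∈ optPerms R.labels M.y, misCluster σ R.labels M.y k ≤ ρ}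
      ≤ prob (M.law S) {R | ¬ M.InitGood β γ R}
        + 2 * (ENNReal.ofReal (M.failPass β ω) + ENNReal.ofReal (32 * M.Q * β * M.K * c₀)
          + ENNReal.ofReal (2 * c₁ / ρ)) := by
  set τ := M.tuning β ω with hτ
  set U := Finset.univ.filter fun i => M.y i = k with hU
  set D₀ : ℝ := M.Q * (τ.θ * M.w) with hD₀
  have hβ := hM.one_le_β
  have hK := M.two_le_castK
  have hQ := M.four_le_castQ
  have hh := hM.one_le_h
  have hn : (0 : ℝ) < clusterSize M.y k := by exact_mod_cast hM.y_pos k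
  have hd0 : 0 < τ.d := by
    simp only [hτ, tuning]
    positivity
  -- the unfavourable outcomes of one pass
  let F : Fin 2 → M.Adj × Split M.Q M.h × M.Vw → Prop := fun b x =>
    (¬ (M.Sized x.2.1 b x.2.2.e x.2.2.f ∧ (M.InitOk τ x.2.1 b x.2.2 → M.ViewGood τ x.1 x.2.1 b x.2.2))) ∨
    (((M.wrongCols τ x.1 x.2.1 b x.2.2).card : ℝ) ≤ D₀ ∧
      ¬ ((M.wrongRows τ x.1 x.2.1 b x.2.2 ∩ Finset.univ).card : ℝ) ≤ τ.d) ∨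
    (((M.wrongCols τ x.1 x.2.1 b x.2.2).card : ℝ) ≤ D₀ ∧
      ¬ ((M.wrongRows τ x.1 x.2.1 b x.2.2 ∩ U).card : ℝ) ≤ clusterSize M.y k * (ρ / 2))
  have hF : ∀ b, prob (M.joint S b) {x | F b x} ≤ ENNReal.ofReal (M.failPass β ω)
      + ENNReal.ofReal (32 * M.Q * β * M.K * c₀) + ENNReal.ofReal (2 * c₁ / ρ) := by
    intro b
    have e1 := prob_joint_not_good hM S b
    have e2 := prob_and_not_le_le (M.joint S b) hd0 (ex_joint_wrongRows S b τ Finset.univ hc₀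
      (D₀ := D₀) fun i _ D hD => h₀ (M.y i) D hD)
    have e3 := prob_and_not_le_le (M.joint S b) (mul_pos hn (half_pos hρ))
      (ex_joint_wrongRows S b τ U hc₁ (D₀ := D₀) fun i hi D hD => by
        rw [(Finset.mem_filter.1 hi).2]
        exact h₁ D hD)
    have g2 : ((Finset.univ : Finset (Fin (2 * (M.Q * M.h)))).card : ℝ) * c₀ / τ.d
        = 32 * M.Q * β * M.K * c₀ := by
      rw [Finset.card_univ, Fintype.card_fin]
      simp only [hτ, tuning]
      push_cast
      field_simp
      ring
    have g3 : (U.card : ℝ) * c₁ / (clusterSize M.y k * (ρ / 2)) = 2 * c₁ / ρ := by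
      have : (U.card : ℝ) = clusterSize M.y k := by
        rw [hU, clusterSize]
      rw [this]
      field_simp
    rw [g2] at e2
    rw [g3] at e3
    refine le_trans ?_ (add_le_add (add_le_add e1 e2) e3)
    refine le_trans ?_ (add_le_add_left (prob_union_le _ _ _) _)
    refine le_trans ?_ (prob_union_le _ _ _)
    refine prob_mono _ fun x hx => ?_
    rcases hx with hx | hx | hx
    · exact Or.inl (Or.inl hx)
    · exact Or.inl (Or.inr hx)
    · exact Or.inr hx
  have hsub : prob (M.fullLaw S)
      {x | ¬ ∀ σ ∈ optPerms x.2.labels M.y, misCluster σ x.2.labels M.y k ≤ ρ}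
      ≤ prob (M.fullLaw S) (({x | ¬ M.InitGood β γ x.2} ∪
          {x | F 1 (x.1, x.2.split, x.2.first.view)}) ∪
          {x | F 0 (x.1, x.2.split, x.2.second.view)}) := by
    refine prob_mono_support _ fun x hx hbad => ?_
    by_contra hn
    simp only [Set.mem_union, Set.mem_ofPred_eq, not_or, F] at hn
    obtain ⟨⟨hinit, hA1, hw1, hk1⟩, hA2, hw2, hk2⟩ := hn
    rw [not_not] at hinit
    obtain ⟨hs1, hg1⟩ := not_not.1 hA1
    obtain ⟨hs2, hg2⟩ := not_not.1 hA2
    rw [not_and_not_right] at hw1 hk1 hw2 hk2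
    obtain ⟨A, -, hx⟩ := (PMF.mem_support_bind_iff _ _ _).1 hx
    obtain ⟨R, hR, rfl⟩ := (PMF.mem_support_map_iff _ _ _).1 hx
    have i1 := hinit.initOk_first hM hγ
    have i2 := hinit.initOk_second hM hγ
    have v1 := hg1 i1
    have v2 := hg2 i2
    rw [Finset.inter_univ] at hw1 hw2
    exact hbad fun σ hσ => misCluster_le_of_good hM hR hs1 hs2 i1 i2 v1 v2
      (hw1 (v1.card_wrongCols hM)) (hw2 (v2.card_wrongCols hM)) (hk1 (v1.card_wrongCols hM))
      (hk2 (v2.card_wrongCols hM)) hσ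
  rw [prob_law S fun R => ¬ ∀ σ ∈ optPerms R.labels M.y, misCluster σ R.labels M.y k ≤ ρ,
    prob_law S fun R => ¬ M.InitGood β γ R]
  refine hsub.trans ((prob_union_le _ _ _).trans ?_)
  refine (add_le_add_left (prob_union_le _ _ _) _).trans ?_
  rw [prob_fullLaw_first S (F 1), prob_fullLaw_second S (F 0), two_mul, ← add_assoc]
  exact add_le_add (add_le_add le_rfl (hF 1)) (hF 0)

/-- The columns that a favourable pass may misclassify carry a negligible number of edges of a row. -/
theorem sum_P_wrong_le (hM : M.Regime β ω) {D : Finset (Fin (M.Q * M.w))}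
    (hD : (D.card : ℝ) ≤ M.Q * ((M.tuning β ω).θ * M.w)) (k : Fin M.K) :
    ∑ j ∈ D, M.P k (M.z j) ≤ 1 / (1000 * (M.Q * M.K * ω)) := by
  have hβ := hM.one_le_β
  have hω := hM.one_le_ω
  have hK := M.two_le_castK
  have hL := M.two_le_castL
  have hQ := M.four_le_castQ
  have hw := hM.one_le_w
  have hX := hM.X_ge_two
  refine (Finset.sum_le_sum fun j _ => hM.P_le_X k (M.z j)).trans ?_
  rw [Finset.sum_const, nsmul_eq_mul]
  refine (mul_le_mul_of_nonneg_right hD (by positivity)).trans (le_of_eq ?_)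
  simp only [tuning]
  field_simp

/-- Crude bound for the misclassification of a row by the second classification; it makes the total
number of errors small enough for relabelings to be identified. -/
theorem PB_badRow_full (hM : M.Regime β ω) {D : Finset (Fin (M.Q * M.w))}
    (hD : (D.card : ℝ) ≤ M.Q * ((M.tuning β ω).θ * M.w)) (k : Fin M.K) :
    PB (fun j => M.P k (M.z j)) (badRow M.P M.z D (2 * (M.tuning β ω).δ) ω k)
      ≤ M.K * Real.exp (14 - infoMin M.Lam) := by
  have hω := hM.one_le_ω
  have hK := M.two_le_castK
  have hL := M.two_le_castL
  have hQ := M.four_le_castQ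
  have hX := hM.X_ge_two
  refine PB_badRow_full_le (X := entryMax M.Lam) (d := 1 / (1000 * (M.Q * M.K * ω))) hω hM.P_pos
    Regime.P_le_one hM.z_pos (le_entryMax M.Lam) ?_ ?_ ?_ ?_ (fun k r hr => infoMin_le M.Lam hr.symm)
    (sum_P_wrong_le hM hD k)
  · simp only [tuning]
    positivity
  · simp only [tuning]
    rw [show 2 * (1 / (2 * ((M.L : ℝ) * entryMax M.Lam))) = 1 / (M.L * entryMax M.Lam) by field_simp]
    apply one_div_le_one_div_of_le (by norm_num)
    nlinarith
  · simp only [tuning]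
    refine le_of_eq ?_
    field_simp
  · rw [mul_one_div, div_le_one (by positivity)]
    nlinarith [mul_pos (show (0 : ℝ) < M.Q by linarith) (show (0 : ℝ) < M.K by linarith),
      mul_le_mul_of_nonneg_right (show (8 : ℝ) ≤ M.Q * M.K by nlinarith) (show 0 ≤ ω by linarith)]

/-- Sharp bound for the misclassification of a row by the second classification, with the factor
`1 / √Λ_min`. -/
theorem PB_badRow_sharp (hM : M.Regime β ω) {c : ℝ} (hP6 : ∀ k l, M.P k l ≤ 1 / 6)
    (hc : ∀ k l, (clusterSize M.z l : ℝ) * M.P k l ^ 2 ≤ c) (hI : 8 ≤ infoMin M.Lam)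
    {D : Finset (Fin (M.Q * M.w))}
    (hD : (D.card : ℝ) ≤ M.Q * ((M.tuning β ω).θ * M.w)) (k : Fin M.K) :
    PB (fun j => M.P k (M.z j)) (badRow M.P M.z D (2 * (M.tuning β ω).δ) ω k)
      ≤ ∑ r ∈ Finset.univ.erase k, 66 * Real.exp (14 + 72 * c) * ω *
        ((1 + 1 / epsGap M.Lam k r) * Real.exp (-info M.Lam k r) / √(entryMin M.Lam)) := by
  have hω := hM.one_le_ω
  have hβ := hM.one_le_β
  have hK := M.two_le_castK
  have hL := M.two_le_castL
  have hQ := M.four_le_castQ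
  have hX := hM.X_ge_two
  have hw := hM.one_le_w
  refine PB_badRow_le hM.P_pos Regime.P_le_one fun r hr => ?_
  refine PB_thr_sharp (X := entryMax M.Lam) (Lm := entryMin M.Lam)
    (d := 1 / (1000 * (M.Q * M.K * ω))) (by have := M.two_le_L; omega) hω hM.P_pos hP6
    (le_entryMax M.Lam) (by linarith [hM.two_le]) (entryMin_le M.Lam) hM.ratio_row ?_ ?_ ?_
    (sum_P_wrong_le hM hD k) (fun l => ?_) hc (hI.trans (infoMin_le M.Lam hr.symm))
  · simp only [tuning]
    positivity
  · simp only [tuning]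
    refine le_of_eq ?_
    field_simp
  · rw [mul_one_div, div_le_one (by positivity)]
    nlinarith [mul_pos (show (0 : ℝ) < M.Q by linarith) (show (0 : ℝ) < M.K by linarith),
      mul_le_mul_of_nonneg_right (show (8 : ℝ) ≤ M.Q * M.K by nlinarith) (show 0 ≤ ω by linarith)]
  · have h1 := hM.col_lower l
    have h2 : 2 * (M.Q * ((M.tuning β ω).θ * M.w)) ≤ (M.Q : ℝ) * M.w / (β * M.L) := by
      have e : 2 * (M.Q * ((M.tuning β ω).θ * M.w))
          = (M.Q : ℝ) * M.w / (β * M.L) * (1 / (500 * (M.Q * M.K * ω * entryMax M.Lam))) := by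
        simp only [tuning]
        field_simp
        norm_num
      rw [e]
      refine mul_le_of_le_one_right (by positivity) ?_
      rw [div_le_one (by positivity)]
      have a1 : (1 : ℝ) ≤ M.Q * M.K := by nlinarith
      have a2 : 1 ≤ M.Q * M.K * ω := by nlinarith
      nlinarith
    have h3 : 2 * (D.card : ℝ) ≤ clusterSize M.z l := by linarith
    exact_mod_cast h3

end BlockModel

/-! ### Asymptotic size of the error terms -/

theorem log_four_ge_one : 1 ≤ Real.log 4 := by
  rw [Real.le_log_iff_exp_le (by norm_num)]
  linarith [Real.exp_one_lt_d9]

theorem log_two_ge_half : 1 / 2 ≤ Real.log 2 := by linarith [Real.log_two_gt_d9]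

/-- An exponential in `U log Q κ` beats every power of `Q`, `κ` and `U`. -/
theorem eventually_pow_mul_exp_le (C a : ℝ) (N : ℕ) {c : ℝ} (hc : 0 < c) (hC : 0 ≤ C) :
    ∀ᶠ U : ℝ in atTop, ∀ Q κ : ℝ, 4 ≤ Q → 2 ≤ κ →
      C * (Q * κ * U ^ a) ^ N * Real.exp (-(c * (U * Real.log Q * κ))) ≤ 1 / U := by
  have h1 := tendsto_rpow_mul_exp_neg_mul_atTop_nhds_zero (a * N + 1) c hc
  have h2 : Tendsto (fun U : ℝ => C * Real.exp (2 * N) * (U ^ (a * N + 1) * Real.exp (-c * U)))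
      atTop (𝓝 0) := by simpa using h1.const_mul (C * Real.exp (2 * N))
  filter_upwards [h2.eventually_le_const zero_lt_one, eventually_ge_atTop (1 : ℝ),
    eventually_ge_atTop (2 * N / c)] with U hU hU1 hUN Q κ hQ hκ
  have hU0 : 0 < U := by linarith
  have hQ0 : 0 < Q := by linarith
  have hlog : 1 ≤ Real.log Q := log_four_ge_one.trans (Real.log_le_log (by norm_num) hQ)
  set p := Real.log Q * κ with hp
  have hp1 : 1 ≤ p := by nlinarith
  -- `Q` and `κ` are at most `exp p`, so their powers are lost in `exp (-(c U p))`
  have hQp : Q ≤ Real.exp p := by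
    calc Q = Real.exp (Real.log Q) := (Real.exp_log hQ0).symm
      _ ≤ _ := Real.exp_le_exp.2 (by nlinarith)
  have hκp : κ ≤ Real.exp p := by
    refine le_trans ?_ (Real.add_one_le_exp p)
    nlinarith
  have hUa : 0 < U ^ a := Real.rpow_pos_of_pos hU0 a
  have h3 : (Q * κ * U ^ a) ^ N ≤ Real.exp (2 * N * p) * U ^ (a * N) := by
    have e1 : Real.exp (2 * N * p) = (Real.exp p * Real.exp p) ^ N := by
      rw [← Real.exp_add, ← Real.exp_nat_mul]
      congr 1
      ring
    rw [mul_pow, e1, Real.rpow_mul_natCast hU0.le]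
    gcongr
  have hcU : 2 * N ≤ c * U := by
    rw [div_le_iff₀ hc] at hUN
    linarith
  have h4 : Real.exp (2 * N * p) * Real.exp (-(c * (U * Real.log Q * κ)))
      ≤ Real.exp (2 * N) * Real.exp (-c * U) := by
    rw [← Real.exp_add, ← Real.exp_add]
    refine Real.exp_le_exp.2 ?_
    have : c * (U * Real.log Q * κ) = c * U * p := by rw [hp]; ring
    rw [this]
    nlinarith
  rw [le_div_iff₀ hU0]
  calc C * (Q * κ * U ^ a) ^ N * Real.exp (-(c * (U * Real.log Q * κ))) * U
      ≤ C * (Real.exp (2 * N * p) * U ^ (a * N)) * Real.exp (-(c * (U * Real.log Q * κ))) * U := by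
        gcongr
    _ = C * U ^ (a * N) * U * (Real.exp (2 * N * p) * Real.exp (-(c * (U * Real.log Q * κ)))) := by
        ring
    _ ≤ C * U ^ (a * N) * U * (Real.exp (2 * N) * Real.exp (-c * U)) := by gcongr
    _ = C * Real.exp (2 * N) * (U ^ (a * N + 1) * Real.exp (-c * U)) := by
        rw [Real.rpow_add hU0, Real.rpow_one]
        ring
    _ ≤ 1 := hU

namespace BlockModel

/-- `K ∨ L`. -/
def kap (M : BlockModel) : ℝ := max (M.K : ℝ) M.L

/-- Quantitative form of the growth conditions: `U` is the ratio that tends to infinity. -/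
structure Scale (M : BlockModel) (β ω C a U : ℝ) : Prop where
  reg : M.Regime β ω
  one_le_C : 1 ≤ C
  a_pos : 0 < a
  one_le_U : 1 ≤ U
  info : U * (M.Q * Real.log M.Q * M.kap) ≤ M.infoBoth
  sup : β * ω * M.supMean ≤ U ^ a
  size : (M.Q : ℝ) ^ 2 * Real.log M.Q * β ^ 2 * ω ^ 3 * (M.K * M.L) * M.kap * Real.log M.kap
    * M.supMean ^ 2 ≤ C * min (M.n : ℝ) M.m

namespace Scale

variable {M : BlockModel} {β ω C a U : ℝ}

theorem K_le (M : BlockModel) : (M.K : ℝ) ≤ M.kap := le_max_left _ _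
theorem L_le (M : BlockModel) : (M.L : ℝ) ≤ M.kap := le_max_right _ _
theorem kap_ge (M : BlockModel) : 2 ≤ M.kap := M.two_le_castK.trans (K_le M)
theorem log_Q (M : BlockModel) : 1 ≤ Real.log M.Q :=
  log_four_ge_one.trans (Real.log_le_log (by norm_num) M.four_le_castQ)
theorem log_kap (M : BlockModel) : 1 / 2 ≤ Real.log M.kap :=
  log_two_ge_half.trans (Real.log_le_log (by norm_num) (kap_ge M))
theorem X_le_sup (M : BlockModel) : entryMax M.Lam ≤ M.supMean := le_max_left _ _
theorem Y_le_sup (M : BlockModel) : entryMax M.Gam ≤ M.supMean := le_max_right _ _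

/-- A quantity that bounds `Q`, `K`, `L`, `β`, `ω` and the mean parameters. -/
def base (M : BlockModel) (a U : ℝ) : ℝ := M.Q * M.kap * U ^ a

theorem sup_ge (h : M.Scale β ω C a U) : 2 ≤ M.supMean := h.reg.X_ge_two.trans (X_le_sup M)

theorem one_le_rpow (h : M.Scale β ω C a U) : 1 ≤ U ^ a :=
  Real.one_le_rpow h.one_le_U h.a_pos.le

theorem Q_le_base (h : M.Scale β ω C a U) : (M.Q : ℝ) ≤ base M a U := by
  have h1 := h.one_le_rpow
  have h2 := kap_ge M
  have h3 := M.four_le_castQ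
  unfold base
  have : (M.Q : ℝ) * 1 ≤ M.Q * M.kap := by gcongr; linarith
  nlinarith

theorem kap_le_base (h : M.Scale β ω C a U) : M.kap ≤ base M a U := by
  have h1 := h.one_le_rpow
  have h2 := kap_ge M
  have h3 := M.four_le_castQ
  unfold base
  have : 1 * M.kap ≤ M.Q * M.kap := by gcongr; linarith
  nlinarith

theorem rpow_le_base (h : M.Scale β ω C a U) : U ^ a ≤ base M a U := by
  have h1 := h.one_le_rpow
  have h2 := kap_ge M
  have h3 := M.four_le_castQ
  unfold base
  have : 1 ≤ M.Q * M.kap := by nlinarith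
  nlinarith

theorem mul_X_le_base (h : M.Scale β ω C a U) : β * ω * entryMax M.Lam ≤ base M a U := by
  have h1 := h.reg.one_le_β
  have h2 := h.reg.one_le_ω
  refine le_trans ?_ (h.sup.trans h.rpow_le_base)
  have := X_le_sup M
  gcongr

theorem X_le_base (h : M.Scale β ω C a U) : entryMax M.Lam ≤ base M a U := by
  have h1 := h.reg.one_le_β
  have h2 := h.reg.one_le_ω
  have h3 := h.reg.X_ge_two
  refine le_trans ?_ h.mul_X_le_base
  have : 1 ≤ β * ω := by nlinarith
  nlinarith

theorem β_le_base (h : M.Scale β ω C a U) : β ≤ base M a U := by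
  have h1 := h.reg.one_le_β
  have h2 := h.reg.one_le_ω
  have h3 := h.reg.X_ge_two
  refine le_trans ?_ h.mul_X_le_base
  have : 1 ≤ ω * entryMax M.Lam := by nlinarith
  nlinarith

theorem one_le_base (h : M.Scale β ω C a U) : 1 ≤ base M a U :=
  (by linarith [M.four_le_castQ] : (1 : ℝ) ≤ M.Q).trans h.Q_le_base

theorem I_ge (h : M.Scale β ω C a U) :
    U * (M.Q * Real.log M.Q * M.kap) ≤ infoMin M.Lam := h.info.trans (min_le_left _ _)

theorem J_ge (h : M.Scale β ω C a U) :
    U * (M.Q * Real.log M.Q * M.kap) ≤ infoMin M.Gam := h.info.trans (min_le_right _ _)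

theorem weight_le (h : M.Scale β ω C a U) {N x : ℝ} (hN : N ≤ M.kap)
    (hx : U * Real.log M.Q * M.kap / 8 ≤ x) :
    M.Q * (N * Real.exp (-x) * (1 + M.L * entryMax M.Lam) / (M.tuning β ω).θ)
      ≤ 2000 * base M a U ^ 8 * Real.exp (-(1 / 8 * (U * Real.log M.Q * M.kap))) := by
  have h1 := h.reg.one_le_β
  have h2 := h.reg.one_le_ω
  have h3 := h.reg.X_ge_two
  have hQ := M.four_le_castQ
  have hK := M.two_le_castK
  have hL := M.two_le_castL
  have b0 := h.one_le_base
  have b1 := h.Q_le_base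
  have b2 := h.kap_le_base
  have b3 := h.X_le_base
  have b4 := h.mul_X_le_base
  have b5 := (K_le M).trans b2
  have b6 := (L_le M).trans b2
  set G := base M a U
  have e1 : M.Q * (N * Real.exp (-x) * (1 + M.L * entryMax M.Lam) / (M.tuning β ω).θ)
      = 1000 * (M.Q * N * (1 + M.L * entryMax M.Lam) * (M.Q * M.K * M.L * (β * ω * entryMax M.Lam)))
        * Real.exp (-x) := by
    simp only [tuning]
    field_simp
  rw [e1]
  have e2 : 1 + M.L * entryMax M.Lam ≤ 2 * (G * G) := by
    have : M.L * entryMax M.Lam ≤ G * G := by gcongr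
    nlinarith
  have e3 : M.Q * M.K * M.L * (β * ω * entryMax M.Lam) ≤ G * G * G * G := by gcongr
  have e4 : M.Q * N ≤ G * G := by
    refine (mul_le_mul_of_nonneg_left hN (by positivity)).trans ?_
    have := kap_ge M
    gcongr
  have e5 : Real.exp (-x) ≤ Real.exp (-(1 / 8 * (U * Real.log M.Q * M.kap))) := by
    refine Real.exp_le_exp.2 ?_
    linarith
  calc _ ≤ 1000 * (G * G * (2 * (G * G)) * (G * G * G * G)) * Real.exp (-x) := by gcongr
    _ ≤ 1000 * (G * G * (2 * (G * G)) * (G * G * G * G)) *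
        Real.exp (-(1 / 8 * (U * Real.log M.Q * M.kap))) := by gcongr
    _ = _ := by ring

theorem failRowWeight_le (h : M.Scale β ω C a U) : M.failRowWeight β ω
    ≤ 2000 * base M a U ^ 8 * Real.exp (-(1 / 8 * (U * Real.log M.Q * M.kap))) := by
  refine h.weight_le (K_le M) ?_
  have hQ := M.four_le_castQ
  have h1 := h.I_ge
  have h2 := log_Q M
  have h3 := kap_ge M
  have h4 := h.one_le_U
  have h5 : 0 ≤ U * Real.log M.Q * M.kap := by positivity
  rw [div_le_div_iff₀ (by norm_num) (by positivity)]
  nlinarith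

theorem failColWeight_le (h : M.Scale β ω C a U) : M.failColWeight β ω
    ≤ 2000 * base M a U ^ 8 * Real.exp (-(1 / 8 * (U * Real.log M.Q * M.kap))) := by
  refine h.weight_le (L_le M) ?_
  have hQ := M.four_le_castQ
  have h1 := h.J_ge
  have h2 := log_Q M
  have h3 := kap_ge M
  have h4 := h.one_le_U
  have h5 : 0 ≤ U * Real.log M.Q * M.kap := by positivity
  rw [div_le_div_iff₀ (by norm_num) (by positivity)]
  nlinarith

theorem failWrong_le (h : M.Scale β ω C a U) :
    32 * M.Q * β * M.K * (M.K * Real.exp (14 - infoMin M.Lam))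
      ≤ 32 * Real.exp 14 * base M a U ^ 8 * Real.exp (-(1 / 8 * (U * Real.log M.Q * M.kap))) := by
  have hQ := M.four_le_castQ
  have h1 := h.I_ge
  have h2 := log_Q M
  have h3 := kap_ge M
  have h4 := h.one_le_U
  have hβ := h.reg.one_le_β
  have b0 := h.one_le_base
  have b1 := h.Q_le_base
  have b2 := (K_le M).trans h.kap_le_base
  have b3 := h.β_le_base
  set G := base M a U
  have h5 : 0 ≤ U * Real.log M.Q * M.kap := by positivity
  have e1 : Real.exp (14 - infoMin M.Lam)
      ≤ Real.exp 14 * Real.exp (-(1 / 8 * (U * Real.log M.Q * M.kap))) := by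
    rw [← Real.exp_add]
    refine Real.exp_le_exp.2 ?_
    nlinarith
  calc _ ≤ 32 * G * G * G * (G * (Real.exp 14 *
        Real.exp (-(1 / 8 * (U * Real.log M.Q * M.kap))))) := by gcongr
    _ = 32 * Real.exp 14 * G ^ 4 * Real.exp (-(1 / 8 * (U * Real.log M.Q * M.kap))) := by ring
    _ ≤ _ := by
      gcongr
      norm_num

/-- The lower bound for the dimensions, without the factor `Q`. -/
def dim (M : BlockModel) (β ω : ℝ) : ℝ := M.Q * Real.log M.Q * β ^ 2 * ω ^ 3 * (M.K * M.L) * M.kap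
  * Real.log M.kap * M.supMean ^ 2

theorem dim_le_h (h : M.Scale β ω C a U) : dim M β ω ≤ C * (2 * M.h) := by
  have hQ := M.four_le_castQ
  have h1 := h.size.trans (mul_le_mul_of_nonneg_left (min_le_left _ _) (by linarith [h.one_le_C]))
  have h2 : (M.n : ℝ) = 2 * (M.Q * M.h) := by simp [n]
  rw [h2] at h1
  have h3 : M.Q * dim M β ω ≤ M.Q * (C * (2 * M.h)) := by
    unfold dim
    linarith
  exact le_of_mul_le_mul_left h3 (by linarith)

theorem dim_le_w (h : M.Scale β ω C a U) : dim M β ω ≤ C * M.w := by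
  have hQ := M.four_le_castQ
  have h1 := h.size.trans (mul_le_mul_of_nonneg_left (min_le_right _ _) (by linarith [h.one_le_C]))
  have h2 : (M.m : ℝ) = M.Q * M.w := by simp [m]
  rw [h2] at h1
  have h3 : M.Q * dim M β ω ≤ M.Q * (C * M.w) := by
    unfold dim
    linarith
  exact le_of_mul_le_mul_left h3 (by linarith)

/-- `β` times the squared number of clusters is negligible with respect to the dimensions. -/
theorem le_dim (h : M.Scale β ω C a U) {N N' : ℝ} (hN : N ≤ M.kap) (hN0 : 0 ≤ N)
    (hNN : N * N' = M.K * M.L) (hN' : 1 ≤ N') :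
    M.Q * β * N ^ 2 * M.supMean ^ 2 ≤ 2 * dim M β ω := by
  have hQ := M.four_le_castQ
  have hβ := h.reg.one_le_β
  have hω := h.reg.one_le_ω
  have h1 := log_Q M
  have h2 := log_kap M
  have h3 := kap_ge M
  have hS := h.sup_ge
  unfold dim
  rw [← hNN]
  have e1 : (1 : ℝ) ≤ ω ^ 3 := one_le_pow₀ hω
  have e2 : β ≤ β ^ 2 := by nlinarith
  calc M.Q * β * N ^ 2 * M.supMean ^ 2
      = 2 * (M.Q * 1 * β * 1 * (N * 1) * N * (1 / 2) * M.supMean ^ 2) := by ring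
    _ ≤ _ := by gcongr

theorem rowSize_le (h : M.Scale β ω C a U) :
    (1 : ℕ) * (M.Q : ℝ) * M.K * (100 * β * M.K / M.h) ≤ 400 * C / M.supMean := by
  have hh := h.reg.one_le_h
  have h1 := h.dim_le_h
  have hS := h.sup_ge
  have h2 := h.le_dim (K_le M) (by positivity) rfl (by linarith [M.two_le_castL])
  rw [mul_div_assoc', div_le_div_iff₀ (by positivity) (by positivity)]
  have h3 : M.Q * β * M.K ^ 2 * M.supMean ≤ M.Q * β * M.K ^ 2 * M.supMean ^ 2 := by
    have := h.reg.one_le_β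
    gcongr
    nlinarith
  push_cast
  nlinarith

theorem colSize_le (h : M.Scale β ω C a U) :
    (1 : ℕ) * (M.Q : ℝ) * M.L * (100 * β * M.L / M.w) ≤ 400 * C / M.supMean := by
  have hh := h.reg.one_le_w
  have h1 := h.dim_le_w
  have hS := h.sup_ge
  have hC := h.one_le_C
  have h2 := h.le_dim (L_le M) (by positivity) (mul_comm _ _) (by linarith [M.two_le_castK])
  rw [mul_div_assoc', div_le_div_iff₀ (by positivity) (by positivity)]
  have h3 : M.Q * β * M.L ^ 2 * M.supMean ≤ M.Q * β * M.L ^ 2 * M.supMean ^ 2 := by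
    have := h.reg.one_le_β
    gcongr
    nlinarith
  push_cast
  nlinarith [mul_nonneg (show 0 ≤ C by linarith) (show (0 : ℝ) ≤ M.w by linarith)]

end Scale

end BlockModel

namespace BlockModel

namespace Scale

variable {M : BlockModel} {β ω C a U : ℝ}

/-- The size condition makes the exponent in the bound for the preliminary row mean parameters of the
order of `U log Q (K ∨ L)`. -/
theorem exponent_le_row (h : M.Scale β ω C a U) :
    1 / (10 ^ 5 * C) * (U * Real.log M.Q * M.kap)
      ≤ (infoMin M.Lam / (40 * (M.L * entryMax M.Lam))) ^ 2 *
        ((M.tuning β ω).ν * (9 / 10 * (entryMax M.Lam / (ω * M.Q)))) / 16 := by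
  have hQ := M.four_le_castQ
  have hK := M.two_le_castK
  have hL := M.two_le_castL
  have hh := h.reg.one_le_h
  have hβ := h.reg.one_le_β
  have hω := h.reg.one_le_ω
  have hX := h.reg.X_ge_two
  have hC := h.one_le_C
  have h1 := h.I_ge
  have h2 := log_Q M
  have h3 := kap_ge M
  have h4 := h.one_le_U
  have h5 := log_kap M
  have h6 := h.dim_le_h
  have h7 := L_le M
  have h8 := X_le_sup M
  set X := entryMax M.Lam
  set I := infoMin M.Lam
  set Z := U * Real.log M.Q * M.kap with hZ
  have hZ0 : 0 ≤ Z := by positivity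
  have hZI : Z ≤ I ^ 2 := by
    have e1 : 1 ≤ U * Real.log M.Q := by nlinarith
    have e2 : 1 ≤ Z := by nlinarith
    have e3 : Z ≤ I := by nlinarith
    nlinarith
  have hdim : M.L ^ 2 * X * β * M.K * ω * M.Q ≤ dim M β ω := by
    unfold dim
    have g1 : β ≤ β ^ 2 := by nlinarith
    have g2 : ω ≤ ω ^ 3 := le_self_pow₀ hω (by norm_num)
    have g3 : 2 * X ≤ M.supMean ^ 2 := by nlinarith
    calc M.L ^ 2 * X * β * M.K * ω * M.Q = M.Q * 1 * β * ω * (M.K * M.L) * M.L * (1 / 2) * (2 * X) := by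
          ring
      _ ≤ _ := by gcongr
  have e : (I / (40 * (M.L * X))) ^ 2 * ((M.tuning β ω).ν * (9 / 10 * (X / (ω * M.Q)))) / 16
      = 81 * (I ^ 2 * M.h) / (2560000 * (M.L ^ 2 * X * β * M.K * ω * M.Q)) := by
    change (I / (40 * (M.L * X))) ^ 2 * ((9 / 10 * (M.h / (β * M.K))) * (9 / 10 * (X / (ω * M.Q)))) / 16
      = _
    field_simp
    ring
  rw [e, one_div_mul_eq_div, div_le_div_iff₀ (by positivity) (by positivity)]
  calc Z * (2560000 * (M.L ^ 2 * X * β * M.K * ω * M.Q))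
      ≤ I ^ 2 * (2560000 * (C * (2 * M.h))) :=
        mul_le_mul hZI (mul_le_mul_of_nonneg_left (hdim.trans h6) (by norm_num)) (by positivity)
          (by positivity)
    _ ≤ _ := by
        have : 0 ≤ I ^ 2 * M.h * C := by positivity
        nlinarith

/-- The analogous bound for the preliminary column mean parameters. -/
theorem exponent_le_col (h : M.Scale β ω C a U) :
    1 / (10 ^ 5 * C) * (U * Real.log M.Q * M.kap)
      ≤ (infoMin M.Gam / (40 * (M.K * entryMax M.Gam))) ^ 2 *
        ((M.tuning β ω).ν' * (9 / 10 * (entryMax M.Gam / (ω * (2 * M.Q))))) / 16 := by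
  have hQ := M.four_le_castQ
  have hK := M.two_le_castK
  have hL := M.two_le_castL
  have hh := h.reg.one_le_w
  have hβ := h.reg.one_le_β
  have hω := h.reg.one_le_ω
  have hX := h.reg.Y_pos
  have hS := h.sup_ge
  have hC := h.one_le_C
  have h1 := h.J_ge
  have h2 := log_Q M
  have h3 := kap_ge M
  have h4 := h.one_le_U
  have h5 := log_kap M
  have h6 := h.dim_le_w
  have h7 := K_le M
  have h8 := Y_le_sup M
  set X := entryMax M.Gam
  set I := infoMin M.Gam
  set Z := U * Real.log M.Q * M.kap with hZ
  have hZ0 : 0 ≤ Z := by positivity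
  have hZI : Z ≤ I ^ 2 := by
    have e1 : 1 ≤ U * Real.log M.Q := by nlinarith
    have e2 : 1 ≤ Z := by nlinarith
    have e3 : Z ≤ I := by nlinarith
    nlinarith
  have hdim : M.K ^ 2 * X * β * M.L * ω * M.Q ≤ dim M β ω := by
    unfold dim
    have g1 : β ≤ β ^ 2 := by nlinarith
    have g2 : ω ≤ ω ^ 3 := le_self_pow₀ hω (by norm_num)
    have g3 : 2 * X ≤ M.supMean ^ 2 := by nlinarith
    calc M.K ^ 2 * X * β * M.L * ω * M.Q = M.Q * 1 * β * ω * (M.K * M.L) * M.K * (1 / 2) * (2 * X) := by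
          ring
      _ ≤ _ := by gcongr
  have e : (I / (40 * (M.K * X))) ^ 2 * ((M.tuning β ω).ν' * (9 / 10 * (X / (ω * (2 * M.Q))))) / 16
      = 81 * (I ^ 2 * M.w) / (5120000 * (M.K ^ 2 * X * β * M.L * ω * M.Q)) := by
    change (I / (40 * (M.K * X))) ^ 2 *
      ((9 / 10 * (M.w / (β * M.L))) * (9 / 10 * (X / (ω * (2 * M.Q))))) / 16 = _
    field_simp
    ring
  rw [e, one_div_mul_eq_div, div_le_div_iff₀ (by positivity) (by positivity)]
  calc Z * (5120000 * (M.K ^ 2 * X * β * M.L * ω * M.Q))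
      ≤ I ^ 2 * (5120000 * (C * M.w)) :=
        mul_le_mul hZI (mul_le_mul_of_nonneg_left (hdim.trans h6) (by norm_num)) (by positivity)
          (by positivity)
    _ ≤ _ := by
        have : 0 ≤ I ^ 2 * M.w * C := by positivity
        nlinarith

theorem failRowMean_le (h : M.Scale β ω C a U) : M.failRowMean β ω
    ≤ 2 * base M a U ^ 3 * Real.exp (-(1 / (10 ^ 5 * C) * (U * Real.log M.Q * M.kap))) := by
  have hQ := M.four_le_castQ
  have b0 := h.one_le_base
  have b1 := h.Q_le_base
  have b2 := (K_le M).trans h.kap_le_base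
  have b3 := (L_le M).trans h.kap_le_base
  have h1 := Real.exp_le_exp.2 (neg_le_neg h.exponent_le_row)
  unfold failRowMean
  set G := base M a U
  calc _ ≤ G * G * G * (2 * Real.exp (-(1 / (10 ^ 5 * C) * (U * Real.log M.Q * M.kap)))) := by
        gcongr
    _ = _ := by ring

theorem failColMean_le (h : M.Scale β ω C a U) : M.failColMean β ω
    ≤ 2 * base M a U ^ 3 * Real.exp (-(1 / (10 ^ 5 * C) * (U * Real.log M.Q * M.kap))) := by
  have hQ := M.four_le_castQ
  have b0 := h.one_le_base
  have b1 := h.Q_le_base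
  have b2 := (K_le M).trans h.kap_le_base
  have b3 := (L_le M).trans h.kap_le_base
  have h1 := Real.exp_le_exp.2 (neg_le_neg h.exponent_le_col)
  unfold failColMean
  set G := base M a U
  calc _ ≤ G * G * G * (2 * Real.exp (-(1 / (10 ^ 5 * C) * (U * Real.log M.Q * M.kap)))) := by
        gcongr
    _ = _ := by ring

/-- The global estimate fails with probability exponentially small in `Λ_min`. -/
theorem failAllMean_le (h : M.Scale β ω C a U) (hΛ : 20 * C ≤ entryMin M.Lam) :
    M.failAllMean β ω ≤ 2 * Real.exp (1 - entryMin M.Lam / (20 * C)) := by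
  have hQ := M.four_le_castQ
  have hK := M.two_le_castK
  have hL := M.two_le_castL
  have hh := h.reg.one_le_h
  have hβ := h.reg.one_le_β
  have hω := h.reg.one_le_ω
  have hX := h.reg.X_ge_two
  have hC := h.one_le_C
  have h2 := log_Q M
  have h3 := kap_ge M
  have h5 := log_kap M
  have h6 := h.dim_le_h
  have h7 := L_le M
  have h7' := K_le M
  have h8 := X_le_sup M
  have hΛ0 := h.reg.two_le
  set X := entryMax M.Lam with hXd
  set Λ := entryMin M.Lam
  set ℓ := Real.log M.kap with hℓ
  have hdim : 4 * (ℓ * (M.L ^ 2 * X ^ 2 * β * M.K)) ≤ dim M β ω := by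
    unfold dim
    have g1 : β ≤ β ^ 2 := by nlinarith
    have g2 : (1 : ℝ) ≤ ω ^ 3 := one_le_pow₀ hω
    calc 4 * (ℓ * (M.L ^ 2 * X ^ 2 * β * M.K))
        = 4 * 1 * β * 1 * (M.K * M.L) * M.L * ℓ * X ^ 2 := by ring
      _ ≤ _ := by gcongr
  have e : (M.tuning β ω).δ ^ 2 * Λ / (4 * (1 / (M.tuning β ω).ν))
      = 9 * (Λ * M.h) / (160 * (M.L ^ 2 * X ^ 2 * β * M.K)) := by
    change (1 / (2 * (M.L * X))) ^ 2 * Λ / (4 * (1 / (9 / 10 * (M.h / (β * M.K))))) = _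
    field_simp
    ring
  have hE : Λ * ℓ / (10 * C) ≤ (M.tuning β ω).δ ^ 2 * Λ / (4 * (1 / (M.tuning β ω).ν)) := by
    rw [e, div_le_div_iff₀ (by positivity) (by positivity)]
    have h9 := mul_le_mul_of_nonneg_left (hdim.trans h6) (show 0 ≤ Λ by linarith)
    have h10 : 0 ≤ Λ * (C * M.h) := by positivity
    nlinarith
  have hκ : M.kap * M.kap = Real.exp (2 * ℓ) := by
    rw [two_mul, Real.exp_add, hℓ, Real.exp_log (by linarith)]
  unfold failAllMean
  calc _ ≤ (1 : ℕ) * M.kap * M.kap * (2 * Real.exp (-(Λ * ℓ / (10 * C)))) := by gcongr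
    _ = 2 * (Real.exp (2 * ℓ) * Real.exp (-(Λ * ℓ / (10 * C)))) := by
        rw [← hκ]
        push_cast
        ring
    _ ≤ 2 * Real.exp (1 - Λ / (20 * C)) := by
        rw [← Real.exp_add]
        gcongr 2 * Real.exp ?_
        have e1 : Λ * ℓ / (10 * C) = 2 * (Λ / (20 * C)) * ℓ := by
          field_simp
          norm_num
        have e2 : 1 ≤ Λ / (20 * C) := by
          rw [le_div_iff₀ (by positivity)]
          linarith
        rw [e1]
        nlinarith

theorem mul_le_dim (h : M.Scale β ω C a U) :
    entryMax M.Lam ^ 2 * (β * M.L) ≤ C * (M.Q * M.w) := by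
  have hQ := M.four_le_castQ
  have hK := M.two_le_castK
  have hL := M.two_le_castL
  have hβ := h.reg.one_le_β
  have hω := h.reg.one_le_ω
  have hX := h.reg.X_ge_two
  have h2 := log_Q M
  have h3 := kap_ge M
  have h5 := log_kap M
  have h6 := h.dim_le_w
  have h8 := X_le_sup M
  have hdim : entryMax M.Lam ^ 2 * (β * M.L) ≤ dim M β ω := by
    unfold dim
    have g1 : β ≤ β ^ 2 := by nlinarith
    have g2 : (1 : ℝ) ≤ ω ^ 3 := one_le_pow₀ hω
    calc entryMax M.Lam ^ 2 * (β * M.L)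
        = 1 * 1 * β * 1 * (1 * M.L) * 2 * (1 / 2) * entryMax M.Lam ^ 2 := by ring
      _ ≤ _ := by gcongr <;> linarith
  have hw := h.reg.one_le_w
  have hC := h.one_le_C
  have h9 : 0 ≤ C * M.w := by positivity
  nlinarith

/-- Poisson regime: the squared connection probabilities of a row have a bounded sum over each column
cluster. -/
theorem clusterSize_mul_sq_le (h : M.Scale β ω C a U) (k l) :
    (clusterSize M.z l : ℝ) * M.P k l ^ 2 ≤ C := by
  have h1 := h.reg.P_le_X k l
  have h2 := le_entryMax M.Lam k l
  have h3 := h.mul_le_dim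
  have hX := h.reg.X_ge_two
  have hQ := M.four_le_castQ
  have hw := h.reg.one_le_w
  calc (clusterSize M.z l : ℝ) * M.P k l ^ 2 = M.Lam k l * M.P k l := by
        simp only [Lam]
        ring
    _ ≤ entryMax M.Lam * (entryMax M.Lam * (β * M.L) / (M.Q * M.w)) :=
        mul_le_mul h2 h1 (h.reg.P_pos k l).le (by linarith)
    _ ≤ C := by
        rw [mul_div_assoc', div_le_iff₀ (by positivity)]
        linarith

theorem P_le_sixth (h : M.Scale β ω C a U) (hΛ : 20 * C ≤ entryMin M.Lam) (k l) :
    M.P k l ≤ 1 / 6 := by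
  have h1 := h.reg.P_le_X k l
  have h2 : entryMin M.Lam ≤ entryMax M.Lam := (entryMin_le M.Lam k l).trans (le_entryMax M.Lam k l)
  have h3 := h.mul_le_dim
  have hX := h.reg.X_ge_two
  have hQ := M.four_le_castQ
  have hw := h.reg.one_le_w
  refine h1.trans ?_
  rw [div_le_div_iff₀ (by positivity) (by norm_num)]
  have h4 : 0 < (M.Q : ℝ) * M.w := by positivity
  have h5 : 20 * C * (M.Q * M.w) ≤ entryMax M.Lam * (M.Q * M.w) :=
    mul_le_mul_of_nonneg_right (hΛ.trans h2) h4.le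
  have h6 : entryMax M.Lam * (6 * (entryMax M.Lam * (β * M.L))) ≤ entryMax M.Lam * (M.Q * M.w) := by
    nlinarith [mul_nonneg (show 0 ≤ C by linarith [h.one_le_C]) h4.le]
  have := le_of_mul_le_mul_left h6 (by linarith)
  linarith

/-- The slack in the exponent of the rate: it tends to zero, but `slack x * log x = √(log x)` still
tends to infinity. -/
def slack (x : ℝ) : ℝ := 1 / √(Real.log x)

theorem rate_eq (h : M.Scale β ω C a U) (ζ : ℝ) (k : Fin M.K) :
    M.rate ω ζ k = ω * (∑ r ∈ Finset.univ.erase k, (1 + 1 / epsGap M.Lam k r) *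
      Real.exp (-Biclust.info M.Lam k r) / √(entryMin M.Lam)) * Real.exp (ζ * Real.log (entryMin M.Lam)) := by
  have hΛ := h.reg.two_le
  rw [rate, mul_assoc, Finset.sum_mul]
  congr 1
  refine Finset.sum_congr rfl fun r _ => ?_
  have e1 : √(entryMin M.Lam) = Real.exp (1 / 2 * Real.log (entryMin M.Lam)) := by
    rw [Real.sqrt_eq_rpow, Real.rpow_def_of_pos (by linarith), mul_comm]
  rw [e1, mul_div_assoc, ← Real.exp_sub, mul_assoc, ← Real.exp_add]
  congr 2
  ring

theorem epsGap_nonneg (h : M.Scale β ω C a U) (k r : Fin M.K) : 0 ≤ epsGap M.Lam k r := by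
  have h0 : ∀ k l, 0 < M.Lam k l := fun k l => by linarith [h.reg.Lam_ge_two k l]
  have h1 : 1 ≤ max (M.Lam k 0 / M.Lam r 0) (M.Lam r 0 / M.Lam k 0) := by
    rcases le_total (M.Lam k 0) (M.Lam r 0) with h2 | h2
    · exact le_max_of_le_right ((one_le_div (h0 k 0)).2 h2)
    · exact le_max_of_le_left ((one_le_div (h0 r 0)).2 h2)
  have h2 := le_ciSup (f := fun l => max (M.Lam k l / M.Lam r l) (M.Lam r l / M.Lam k l))
    (Set.finite_range _).bddAbove 0
  unfold epsGap
  linarith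

/-- The error bound for a single model. The sharp rate is exceeded by a factor `exp √(log Λ_min)`, so
that by Markov its failure probability is of order `exp (-√(log Λ_min))`. -/
theorem prob_le (h : M.Scale β ω C a U) (S : Initializer M.K M.L M.h M.w) {γ : ℝ}
    (hγ : γ ≤ M.initRate β ω) (hΛ : 20 * C ≤ entryMin M.Lam) (hI : 8 ≤ infoMin M.Lam)
    (hU₁ : 2000 * base M a U ^ 8 * Real.exp (-(1 / 8 * (U * Real.log M.Q * M.kap))) ≤ 1 / U)
    (hU₂ : 32 * Real.exp 14 * base M a U ^ 8 * Real.exp (-(1 / 8 * (U * Real.log M.Q * M.kap)))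
      ≤ 1 / U)
    (hU₃ : 2 * base M a U ^ 3 * Real.exp (-(1 / (10 ^ 5 * C) * (U * Real.log M.Q * M.kap))) ≤ 1 / U)
    (k : Fin M.K) :
    prob (M.law S) {R | ¬ ∀ σ ∈ optPerms R.labels M.y, misCluster σ R.labels M.y k
        ≤ 66 * Real.exp (14 + 72 * C) * M.rate ω (slack (entryMin M.Lam)) k}
      ≤ prob (M.law S) {R | ¬ M.InitGood β γ R}
        + 2 * ENNReal.ofReal (800 * C / entryMin M.Lam + 5 / U
          + 2 * Real.exp (1 - entryMin M.Lam / (20 * C))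
          + 2 * Real.exp (-√(Real.log (entryMin M.Lam)))) := by
  have hM := h.reg
  have hΛ2 := hM.two_le
  have hC := h.one_le_C
  have hω := hM.one_le_ω
  have hU := h.one_le_U
  set Λ := entryMin M.Lam with hΛd
  set A : ℝ := ∑ r ∈ Finset.univ.erase k, (1 + 1 / epsGap M.Lam k r) *
      Real.exp (-Biclust.info M.Lam k r) / √Λ with hA
  set c₁ : ℝ := 66 * Real.exp (14 + 72 * C) * (ω * A) with hc₁
  have hsqrt : 0 < √Λ := Real.sqrt_pos.2 (by linarith)
  have hA0 : 0 < A := by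
    refine Finset.sum_pos (fun r _ => ?_) ?_
    · have := h.epsGap_nonneg k r
      positivity
    · rw [← Finset.card_pos, Finset.card_erase_of_mem (Finset.mem_univ k), Finset.card_univ,
        Fintype.card_fin]
      have := M.two_le_K
      omega
  have hlog : 0 < Real.log Λ := Real.log_pos (by linarith)
  have hslack : slack Λ * Real.log Λ = √(Real.log Λ) := by
    rw [slack, one_div_mul_eq_div, Real.div_sqrt]
  have hrate := h.rate_eq (slack Λ) k
  rw [← hΛd, hslack, ← hA] at hrate
  have hρ : 66 * Real.exp (14 + 72 * C) * M.rate ω (slack Λ) k = c₁ * Real.exp (√(Real.log Λ)) := by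
    rw [hrate, hc₁]
    ring
  have hc₁0 : 0 < c₁ := by positivity
  rw [hρ]
  refine (prob_not_misCluster_le hM S hγ (ρ := c₁ * Real.exp (√(Real.log Λ))) (by positivity)
    (c₀ := M.K * Real.exp (14 - infoMin M.Lam)) (c₁ := c₁) (by positivity) hc₁0.le
    (fun k D hD => PB_badRow_full hM hD k) (fun D hD => ?_)).trans ?_
  · refine (PB_badRow_sharp hM (h.P_le_sixth hΛ) h.clusterSize_mul_sq_le hI hD k).trans
      (le_of_eq ?_)
    rw [← Finset.mul_sum, hc₁]
    ring
  · refine add_le_add le_rfl (mul_le_mul_right ?_ _)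
    have hp0 : 0 ≤ M.failPass β ω := by
      have hβ := hM.one_le_β
      have hθ := θ_pos hM
      have hX := hM.X_ge_two
      unfold failPass failRowMean failColMean failRowWeight failColWeight failAllMean
      positivity
    have hβ := hM.one_le_β
    rw [← ENNReal.ofReal_add hp0 (by positivity), ← ENNReal.ofReal_add (by positivity) (by positivity)]
    refine ENNReal.ofReal_le_ofReal ?_
    have f1 := h.rowSize_le
    have f2 := h.colSize_le
    have f3 := h.failRowMean_le.trans hU₃
    have f4 := h.failColMean_le.trans hU₃
    have f5 := h.failRowWeight_le.trans hU₁
    have f6 := h.failColWeight_le.trans hU₁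
    have f7 := h.failAllMean_le hΛ
    have f8 := h.failWrong_le.trans hU₂
    have f9 : 2 * c₁ / (c₁ * Real.exp (√(Real.log Λ))) = 2 * Real.exp (-√(Real.log Λ)) := by
      rw [Real.exp_neg]
      field_simp
    have f10 : 400 * C / M.supMean ≤ 400 * C / Λ := by
      have : Λ ≤ M.supMean := ((entryMin_le M.Lam 0 0).trans (le_entryMax M.Lam 0 0)).trans (X_le_sup M)
      gcongr
    have f11 : 800 * C / Λ = 400 * C / Λ + 400 * C / Λ := by ring
    have f12 : 5 / U = 1 / U + 1 / U + 1 / U + 1 / U + 1 / U := by ring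
    rw [f9, f11, f12]
    unfold failPass
    linarith

end Scale

end BlockModel

/-! ### Passage to the limit -/

namespace BlockModel

/-- The growth conditions hold with positive means and information only if no cluster is empty,
so the divisions in the balance conditions are genuine. -/
theorem regime_of {M : BlockModel} {β ω : ℝ}
    (hΛ : entryMax M.Lam ≤ ω * entryMin M.Lam) (hΓ : entryMax M.Gam ≤ ω * entryMin M.Gam)
    (hy : ∀ k, 1 / (β * M.K) ≤ clusterProp M.y k)
    (hz : ∀ l, 1 / (β * M.L) ≤ clusterProp M.z l ∧ clusterProp M.z l ≤ β / M.L)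
    (h2 : 2 ≤ entryMin M.Lam) (hI : 0 < M.infoBoth) : M.Regime β ω := by
  have hK := M.two_le_castK
  have hL := M.two_le_castL
  have hn : ∀ l, 0 < clusterSize M.z l := fun l => by
    have h3 : 0 < M.Lam 0 l := by linarith [entryMin_le M.Lam 0 l]
    refine Nat.pos_of_ne_zero fun h0 => ?_
    simp [Lam, h0] at h3
  have hm : 0 < M.Q * M.w := by
    obtain ⟨j, -⟩ := Finset.card_pos.1 (hn 0)
    exact j.pos
  have hw : 0 < M.w := Nat.pos_of_mul_pos_left hm
  have hmR : (0 : ℝ) < M.Q * M.w := by exact_mod_cast hm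
  have hz0 : 0 < clusterProp M.z 0 := by
    have := hn 0
    rw [clusterProp, Fintype.card_fin]
    positivity
  have hβ0 : 0 < β := by
    have h3 := hz0.trans_le (hz 0).2
    by_contra h4
    exact absurd h3 (not_lt.2 (div_nonpos_of_nonpos_of_nonneg (not_lt.1 h4) (by positivity)))
  have hβ : 1 ≤ β := by
    have h3 := (hz 0).1.trans (hz 0).2
    rw [div_le_div_iff₀ (by positivity) (by positivity), ← mul_assoc] at h3
    have h4 := le_of_mul_le_mul_right h3 (by positivity)
    nlinarith
  have hnR : (0 : ℝ) < 2 * (M.Q * M.h) := by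
    have h3 : 0 < clusterProp M.y 0 := lt_of_lt_of_le (by positivity) (hy 0)
    rw [clusterProp, Fintype.card_fin] at h3
    refine lt_of_le_of_ne (by positivity) fun h0 => ?_
    have h5 : ((2 * (M.Q * M.h) : ℕ) : ℝ) = 0 := by
      push_cast
      exact h0.symm
    rw [h5, div_zero] at h3
    exact lt_irrefl _ h3
  have hh : 0 < M.h := by
    refine Nat.pos_of_ne_zero fun h0 => ?_
    simp [h0] at hnR
  refine ⟨hβ, ?_, hh, hw, fun k => ?_, fun l => ?_, hΛ, hΓ, h2,
    hI.trans_le (min_le_left _ _), hI.trans_le (min_le_right _ _)⟩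
  · have h3 := ((entryMin_le M.Lam 0 0).trans (le_entryMax M.Lam 0 0)).trans hΛ
    nlinarith
  · have h3 := hy k
    rw [clusterProp, Fintype.card_fin, le_div_iff₀ (by push_cast; exact hnR)] at h3
    push_cast at h3
    rwa [one_div_mul_eq_div] at h3
  · have h3 := (hz l).1
    rw [clusterProp, Fintype.card_fin, le_div_iff₀ (by push_cast; exact hmR)] at h3
    push_cast at h3
    rwa [one_div_mul_eq_div] at h3

theorem le_supMean_mul {M : BlockModel} {β ω : ℝ} (h : M.Regime β ω) :
    entryMin M.Lam ≤ β * ω * M.supMean := by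
  have h1 : entryMin M.Lam ≤ M.supMean :=
    ((entryMin_le M.Lam 0 0).trans (le_entryMax M.Lam 0 0)).trans (le_max_left _ _)
  have h2 := h.one_le_β
  have h3 := h.one_le_ω
  have h4 := h.two_le
  have h5 : 1 ≤ β * ω := by nlinarith
  nlinarith

end BlockModel

theorem tendsto_slack : Tendsto BlockModel.Scale.slack atTop (𝓝 0) := by
  have h : Tendsto (fun x => √(Real.log x)) atTop atTop :=
    Real.tendsto_sqrt_atTop.comp Real.tendsto_log_atTop
  exact h.const_div_atTop 1

/-- If the failure probabilities tend to zero uniformly, the success probabilities tend to one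
uniformly. -/
theorem tendsto_iInf_prob {κ : ℕ → Type} [∀ t, Nonempty (κ t)] {Ω : ℕ → Type}
    (p : ∀ t, PMF (Ω t)) (E : ∀ t, κ t → Ω t → Prop) {f : ℕ → ℝ≥0∞} (hf : Tendsto f atTop (𝓝 0))
    (h : ∀ᶠ t in atTop, ∀ k, prob (p t) {x | ¬ E t k x} ≤ f t) :
    Tendsto (fun t => ⨅ k, prob (p t) {x | E t k x}) atTop (𝓝 1) := by
  have h1 : Tendsto (fun t => 1 - f t) atTop (𝓝 1) := by
    simpa using ENNReal.Tendsto.sub tendsto_const_nhds hf (Or.inl ENNReal.one_ne_top)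
  refine tendsto_of_tendsto_of_tendsto_of_le_of_le' h1 tendsto_const_nhds ?_
    (Eventually.of_forall fun t => (iInf_le _ (Classical.arbitrary _)).trans (prob_le_one _ _))
  filter_upwards [h] with t ht
  refine le_iInf fun k => tsub_le_iff_right.2 ?_
  rw [← prob_add_compl (p t) {x | E t k x}]
  gcongr
  exact ht k

end

end Biclust

theorem theorem3
    (M : ℕ → Biclust.BlockModel)
    (S : ∀ t, Biclust.Initializer (M t).K (M t).L (M t).h (M t).w)
    (β ω γ : ℕ → ℝ)
    (hA1 : ∀ t, Biclust.entryMax (M t).Lam ≤ ω t * Biclust.entryMin (M t).Lam ∧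
      Biclust.entryMax (M t).Gam ≤ ω t * Biclust.entryMin (M t).Gam)
    (hA2 : ∀ t,
      (∀ k, 1 / (β t * (M t).K) ≤ Biclust.clusterProp (M t).y k ∧
        Biclust.clusterProp (M t).y k ≤ β t / (M t).K) ∧
      (∀ l, 1 / (β t * (M t).L) ≤ Biclust.clusterProp (M t).z l ∧
        Biclust.clusterProp (M t).z l ≤ β t / (M t).L))
    (hA3 : (fun t => ((M t).Q : ℝ) ^ 2 * Real.log (M t).Q * β t ^ 2 * ω t ^ 3 *
        (((M t).K : ℝ) * (M t).L) * (max (M t).K (M t).L : ℝ) *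
        Real.log (max (M t).K (M t).L : ℝ) * (M t).supMean ^ 2)
      =O[atTop] fun t => (min (M t).n (M t).m : ℝ))
    (hA4 : ∃ a : ℝ, 0 < a ∧ (fun t => β t * ω t * (M t).supMean)
      =o[atTop] fun t => ((M t).infoBoth /
        ((M t).Q * Real.log (M t).Q * (max (M t).K (M t).L : ℝ))) ^ a)
    (hI : Tendsto (fun t => (M t).infoBoth) atTop atTop)
    (hLam : Tendsto (fun t => Biclust.entryMin (M t).Lam) atTop atTop)
    (hγ : ∀ t, γ t ≤ 1 / (384 * β t ^ 2 * ω t) *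
      min (Biclust.infoMin (M t).Lam / (8 * (M t).L * Biclust.entryMax (M t).Lam))
        (Biclust.infoMin (M t).Gam / (16 * (M t).K * Biclust.entryMax (M t).Gam)))
    (hinit : Tendsto
      (fun t => Biclust.prob ((M t).law (S t)) {R | (M t).InitGood (β t) (γ t) R})
      atTop (𝓝 1)) :
    ∃ (C : ℝ) (ζ : ℕ → ℝ), Tendsto ζ atTop (𝓝 0) ∧
      Tendsto (fun t => ⨅ k : Fin (M t).K, Biclust.prob ((M t).law (S t))
        {R | ∀ σ ∈ Biclust.optPerms R.labels (M t).y,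
          Biclust.misCluster σ R.labels (M t).y k ≤ C * (M t).rate (ω t) (ζ t) k})
        atTop (𝓝 1) := by
  obtain ⟨a, ha, hA4⟩ := hA4
  obtain ⟨C, hC1, hC⟩ := hA3.exists_pos
  rw [Asymptotics.isBigOWith_iff] at hC
  set D : ℝ := max C 1 with hD
  have hD1 : 1 ≤ D := le_max_right _ _
  set Λ : ℕ → ℝ := fun t => Biclust.entryMin (M t).Lam with hΛd
  set U : ℕ → ℝ := fun t => (M t).infoBoth /
    ((M t).Q * Real.log (M t).Q * (max (M t).K (M t).L : ℝ)) with hUd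
  have hden : ∀ t, 0 < ((M t).Q * Real.log (M t).Q * (M t).kap : ℝ) := fun t => by
    have h1 := (M t).four_le_castQ
    have h2 := Biclust.BlockModel.Scale.log_Q (M t)
    have h3 := Biclust.BlockModel.Scale.kap_ge (M t)
    positivity
  have hreg : ∀ᶠ t in atTop, (M t).Regime (β t) (ω t) := by
    filter_upwards [hLam.eventually_ge_atTop 2, hI.eventually_gt_atTop 0] with t h1 h2
    exact Biclust.BlockModel.regime_of (hA1 t).1 (hA1 t).2 (fun k => ((hA2 t).1 k).1) (hA2 t).2 h1 h2
  have hU0 : ∀ᶠ t in atTop, 0 ≤ U t := by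
    filter_upwards [hI.eventually_ge_atTop 0] with t h1
    exact div_nonneg h1 (hden t).le
  have hsup : ∀ᶠ t in atTop, β t * ω t * (M t).supMean ≤ U t ^ a := by
    filter_upwards [hA4.def one_pos, hU0] with t h1 h2
    rw [one_mul, Real.norm_of_nonneg (Real.rpow_nonneg h2 a)] at h1
    exact (le_abs_self _).trans h1
  -- `U ^ a` dominates the mean parameters, which tend to infinity
  have hU : Tendsto U atTop atTop := by
    have h1 : Tendsto (fun t => U t ^ a) atTop atTop := by
      refine tendsto_atTop_mono' atTop ?_ hLam
      filter_upwards [hreg, hsup] with t h2 h3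
      exact (Biclust.BlockModel.le_supMean_mul h2).trans h3
    refine ((tendsto_rpow_atTop (inv_pos.2 ha)).comp h1).congr' ?_
    filter_upwards [hU0] with t h2
    exact Real.rpow_rpow_inv h2 ha.ne'
  have hscale : ∀ᶠ t in atTop, (M t).Scale (β t) (ω t) D a (U t) := by
    filter_upwards [hreg, hU.eventually_ge_atTop 1, hsup, hC] with t h1 h2 h3 h4
    refine ⟨h1, hD1, ha, h2, (div_mul_cancel₀ _ (hden t).ne').le, h3, ?_⟩
    refine (le_abs_self _).trans (h4.trans ?_)
    have h5 : (0 : ℝ) ≤ min ((M t).n : ℝ) (M t).m := by positivity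
    rw [Real.norm_of_nonneg h5]
    exact mul_le_mul_of_nonneg_right (le_max_left _ _) h5
  have hc : (0 : ℝ) < 1 / (10 ^ 5 * D) := by positivity
  have hU₁ := hU.eventually (Biclust.eventually_pow_mul_exp_le 2000 a 8 (c := 1 / 8) (by norm_num)
    (by norm_num))
  have hU₂ := hU.eventually (Biclust.eventually_pow_mul_exp_le (32 * Real.exp 14) a 8 (c := 1 / 8)
    (by norm_num) (by positivity))
  have hU₃ := hU.eventually (Biclust.eventually_pow_mul_exp_le 2 a 3 hc (by norm_num))
  refine ⟨66 * Real.exp (14 + 72 * D), fun t => Biclust.BlockModel.Scale.slack (Λ t),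
    Biclust.tendsto_slack.comp hLam, ?_⟩
  have hbad : Tendsto (fun t => Biclust.prob ((M t).law (S t))
      {R | ¬ (M t).InitGood (β t) (γ t) R}) atTop (𝓝 0) := by
    have h1 := ENNReal.Tendsto.sub (tendsto_const_nhds (x := (1 : ℝ≥0∞))) hinit
      (Or.inl ENNReal.one_ne_top)
    rw [tsub_self] at h1
    refine h1.congr fun t => ?_
    rw [← Biclust.prob_add_compl ((M t).law (S t)) {R | (M t).InitGood (β t) (γ t) R},
      ENNReal.add_sub_cancel_left
        (ne_top_of_le_ne_top ENNReal.one_ne_top (Biclust.prob_le_one _ _))]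
    rfl
  have herr : Tendsto (fun t => 800 * D / Λ t + 5 / U t + 2 * Real.exp (1 - Λ t / (20 * D))
      + 2 * Real.exp (-√(Real.log (Λ t)))) atTop (𝓝 0) := by
    have h1 : Tendsto (fun t => Real.exp (1 - Λ t / (20 * D))) atTop (𝓝 0) := by
      refine Real.tendsto_exp_atBot.comp ?_
      have h2 : Tendsto (fun t => Λ t / (20 * D)) atTop atTop :=
        hLam.atTop_div_const (by positivity)
      exact tendsto_atBot_add_const_left _ 1 (tendsto_neg_atTop_atBot.comp h2)
    have h3 : Tendsto (fun t => Real.exp (-√(Real.log (Λ t)))) atTop (𝓝 0) :=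
      Real.tendsto_exp_neg_atTop_nhds_zero.comp
        (Real.tendsto_sqrt_atTop.comp (Real.tendsto_log_atTop.comp hLam))
    simpa using (((hLam.const_div_atTop (800 * D)).add (hU.const_div_atTop 5)).add
      (h1.const_mul 2)).add (h3.const_mul 2)
  have hfail : Tendsto (fun t => Biclust.prob ((M t).law (S t))
      {R | ¬ (M t).InitGood (β t) (γ t) R} + 2 * ENNReal.ofReal (800 * D / Λ t + 5 / U t
        + 2 * Real.exp (1 - Λ t / (20 * D)) + 2 * Real.exp (-√(Real.log (Λ t))))) atTop (𝓝 0) := by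
    have h1 := ENNReal.tendsto_ofReal herr
    rw [ENNReal.ofReal_zero] at h1
    simpa using hbad.add (ENNReal.Tendsto.const_mul h1 (Or.inr ENNReal.ofNat_ne_top) (a := 2))
  refine Biclust.tendsto_iInf_prob (κ := fun t => Fin (M t).K)
    (Ω := fun t => Biclust.Run (M t).K (M t).L (M t).Q (M t).h (M t).w) (fun t => (M t).law (S t))
    (fun t k R => ∀ σ ∈ Biclust.optPerms R.labels (M t).y, Biclust.misCluster σ R.labels (M t).y k
      ≤ 66 * Real.exp (14 + 72 * D) * (M t).rate (ω t) (Biclust.BlockModel.Scale.slack (Λ t)) k)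
    hfail ?_
  filter_upwards [hscale, hLam.eventually_ge_atTop (20 * D), hI.eventually_ge_atTop 8, hU₁, hU₂, hU₃]
    with t h h1 h2 h3 h4 h5 k
  have hQ := (M t).four_le_castQ
  have hκ := Biclust.BlockModel.Scale.kap_ge (M t)
  exact h.prob_le (S t) (hγ t) h1 (h2.trans (min_le_left _ _)) (h3 _ _ hQ hκ) (h4 _ _ hQ hκ)
    (h5 _ _ hQ hκ) k
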